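/- Let $M$ be a closed connected oriented three-manifold with a finite pseudotriangulation in which the four vertices of every tetrahedron are different (different simplices may have the same vertices). Ascribe to every vertex $A$ a point $\vec r_A\in\mathbb R^4$ so that no five different vertices lie in one affine hyperplane. Let $l$ be the length of an edge and $S$ the area of a 2-face. For a face $ABC$ common to the right-oriented tetrahedra $EABC$ and $ABCD$, let $\vartheta_{ABC}$ be the exterior dihedral angle at $ABC$ in the 4-simplex $ABCDE$, taken with the minus sign if the oriented volume of $ABCDE$ is negative (a constant if $D=E$). Consider the complex of based real vector spaces $$0\to\mathfrak e_4\xrightarrow{f_1}(dx)\xrightarrow{f_2}(dl)\oplus(d\vartheta)\xrightarrow{f_3}(d\omega)\xrightarrow{f_4}(d\rho)\xrightarrow{f_5}(d\alpha)\oplus(d\beta)\to0,$$ where: - $\mathfrak e_4$ consists of the infinitesimal motions $(d\vec r,\mathcal A)$ of $\mathbb R^4$, $\mathcal A\in\mathfrak{so}(4)$, and $f_1$ gives the coordinate differentials $d\vec r+\mathcal A\,\vec r_A$ at every vertex $A$; - $f_2$ is the differential of all edge lengths and all angles $\vartheta$ as functions of the vertex coordinates; - $f_3$ is the differential, at the actual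 values of $l$ and $\vartheta$, of the deficit rotations $\omega_{BC}$ around all edges as functions of arbitrary lengths $l$ and angles $\vartheta$: $\omega_{BC}$ is the rotation obtained when a coordinate system associated with a tetrahedron at $BC$ is extended through all tetrahedra around $BC$ back to the initial one. An infinitesimal rotation $d\omega_{BC}$ around $BC$ is given by its three components in positively oriented orthonormal axes, the first of which is directed along $BC$, and $d\omega_{CB}=-d\omega_{BC}$; - $f_4$ gives $d\rho_A=\sum_B d\omega_{AB}\in\mathfrak{so}(4)$ for every vertex $A$ (sum over all edges $AB$ at $A$), and $f_5$ gives $d\alpha=\sum_A d\rho_A\in\mathfrak{so}(4)$ and $d\beta=\sum_A d\rho_A\,\vec r_A\in\mathbb R^4$. If the complex is acyclic, let $$\tau=\frac{\operatorname{minor}f_2\cdot\operatorname{minor}f_4}{\operatorname{minor}f_1\cdot\operatorname{minor}f_3\cdot\operatorname{minor}f_5}$$ be its torsion, where the minors are nonzero and the basis of each of the six spaces is completely divided between the rows of one minor and the columns of the next; up to a sign, $\tau$ does not depend on the choice of the minors. Set $$I=\tau\cdot\frac{\prod_{\text{edges}}l^3}{\prod_{\text{2-faces}}2S}.$$ The move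 $0\to2$ at a face $ABC$, common to the tetrahedra $FABC$ and $ABCD$, doubles it into two faces $ABC$ and $(ABC)'$ and fills the space between them with two mutually oppositely oriented tetrahedra $ABCE$ and $EABC$ with a new vertex $E$: they are glued to each other along $ABE,BCE,CAE$, the first is glued to $FABC$ along $ABC$ and the second to $ABCD$ along $(ABC)'$. The move $1\to4$ divides a tetrahedron into four by a new vertex $E$. The point ascribed to $E$ is arbitrary, subject to the general position condition for all vertices including $E$; the other points are not changed. **Theorem.** Under a move $0\to2$ the complex is acyclic before the move if and only if it is acyclic after it, and in that case the (nonzero) value of $I$ is, up to a sign, the same before and after the move. The same is true for the moves $1\to4$. Thus $I$ is invariant under the moves $0\to2$ and $1\leftrightarrow4$. -/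

import Mathlib

open scoped Matrix

/-- Euclidean four-space with its standard coordinates `w, x, y, z`. -/
abbrev R4 : Type := EuclideanSpace ℝ (Fin 4)

/-! ## Pseudotriangulations -/

/-- Cells and incidences of an oriented complex glued from tetrahedra. `V`, `E`, `F`, `T` are the
types of vertices, edges, two-dimensional faces and tetrahedra. The vertices of every tetrahedron
are labelled by `Fin 4`. -/
structure TetComplex (V E F T : Type*) where
  /-- the vertices of a tetrahedron -/
  vert : T → Fin 4 → V
  /-- the edge of a tetrahedron joining two of its (different) vertices; the value at two equal
  labels has no meaning and is never used -/
  edge : T → Fin 4 → Fin 4 → E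
  /-- the face of a tetrahedron opposite to the given vertex -/
  face : T → Fin 4 → F
  /-- the fixed orientation of a tetrahedron: the ordering `vert t (s 0), …, vert t (s 3)` of its
  vertices is right when the permutation `s` has the sign `ori t` -/
  ori : T → ℤˣ
  /-- the first end of an edge (every edge is given an arbitrary direction) -/
  src : E → V
  /-- the second end of an edge -/
  tgt : E → V

namespace TetComplex

variable {V E F T : Type*}

/-- The two tetrahedra at a face `ABC`: the right-oriented tetrahedra `EABC` (`left`, its vertices
being ordered by `lord`) and `ABCD` (`right`, ordered by `rord`), glued along `ABC`. The vertices
`D` and `E` may coincide. -/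
structure FaceStar (K : TetComplex V E F T) (f : F) where
  left : T
  right : T
  lord : Equiv.Perm (Fin 4)
  rord : Equiv.Perm (Fin 4)
  left_ne_right : left ≠ right
  left_face : K.face left (lord 0) = f
  right_face : K.face right (rord 3) = f
  left_oriented : Equiv.Perm.sign lord = K.ori left
  right_oriented : Equiv.Perm.sign rord = K.ori right
  vert_glue : ∀ a : Fin 3, K.vert left (lord a.succ) = K.vert right (rord a.castSucc)
  edge_glue : ∀ a b : Fin 3, a ≠ b →
    K.edge left (lord a.succ) (lord b.succ) = K.edge right (rord a.castSucc) (rord b.castSucc)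
  covers : ∀ t i, K.face t i = f → (t = left ∧ i = lord 0) ∨ (t = right ∧ i = rord 3)

/-- The star of an edge `BC` (directed from `B = src` to `C = tgt`): the right-oriented tetrahedra
`A₁A₂BC, A₂A₃BC, …, AₙA₁BC` in their cyclic order. The `k`-th of them is `tet k`, with vertices
ordered by `ord k`; it is glued to the next one along the face opposite to its first vertex. Every
tetrahedron containing the edge occurs exactly once. -/
structure EdgeStar (K : TetComplex V E F T) (e : E) where
  n : ℕ
  pos : 0 < n
  tet : Fin n → T
  ord : Fin n → Equiv.Perm (Fin 4)
  oriented : ∀ k, Equiv.Perm.sign (ord k) = K.ori (tet k)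
  edge_eq : ∀ k, K.edge (tet k) (ord k 2) (ord k 3) = e
  src_eq : ∀ k, K.vert (tet k) (ord k 2) = K.src e
  tgt_eq : ∀ k, K.vert (tet k) (ord k 3) = K.tgt e
  face_glue : ∀ k, K.face (tet k) (ord k 0) = K.face (tet (finRotate n k)) (ord (finRotate n k) 1)
  vert_glue : ∀ k, K.vert (tet k) (ord k 1) = K.vert (tet (finRotate n k)) (ord (finRotate n k) 0)
  covers : ∀ t i j, i ≠ j → K.edge t i j = e → ∃! k, tet k = t

/-- `v` is a vertex of the face `f`. -/
def FaceHasVert (K : TetComplex V E F T) (f : F) (v : V) : Prop :=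
  ∃ t i j, K.face t i = f ∧ j ≠ i ∧ K.vert t j = v

/-- `v` is a vertex of the tetrahedron `t`. -/
def TetHasVert (K : TetComplex V E F T) (t : T) (v : V) : Prop :=
  ∃ i, K.vert t i = v

/-- The (finite) complex is a pseudotriangulation of a closed connected oriented three-manifold in
which all four vertices of every tetrahedron are different. -/
structure IsClosedPseudotriangulation (K : TetComplex V E F T) : Prop where
  vert_injective : ∀ t, Function.Injective (K.vert t)
  edge_symm : ∀ t i j, K.edge t i j = K.edge t j i
  edge_ends : ∀ t i j, i ≠ j →
    (K.src (K.edge t i j) = K.vert t i ∧ K.tgt (K.edge t i j) = K.vert t j) ∨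
    (K.src (K.edge t i j) = K.vert t j ∧ K.tgt (K.edge t i j) = K.vert t i)
  /-- every face belongs to exactly two tetrahedra, consistently glued and oriented -/
  face_star : ∀ f, Nonempty (K.FaceStar f)
  /-- the link of every edge is a circle -/
  edge_star : ∀ e, Nonempty (K.EdgeStar e)
  /-- the link of every vertex (a closed surface) is connected … -/
  link_connected : ∀ v t t', K.TetHasVert t v → K.TetHasVert t' v →
    Relation.ReflTransGen
      (fun a b => ∃ i j, K.face a i = K.face b j ∧ K.FaceHasVert (K.face a i) v) t t'
  /-- … and has Euler characteristic two, that is, it is a sphere -/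
  link_euler : ∀ v,
    {e : E | K.src e = v ∨ K.tgt e = v}.ncard + {t : T | K.TetHasVert t v}.ncard =
      {f : F | K.FaceHasVert f v}.ncard + 2
  connected : ∀ t t', Relation.ReflTransGen (fun a b => ∃ i j, K.face a i = K.face b j) t t'

/-! ## The moves -/

/-- The move `0 → 2` at the face `ABC` opposite to the vertex `D`, labelled `i₀`, of the
tetrahedron `t₀ = ABCD`. The new vertex `E` is `none`; the new edges join `E` to `A, B, C`; the new
faces are `(ABC)'` (`none`) and the faces of the new tetrahedra opposite to `A, B, C` (the triangles
`BEC, CEA, AEB`), labelled by the label of the missing vertex. The new tetrahedra are copies of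
`t₀` with `D` replaced by `E`: the first one (`false`) has the orientation of `t₀` and takes the
place of `t₀` at the face `ABC`; the second one (`true`) has the opposite orientation and is glued
to `t₀` along `(ABC)'`. -/
def inflate [DecidableEq T] (K : TetComplex V E F T) (t₀ : T) (i₀ : Fin 4) :
    TetComplex (Option V) (E ⊕ {j : Fin 4 // j ≠ i₀}) (F ⊕ Option {j : Fin 4 // j ≠ i₀})
      (T ⊕ Bool) where
  vert
    | Sum.inl t, i => some (K.vert t i)
    | Sum.inr _, i => if i = i₀ then none else some (K.vert t₀ i)
  edge
    | Sum.inl t, i, j => Sum.inl (K.edge t i j)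
    | Sum.inr _, i, j =>
      if hi : i = i₀ then
        if hj : j = i₀ then Sum.inl (K.edge t₀ i j) else Sum.inr ⟨j, hj⟩
      else
        if j = i₀ then Sum.inr ⟨i, hi⟩ else Sum.inl (K.edge t₀ i j)
  face
    | Sum.inl t, i => if t = t₀ ∧ i = i₀ then Sum.inr none else Sum.inl (K.face t i)
    | Sum.inr b, i =>
      if hi : i = i₀ then
        if b then Sum.inr none else Sum.inl (K.face t₀ i₀)
      else Sum.inr (some ⟨i, hi⟩)
  ori
    | Sum.inl t => K.ori t
    | Sum.inr b => if b then -K.ori t₀ else K.ori t₀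
  src
    | Sum.inl e => some (K.src e)
    | Sum.inr j => some (K.vert t₀ j)
  tgt
    | Sum.inl e => some (K.tgt e)
    | Sum.inr _ => none

/-- The move `1 → 4` in the tetrahedron `t₀`: it is divided into four tetrahedra by a new vertex
`E` (`none`). The new tetrahedron `i` is `t₀` with the vertex labelled `i` replaced by `E`, with
the orientation of `t₀`; the new edge `j` joins the vertex of `t₀` labelled `j` to `E`; the common
face of the new tetrahedra `i` and `j` is labelled by `{i, j}`. -/
def subdivide (K : TetComplex V E F T) (t₀ : T) :
    TetComplex (Option V) (E ⊕ Fin 4) (F ⊕ {s : Finset (Fin 4) // s.card = 2})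
      ({t : T // t ≠ t₀} ⊕ Fin 4) where
  vert
    | Sum.inl t, i => some (K.vert t i)
    | Sum.inr a, i => if i = a then none else some (K.vert t₀ i)
  edge
    | Sum.inl t, i, j => Sum.inl (K.edge t i j)
    | Sum.inr a, i, j =>
      if i = a then
        if j = a then Sum.inl (K.edge t₀ i j) else Sum.inr j
      else
        if j = a then Sum.inr i else Sum.inl (K.edge t₀ i j)
  face
    | Sum.inl t, i => Sum.inl (K.face t i)
    | Sum.inr a, i =>
      if h : a = i then Sum.inl (K.face t₀ i) else Sum.inr ⟨{a, i}, Finset.card_pair h⟩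
  ori
    | Sum.inl t => K.ori t
    | Sum.inr _ => K.ori t₀
  src
    | Sum.inl e => some (K.src e)
    | Sum.inr j => some (K.vert t₀ j)
  tgt
    | Sum.inl e => some (K.tgt e)
    | Sum.inr _ => none

end TetComplex

/-! ## Euclidean geometry -/

/-- No five different vertices lie in one affine hyperplane. -/
def GeneralPosition {V : Type*} (p : V → R4) : Prop :=
  ∀ s : Fin 5 → V, Function.Injective s → AffineIndependent ℝ (p ∘ s)

/-- The component of `v` orthogonal to `u`. -/
noncomputable def perp (u v : R4) : R4 := v - (inner ℝ u v / inner ℝ u u) • u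

/-- The oriented volume of the four-simplex `ABCDE`. -/
noncomputable def vol4 (a b c d e : R4) : ℝ :=
  1 / 24 * (Matrix.of ![⇑(b - a), ⇑(c - a), ⇑(d - a), ⇑(e - a)]).det

/-- Twice the area of the triangle `ABC`. -/
noncomputable def area2 (a b c : R4) : ℝ := ‖b - a‖ * ‖perp (b - a) (c - a)‖

/-- The inner dihedral angle at the two-face `ABC` of the four-simplex `ABCDE`: the angle between
the components of `AD` and `AE` orthogonal to the plane `ABC`. -/
noncomputable def innerAngle (a b c d e : R4) : ℝ :=
  InnerProductGeometry.angle
    (perp (perp (b - a) (c - a)) (perp (b - a) (d - a)))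
    (perp (perp (b - a) (c - a)) (perp (b - a) (e - a)))

/-- The angle at the face `ABC` between adjacent tetrahedra `EABC` and `ABCD`: the exterior
dihedral angle at `ABC` in `ABCDE`, taken with the minus sign if the oriented volume of `ABCDE` is
negative. (If `D = E`, it is constantly `π`.) -/
noncomputable def theta (a b c d e : R4) : ℝ :=
  (if vol4 a b c d e < 0 then -1 else 1) * (Real.pi - innerAngle a b c d e)

/-- The inner dihedral angle at the edge joining the vertices `2` and `3` of a Euclidean
tetrahedron with the edge lengths `L i j`. Here `g i j` is the inner product of the vectors going
from the vertex `2` to the vertices `i` and `j`. -/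
noncomputable def dihedral (L : Fin 4 → Fin 4 → ℝ) : ℝ :=
  let g : Fin 4 → Fin 4 → ℝ := fun i j =>
    (L i 2 ^ 2 + L j 2 ^ 2 - (if i = j then 0 else L i j ^ 2)) / 2
  Real.arccos ((g 0 1 * g 3 3 - g 0 3 * g 1 3) /
    (√(g 0 0 * g 3 3 - g 0 3 ^ 2) * √(g 1 1 * g 3 3 - g 1 3 ^ 2)))

/-- The rotation through the angle `t` in the plane of the `i`-th and `j`-th axes, from the `i`-th
to the `j`-th. -/
noncomputable def rot (i j : Fin 4) (t : ℝ) : Matrix (Fin 4) (Fin 4) ℝ :=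
  Matrix.of fun a b =>
    if a = b then (if a = i ∨ a = j then Real.cos t else 1)
    else if a = j ∧ b = i then Real.sin t
    else if a = i ∧ b = j then -Real.sin t
    else 0

/-- The antisymmetric matrix with the entries `1` at `(i, j)` and `-1` at `(j, i)`. -/
def skew (i j : Fin 4) : Matrix (Fin 4) (Fin 4) ℝ :=
  Matrix.single i j 1 - Matrix.single j i 1

/-- The positions `12, 13, 14, 23, 24, 34` of the coordinates in `so(4)`. -/
def soPos : Fin 6 → Fin 4 × Fin 4 := ![(0, 1), (0, 2), (0, 3), (1, 2), (1, 3), (2, 3)]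

/-- The positions `34, 42, 23` of the components of a rotation leaving the first axis fixed. -/
def axisPos : Fin 3 → Fin 4 × Fin 4 := ![(2, 3), (3, 1), (1, 2)]

/-- The coordinates of the vector `v` in the orthonormal frame formed by the columns of `G`. -/
def coordsIn (G : Matrix (Fin 4) (Fin 4) ℝ) (v : R4) : Fin 4 → ℝ := Gᵀ *ᵥ ⇑v

/-! ## The complex of differentials -/

/-- The auxiliary choices made when the complex of a geometrized pseudotriangulation is written in
matrix form: which of the two tetrahedra at a face is called `EABC` and how `ABC` are named, from
which tetrahedron one starts going round an edge, and the axes for the components of a deficit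
angle. -/
structure Presentation {V E F T : Type*} (K : TetComplex V E F T) (p : V → R4) where
  faceStar : ∀ f, K.FaceStar f
  edgeStar : ∀ e, K.EdgeStar e
  /-- a positively oriented coordinate system whose first axis has the direction of the edge -/
  axes : E → Matrix (Fin 4) (Fin 4) ℝ
  axes_mem : ∀ e, axes e ∈ Matrix.specialOrthogonalGroup (Fin 4) ℝ
  axes_edge : ∀ e,
    coordsIn (axes e) (p (K.tgt e) - p (K.src e)) = ![dist (p (K.src e)) (p (K.tgt e)), 0, 0, 0]
  /-- the positively oriented coordinate system associated with the initial tetrahedron `A₁A₂BC` of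
  the star of an edge `BC`: the first axis has the direction of `BC`, the second lies in the plane
  `A₁BC` on the side of `A₁`, the third lies in the hyperplane `A₁A₂BC` on the side of `A₂` -/
  frame : E → Matrix (Fin 4) (Fin 4) ℝ
  frame_mem : ∀ e, frame e ∈ Matrix.specialOrthogonalGroup (Fin 4) ℝ
  frame_edge : ∀ e,
    coordsIn (frame e) (p (K.tgt e) - p (K.src e)) = ![dist (p (K.src e)) (p (K.tgt e)), 0, 0, 0]
  frame_fst : ∀ e, ∀ c : Fin 4 → ℝ,
    c = coordsIn (frame e)
      (p (K.vert ((edgeStar e).tet ⟨0, (edgeStar e).pos⟩)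
        ((edgeStar e).ord ⟨0, (edgeStar e).pos⟩ 0)) - p (K.src e)) →
    0 < c 1 ∧ c 2 = 0 ∧ c 3 = 0
  frame_snd : ∀ e, ∀ c : Fin 4 → ℝ,
    c = coordsIn (frame e)
      (p (K.vert ((edgeStar e).tet ⟨0, (edgeStar e).pos⟩)
        ((edgeStar e).ord ⟨0, (edgeStar e).pos⟩ 1)) - p (K.src e)) →
    0 < c 2 ∧ c 3 = 0

namespace Presentation

variable {V E F T : Type*} {K : TetComplex V E F T} {p : V → R4}

/-- The length of the edge `e` as a function of the vertex coordinates. -/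
noncomputable def length (_P : Presentation K p) (e : E) (q : V → R4) : ℝ :=
  dist (q (K.src e)) (q (K.tgt e))

/-- The angle at the face `f` as a function of the vertex coordinates. -/
noncomputable def angle (P : Presentation K p) (f : F) (q : V → R4) : ℝ :=
  let s := P.faceStar f
  theta (q (K.vert s.left (s.lord 1))) (q (K.vert s.left (s.lord 2)))
    (q (K.vert s.left (s.lord 3))) (q (K.vert s.right (s.rord 3))) (q (K.vert s.left (s.lord 0)))

/-- Twice the area of the face `f`. -/
noncomputable def doubleArea (P : Presentation K p) (f : F) : ℝ :=
  let s := P.faceStar f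
  area2 (p (K.vert s.left (s.lord 1))) (p (K.vert s.left (s.lord 2)))
    (p (K.vert s.left (s.lord 3)))

/-- All edge lengths and angles as functions of the vertex coordinates. -/
noncomputable def measure (P : Presentation K p) (q : V → R4) : E ⊕ F → ℝ :=
  Sum.elim (fun e => P.length e q) (fun f => P.angle f q)

/-- The deficit angle (an element of the rotation group) around the edge `e` for arbitrary edge
lengths `y (inl _)` and angles `y (inr _)`. A coordinate system is associated with the initial
tetrahedron `A₁A₂BC` and extended successively to `A₂A₃BC`, `A₃A₄BC`, …: the passage from the frame
of `AₖAₖ₊₁BC` to the frame of the next tetrahedron is the rotation through the dihedral angle at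
`BC` of `AₖAₖ₊₁BC` (the second axis goes over to the plane `Aₖ₊₁BC`) followed by the rotation
through the angle at the face `Aₖ₊₁BC` around this face. The matrix product is the resulting frame
with respect to the original one; it is rewritten as a linear operator of `ℝ⁴` in the standard
coordinates. -/
noncomputable def deficit (P : Presentation K p) (e : E) (y : E ⊕ F → ℝ) :
    Matrix (Fin 4) (Fin 4) ℝ :=
  let s := P.edgeStar e
  P.frame e *
    (List.ofFn fun k : Fin s.n =>
      rot 1 2 (dihedral fun i j => y (Sum.inl (K.edge (s.tet k) (s.ord k i) (s.ord k j)))) *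
      rot 2 3 (y (Sum.inr (K.face (s.tet k) (s.ord k 0))))).prod *
    (P.frame e)ᵀ

section Matrices

variable [Fintype V] [Fintype E] [Fintype F] [DecidableEq V] [DecidableEq E] [DecidableEq F]

/-- Infinitesimal motions `(dr, 𝒜)` to coordinate differentials: `dx_A = dr + 𝒜 x_A`. -/
noncomputable def f₁ (_P : Presentation K p) : Matrix (V × Fin 4) (Fin 4 ⊕ Fin 6) ℝ :=
  Matrix.of fun r => Sum.elim
    (fun j => if r.2 = j then 1 else 0)
    (fun m => (skew (soPos m).1 (soPos m).2 *ᵥ ⇑(p r.1)) r.2)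

/-- Coordinate differentials to differentials of lengths and angles. -/
noncomputable def f₂ (P : Presentation K p) : Matrix (E ⊕ F) (V × Fin 4) ℝ :=
  Matrix.of fun r c =>
    fderiv ℝ (fun q : V → R4 => P.measure q r) p (Pi.single c.1 (EuclideanSpace.single c.2 1))

/-- Differentials of lengths and angles to infinitesimal deficit angles; the components are taken
in the chosen axes of the edge. -/
noncomputable def f₃ (P : Presentation K p) : Matrix (E × Fin 3) (E ⊕ F) ℝ :=
  Matrix.of fun r c =>
    fderiv ℝ
      (fun y : E ⊕ F → ℝ =>
        ((P.axes r.1)ᵀ * P.deficit r.1 y * P.axes r.1) (axisPos r.2).1 (axisPos r.2).2)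
      (P.measure p) (Pi.single c 1)

/-- Infinitesimal deficit angles to `dρ_A = ∑_B dω_AB`, where `dω_BA = -dω_AB`. -/
noncomputable def f₄ (P : Presentation K p) : Matrix (V × Fin 6) (E × Fin 3) ℝ :=
  Matrix.of fun r c =>
    ((if K.src c.1 = r.1 then 1 else 0) - (if K.tgt c.1 = r.1 then 1 else 0)) *
      (P.axes c.1 * skew (axisPos c.2).1 (axisPos c.2).2 * (P.axes c.1)ᵀ)
        (soPos r.2).1 (soPos r.2).2

/-- `dα = ∑_A dρ_A` and `dβ = ∑_A dρ_A x_A`. -/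
noncomputable def f₅ (_P : Presentation K p) : Matrix (Fin 6 ⊕ Fin 4) (V × Fin 6) ℝ :=
  Matrix.of fun r c => Sum.elim
    (fun m => if m = c.2 then 1 else 0)
    (fun k => (skew (soPos c.2).1 (soPos c.2).2 *ᵥ ⇑(p c.1)) k) r

end Matrices

end Presentation

/-! ## Acyclicity and torsion -/

section Torsion

variable {I₀ I₁ I₂ I₃ I₄ I₅ : Type*} [Fintype I₀] [Fintype I₁] [Fintype I₂] [Fintype I₃]
  [Fintype I₄] [Fintype I₅] [DecidableEq I₀] [DecidableEq I₁] [DecidableEq I₂] [DecidableEq I₃]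
  [DecidableEq I₄] [DecidableEq I₅]

/-- Exactness of the sequence `0 → ℝ^I₀ → ℝ^I₁ → ⋯ → ℝ^I₅ → 0`. -/
def ExactSeq (g₁ : Matrix I₁ I₀ ℝ) (g₂ : Matrix I₂ I₁ ℝ) (g₃ : Matrix I₃ I₂ ℝ)
    (g₄ : Matrix I₄ I₃ ℝ) (g₅ : Matrix I₅ I₄ ℝ) : Prop :=
  LinearMap.ker g₁.mulVecLin = ⊥ ∧
  LinearMap.range g₁.mulVecLin = LinearMap.ker g₂.mulVecLin ∧
  LinearMap.range g₂.mulVecLin = LinearMap.ker g₃.mulVecLin ∧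
  LinearMap.range g₃.mulVecLin = LinearMap.ker g₄.mulVecLin ∧
  LinearMap.range g₄.mulVecLin = LinearMap.ker g₅.mulVecLin ∧
  LinearMap.range g₅.mulVecLin = ⊤

/-- A choice of nonzero minors of the five matrices such that the basis of each of the six spaces is
completely divided between the rows of one minor and the columns of the next one: `rₖ` is the set of
the rows of the `k`-th minor, its columns are those outside `rₖ₋₁`; all columns are taken in the
first minor and all rows in the fifth. The bijections arrange the rows and the columns in
corresponding orders; they affect the minors only by signs. -/
structure TauChain (g₁ : Matrix I₁ I₀ ℝ) (g₂ : Matrix I₂ I₁ ℝ) (g₃ : Matrix I₃ I₂ ℝ)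
    (g₄ : Matrix I₄ I₃ ℝ) (g₅ : Matrix I₅ I₄ ℝ) where
  r₁ : Finset I₁
  r₂ : Finset I₂
  r₃ : Finset I₃
  r₄ : Finset I₄
  e₁ : I₀ ≃ {i // i ∈ r₁}
  e₂ : {i // i ∉ r₁} ≃ {i // i ∈ r₂}
  e₃ : {i // i ∉ r₂} ≃ {i // i ∈ r₃}
  e₄ : {i // i ∉ r₃} ≃ {i // i ∈ r₄}
  e₅ : {i // i ∉ r₄} ≃ I₅
  minor₁_ne : (g₁.submatrix (fun i => (e₁ i : I₁)) id).det ≠ 0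
  minor₂_ne : (g₂.submatrix (fun i => (e₂ i : I₂)) Subtype.val).det ≠ 0
  minor₃_ne : (g₃.submatrix (fun i => (e₃ i : I₃)) Subtype.val).det ≠ 0
  minor₄_ne : (g₄.submatrix (fun i => (e₄ i : I₄)) Subtype.val).det ≠ 0
  minor₅_ne : (g₅.submatrix (fun i => e₅ i) Subtype.val).det ≠ 0

/-- The alternating product of the minors. -/
noncomputable def TauChain.torsion {g₁ : Matrix I₁ I₀ ℝ} {g₂ : Matrix I₂ I₁ ℝ}
    {g₃ : Matrix I₃ I₂ ℝ} {g₄ : Matrix I₄ I₃ ℝ} {g₅ : Matrix I₅ I₄ ℝ}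
    (c : TauChain g₁ g₂ g₃ g₄ g₅) : ℝ :=
  ((g₂.submatrix (fun i => (c.e₂ i : I₂)) Subtype.val).det *
    (g₄.submatrix (fun i => (c.e₄ i : I₄)) Subtype.val).det) /
  ((g₁.submatrix (fun i => (c.e₁ i : I₁)) id).det *
    (g₃.submatrix (fun i => (c.e₃ i : I₃)) Subtype.val).det *
    (g₅.submatrix (fun i => c.e₅ i) Subtype.val).det)

/-- The torsion exists and equals `t` up to a sign, whatever minors are chosen. -/
def HasTorsion (g₁ : Matrix I₁ I₀ ℝ) (g₂ : Matrix I₂ I₁ ℝ) (g₃ : Matrix I₃ I₂ ℝ)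
    (g₄ : Matrix I₄ I₃ ℝ) (g₅ : Matrix I₅ I₄ ℝ) (t : ℝ) : Prop :=
  Nonempty (TauChain g₁ g₂ g₃ g₄ g₅) ∧ ∀ c : TauChain g₁ g₂ g₃ g₄ g₅, |c.torsion| = t

end Torsion

namespace Presentation

variable {V E F T : Type*} {K : TetComplex V E F T} {p : V → R4}
variable [Fintype V] [Fintype E] [Fintype F] [DecidableEq V] [DecidableEq E] [DecidableEq F]

/-- The complex of differentials is acyclic. -/
def Acyclic (P : Presentation K p) : Prop := ExactSeq P.f₁ P.f₂ P.f₃ P.f₄ P.f₅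

/-- `I` is the value (up to a sign) of the torsion multiplied by the product of `l³` over all edges
and divided by the product of `2S` over all faces. -/
def HasInvariant (P : Presentation K p) (I : ℝ) : Prop :=
  ∃ t : ℝ, HasTorsion P.f₁ P.f₂ P.f₃ P.f₄ P.f₅ t ∧
    I = t * ((∏ e : E, P.length e p ^ 3) / ∏ f : F, P.doubleArea f)

end Presentation

/-! The torsion of an acyclic based complex is multiplicative: if a complex is enlarged, in block
triangular form, by a short acyclic complex, then acyclicity is preserved in both directions and the
torsion is multiplied by the torsion of the added piece. Both moves are of this kind after changes
of bases with determinant `±1`. Two pieces are added. One is `0 → (dx_E) → J → 0`, where `J`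
consists of four new lengths or angles: the four new lengths for `1 → 4`, the three new lengths and
the angle at `(ABC)'` for `0 → 2`. The other is `0 → Q → (dω at the new edges) → so(4) → 0`, where
`Q` are the angles at the new faces containing `E` and `so(4)` is the space of `dρ_E`.

The essential change of basis takes place in `(dl) ⊕ (dϑ)`. For `0 → 2` the angles at `ABC` and
`(ABC)'` add up, to within a constant, to the old angle, the angles at the faces through `E` are
constant, and the two new tetrahedra have opposite orientations, so that lengths act through them
with opposite signs. For `1 → 4` the angles at the inner faces, and the differences between the old
and the new angles at the faces of the divided tetrahedron, are functions of the lengths in the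
4-simplex `ABCDE`; they are subtracted. A change of length accompanied by these changes of angles is
a genuine deformation of the 4-simplex. The development of its three tetrahedra around an edge
remains trivial (`sum_three_tetrahedra`), so this change is invisible at the new edges and is seen
at the old edges exactly as before the move.

The passage from lengths and angles to bivectors rests on `Adapted.step`: the dihedral rotation
followed by the rotation through `ϑ` carries the frame of one tetrahedron to the frame of the next
one. Hence the differential of a deficit rotation is a sum of unit bivectors, one for every dihedral
angle and one for every face (`hasMatrixDeriv_development`). Since this sum runs over flags, it does
not depend on the choices made in a presentation, and it can be compared before and after a move.

It remains to evaluate three determinants. Let `a` be the matrix of the edge vectors at `E`,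
completed for `0 → 2` by the gradient of the angle at `(ABC)'`. With `r` new edges, the absolute
determinants are `|det a| ∏ l⁻¹` for the first piece and `|det a|³` and `|det a|^r ∏ l² ∏ (2S)⁻¹`
for the second (`absDet_star`). For `r = 4` the determinant of `a` cancels. For `r = 3` one factor
survives; it equals the doubled area of `(ABC)'` by `abs_det_theta_gradient`. In both cases the
torsion is multiplied by `∏ 2S / ∏ l³` over the new faces and edges, which the weight in `I`
compensates. The general mechanism is `Presentation.insertion`, resting on `Extension.exactSeq_iff`
and `Extension.exists_liftChain`. -/

set_option linter.unusedSectionVars false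

/-! ## Absolute determinants of matrices with arbitrary index types -/

/-- The absolute value of the determinant of a matrix whose rows and columns are indexed by
different types of the same size. -/
noncomputable def absDet {m n : Type*} [Fintype m] [Fintype n] [DecidableEq n]
    (M : Matrix m n ℝ) : ℝ :=
  √(Mᵀ * M).det

section AbsDet

variable {l m n o : Type*} [Fintype l] [Fintype m] [Fintype n] [Fintype o]
  [DecidableEq l] [DecidableEq m] [DecidableEq n] [DecidableEq o]

theorem absDet_eq (M : Matrix m n ℝ) (e : n ≃ m) : absDet M = |(M.submatrix e id).det| := by
  have h : Mᵀ * M = (M.submatrix e id)ᵀ * M.submatrix e id := by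
    rw [Matrix.transpose_submatrix, Matrix.submatrix_mul_equiv]
    simp
  rw [absDet, h, Matrix.det_mul, Matrix.det_transpose, Real.sqrt_mul_self_eq_abs]

theorem absDet_square (M : Matrix n n ℝ) : absDet M = |M.det| := by
  simpa using absDet_eq M (Equiv.refl n)

theorem absDet_nonneg (M : Matrix m n ℝ) : 0 ≤ absDet M := Real.sqrt_nonneg _

theorem absDet_mul_right (M : Matrix m n ℝ) (C : Matrix n n ℝ) :
    absDet (M * C) = absDet M * |C.det| := by
  have h : (M * C)ᵀ * (M * C) = Cᵀ * (Mᵀ * M) * C := by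
    simp only [Matrix.transpose_mul, Matrix.mul_assoc]
  rw [absDet, h, Matrix.det_mul, Matrix.det_mul, Matrix.det_transpose,
    show C.det * (Mᵀ * M).det * C.det = (C.det * C.det) * (Mᵀ * M).det by ring,
    Real.sqrt_mul (mul_self_nonneg _), Real.sqrt_mul_self_eq_abs, mul_comm, absDet]

theorem absDet_submatrix (M : Matrix m n ℝ) (e : l ≃ m) (f : o ≃ n) :
    absDet (M.submatrix e f) = absDet M := by
  rw [absDet, absDet, Matrix.transpose_submatrix, Matrix.submatrix_mul_equiv,
    Matrix.det_submatrix_equiv_self]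

/-- The middle index type must have the size of the columns of `M`: a Gram determinant is
multiplicative on this side only when the right factor is square. -/
theorem absDet_mul_left (U : Matrix l m ℝ) (M : Matrix m n ℝ)
    (h : Fintype.card m = Fintype.card n) :
    absDet (U * M) = absDet U * absDet M := by
  have e₂ : n ≃ m := Fintype.equivOfCardEq h.symm
  have h : U * M = U.submatrix id e₂ * M.submatrix e₂ id := by
    rw [Matrix.submatrix_mul_equiv]; simp
  rw [h, absDet_mul_right, ← absDet_eq]
  congr 1
  exact absDet_submatrix U (Equiv.refl l) e₂

theorem absDet_fromBlocks_zero₂₁ (A : Matrix m n ℝ) (B : Matrix m o ℝ) (D : Matrix l o ℝ)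
    (h₁ : Fintype.card m = Fintype.card n) (h₂ : Fintype.card l = Fintype.card o) :
    absDet (Matrix.fromBlocks A B 0 D) = absDet A * absDet D := by
  have e₁ : n ≃ m := Fintype.equivOfCardEq h₁.symm
  have e₂ : o ≃ l := Fintype.equivOfCardEq h₂.symm
  rw [absDet_eq A e₁, absDet_eq D e₂, absDet_eq _ (Equiv.sumCongr e₁ e₂), ← abs_mul,
    ← Matrix.det_fromBlocks_zero₂₁ (A.submatrix e₁ id) (B.submatrix e₁ id)]
  congr 2
  ext i j
  rcases i with i | i <;> rcases j with j | j <;> rfl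

theorem absDet_fromBlocks_zero₁₂ (A : Matrix m n ℝ) (C : Matrix l n ℝ) (D : Matrix l o ℝ)
    (h₁ : Fintype.card m = Fintype.card n) (h₂ : Fintype.card l = Fintype.card o) :
    absDet (Matrix.fromBlocks A 0 C D) = absDet A * absDet D := by
  have e₁ : n ≃ m := Fintype.equivOfCardEq h₁.symm
  have e₂ : o ≃ l := Fintype.equivOfCardEq h₂.symm
  rw [absDet_eq A e₁, absDet_eq D e₂, absDet_eq _ (Equiv.sumCongr e₁ e₂), ← abs_mul,
    ← Matrix.det_fromBlocks_zero₁₂ (A.submatrix e₁ id) (C.submatrix e₂ id)]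
  congr 2
  ext i j
  rcases i with i | i <;> rcases j with j | j <;> rfl

/-- Every vector is a combination of the columns of a matrix with a nonzero determinant. -/
theorem exists_mulVec_of_absDet_ne_zero (M : Matrix m n ℝ)
    (h : Fintype.card m = Fintype.card n) (hM : absDet M ≠ 0) (v : m → ℝ) :
    ∃ w, M *ᵥ w = v := by
  have e : n ≃ m := Fintype.equivOfCardEq h.symm
  rw [absDet_eq M e, ne_eq, abs_eq_zero] at hM
  have hu : IsUnit (M.submatrix e id).det := isUnit_iff_ne_zero.2 hM
  refine ⟨(M.submatrix e id)⁻¹ *ᵥ (v ∘ e), ?_⟩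
  have h1 : (M.submatrix e id) *ᵥ ((M.submatrix e id)⁻¹ *ᵥ (v ∘ e)) = v ∘ e := by
    rw [Matrix.mulVec_mulVec, Matrix.mul_nonsing_inv _ hu, Matrix.one_mulVec]
  funext i
  have := congrFun h1 (e.symm i)
  simpa [Matrix.mulVec, dotProduct] using this

theorem exists_mul_of_absDet_ne_zero (M : Matrix m n ℝ)
    (h : Fintype.card m = Fintype.card n) (hM : absDet M ≠ 0) (B : Matrix m o ℝ) :
    ∃ C : Matrix n o ℝ, M * C = B := by
  choose w hw using fun j => exists_mulVec_of_absDet_ne_zero M h hM (fun i => B i j)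
  refine ⟨Matrix.of fun i j => w j i, ?_⟩
  ext i j
  exact congrFun (hw j) i

theorem mulVec_injective_of_absDet_ne_zero (M : Matrix m n ℝ) (hM : absDet M ≠ 0) {v : n → ℝ}
    (h : M *ᵥ v = 0) : v = 0 := by
  have h0 : (Mᵀ * M).det ≠ 0 := by
    intro h0; exact hM (by rw [absDet, h0, Real.sqrt_zero])
  refine Matrix.eq_zero_of_mulVec_eq_zero h0 ?_
  rw [← Matrix.mulVec_mulVec, h, Matrix.mulVec_zero]

end AbsDet

/-! ## Torsion through lifts -/

section LiftChain

variable {I₀ I₁ I₂ I₃ I₄ I₅ : Type*} [Fintype I₀] [Fintype I₁] [Fintype I₂] [Fintype I₃]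
  [Fintype I₄] [Fintype I₅] [DecidableEq I₀] [DecidableEq I₁] [DecidableEq I₂] [DecidableEq I₃]
  [DecidableEq I₄] [DecidableEq I₅]

/-- A choice of lifts `bₖ` such that the columns of `[gₖ bₖ₋₁ | bₖ]` form bases of all spaces. -/
structure LiftChain (g₁ : Matrix I₁ I₀ ℝ) (g₂ : Matrix I₂ I₁ ℝ) (g₃ : Matrix I₃ I₂ ℝ)
    (g₄ : Matrix I₄ I₃ ℝ) (g₅ : Matrix I₅ I₄ ℝ) where
  n₁ : ℕ
  n₂ : ℕ
  n₃ : ℕ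
  n₄ : ℕ
  b₁ : Matrix I₁ (Fin n₁) ℝ
  b₂ : Matrix I₂ (Fin n₂) ℝ
  b₃ : Matrix I₃ (Fin n₃) ℝ
  b₄ : Matrix I₄ (Fin n₄) ℝ
  card₁ : Fintype.card I₁ = Fintype.card I₀ + n₁
  card₂ : Fintype.card I₂ = n₁ + n₂
  card₃ : Fintype.card I₃ = n₂ + n₃
  card₄ : Fintype.card I₄ = n₃ + n₄
  card₅ : Fintype.card I₅ = n₄
  ne₁ : absDet (Matrix.fromCols g₁ b₁) ≠ 0
  ne₂ : absDet (Matrix.fromCols (g₂ * b₁) b₂) ≠ 0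
  ne₃ : absDet (Matrix.fromCols (g₃ * b₂) b₃) ≠ 0
  ne₄ : absDet (Matrix.fromCols (g₄ * b₃) b₄) ≠ 0
  ne₅ : absDet (g₅ * b₄) ≠ 0

variable {g₁ : Matrix I₁ I₀ ℝ} {g₂ : Matrix I₂ I₁ ℝ} {g₃ : Matrix I₃ I₂ ℝ}
  {g₄ : Matrix I₄ I₃ ℝ} {g₅ : Matrix I₅ I₄ ℝ}

/-- The alternating product of the determinants of a chain of lifts. -/
noncomputable def LiftChain.torsion (c : LiftChain g₁ g₂ g₃ g₄ g₅) : ℝ :=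
  absDet (Matrix.fromCols (g₂ * c.b₁) c.b₂) * absDet (Matrix.fromCols (g₄ * c.b₃) c.b₄) /
    (absDet (Matrix.fromCols g₁ c.b₁) * absDet (Matrix.fromCols (g₃ * c.b₂) c.b₃) *
      absDet (g₅ * c.b₄))

/-- Consecutive matrices compose to zero. -/
def IsComplex (g₁ : Matrix I₁ I₀ ℝ) (g₂ : Matrix I₂ I₁ ℝ) (g₃ : Matrix I₃ I₂ ℝ)
    (g₄ : Matrix I₄ I₃ ℝ) (g₅ : Matrix I₅ I₄ ℝ) : Prop :=
  g₂ * g₁ = 0 ∧ g₃ * g₂ = 0 ∧ g₄ * g₃ = 0 ∧ g₅ * g₄ = 0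

/-- The columns of `[g | b]` form a basis, so the columns of any other lift expand in it. -/
theorem exists_lift_decomposition {I J : Type*} [Fintype I] [DecidableEq I] [Fintype J]
    [DecidableEq J] {n n' : ℕ} (g : Matrix I J ℝ) (b : Matrix I (Fin n) ℝ)
    (b' : Matrix I (Fin n') ℝ) (hc : Fintype.card I = Fintype.card J + n)
    (h : absDet (Matrix.fromCols g b) ≠ 0) :
    ∃ (C : Matrix J (Fin n') ℝ) (A : Matrix (Fin n) (Fin n') ℝ), b' = g * C + b * A := by
  obtain ⟨X, hX⟩ := exists_mul_of_absDet_ne_zero _ (by simp [hc]) h b'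
  refine ⟨X.toRows₁, X.toRows₂, ?_⟩
  rw [← hX, ← Matrix.fromCols_mul_fromRows, Matrix.fromRows_toRows]

/-- A change of lifts multiplies `[g | b]` on the right by a block triangular matrix. -/
theorem absDet_fromCols_change {I J : Type*} [Fintype I] [DecidableEq I] [Fintype J]
    [DecidableEq J] {n : ℕ} (g : Matrix I J ℝ) (b : Matrix I (Fin n) ℝ) (B : Matrix J J ℝ)
    (C : Matrix J (Fin n) ℝ) (A : Matrix (Fin n) (Fin n) ℝ) :
    absDet (Matrix.fromCols (g * B) (g * C + b * A)) =
      absDet (Matrix.fromCols g b) * (|B.det| * |A.det|) := by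
  have : Matrix.fromCols (g * B) (g * C + b * A) =
      Matrix.fromCols g b * Matrix.fromBlocks B C 0 A := by
    rw [Matrix.fromCols_mul_fromBlocks]; simp
  rw [this, absDet_mul_right, Matrix.det_fromBlocks_zero₂₁, abs_mul]

/-- A new lift differs from the old one by a matrix `Aₖ` and by a part in the image of the preceding
map. That part is killed by the next map, so `det Aₖ` enters two consecutive determinants only;
these stand on opposite sides of the fraction and the factors cancel. -/
theorem LiftChain.torsion_eq (hg : IsComplex g₁ g₂ g₃ g₄ g₅) (c c' : LiftChain g₁ g₂ g₃ g₄ g₅) :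
    c.torsion = c'.torsion := by
  obtain ⟨h21, h32, h43, h54⟩ := hg
  obtain ⟨n₁, n₂, n₃, n₄, b₁, b₂, b₃, b₄, k₁, k₂, k₃, k₄, k₅, e₁, e₂, e₃, e₄, e₅⟩ := c
  obtain ⟨n₁', n₂', n₃', n₄', b₁', b₂', b₃', b₄', k₁', k₂', k₃', k₄', k₅', e₁', e₂', e₃', e₄',
    e₅'⟩ := c'
  -- The numbers of columns in the lifts are determined by the dimensions of the spaces.
  obtain rfl : n₁ = n₁' := by omega
  obtain rfl : n₂ = n₂' := by omega
  obtain rfl : n₃ = n₃' := by omega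
  obtain rfl : n₄ = n₄' := by omega
  obtain ⟨C₁, A₁, rfl⟩ := exists_lift_decomposition g₁ b₁ b₁' k₁ e₁
  obtain ⟨C₂, A₂, rfl⟩ := exists_lift_decomposition (g₂ * b₁) b₂ b₂' (by simpa using k₂) e₂
  obtain ⟨C₃, A₃, rfl⟩ := exists_lift_decomposition (g₃ * b₂) b₃ b₃' (by simpa using k₃) e₃
  obtain ⟨C₄, A₄, rfl⟩ := exists_lift_decomposition (g₄ * b₃) b₄ b₄' (by simpa using k₄) e₄
  have q₁ : g₂ * (g₁ * C₁ + b₁ * A₁) = g₂ * b₁ * A₁ := by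
    rw [Matrix.mul_add, ← Matrix.mul_assoc, h21, Matrix.zero_mul, zero_add, Matrix.mul_assoc]
  have q₂ : g₃ * (g₂ * b₁ * C₂ + b₂ * A₂) = g₃ * b₂ * A₂ := by
    rw [Matrix.mul_add, Matrix.mul_assoc g₂, ← Matrix.mul_assoc, h32, Matrix.zero_mul, zero_add,
      Matrix.mul_assoc]
  have q₃ : g₄ * (g₃ * b₂ * C₃ + b₃ * A₃) = g₄ * b₃ * A₃ := by
    rw [Matrix.mul_add, Matrix.mul_assoc g₃, ← Matrix.mul_assoc, h43, Matrix.zero_mul, zero_add,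
      Matrix.mul_assoc]
  have q₄ : g₅ * (g₄ * b₃ * C₄ + b₄ * A₄) = g₅ * b₄ * A₄ := by
    rw [Matrix.mul_add, Matrix.mul_assoc g₄, ← Matrix.mul_assoc, h54, Matrix.zero_mul, zero_add,
      Matrix.mul_assoc]
  have p₁ := absDet_fromCols_change g₁ b₁ 1 C₁ A₁
  have p₂ := absDet_fromCols_change (g₂ * b₁) b₂ A₁ C₂ A₂
  have p₃ := absDet_fromCols_change (g₃ * b₂) b₃ A₂ C₃ A₃
  have p₄ := absDet_fromCols_change (g₄ * b₃) b₄ A₃ C₄ A₄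
  have p₅ := absDet_mul_right (g₅ * b₄) A₄
  rw [Matrix.mul_one, Matrix.det_one, abs_one, one_mul] at p₁
  simp only [q₁, q₂, q₃, q₄] at e₁' e₂' e₃' e₄' e₅'
  simp only [LiftChain.torsion, q₁, q₂, q₃, q₄]
  rw [p₁] at e₁'; rw [p₂] at e₂'; rw [p₃] at e₃'; rw [p₄] at e₄'; rw [p₅] at e₅'
  rw [p₁, p₂, p₃, p₄, p₅]
  have a₁ := right_ne_zero_of_mul e₁'
  have a₂ := right_ne_zero_of_mul (right_ne_zero_of_mul e₂')
  have a₃ := right_ne_zero_of_mul (right_ne_zero_of_mul e₃')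
  have a₄ := right_ne_zero_of_mul e₅'
  field_simp

theorem LiftChain.torsion_pos (c : LiftChain g₁ g₂ g₃ g₄ g₅) : 0 < c.torsion := by
  have q₁ := lt_of_le_of_ne (absDet_nonneg _) c.ne₁.symm
  have q₂ := lt_of_le_of_ne (absDet_nonneg _) c.ne₂.symm
  have q₃ := lt_of_le_of_ne (absDet_nonneg _) c.ne₃.symm
  have q₄ := lt_of_le_of_ne (absDet_nonneg _) c.ne₄.symm
  have q₅ := lt_of_le_of_ne (absDet_nonneg _) c.ne₅.symm
  unfold LiftChain.torsion
  positivity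

/-- The columns of the unit matrix outside a set complete a minor to a basis. -/
theorem absDet_fromCols_unit {I J : Type*} [Fintype I] [DecidableEq I] [Fintype J]
    [DecidableEq J] {n : ℕ} (M : Matrix I J ℝ) (r : Finset I) (e : J ≃ {i // i ∈ r})
    (f : Fin n ≃ {i // i ∉ r}) :
    absDet (Matrix.fromCols M ((1 : Matrix I I ℝ).submatrix id fun k => (f k : I))) =
      |(M.submatrix (fun j => (e j : I)) id).det| := by
  let φ : J ⊕ Fin n ≃ I := (Equiv.sumCongr e f).trans (Equiv.sumCompl (fun i => i ∈ r))
  have hφ₁ : ∀ j, φ (Sum.inl j) = (e j : I) := fun j => rfl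
  have hφ₂ : ∀ k, φ (Sum.inr k) = (f k : I) := fun k => rfl
  rw [absDet_eq _ φ]
  have : (Matrix.fromCols M ((1 : Matrix I I ℝ).submatrix id fun k => (f k : I))).submatrix φ id
      = Matrix.fromBlocks (M.submatrix (fun j => (e j : I)) id) 0
          (M.submatrix (fun j => (f j : I)) id) 1 := by
    ext i j
    rcases i with i | i <;> rcases j with j | j <;>
      simp only [Matrix.submatrix_apply, id, hφ₁, hφ₂, Matrix.fromCols_apply_inl,
        Matrix.fromCols_apply_inr, Matrix.fromBlocks_apply₁₁, Matrix.fromBlocks_apply₁₂,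
        Matrix.fromBlocks_apply₂₁, Matrix.fromBlocks_apply₂₂, Matrix.zero_apply]
    · exact Matrix.one_apply_ne fun h => (f j).2 (h ▸ (e i).2)
    · simp [Matrix.one_apply, Subtype.coe_inj]
  rw [this, Matrix.det_fromBlocks_zero₁₂, Matrix.det_one, mul_one]

/-- Applied to unit vectors a matrix yields a selection of its columns, and completion by further
unit vectors deletes rows. What is left is a minor. -/
theorem absDet_unit_lift {I J : Type*} [Fintype I] [DecidableEq I] [Fintype J]
    [DecidableEq J] {n n' : ℕ} (g : Matrix I J ℝ) (s : Finset J) (r : Finset I)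
    (e : {j // j ∉ s} ≃ {i // i ∈ r}) (h : Fin n' ≃ {j // j ∉ s}) (f : Fin n ≃ {i // i ∉ r}) :
    absDet (Matrix.fromCols (g * (1 : Matrix J J ℝ).submatrix id fun k => (h k : J))
        ((1 : Matrix I I ℝ).submatrix id fun k => (f k : I))) =
      |(g.submatrix (fun j => (e j : I)) Subtype.val).det| := by
  rw [absDet_fromCols_unit _ r (h.trans e) f]
  rw [← Matrix.det_submatrix_equiv_self h (g.submatrix (fun j => (e j : I)) Subtype.val)]
  congr 2
  ext i j
  simp [Matrix.mul_apply, Matrix.one_apply]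

theorem card_eq_add_compl {I : Type*} [Fintype I] [DecidableEq I] (r : Finset I) :
    Fintype.card I = Fintype.card {i // i ∈ r} + Fintype.card {i // i ∉ r} := by
  rw [← Fintype.card_sum]
  exact Fintype.card_congr (Equiv.sumCompl (fun i => i ∈ r)).symm

/-- The unit vectors outside the rows of each minor serve as lifts. In this way all choices of
minors become special cases of choices of lifts, and the independence of the choice follows from
`LiftChain.torsion_eq`. -/
theorem TauChain.exists_liftChain (c : TauChain g₁ g₂ g₃ g₄ g₅) :
    ∃ d : LiftChain g₁ g₂ g₃ g₄ g₅, d.torsion = |c.torsion| := by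
  obtain ⟨r₁, r₂, r₃, r₄, e₁, e₂, e₃, e₄, e₅, m₁, m₂, m₃, m₄, m₅⟩ := c
  let f₁ := (Fintype.equivFin {i // i ∉ r₁}).symm
  let f₂ := (Fintype.equivFin {i // i ∉ r₂}).symm
  let f₃ := (Fintype.equivFin {i // i ∉ r₃}).symm
  let f₄ := (Fintype.equivFin {i // i ∉ r₄}).symm
  have q₁ := absDet_fromCols_unit g₁ r₁ e₁ f₁
  have q₂ := absDet_unit_lift g₂ r₁ r₂ e₂ f₁ f₂
  have q₃ := absDet_unit_lift g₃ r₂ r₃ e₃ f₂ f₃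
  have q₄ := absDet_unit_lift g₄ r₃ r₄ e₄ f₃ f₄
  have q₅ : absDet (g₅ * (1 : Matrix I₄ I₄ ℝ).submatrix id fun k => (f₄ k : I₄)) =
      |(g₅.submatrix (fun i => e₅ i) Subtype.val).det| := by
    rw [absDet_eq _ (f₄.trans e₅),
      ← Matrix.det_submatrix_equiv_self f₄ (g₅.submatrix (fun i => e₅ i) Subtype.val)]
    congr 2
    ext i j
    simp [Matrix.mul_apply, Matrix.one_apply]
  refine ⟨⟨_, _, _, _, (1 : Matrix I₁ I₁ ℝ).submatrix id fun k => (f₁ k : I₁),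
    (1 : Matrix I₂ I₂ ℝ).submatrix id fun k => (f₂ k : I₂),
    (1 : Matrix I₃ I₃ ℝ).submatrix id fun k => (f₃ k : I₃),
    (1 : Matrix I₄ I₄ ℝ).submatrix id fun k => (f₄ k : I₄), ?_, ?_, ?_, ?_, ?_,
    by rw [q₁]; exact abs_ne_zero.2 m₁, by rw [q₂]; exact abs_ne_zero.2 m₂,
    by rw [q₃]; exact abs_ne_zero.2 m₃, by rw [q₄]; exact abs_ne_zero.2 m₄,
    by rw [q₅]; exact abs_ne_zero.2 m₅⟩, ?_⟩
  · rw [Fintype.card_congr e₁]; exact card_eq_add_compl r₁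
  · rw [Fintype.card_congr e₂]; exact card_eq_add_compl r₂
  · rw [Fintype.card_congr e₃]; exact card_eq_add_compl r₃
  · rw [Fintype.card_congr e₄]; exact card_eq_add_compl r₄
  · exact (Fintype.card_congr e₅).symm
  · simp only [LiftChain.torsion, TauChain.torsion, q₁, q₂, q₃, q₄, q₅, abs_div, abs_mul]

/-! ### Existence of minors -/

/-- The row rank equals the column rank, so a maximal independent family of rows of an injective
matrix has as many members as there are columns. -/
theorem exists_minor {I J : Type*} [Fintype I] [DecidableEq I] [Fintype J] [DecidableEq J]
    (M : Matrix I J ℝ) (h : ∀ v, M *ᵥ v = 0 → v = 0) :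
    ∃ (r : Finset I) (e : J ≃ {i // i ∈ r}), (M.submatrix (fun j => (e j : I)) id).det ≠ 0 := by
  obtain ⟨κ, a, ha, hs, hli⟩ := exists_linearIndependent' ℝ M.row
  have : Finite κ := Finite.of_injective a ha
  have := Fintype.ofFinite κ
  classical
  have hinj : Function.Injective M.mulVec := by
    intro v w hvw
    exact sub_eq_zero.1 (h (v - w) (by rw [Matrix.mulVec_sub]; exact sub_eq_zero.2 hvw))
  have hrank : M.rank = Fintype.card J := by
    rw [Matrix.mulVec_injective_iff] at hinj
    rw [← Matrix.rank_transpose]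
    exact hinj.rank_matrix
  have hcard : Fintype.card κ = Fintype.card J := by
    rw [← hrank, Matrix.rank_eq_finrank_span_row, ← hs, finrank_span_eq_card hli]
  obtain ⟨f⟩ : Nonempty (J ≃ κ) := ⟨Fintype.equivOfCardEq hcard.symm⟩
  refine ⟨Finset.univ.map ⟨a, ha⟩,
    f.trans (Equiv.ofBijective (fun k => ⟨a k, by simp⟩) ⟨?_, ?_⟩), ?_⟩
  · intro k k' hk
    exact ha (congrArg Subtype.val hk)
  · rintro ⟨i, hi⟩
    obtain ⟨k, -, hk⟩ := Finset.mem_map.1 hi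
    exact ⟨k, Subtype.ext hk⟩
  · have h1 : LinearIndependent ℝ (M.submatrix (fun j => a (f j)) id).row :=
      hli.comp f f.injective
    exact ((Matrix.isUnit_iff_isUnit_det _).1
      (Matrix.linearIndependent_rows_iff_isUnit.1 h1)).ne_zero

/-- Restriction to the complement of a set is transversal to the range of a matrix. -/
def Transversal {I J : Type*} [Fintype J] (g : Matrix I J ℝ) (r : Finset I) : Prop :=
  (∀ w, (∀ i ∈ r, (g *ᵥ w) i = 0) → g *ᵥ w = 0) ∧ ∀ u : I → ℝ, ∃ w, ∀ i ∈ r, (g *ᵥ w) i = u i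

theorem mulVec_submatrix_val {I J : Type*} [Fintype J] [DecidableEq J] (g : Matrix I J ℝ)
    (s : Finset J) (v : {j // j ∉ s} → ℝ) :
    g.submatrix id (Subtype.val : {j // j ∉ s} → J) *ᵥ v =
      g *ᵥ fun j => if h : j ∉ s then v ⟨j, h⟩ else 0 := by
  funext i
  simp only [Matrix.mulVec, dotProduct, Matrix.submatrix_apply, id]
  have : ∀ j : {j // j ∉ s}, g i j * v j =
      (fun j => g i j * if h : j ∉ s then v ⟨j, h⟩ else 0) j := by
    intro j; simp [j.2]
  rw [Finset.sum_congr rfl fun j _ => this j,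
    ← Finset.sum_subtype (Finset.univ.filter fun j => j ∉ s) (by simp)
      (fun j => g i j * if h : j ∉ s then v ⟨j, h⟩ else 0)]
  refine Finset.sum_filter_of_ne fun x _ hx hxs => hx ?_
  simp [hxs]

/-- By exactness the kernel of `g` is the range of `g'`. Transversality makes it a complement of the
vectors vanishing on `s`, so `g` loses nothing of its range and becomes injective when only the
columns outside `s` are kept. -/
theorem exists_minor_step {I J L : Type*} [Fintype I] [DecidableEq I] [Fintype J]
    [DecidableEq J] [Fintype L] (g' : Matrix J L ℝ) (g : Matrix I J ℝ) (s : Finset J)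
    (hs : Transversal g' s)
    (hex : LinearMap.range g'.mulVecLin = LinearMap.ker g.mulVecLin) :
    (∀ v, g.submatrix id (Subtype.val : {j // j ∉ s} → J) *ᵥ v = 0 → v = 0) ∧
    ∀ u, ∃ v, g *ᵥ u = g.submatrix id (Subtype.val : {j // j ∉ s} → J) *ᵥ v := by
  constructor
  · intro v hv
    rw [mulVec_submatrix_val] at hv
    have : (fun j => if h : j ∉ s then v ⟨j, h⟩ else 0) ∈ LinearMap.range g'.mulVecLin := by
      rw [hex]; exact hv
    obtain ⟨w, hw⟩ := this
    change g' *ᵥ w = _ at hw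
    have := hs.1 w (fun j hj => by rw [hw]; simp [hj])
    rw [hw] at this
    funext j
    have := congrFun this j
    simpa [j.2] using this
  · intro u
    obtain ⟨w, hw⟩ := hs.2 u
    refine ⟨fun j => u j - (g' *ᵥ w) j, ?_⟩
    rw [mulVec_submatrix_val]
    have h1 : g *ᵥ (g' *ᵥ w) = 0 := by
      have : g' *ᵥ w ∈ LinearMap.ker g.mulVecLin := by rw [← hex]; exact ⟨w, rfl⟩
      exact this
    have h2 : (fun j => if _ : j ∉ s then u j - (g' *ᵥ w) j else 0) = u - g' *ᵥ w := by
      funext j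
      by_cases hj : j ∈ s
      · simp [hj, hw j hj]
      · simp [hj]
    rw [h2, Matrix.mulVec_sub, h1, sub_zero]

/-- Both matrices have the same range, and on it the coordinates in `r` form an isomorphism because
the minor of `h` is invertible. -/
theorem transversal_of_minor {I J K : Type*} [Fintype I] [DecidableEq I] [Fintype J]
    [Fintype K] [DecidableEq K] (g : Matrix I J ℝ) (h : Matrix I K ℝ) (r : Finset I)
    (e : K ≃ {i // i ∈ r}) (hd : (h.submatrix (fun j => (e j : I)) id).det ≠ 0)
    (h₁ : ∀ u, ∃ v, g *ᵥ u = h *ᵥ v) (h₂ : ∀ v, ∃ u, g *ᵥ u = h *ᵥ v) : Transversal g r := by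
  constructor
  · intro w hw
    obtain ⟨v, hv⟩ := h₁ w
    have : v = 0 := by
      refine Matrix.eq_zero_of_mulVec_eq_zero hd ?_
      funext j
      have := hw (e j) (e j).2
      rw [hv] at this
      exact this
    rw [hv, this, Matrix.mulVec_zero]
  · intro u
    have hu : IsUnit (h.submatrix (fun j => (e j : I)) id).det := isUnit_iff_ne_zero.2 hd
    obtain ⟨w, hw⟩ := h₂ ((h.submatrix (fun j => (e j : I)) id)⁻¹ *ᵥ fun j => u (e j))
    refine ⟨w, fun i hi => ?_⟩
    have h3 : (h.submatrix (fun j => (e j : I)) id) *ᵥ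
        ((h.submatrix (fun j => (e j : I)) id)⁻¹ *ᵥ fun j => u (e j)) = fun j => u (e j) := by
      rw [Matrix.mulVec_mulVec, Matrix.mul_nonsing_inv _ hu, Matrix.one_mulVec]
    rw [hw]
    have := congrFun h3 (e.symm ⟨i, hi⟩)
    simpa [Matrix.mulVec, dotProduct] using this

theorem exists_minor_transversal {I J L : Type*} [Fintype I] [DecidableEq I] [Fintype J]
    [DecidableEq J] [Fintype L] (g' : Matrix J L ℝ) (g : Matrix I J ℝ) (s : Finset J)
    (hs : Transversal g' s)
    (hex : LinearMap.range g'.mulVecLin = LinearMap.ker g.mulVecLin) :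
    ∃ (r : Finset I) (e : {j // j ∉ s} ≃ {i // i ∈ r}),
      (g.submatrix (fun j => (e j : I)) Subtype.val).det ≠ 0 ∧ Transversal g r := by
  obtain ⟨h₁, h₂⟩ := exists_minor_step g' g s hs hex
  obtain ⟨r, e, he⟩ := exists_minor _ h₁
  refine ⟨r, e, he, transversal_of_minor g _ r e he h₂ fun v => ?_⟩
  exact ⟨_, (mulVec_submatrix_val g s v).symm⟩

/-- The minors are chosen from left to right: the rows of each one leave exactly the columns on
which the next map is injective. -/
theorem ExactSeq.nonempty_tauChain (h : ExactSeq g₁ g₂ g₃ g₄ g₅) :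
    Nonempty (TauChain g₁ g₂ g₃ g₄ g₅) := by
  obtain ⟨x₀, x₁, x₂, x₃, x₄, x₅⟩ := h
  obtain ⟨r₁, e₁, m₁⟩ := exists_minor g₁ fun v hv => by
    have : v ∈ LinearMap.ker g₁.mulVecLin := hv
    rwa [x₀] at this
  have t₁ := transversal_of_minor g₁ g₁ r₁ e₁ m₁ (fun u => ⟨u, rfl⟩) fun u => ⟨u, rfl⟩
  obtain ⟨r₂, e₂, m₂, t₂⟩ := exists_minor_transversal g₁ g₂ r₁ t₁ x₁
  obtain ⟨r₃, e₃, m₃, t₃⟩ := exists_minor_transversal g₂ g₃ r₂ t₂ x₂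
  obtain ⟨r₄, e₄, m₄, t₄⟩ := exists_minor_transversal g₃ g₄ r₃ t₃ x₃
  obtain ⟨y₁, y₂⟩ := exists_minor_step g₄ g₅ r₄ t₄ x₄
  have hinj : Function.Injective (g₅.submatrix id (Subtype.val : {j // j ∉ r₄} → I₄)).mulVecLin := by
    rw [← LinearMap.ker_eq_bot, LinearMap.ker_eq_bot']
    exact y₁
  have hsurj : Function.Surjective (g₅.submatrix id (Subtype.val : {j // j ∉ r₄} → I₄)).mulVecLin := by
    intro u
    obtain ⟨w, rfl⟩ : u ∈ LinearMap.range g₅.mulVecLin := by rw [x₅]; trivial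
    obtain ⟨v, hv⟩ := y₂ w
    exact ⟨v, hv.symm⟩
  -- Surjectivity at the right end makes the last restricted matrix square, so all rows of `g₅` can
  -- be used.
  have hcard := (LinearEquiv.ofBijective _ ⟨hinj, hsurj⟩).finrank_eq
  rw [Module.finrank_pi, Module.finrank_pi] at hcard
  let e₅ := Fintype.equivOfCardEq hcard
  refine ⟨⟨r₁, r₂, r₃, r₄, e₁, e₂, e₃, e₄, e₅, m₁, m₂, m₃, m₄, ?_⟩⟩
  intro h0
  obtain ⟨v, hv, hv0⟩ := Matrix.exists_mulVec_eq_zero_iff.2 h0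
  refine hv (y₁ v ?_)
  funext i
  have := congrFun hv0 (e₅.symm i)
  simpa [Matrix.mulVec, dotProduct] using this

theorem mul_eq_zero_of_range_eq_ker {I J L : Type*} [Fintype I] [DecidableEq I] [Fintype J]
    [DecidableEq J] [Fintype L] [DecidableEq L] (g' : Matrix J L ℝ) (g : Matrix I J ℝ)
    (hex : LinearMap.range g'.mulVecLin ≤ LinearMap.ker g.mulVecLin) : g * g' = 0 := by
  ext i j
  have : g'.mulVecLin (Pi.single j 1) ∈ LinearMap.ker g.mulVecLin := hex ⟨_, rfl⟩
  have := congrFun (show g *ᵥ (g' *ᵥ Pi.single j 1) = 0 from this) i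
  rw [Matrix.mulVec_mulVec] at this
  simpa using this

theorem ExactSeq.isComplex (h : ExactSeq g₁ g₂ g₃ g₄ g₅) : IsComplex g₁ g₂ g₃ g₄ g₅ :=
  ⟨mul_eq_zero_of_range_eq_ker _ _ h.2.1.le, mul_eq_zero_of_range_eq_ker _ _ h.2.2.1.le,
    mul_eq_zero_of_range_eq_ker _ _ h.2.2.2.1.le, mul_eq_zero_of_range_eq_ker _ _ h.2.2.2.2.1.le⟩

/-- The torsion of an exact sequence is computed by any chain of lifts. -/
theorem ExactSeq.hasTorsion (h : ExactSeq g₁ g₂ g₃ g₄ g₅) (d : LiftChain g₁ g₂ g₃ g₄ g₅) :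
    HasTorsion g₁ g₂ g₃ g₄ g₅ d.torsion := by
  refine ⟨h.nonempty_tauChain, fun c => ?_⟩
  obtain ⟨d', hd'⟩ := c.exists_liftChain
  rw [← hd']
  exact LiftChain.torsion_eq h.isComplex d' d

theorem ExactSeq.nonempty_liftChain (h : ExactSeq g₁ g₂ g₃ g₄ g₅) :
    Nonempty (LiftChain g₁ g₂ g₃ g₄ g₅) := by
  obtain ⟨c⟩ := h.nonempty_tauChain
  obtain ⟨d, -⟩ := c.exists_liftChain
  exact ⟨d⟩

end LiftChain

/-! ## Unimodular changes of bases -/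

/-- A change of basis with determinant `±1`. -/
structure UnitChange (I J : Type*) [Fintype I] [Fintype J] [DecidableEq I] [DecidableEq J] where
  U : Matrix I J ℝ
  W : Matrix J I ℝ
  UW : U * W = 1
  WU : W * U = 1
  card : Fintype.card I = Fintype.card J
  abs : absDet U = 1

namespace UnitChange

variable {I J : Type*} [Fintype I] [Fintype J] [DecidableEq I] [DecidableEq J]

def symm (c : UnitChange I J) : UnitChange J I where
  U := c.W
  W := c.U
  UW := c.WU
  WU := c.UW
  card := c.card.symm
  abs := by
    have := absDet_mul_left c.U c.W c.card.symm
    rwa [c.abs, c.UW, one_mul, absDet_square, Matrix.det_one, abs_one, eq_comm] at this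

def refl (I : Type*) [Fintype I] [DecidableEq I] : UnitChange I I :=
  ⟨1, 1, one_mul 1, one_mul 1, rfl, by rw [absDet_square, Matrix.det_one, abs_one]⟩

/-- A renumbering of the basis after a change of basis. -/
def ofEquiv (e : J ≃ I) (A B : Matrix I I ℝ) (hAB : A * B = 1) (hd : |A.det| = 1) :
    UnitChange I J where
  U := A.submatrix id e
  W := B.submatrix e id
  UW := by rw [Matrix.submatrix_mul_equiv, hAB]; simp
  WU := by
    have h : B * A = 1 := mul_eq_one_comm.1 hAB
    have := Matrix.submatrix_mul_equiv B A e (Equiv.refl I) e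
    simp only [Equiv.coe_refl] at this
    rw [this, h]; simp
  card := (Fintype.card_congr e).symm
  abs := by
    have := absDet_submatrix A (Equiv.refl I) e
    simp only [Equiv.coe_refl] at this
    rw [this, absDet_square, hd]

end UnitChange

theorem range_eq_ker_change {A B C A' B' C' : Type*} [Fintype A] [Fintype B] [Fintype C]
    [Fintype A'] [Fintype B'] [Fintype C'] [DecidableEq A] [DecidableEq B] [DecidableEq C]
    [DecidableEq A'] [DecidableEq B'] [DecidableEq C'] (a : UnitChange A A')
    (b : UnitChange B B') (c : UnitChange C C') (g : Matrix B A ℝ) (h : Matrix C B ℝ)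
    (hex : LinearMap.range g.mulVecLin = LinearMap.ker h.mulVecLin) :
    LinearMap.range (b.W * g * a.U).mulVecLin = LinearMap.ker (c.W * h * b.U).mulVecLin := by
  have h0 := mul_eq_zero_of_range_eq_ker g h hex.le
  apply le_antisymm
  · rintro _ ⟨v, rfl⟩
    change (c.W * h * b.U) *ᵥ ((b.W * g * a.U) *ᵥ v) = 0
    rw [Matrix.mulVec_mulVec]
    have : c.W * h * b.U * (b.W * g * a.U) = c.W * (h * ((b.U * b.W) * g)) * a.U := by
      simp only [Matrix.mul_assoc]
    rw [this, b.UW, Matrix.one_mul, h0, Matrix.mul_zero, Matrix.zero_mul, Matrix.zero_mulVec]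
  · intro v hv
    have hv : (c.W * h * b.U) *ᵥ v = 0 := hv
    have h1 : h *ᵥ (b.U *ᵥ v) = 0 := by
      have := congrArg (fun x => c.U *ᵥ x) hv
      simp only [Matrix.mulVec_mulVec, Matrix.mulVec_zero] at this
      rw [← Matrix.mul_assoc, ← Matrix.mul_assoc, c.UW, Matrix.one_mul] at this
      rwa [Matrix.mulVec_mulVec]
    obtain ⟨w, hw⟩ : b.U *ᵥ v ∈ LinearMap.range g.mulVecLin := by rw [hex]; exact h1
    have hw : g *ᵥ w = b.U *ᵥ v := hw
    refine ⟨a.W *ᵥ w, ?_⟩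
    change (b.W * g * a.U) *ᵥ (a.W *ᵥ w) = v
    rw [Matrix.mulVec_mulVec, Matrix.mul_assoc, a.UW, Matrix.mul_one, ← Matrix.mulVec_mulVec, hw,
      Matrix.mulVec_mulVec, b.WU, Matrix.one_mulVec]

section Change

variable {I₀ I₁ I₂ I₃ I₄ I₅ : Type*} [Fintype I₀] [Fintype I₁] [Fintype I₂] [Fintype I₃]
  [Fintype I₄] [Fintype I₅] [DecidableEq I₀] [DecidableEq I₁] [DecidableEq I₂] [DecidableEq I₃]
  [DecidableEq I₄] [DecidableEq I₅]
  {K₁ K₂ K₃ K₄ : Type*} [Fintype K₁] [Fintype K₂] [Fintype K₃]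
  [Fintype K₄] [DecidableEq K₁] [DecidableEq K₂] [DecidableEq K₃] [DecidableEq K₄]
  (g₁ : Matrix I₁ I₀ ℝ) (g₂ : Matrix I₂ I₁ ℝ) (g₃ : Matrix I₃ I₂ ℝ)
  (g₄ : Matrix I₄ I₃ ℝ) (g₅ : Matrix I₅ I₄ ℝ)
  (c₁ : UnitChange I₁ K₁) (c₂ : UnitChange I₂ K₂) (c₃ : UnitChange I₃ K₃)
  (c₄ : UnitChange I₄ K₄)

theorem ExactSeq.change (h : ExactSeq g₁ g₂ g₃ g₄ g₅) :
    ExactSeq (c₁.W * g₁) (c₂.W * g₂ * c₁.U) (c₃.W * g₃ * c₂.U) (c₄.W * g₄ * c₃.U) (g₅ * c₄.U) := by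
  obtain ⟨x₀, x₁, x₂, x₃, x₄, x₅⟩ := h
  refine ⟨?_, ?_, range_eq_ker_change c₁ c₂ c₃ g₂ g₃ x₂, range_eq_ker_change c₂ c₃ c₄ g₃ g₄ x₃,
    ?_, ?_⟩
  · rw [LinearMap.ker_eq_bot'] at x₀ ⊢
    intro v hv
    refine x₀ v ?_
    have hv : (c₁.W * g₁) *ᵥ v = 0 := hv
    have := congrArg (fun x => c₁.U *ᵥ x) hv
    simp only [Matrix.mulVec_mulVec, Matrix.mulVec_zero, ← Matrix.mul_assoc, c₁.UW,
      Matrix.one_mul] at this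
    exact this
  · have := range_eq_ker_change (UnitChange.refl I₀) c₁ c₂ g₁ g₂ x₁
    simpa [UnitChange.refl] using this
  · have := range_eq_ker_change c₃ c₄ (UnitChange.refl I₅) g₄ g₅ x₄
    simpa [UnitChange.refl] using this
  · rw [LinearMap.range_eq_top] at x₅ ⊢
    intro u
    obtain ⟨w, hw⟩ := x₅ u
    refine ⟨c₄.W *ᵥ w, ?_⟩
    change (g₅ * c₄.U) *ᵥ (c₄.W *ᵥ w) = u
    rw [Matrix.mulVec_mulVec, Matrix.mul_assoc, c₄.UW, Matrix.mul_one]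
    exact hw

theorem UnitChange.cancel {A B A' B' : Type*} [Fintype A] [Fintype B] [Fintype A'] [Fintype B']
    [DecidableEq A] [DecidableEq B] [DecidableEq A'] [DecidableEq B']
    (a : UnitChange A A') (b : UnitChange B B') (g : Matrix B A ℝ) :
    b.symm.W * (b.W * g * a.U) * a.symm.U = g := by
  have : b.U * (b.W * g * a.U) * a.W = (b.U * b.W) * g * (a.U * a.W) := by
    simp only [Matrix.mul_assoc]
  rw [UnitChange.symm, UnitChange.symm, this, a.UW, b.UW, Matrix.one_mul, Matrix.mul_one]

theorem ExactSeq.change_iff : ExactSeq g₁ g₂ g₃ g₄ g₅ ↔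
    ExactSeq (c₁.W * g₁) (c₂.W * g₂ * c₁.U) (c₃.W * g₃ * c₂.U) (c₄.W * g₄ * c₃.U)
      (g₅ * c₄.U) := by
  refine ⟨ExactSeq.change g₁ g₂ g₃ g₄ g₅ c₁ c₂ c₃ c₄, fun h => ?_⟩
  have := ExactSeq.change _ _ _ _ _ c₁.symm c₂.symm c₃.symm c₄.symm h
  have e₁ : c₁.symm.W * (c₁.W * g₁) = g₁ := by
    rw [← Matrix.mul_assoc, UnitChange.symm, c₁.UW, Matrix.one_mul]
  have e₅ : g₅ * c₄.U * c₄.symm.U = g₅ := by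
    rw [Matrix.mul_assoc, UnitChange.symm, c₄.UW, Matrix.mul_one]
  rwa [e₁, e₅, c₁.cancel c₂, c₂.cancel c₃, c₃.cancel c₄] at this

variable {g₁ g₂ g₃ g₄ g₅}

theorem absDet_fromCols_unitChange {I K J L : Type*} [Fintype I] [Fintype K] [DecidableEq I]
    [DecidableEq K] [Fintype J] [DecidableEq J] [Fintype L] [DecidableEq L] (c : UnitChange I K)
    (A : Matrix K J ℝ) (B : Matrix K L ℝ)
    (hc : Fintype.card K = Fintype.card J + Fintype.card L) :
    absDet (Matrix.fromCols (c.U * A) (c.U * B)) = absDet (Matrix.fromCols A B) := by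
  rw [← Matrix.mul_fromCols, absDet_mul_left _ _ (by simpa using hc), c.abs, one_mul]

/-- Lifts are carried back by the matrices `U`. Every determinant is multiplied by some `absDet U =
1`, so the torsions agree exactly. -/
theorem LiftChain.exists_change (d : LiftChain (c₁.W * g₁) (c₂.W * g₂ * c₁.U)
      (c₃.W * g₃ * c₂.U) (c₄.W * g₄ * c₃.U) (g₅ * c₄.U)) :
    ∃ d' : LiftChain g₁ g₂ g₃ g₄ g₅, d'.torsion = d.torsion := by
  obtain ⟨n₁, n₂, n₃, n₄, b₁, b₂, b₃, b₄, k₁, k₂, k₃, k₄, k₅, e₁, e₂, e₃, e₄, e₅⟩ := d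
  have q₁ : absDet (Matrix.fromCols g₁ (c₁.U * b₁)) =
      absDet (Matrix.fromCols (c₁.W * g₁) b₁) := by
    rw [← absDet_fromCols_unitChange c₁ _ _ (by simpa using k₁), ← Matrix.mul_assoc, c₁.UW,
      Matrix.one_mul]
  have q₂ : absDet (Matrix.fromCols (g₂ * (c₁.U * b₁)) (c₂.U * b₂)) =
      absDet (Matrix.fromCols (c₂.W * g₂ * c₁.U * b₁) b₂) := by
    rw [← absDet_fromCols_unitChange c₂ _ _ (by simpa using k₂)]
    simp only [← Matrix.mul_assoc, c₂.UW, Matrix.one_mul]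
  have q₃ : absDet (Matrix.fromCols (g₃ * (c₂.U * b₂)) (c₃.U * b₃)) =
      absDet (Matrix.fromCols (c₃.W * g₃ * c₂.U * b₂) b₃) := by
    rw [← absDet_fromCols_unitChange c₃ _ _ (by simpa using k₃)]
    simp only [← Matrix.mul_assoc, c₃.UW, Matrix.one_mul]
  have q₄ : absDet (Matrix.fromCols (g₄ * (c₃.U * b₃)) (c₄.U * b₄)) =
      absDet (Matrix.fromCols (c₄.W * g₄ * c₃.U * b₃) b₄) := by
    rw [← absDet_fromCols_unitChange c₄ _ _ (by simpa using k₄)]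
    simp only [← Matrix.mul_assoc, c₄.UW, Matrix.one_mul]
  have q₅ : absDet (g₅ * (c₄.U * b₄)) = absDet (g₅ * c₄.U * b₄) := by rw [Matrix.mul_assoc]
  refine ⟨⟨n₁, n₂, n₃, n₄, c₁.U * b₁, c₂.U * b₂, c₃.U * b₃, c₄.U * b₄, c₁.card.trans k₁,
    c₂.card.trans k₂, c₃.card.trans k₃, c₄.card.trans k₄, k₅, q₁ ▸ e₁, q₂ ▸ e₂, q₃ ▸ e₃, q₄ ▸ e₄,
    q₅ ▸ e₅⟩, ?_⟩
  simp only [LiftChain.torsion, q₁, q₂, q₃, q₄, q₅]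

end Change

/-! ## Extension of a complex by an acyclic one -/

theorem range_eq_ker_iff {A B C : Type*} [Fintype A] [Fintype B] [Fintype C] [DecidableEq A]
    [DecidableEq B] [DecidableEq C] (g : Matrix B A ℝ) (h : Matrix C B ℝ) :
    LinearMap.range g.mulVecLin = LinearMap.ker h.mulVecLin ↔
      h * g = 0 ∧ ∀ v, h *ᵥ v = 0 → ∃ w, g *ᵥ w = v := by
  constructor
  · intro hex
    refine ⟨mul_eq_zero_of_range_eq_ker g h hex.le, fun v hv => ?_⟩
    have : v ∈ LinearMap.ker h.mulVecLin := hv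
    rw [← hex] at this
    exact this
  · rintro ⟨h0, hex⟩
    apply le_antisymm
    · rintro _ ⟨v, rfl⟩
      change h *ᵥ (g *ᵥ v) = 0
      rw [Matrix.mulVec_mulVec, h0, Matrix.zero_mulVec]
    · intro v hv
      exact hex v hv

theorem exactSeq_iff {I₀ I₁ I₂ I₃ I₄ I₅ : Type*} [Fintype I₀] [Fintype I₁] [Fintype I₂]
    [Fintype I₃] [Fintype I₄] [Fintype I₅] [DecidableEq I₀] [DecidableEq I₁] [DecidableEq I₂]
    [DecidableEq I₃] [DecidableEq I₄] [DecidableEq I₅] (g₁ : Matrix I₁ I₀ ℝ) (g₂ : Matrix I₂ I₁ ℝ)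
    (g₃ : Matrix I₃ I₂ ℝ) (g₄ : Matrix I₄ I₃ ℝ) (g₅ : Matrix I₅ I₄ ℝ) :
    ExactSeq g₁ g₂ g₃ g₄ g₅ ↔ IsComplex g₁ g₂ g₃ g₄ g₅ ∧ (∀ v, g₁ *ᵥ v = 0 → v = 0) ∧
      (∀ v, g₂ *ᵥ v = 0 → ∃ w, g₁ *ᵥ w = v) ∧ (∀ v, g₃ *ᵥ v = 0 → ∃ w, g₂ *ᵥ w = v) ∧
      (∀ v, g₄ *ᵥ v = 0 → ∃ w, g₃ *ᵥ w = v) ∧ (∀ v, g₅ *ᵥ v = 0 → ∃ w, g₄ *ᵥ w = v) ∧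
      ∀ v, ∃ w, g₅ *ᵥ w = v := by
  rw [ExactSeq, range_eq_ker_iff, range_eq_ker_iff, range_eq_ker_iff, range_eq_ker_iff,
    LinearMap.ker_eq_bot', LinearMap.range_eq_top]
  simp only [IsComplex, Function.Surjective, Matrix.mulVecLin_apply]
  tauto

theorem sum_elim_eq_zero {A B : Type*} (a : A → ℝ) (b : B → ℝ) :
    Sum.elim a b = 0 ↔ a = 0 ∧ b = 0 := by
  rw [← Sum.elim_zero_zero, Sum.elim_eq_iff]

theorem exists_sum_elim {A B : Type*} (c : A ⊕ B → ℝ) : ∃ a b, c = Sum.elim a b :=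
  ⟨c ∘ Sum.inl, c ∘ Sum.inr, (Sum.elim_comp_inl_inr c).symm⟩

/-- Chains of lifts with arbitrary index types. -/
theorem LiftChain.exists_of_types {I₀ I₁ I₂ I₃ I₄ I₅ R₁ R₂ R₃ R₄ : Type*} [Fintype I₀]
    [Fintype I₁] [Fintype I₂] [Fintype I₃] [Fintype I₄] [Fintype I₅] [DecidableEq I₀]
    [DecidableEq I₁] [DecidableEq I₂] [DecidableEq I₃] [DecidableEq I₄] [DecidableEq I₅]
    [Fintype R₁] [Fintype R₂] [Fintype R₃] [Fintype R₄] [DecidableEq R₁] [DecidableEq R₂]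
    [DecidableEq R₃] [DecidableEq R₄] {g₁ : Matrix I₁ I₀ ℝ} {g₂ : Matrix I₂ I₁ ℝ}
    {g₃ : Matrix I₃ I₂ ℝ} {g₄ : Matrix I₄ I₃ ℝ} {g₅ : Matrix I₅ I₄ ℝ} (b₁ : Matrix I₁ R₁ ℝ)
    (b₂ : Matrix I₂ R₂ ℝ) (b₃ : Matrix I₃ R₃ ℝ) (b₄ : Matrix I₄ R₄ ℝ)
    (card₁ : Fintype.card I₁ = Fintype.card I₀ + Fintype.card R₁)
    (card₂ : Fintype.card I₂ = Fintype.card R₁ + Fintype.card R₂)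
    (card₃ : Fintype.card I₃ = Fintype.card R₂ + Fintype.card R₃)
    (card₄ : Fintype.card I₄ = Fintype.card R₃ + Fintype.card R₄)
    (card₅ : Fintype.card I₅ = Fintype.card R₄)
    (ne₁ : absDet (Matrix.fromCols g₁ b₁) ≠ 0)
    (ne₂ : absDet (Matrix.fromCols (g₂ * b₁) b₂) ≠ 0)
    (ne₃ : absDet (Matrix.fromCols (g₃ * b₂) b₃) ≠ 0)
    (ne₄ : absDet (Matrix.fromCols (g₄ * b₃) b₄) ≠ 0)
    (ne₅ : absDet (g₅ * b₄) ≠ 0) :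
    ∃ d : LiftChain g₁ g₂ g₃ g₄ g₅, d.torsion =
      absDet (Matrix.fromCols (g₂ * b₁) b₂) * absDet (Matrix.fromCols (g₄ * b₃) b₄) /
      (absDet (Matrix.fromCols g₁ b₁) * absDet (Matrix.fromCols (g₃ * b₂) b₃) *
        absDet (g₅ * b₄)) := by
  let f₁ := (Fintype.equivFin R₁).symm
  let f₂ := (Fintype.equivFin R₂).symm
  let f₃ := (Fintype.equivFin R₃).symm
  let f₄ := (Fintype.equivFin R₄).symm
  have q₁ : absDet (Matrix.fromCols g₁ (b₁.submatrix id f₁)) = absDet (Matrix.fromCols g₁ b₁) := by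
    rw [← absDet_submatrix _ (Equiv.refl I₁) (Equiv.sumCongr (Equiv.refl I₀) f₁)]
    congr 1; ext i j; rcases j with j | j <;> rfl
  have q₂ : absDet (Matrix.fromCols (g₂ * b₁.submatrix id f₁) (b₂.submatrix id f₂)) =
      absDet (Matrix.fromCols (g₂ * b₁) b₂) := by
    rw [← absDet_submatrix _ (Equiv.refl I₂) (Equiv.sumCongr f₁ f₂)]
    congr 1; ext i j; rcases j with j | j <;> rfl
  have q₃ : absDet (Matrix.fromCols (g₃ * b₂.submatrix id f₂) (b₃.submatrix id f₃)) =
      absDet (Matrix.fromCols (g₃ * b₂) b₃) := by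
    rw [← absDet_submatrix _ (Equiv.refl I₃) (Equiv.sumCongr f₂ f₃)]
    congr 1; ext i j; rcases j with j | j <;> rfl
  have q₄ : absDet (Matrix.fromCols (g₄ * b₃.submatrix id f₃) (b₄.submatrix id f₄)) =
      absDet (Matrix.fromCols (g₄ * b₃) b₄) := by
    rw [← absDet_submatrix _ (Equiv.refl I₄) (Equiv.sumCongr f₃ f₄)]
    congr 1; ext i j; rcases j with j | j <;> rfl
  have q₅ : absDet (g₅ * b₄.submatrix id f₄) = absDet (g₅ * b₄) := by
    rw [← absDet_submatrix _ (Equiv.refl I₅) f₄]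
    rfl
  refine ⟨⟨_, _, _, _, b₁.submatrix id f₁, b₂.submatrix id f₂, b₃.submatrix id f₃,
    b₄.submatrix id f₄, card₁, card₂, card₃, card₄, card₅, q₁ ▸ ne₁, q₂ ▸ ne₂, q₃ ▸ ne₃,
    q₄ ▸ ne₄, q₅ ▸ ne₅⟩, ?_⟩
  simp only [LiftChain.torsion, q₁, q₂, q₃, q₄, q₅]

section Block

variable {I₀ I₁ I₂ I₃ I₄ I₅ J₁ J₂ Q J₃ J₄ : Type*} [Fintype I₀] [Fintype I₁] [Fintype I₂]
  [Fintype I₃] [Fintype I₄] [Fintype I₅] [DecidableEq I₀] [DecidableEq I₁] [DecidableEq I₂]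
  [DecidableEq I₃] [DecidableEq I₄] [DecidableEq I₅] [Fintype J₁] [Fintype J₂] [Fintype Q]
  [Fintype J₃] [Fintype J₄] [DecidableEq J₁] [DecidableEq J₂] [DecidableEq Q] [DecidableEq J₃]
  [DecidableEq J₄]

/-- Blocks extending a complex by the acyclic complexes `0 → J₁ → J₂ → 0` and
`0 → Q → J₃ → J₄ → 0`. -/
structure Extension (g₁ : Matrix I₁ I₀ ℝ) (g₄ : Matrix I₄ I₃ ℝ) (g₅ : Matrix I₅ I₄ ℝ)
    (J₁ J₂ Q J₃ J₄ : Type*) [Fintype J₁] [Fintype J₂] [Fintype Q]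
    [Fintype J₃] [Fintype J₄] [DecidableEq J₁] [DecidableEq J₂] [DecidableEq Q] [DecidableEq J₃]
    [DecidableEq J₄] where
  B₁ : Matrix J₁ I₀ ℝ
  B₂ : Matrix J₂ I₁ ℝ
  M : Matrix J₂ J₁ ℝ
  X : Matrix I₃ Q ℝ
  N : Matrix J₃ Q ℝ
  Y : Matrix I₄ J₃ ℝ
  Z : Matrix J₄ J₃ ℝ
  B₅ : Matrix I₅ J₄ ℝ
  S : Matrix J₃ J₄ ℝ
  h₂₁ : B₂ * g₁ + M * B₁ = 0
  h₄₃ : g₄ * X + Y * N = 0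
  hZN : Z * N = 0
  h₅₄ : g₅ * Y + B₅ * Z = 0
  card₁ : Fintype.card J₂ = Fintype.card J₁
  card₃ : Fintype.card J₃ = Fintype.card Q + Fintype.card J₄
  hM : absDet M ≠ 0
  hNS : absDet (Matrix.fromCols N S) ≠ 0
  hZS : absDet (Z * S) ≠ 0

namespace Extension

variable {g₁ : Matrix I₁ I₀ ℝ} {g₂ : Matrix I₂ I₁ ℝ} {g₃ : Matrix I₃ I₂ ℝ}
  {g₄ : Matrix I₄ I₃ ℝ} {g₅ : Matrix I₅ I₄ ℝ} (x : Extension g₁ g₄ g₅ J₁ J₂ Q J₃ J₄)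

def G₁ : Matrix (I₁ ⊕ J₁) I₀ ℝ := Matrix.fromRows g₁ x.B₁

/-- The zero blocks are what the changes of bases must achieve: the old rows do not feel the
coordinates `J₁` of the new vertex, and the corrected rows `Q` vanish altogether. Correspondingly
the columns `J₂` of `G₃` vanish. -/
def G₂ (g₂ : Matrix I₂ I₁ ℝ) : Matrix (I₂ ⊕ (J₂ ⊕ Q)) (I₁ ⊕ J₁) ℝ :=
  Matrix.fromBlocks g₂ 0 (Matrix.fromRows x.B₂ 0) (Matrix.fromRows x.M 0)

def G₃ (g₃ : Matrix I₃ I₂ ℝ) : Matrix (I₃ ⊕ J₃) (I₂ ⊕ (J₂ ⊕ Q)) ℝ :=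
  Matrix.fromBlocks g₃ (Matrix.fromCols 0 x.X) 0 (Matrix.fromCols 0 x.N)

def G₄ : Matrix (I₄ ⊕ J₄) (I₃ ⊕ J₃) ℝ := Matrix.fromBlocks g₄ x.Y 0 x.Z

def G₅ : Matrix I₅ (I₄ ⊕ J₄) ℝ := Matrix.fromCols g₅ x.B₅

/-- Together with `N_injective` and `exists_Z` this is the exactness of `0 → Q → J₃ → J₄ → 0`: the
columns of `[N | S]` form a basis, `Z` kills `N` and is injective on the span of `S`. -/
theorem exists_N {z : J₃ → ℝ} (hz : x.Z *ᵥ z = 0) : ∃ a, x.N *ᵥ a = z := by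
  obtain ⟨w, rfl⟩ := exists_mulVec_of_absDet_ne_zero _ (by simpa using x.card₃) x.hNS z
  rw [Matrix.fromCols_mulVec, Matrix.mulVec_add, Matrix.mulVec_mulVec, Matrix.mulVec_mulVec,
    x.hZN, Matrix.zero_mulVec, zero_add] at hz
  have := mulVec_injective_of_absDet_ne_zero _ x.hZS hz
  exact ⟨w ∘ Sum.inl, by rw [Matrix.fromCols_mulVec, this, Matrix.mulVec_zero, add_zero]⟩

theorem N_injective {a : Q → ℝ} (ha : x.N *ᵥ a = 0) : a = 0 := by
  have h := mulVec_injective_of_absDet_ne_zero _ x.hNS (v := Sum.elim a 0) (by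
    rw [Matrix.fromCols_mulVec]
    simp [ha])
  funext q
  exact congrFun h (Sum.inl q)

theorem exists_Z (u : J₄ → ℝ) : ∃ z, x.Z *ᵥ z = u := by
  obtain ⟨w, hw⟩ := exists_mulVec_of_absDet_ne_zero _ rfl x.hZS u
  exact ⟨x.S *ᵥ w, by rw [Matrix.mulVec_mulVec, hw]⟩

/-- The products of consecutive enlarged matrices are the old products bordered by zeros; the mixed
blocks vanish by the four relations of `Extension`. Nothing has to be assumed about the old
products, which are therefore zero before a move exactly when they are zero after it. -/
theorem isComplex_iff : IsComplex x.G₁ (x.G₂ g₂) (x.G₃ g₃) x.G₄ x.G₅ ↔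
    IsComplex g₁ g₂ g₃ g₄ g₅ := by
  have e₁ : x.G₂ g₂ * x.G₁ = Matrix.fromRows (g₂ * g₁) 0 := by
    rw [G₂, G₁, Matrix.fromBlocks_mul_fromRows, Matrix.zero_mul, add_zero,
      Matrix.fromRows_mul, Matrix.fromRows_mul, Matrix.zero_mul, Matrix.zero_mul]
    congr 1
    ext i j
    rcases i with i | i
    · simpa using congrFun (congrFun x.h₂₁ i) j
    · simp
  have e₂ : x.G₃ g₃ * x.G₂ g₂ = Matrix.fromBlocks (g₃ * g₂) 0 0 0 := by
    rw [G₂, G₃, Matrix.fromBlocks_multiply]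
    simp [Matrix.fromCols_mul_fromRows]
  have e₃ : x.G₄ * x.G₃ g₃ = Matrix.fromBlocks (g₄ * g₃) 0 0 0 := by
    rw [G₃, G₄, Matrix.fromBlocks_multiply]
    simp [Matrix.mul_fromCols, x.hZN]
    have := x.h₄₃
    ext i j
    rcases j with j | j
    · simp
    · simpa using congrFun (congrFun this i) j
  have e₄ : x.G₅ * x.G₄ = Matrix.fromCols (g₅ * g₄) 0 := by
    rw [G₅, G₄, Matrix.fromCols_mul_fromBlocks, x.h₅₄]
    simp
  rw [IsComplex, IsComplex, e₁, e₂, e₃, e₄]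
  constructor
  · rintro ⟨h₁, h₂, h₃, h₄⟩
    refine ⟨?_, ?_, ?_, ?_⟩
    · ext i j; exact congrFun (congrFun h₁ (Sum.inl i)) j
    · ext i j; exact congrFun (congrFun h₂ (Sum.inl i)) (Sum.inl j)
    · ext i j; exact congrFun (congrFun h₃ (Sum.inl i)) (Sum.inl j)
    · ext i j; exact congrFun (congrFun h₄ i) (Sum.inl j)
  · rintro ⟨h₁, h₂, h₃, h₄⟩
    rw [h₁, h₂, h₃, h₄]
    simp

/-- A diagram chase. The component of a cycle in the added piece is itself a cycle there, hence a
boundary; after subtracting that boundary a cycle of the old complex remains. In the opposite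
direction a preimage found in the large complex is corrected in the same way. -/
theorem exactSeq_iff : ExactSeq x.G₁ (x.G₂ g₂) (x.G₃ g₃) x.G₄ x.G₅ ↔
    ExactSeq g₁ g₂ g₃ g₄ g₅ := by
  have m₁ : ∀ v, x.G₁ *ᵥ v = Sum.elim (g₁ *ᵥ v) (x.B₁ *ᵥ v) := fun v => Matrix.fromRows_mulVec ..
  have m₂ : ∀ v w, x.G₂ g₂ *ᵥ Sum.elim v w =
      Sum.elim (g₂ *ᵥ v) (Sum.elim (x.B₂ *ᵥ v + x.M *ᵥ w) 0) := by
    intro v w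
    rw [G₂, Matrix.fromBlocks_mulVec]
    simp only [Sum.elim_comp_inl, Sum.elim_comp_inr, Matrix.fromRows_mulVec, Matrix.zero_mulVec,
      add_zero]
    congr 1
    funext i
    rcases i with i | i <;> simp
  have m₃ : ∀ v a b, x.G₃ g₃ *ᵥ Sum.elim v (Sum.elim a b) =
      Sum.elim (g₃ *ᵥ v + x.X *ᵥ b) (x.N *ᵥ b) := by
    intro v a b
    rw [G₃, Matrix.fromBlocks_mulVec]
    simp [Matrix.fromCols_mulVec]
  have m₄ : ∀ v w, x.G₄ *ᵥ Sum.elim v w = Sum.elim (g₄ *ᵥ v + x.Y *ᵥ w) (x.Z *ᵥ w) := by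
    intro v w
    rw [G₄, Matrix.fromBlocks_mulVec]
    simp
  have m₅ : ∀ v w, x.G₅ *ᵥ Sum.elim v w = g₅ *ᵥ v + x.B₅ *ᵥ w := by
    intro v w
    rw [G₅, Matrix.fromCols_mulVec]
    simp
  have hB : ∀ v, x.B₂ *ᵥ (g₁ *ᵥ v) + x.M *ᵥ (x.B₁ *ᵥ v) = 0 := by
    intro v
    rw [Matrix.mulVec_mulVec, Matrix.mulVec_mulVec, ← Matrix.add_mulVec, x.h₂₁, Matrix.zero_mulVec]
  have hX : ∀ b, g₄ *ᵥ (x.X *ᵥ b) + x.Y *ᵥ (x.N *ᵥ b) = 0 := by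
    intro b
    rw [Matrix.mulVec_mulVec, Matrix.mulVec_mulVec, ← Matrix.add_mulVec, x.h₄₃, Matrix.zero_mulVec]
  have hY : ∀ z, g₅ *ᵥ (x.Y *ᵥ z) + x.B₅ *ᵥ (x.Z *ᵥ z) = 0 := by
    intro z
    rw [Matrix.mulVec_mulVec, Matrix.mulVec_mulVec, ← Matrix.add_mulVec, x.h₅₄, Matrix.zero_mulVec]
  have hMs := exists_mulVec_of_absDet_ne_zero _ x.card₁ x.hM
  rw [_root_.exactSeq_iff, _root_.exactSeq_iff, x.isComplex_iff]
  refine and_congr_right fun _ => ⟨?_, ?_⟩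
  · rintro ⟨h₀, h₁, h₂, h₃, h₄, h₅⟩
    refine ⟨fun v hv => h₀ v ?_, fun v hv => ?_, fun v hv => ?_, fun v hv => ?_, fun v hv => ?_,
      fun u => ?_⟩
    · rw [m₁, sum_elim_eq_zero]
      refine ⟨hv, mulVec_injective_of_absDet_ne_zero _ x.hM ?_⟩
      simpa [hv] using hB v
    -- The motion of the new vertex is chosen so that the four new quantities in `J₂` do not change.
    · obtain ⟨w, hw⟩ := hMs (-(x.B₂ *ᵥ v))
      obtain ⟨u, hu⟩ := h₁ (Sum.elim v w) (by rw [m₂, hv, hw]; simp)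
      rw [m₁, Sum.elim_eq_iff] at hu
      exact ⟨u, hu.1⟩
    · obtain ⟨w, hw⟩ := h₂ (Sum.elim v (Sum.elim 0 0)) (by rw [m₃, hv]; simp)
      obtain ⟨a, b, rfl⟩ := exists_sum_elim w
      rw [m₂, Sum.elim_eq_iff] at hw
      exact ⟨a, hw.1⟩
    · obtain ⟨w, hw⟩ := h₃ (Sum.elim v 0) (by rw [m₄, hv]; simp)
      obtain ⟨a, c, rfl⟩ := exists_sum_elim w
      obtain ⟨c, b, rfl⟩ := exists_sum_elim c
      rw [m₃, Sum.elim_eq_iff] at hw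
      have := x.N_injective hw.2
      exact ⟨a, by simpa [this] using hw.1⟩
    · obtain ⟨w, hw⟩ := h₄ (Sum.elim v 0) (by rw [m₅, hv]; simp)
      obtain ⟨a, b, rfl⟩ := exists_sum_elim w
      rw [m₄, Sum.elim_eq_iff] at hw
      obtain ⟨c, rfl⟩ := x.exists_N hw.2
      refine ⟨a - x.X *ᵥ c, ?_⟩
      rw [Matrix.mulVec_sub, ← hw.1, eq_neg_of_add_eq_zero_left (hX c), sub_neg_eq_add]
    · obtain ⟨w, rfl⟩ := h₅ u
      obtain ⟨a, b, rfl⟩ := exists_sum_elim w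
      obtain ⟨z, rfl⟩ := x.exists_Z b
      refine ⟨a - x.Y *ᵥ z, ?_⟩
      rw [Matrix.mulVec_sub, m₅, eq_neg_of_add_eq_zero_left (hY z), sub_neg_eq_add]
  · rintro ⟨h₀, h₁, h₂, h₃, h₄, h₅⟩
    refine ⟨fun v hv => ?_, fun v hv => ?_, fun v hv => ?_, fun v hv => ?_, fun v hv => ?_,
      fun u => ?_⟩
    · rw [m₁, sum_elim_eq_zero] at hv
      exact h₀ v hv.1
    · obtain ⟨a, b, rfl⟩ := exists_sum_elim v
      rw [m₂, sum_elim_eq_zero, sum_elim_eq_zero] at hv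
      obtain ⟨u, rfl⟩ := h₁ a hv.1
      refine ⟨u, ?_⟩
      have : x.M *ᵥ (b - x.B₁ *ᵥ u) = 0 := by
        rw [Matrix.mulVec_sub, eq_neg_of_add_eq_zero_right hv.2.1,
          eq_neg_of_add_eq_zero_right (hB u), sub_self]
      rw [m₁, sub_eq_zero.1 (mulVec_injective_of_absDet_ne_zero _ x.hM this)]
    · obtain ⟨a, c, rfl⟩ := exists_sum_elim v
      obtain ⟨c, b, rfl⟩ := exists_sum_elim c
      rw [m₃, sum_elim_eq_zero] at hv
      have hb := x.N_injective hv.2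
      subst hb
      obtain ⟨u, rfl⟩ := h₂ a (by simpa using hv.1)
      obtain ⟨w, hw⟩ := hMs (c - x.B₂ *ᵥ u)
      exact ⟨Sum.elim u w, by rw [m₂, hw]; simp⟩
    · obtain ⟨a, w, rfl⟩ := exists_sum_elim v
      rw [m₄, sum_elim_eq_zero] at hv
      obtain ⟨b, rfl⟩ := x.exists_N hv.2
      obtain ⟨u, hu⟩ := h₃ (a - x.X *ᵥ b) (by
        rw [Matrix.mulVec_sub, eq_neg_of_add_eq_zero_left (hX b), sub_neg_eq_add, hv.1])
      exact ⟨Sum.elim u (Sum.elim 0 b), by rw [m₃, hu, sub_add_cancel]⟩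
    · obtain ⟨a, w, rfl⟩ := exists_sum_elim v
      rw [m₅] at hv
      obtain ⟨z, rfl⟩ := x.exists_Z w
      obtain ⟨u, hu⟩ := h₄ (a - x.Y *ᵥ z) (by
        rw [Matrix.mulVec_sub, eq_neg_of_add_eq_zero_left (hY z), sub_neg_eq_add, hv])
      exact ⟨Sum.elim u z, by rw [m₄, hu, sub_add_cancel]⟩
    · obtain ⟨w, rfl⟩ := h₅ u
      exact ⟨Sum.elim w 0, by rw [m₅]; simp⟩

/-- The old lifts are completed by all of `J₁` in the first space, by all of `Q` in the second and
by the columns of `S` in the third. Every enlarged determinant is then block triangular: the second,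
third and fourth acquire the factors `M`, `[N | S]` and `Z S`, the other two do not change. -/
theorem exists_liftChain (d : LiftChain g₁ g₂ g₃ g₄ g₅) :
    ∃ d' : LiftChain x.G₁ (x.G₂ g₂) (x.G₃ g₃) x.G₄ x.G₅, d'.torsion = d.torsion *
      (absDet x.M * absDet (x.Z * x.S) / absDet (Matrix.fromCols x.N x.S)) := by
  obtain ⟨n₁, n₂, n₃, n₄, b₁, b₂, b₃, b₄, k₁, k₂, k₃, k₄, k₅, e₁, e₂, e₃, e₄, e₅⟩ := d
  let c₁ : Matrix (I₁ ⊕ J₁) (Fin n₁ ⊕ J₁) ℝ := Matrix.fromBlocks b₁ 0 0 1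
  let c₂ : Matrix (I₂ ⊕ (J₂ ⊕ Q)) (Fin n₂ ⊕ Q) ℝ :=
    Matrix.fromBlocks b₂ 0 0 (Matrix.fromRows 0 1)
  let c₃ : Matrix (I₃ ⊕ J₃) (Fin n₃ ⊕ J₄) ℝ := Matrix.fromBlocks b₃ 0 0 x.S
  let c₄ : Matrix (I₄ ⊕ J₄) (Fin n₄) ℝ := Matrix.fromRows b₄ 0
  have q₁ : absDet (Matrix.fromCols x.G₁ c₁) = absDet (Matrix.fromCols g₁ b₁) := by
    rw [← absDet_submatrix _ (Equiv.refl _) (Equiv.sumAssoc I₀ (Fin n₁) J₁)]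
    have : (Matrix.fromCols x.G₁ c₁).submatrix (Equiv.refl _) (Equiv.sumAssoc I₀ (Fin n₁) J₁) =
        Matrix.fromBlocks (Matrix.fromCols g₁ b₁) 0 (Matrix.fromCols x.B₁ 0) 1 := by
      ext i j
      rcases i with i | i <;> rcases j with (j | j) | j <;> rfl
    rw [this, absDet_fromBlocks_zero₁₂ _ _ _ (by simpa using k₁) rfl, absDet_square, Matrix.det_one,
      abs_one, mul_one]
  have q₂ : absDet (Matrix.fromCols (x.G₂ g₂ * c₁) c₂) =
      absDet (Matrix.fromCols (g₂ * b₁) b₂) * absDet x.M := by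
    have e : x.G₂ g₂ * c₁ =
        Matrix.fromBlocks (g₂ * b₁) 0 (Matrix.fromRows (x.B₂ * b₁) 0) (Matrix.fromRows x.M 0) := by
      simp [G₂, c₁, Matrix.fromBlocks_multiply, Matrix.fromRows_mul]
    rw [e, ← absDet_submatrix _ (Equiv.refl _) (Equiv.sumSumSumComm (Fin n₁) (Fin n₂) J₁ Q)]
    have : (Matrix.fromCols (Matrix.fromBlocks (g₂ * b₁) 0 (Matrix.fromRows (x.B₂ * b₁) 0)
          (Matrix.fromRows x.M 0)) c₂).submatrix (Equiv.refl _)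
            (Equiv.sumSumSumComm (Fin n₁) (Fin n₂) J₁ Q) =
        Matrix.fromBlocks (Matrix.fromCols (g₂ * b₁) b₂) 0
          (Matrix.fromCols (Matrix.fromRows (x.B₂ * b₁) 0) 0)
          (Matrix.fromBlocks x.M 0 0 1) := by
      ext i j
      rcases i with i | i | i <;> rcases j with (j | j) | (j | j) <;> rfl
    rw [this, absDet_fromBlocks_zero₁₂ _ _ _ (by simpa using k₂) (by simp [x.card₁]),
      absDet_fromBlocks_zero₁₂ _ _ _ x.card₁ rfl, absDet_square 1, Matrix.det_one, abs_one, mul_one]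
  have q₃ : absDet (Matrix.fromCols (x.G₃ g₃ * c₂) c₃) =
      absDet (Matrix.fromCols (g₃ * b₂) b₃) * absDet (Matrix.fromCols x.N x.S) := by
    have e : x.G₃ g₃ * c₂ = Matrix.fromBlocks (g₃ * b₂) x.X 0 x.N := by
      simp [G₃, c₂, Matrix.fromBlocks_multiply, Matrix.fromCols_mul_fromRows]
    rw [e, ← absDet_submatrix _ (Equiv.refl _) (Equiv.sumSumSumComm (Fin n₂) (Fin n₃) Q J₄)]
    have : (Matrix.fromCols (Matrix.fromBlocks (g₃ * b₂) x.X 0 x.N) c₃).submatrix (Equiv.refl _)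
            (Equiv.sumSumSumComm (Fin n₂) (Fin n₃) Q J₄) =
        Matrix.fromBlocks (Matrix.fromCols (g₃ * b₂) b₃) (Matrix.fromCols x.X 0) 0
          (Matrix.fromCols x.N x.S) := by
      ext i j
      rcases i with i | i <;> rcases j with (j | j) | (j | j) <;> rfl
    rw [this, absDet_fromBlocks_zero₂₁ _ _ _ (by simpa using k₃) (by simp [x.card₃])]
  have q₄ : absDet (Matrix.fromCols (x.G₄ * c₃) c₄) =
      absDet (Matrix.fromCols (g₄ * b₃) b₄) * absDet (x.Z * x.S) := by
    have e : x.G₄ * c₃ = Matrix.fromBlocks (g₄ * b₃) (x.Y * x.S) 0 (x.Z * x.S) := by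
      simp [G₄, c₃, Matrix.fromBlocks_multiply]
    let φ : (Fin n₃ ⊕ Fin n₄) ⊕ J₄ ≃ (Fin n₃ ⊕ J₄) ⊕ Fin n₄ :=
      (Equiv.sumAssoc _ _ _).trans (((Equiv.refl _).sumCongr (Equiv.sumComm _ _)).trans
        (Equiv.sumAssoc _ _ _).symm)
    rw [e, ← absDet_submatrix _ (Equiv.refl _) φ]
    have : (Matrix.fromCols (Matrix.fromBlocks (g₄ * b₃) (x.Y * x.S) 0 (x.Z * x.S))
          c₄).submatrix (Equiv.refl _) φ =
        Matrix.fromBlocks (Matrix.fromCols (g₄ * b₃) b₄) (x.Y * x.S) 0 (x.Z * x.S) := by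
      ext i j
      rcases i with i | i <;> rcases j with (j | j) | j <;> rfl
    rw [this, absDet_fromBlocks_zero₂₁ _ _ _ (by simpa using k₄) rfl]
  have q₅ : absDet (x.G₅ * c₄) = absDet (g₅ * b₄) := by
    congr 1
    simp [G₅, c₄, Matrix.fromCols_mul_fromRows]
  have hJ := x.card₁
  have hK := x.card₃
  obtain ⟨d', hd'⟩ := LiftChain.exists_of_types (g₁ := x.G₁) (g₂ := x.G₂ g₂) (g₃ := x.G₃ g₃)
    (g₄ := x.G₄) (g₅ := x.G₅) c₁ c₂ c₃ c₄ (by simp; omega) (by simp; omega) (by simp; omega)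
    (by simp; omega) (by simpa using k₅) (q₁ ▸ e₁) (q₂ ▸ mul_ne_zero e₂ x.hM)
    (q₃ ▸ mul_ne_zero e₃ x.hNS) (q₄ ▸ mul_ne_zero e₄ x.hZS) (q₅ ▸ e₅)
  refine ⟨d', ?_⟩
  rw [hd', q₁, q₂, q₃, q₄, q₅, LiftChain.torsion]
  have := x.hNS
  field_simp

end Extension

end Block

/-! ## Frames and bivectors -/

/-- The antisymmetric matrix whose `(i, j)` entry is the determinant of `x, y, eᵢ, eⱼ`. -/
def dualWedge (x y : Fin 4 → ℝ) : Matrix (Fin 4) (Fin 4) ℝ :=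
  !![0, x 2 * y 3 - x 3 * y 2, x 3 * y 1 - x 1 * y 3, x 1 * y 2 - x 2 * y 1;
    -(x 2 * y 3 - x 3 * y 2), 0, x 0 * y 3 - x 3 * y 0, x 2 * y 0 - x 0 * y 2;
    -(x 3 * y 1 - x 1 * y 3), -(x 0 * y 3 - x 3 * y 0), 0, x 0 * y 1 - x 1 * y 0;
    -(x 1 * y 2 - x 2 * y 1), -(x 2 * y 0 - x 0 * y 2), -(x 0 * y 1 - x 1 * y 0), 0]

/-- The exterior product of two vectors. -/
def wedge (x y : Fin 4 → ℝ) : Matrix (Fin 4) (Fin 4) ℝ :=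
  Matrix.vecMulVec x y - Matrix.vecMulVec y x

theorem det_fin_four (A : Matrix (Fin 4) (Fin 4) ℝ) : A.det =
    A 0 0 * (A 1 1 * (A 2 2 * A 3 3 - A 2 3 * A 3 2) - A 1 2 * (A 2 1 * A 3 3 - A 2 3 * A 3 1)
      + A 1 3 * (A 2 1 * A 3 2 - A 2 2 * A 3 1))
    - A 0 1 * (A 1 0 * (A 2 2 * A 3 3 - A 2 3 * A 3 2) - A 1 2 * (A 2 0 * A 3 3 - A 2 3 * A 3 0)
      + A 1 3 * (A 2 0 * A 3 2 - A 2 2 * A 3 0))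
    + A 0 2 * (A 1 0 * (A 2 1 * A 3 3 - A 2 3 * A 3 1) - A 1 1 * (A 2 0 * A 3 3 - A 2 3 * A 3 0)
      + A 1 3 * (A 2 0 * A 3 1 - A 2 1 * A 3 0))
    - A 0 3 * (A 1 0 * (A 2 1 * A 3 2 - A 2 2 * A 3 1) - A 1 1 * (A 2 0 * A 3 2 - A 2 2 * A 3 0)
      + A 1 2 * (A 2 0 * A 3 1 - A 2 1 * A 3 0)) := by
  rw [Matrix.det_succ_row_zero]
  simp only [Fin.sum_univ_four, Matrix.det_fin_three, Matrix.submatrix_apply]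
  norm_num [Fin.succAbove, Fin.lt_def]
  simp only [show Fin.succ (2 : Fin 3) = 3 from rfl, show Fin.castSucc (2 : Fin 3) = 2 from rfl]
  ring

theorem dotProduct_dualWedge (x y u v : Fin 4 → ℝ) :
    u ⬝ᵥ (dualWedge x y *ᵥ v) = (Matrix.of ![x, y, u, v]).det := by
  rw [det_fin_four]
  simp [dualWedge, Matrix.mulVec, dotProduct, Fin.sum_univ_four]
  ring

/-- The entries of `dualWedge` are determinants, so the bilinear form it defines is invariant under
rotations. Unlike `wedge_conj` this needs determinant one. -/
theorem dualWedge_conj {F : Matrix (Fin 4) (Fin 4) ℝ} (hF : F ∈ Matrix.specialOrthogonalGroup (Fin 4) ℝ)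
    (x y : Fin 4 → ℝ) : dualWedge (F *ᵥ x) (F *ᵥ y) = F * dualWedge x y * Fᵀ := by
  rw [Matrix.mem_specialOrthogonalGroup_iff, Matrix.mem_orthogonalGroup_iff] at hF
  obtain ⟨h1, h2⟩ := hF
  have h1 : F * Fᵀ = 1 := h1
  have key : Fᵀ * dualWedge (F *ᵥ x) (F *ᵥ y) * F = dualWedge x y := by
    refine Matrix.ext fun i j => ?_
    have e1 : (Fᵀ * dualWedge (F *ᵥ x) (F *ᵥ y) * F) i j =
        (F *ᵥ Pi.single i 1) ⬝ᵥ (dualWedge (F *ᵥ x) (F *ᵥ y) *ᵥ (F *ᵥ Pi.single j 1)) := by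
      rw [Matrix.mulVec_single_one, Matrix.mulVec_single_one, Matrix.mul_assoc, Matrix.mul_apply]
      rfl
    have e2 : dualWedge x y i j = Pi.single i 1 ⬝ᵥ (dualWedge x y *ᵥ Pi.single j 1) := by simp
    rw [e1, e2, dotProduct_dualWedge, dotProduct_dualWedge]
    have : Matrix.of ![F *ᵥ x, F *ᵥ y, F *ᵥ Pi.single i 1, F *ᵥ Pi.single j 1] =
        Matrix.of ![x, y, Pi.single i 1, Pi.single j 1] * Fᵀ := by
      refine Matrix.ext fun a b => ?_
      fin_cases a <;> simp [Matrix.mul_apply, Matrix.mulVec, dotProduct, mul_comm, Pi.single_apply]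
    rw [this, Matrix.det_mul, Matrix.det_transpose, h2, mul_one]
  -- The equality of forms in the rotated basis is conjugated back.
  rw [← key]
  have : F * (Fᵀ * dualWedge (F *ᵥ x) (F *ᵥ y) * F) * Fᵀ =
      (F * Fᵀ) * dualWedge (F *ᵥ x) (F *ᵥ y) * (F * Fᵀ) := by simp only [Matrix.mul_assoc]
  rw [this, h1, Matrix.one_mul, Matrix.mul_one]

theorem wedge_conj (F : Matrix (Fin 4) (Fin 4) ℝ) (x y : Fin 4 → ℝ) :
    wedge (F *ᵥ x) (F *ᵥ y) = F * wedge x y * Fᵀ := by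
  simp [wedge, Matrix.mul_sub, Matrix.sub_mul, Matrix.mul_vecMulVec, Matrix.vecMulVec_mul,
    Matrix.vecMul_transpose]

theorem dualWedge_smul_left (r : ℝ) (x y : Fin 4 → ℝ) : dualWedge (r • x) y = r • dualWedge x y := by
  ext i j; fin_cases i <;> fin_cases j <;> simp [dualWedge] <;> ring

theorem dualWedge_smul_right (r : ℝ) (x y : Fin 4 → ℝ) : dualWedge x (r • y) = r • dualWedge x y := by
  ext i j; fin_cases i <;> fin_cases j <;> simp [dualWedge] <;> ring

theorem dualWedge_add_right (x y z : Fin 4 → ℝ) : dualWedge x (y + z) = dualWedge x y + dualWedge x z := by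
  ext i j; fin_cases i <;> fin_cases j <;> simp [dualWedge] <;> ring

theorem dualWedge_add_left (x y z : Fin 4 → ℝ) : dualWedge (x + y) z = dualWedge x z + dualWedge y z := by
  ext i j; fin_cases i <;> fin_cases j <;> simp [dualWedge] <;> ring

theorem dualWedge_self (x : Fin 4 → ℝ) : dualWedge x x = 0 := by
  ext i j; fin_cases i <;> fin_cases j <;> simp [dualWedge] <;> ring

theorem dualWedge_swap (x y : Fin 4 → ℝ) : dualWedge y x = -dualWedge x y := by
  ext i j; fin_cases i <;> fin_cases j <;> simp [dualWedge] <;> ring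

theorem dualWedge_transpose (x y : Fin 4 → ℝ) : (dualWedge x y)ᵀ = -dualWedge x y := by
  ext i j; fin_cases i <;> fin_cases j <;> simp [dualWedge]

theorem dualWedge_mulVec_left (x y : Fin 4 → ℝ) : dualWedge x y *ᵥ x = 0 := by
  ext i; fin_cases i <;> simp [dualWedge, Matrix.mulVec, dotProduct, Fin.sum_univ_four] <;> ring

theorem wedge_smul_left (r : ℝ) (x y : Fin 4 → ℝ) : wedge (r • x) y = r • wedge x y := by
  ext i j; simp [wedge, Matrix.vecMulVec]; ring

theorem wedge_smul_right (r : ℝ) (x y : Fin 4 → ℝ) : wedge x (r • y) = r • wedge x y := by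
  ext i j; simp [wedge, Matrix.vecMulVec]; ring

theorem wedge_add_right (x y z : Fin 4 → ℝ) : wedge x (y + z) = wedge x y + wedge x z := by
  ext i j; simp [wedge, Matrix.vecMulVec]; ring

theorem wedge_self (x : Fin 4 → ℝ) : wedge x x = 0 := by
  ext i j; simp [wedge, Matrix.vecMulVec]

theorem wedge_swap (x y : Fin 4 → ℝ) : wedge y x = -wedge x y := by
  ext i j; simp [wedge, Matrix.vecMulVec]

theorem dualWedge_single : dualWedge (Pi.single 0 1) (Pi.single 1 1) = skew 2 3 := by
  ext i j; fin_cases i <;> fin_cases j <;> simp [dualWedge, skew, Matrix.single]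

theorem wedge_single (i j : Fin 4) : wedge (Pi.single i 1) (Pi.single j 1) = skew i j := by
  ext a b; simp [wedge, skew, Matrix.single, Matrix.vecMulVec, Pi.single_apply, ite_and, eq_comm]
  split_ifs <;> rfl

/-! ### Coordinates -/

section Coords

variable {F : Matrix (Fin 4) (Fin 4) ℝ}

theorem mul_transpose_of_mem (hF : F ∈ Matrix.specialOrthogonalGroup (Fin 4) ℝ) : F * Fᵀ = 1 :=
  (Matrix.mem_orthogonalGroup_iff _ _).1 (Matrix.mem_specialOrthogonalGroup_iff.1 hF).1

theorem transpose_mul_of_mem (hF : F ∈ Matrix.specialOrthogonalGroup (Fin 4) ℝ) : Fᵀ * F = 1 :=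
  mul_eq_one_comm.1 (mul_transpose_of_mem hF)

theorem det_of_mem (hF : F ∈ Matrix.specialOrthogonalGroup (Fin 4) ℝ) : F.det = 1 :=
  (Matrix.mem_specialOrthogonalGroup_iff.1 hF).2

theorem mem_of_eqs (h₁ : F * Fᵀ = 1) (h₂ : F.det = 1) :
    F ∈ Matrix.specialOrthogonalGroup (Fin 4) ℝ :=
  Matrix.mem_specialOrthogonalGroup_iff.2 ⟨(Matrix.mem_orthogonalGroup_iff _ _).2 h₁, h₂⟩

theorem mul_coordsIn (hF : F ∈ Matrix.specialOrthogonalGroup (Fin 4) ℝ) (v : R4) :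
    F *ᵥ coordsIn F v = ⇑v := by
  rw [coordsIn, Matrix.mulVec_mulVec, mul_transpose_of_mem hF, Matrix.one_mulVec]

theorem coordsIn_sub (u v : R4) : coordsIn F (u - v) = coordsIn F u - coordsIn F v := by
  simp [coordsIn, Matrix.mulVec_sub]

theorem coordsIn_smul (r : ℝ) (v : R4) : coordsIn F (r • v) = r • coordsIn F v := by
  simp [coordsIn, Matrix.mulVec_smul]

theorem inner_eq_dotProduct (u v : R4) : inner ℝ u v = ⇑u ⬝ᵥ ⇑v := by
  simp [PiLp.inner_apply, dotProduct, mul_comm]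

theorem inner_eq_coords (hF : F ∈ Matrix.specialOrthogonalGroup (Fin 4) ℝ) (u v : R4) :
    inner ℝ u v = coordsIn F u ⬝ᵥ coordsIn F v := by
  rw [inner_eq_dotProduct, coordsIn, coordsIn, Matrix.dotProduct_mulVec, Matrix.vecMul_transpose,
    Matrix.mulVec_mulVec, mul_transpose_of_mem hF, Matrix.one_mulVec]

theorem det_coords (hF : F ∈ Matrix.specialOrthogonalGroup (Fin 4) ℝ) (u v w z : R4) :
    (Matrix.of ![⇑u, ⇑v, ⇑w, ⇑z]).det =
      (Matrix.of ![coordsIn F u, coordsIn F v, coordsIn F w, coordsIn F z]).det := by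
  have : Matrix.of ![coordsIn F u, coordsIn F v, coordsIn F w, coordsIn F z] =
      Matrix.of ![⇑u, ⇑v, ⇑w, ⇑z] * F := by
    refine Matrix.ext fun a b => ?_
    fin_cases a <;> simp [Matrix.mul_apply, coordsIn, Matrix.mulVec, dotProduct, mul_comm]
  rw [this, Matrix.det_mul, det_of_mem hF, mul_one]

theorem norm_sq_eq_coords (hF : F ∈ Matrix.specialOrthogonalGroup (Fin 4) ℝ) (u : R4) :
    ‖u‖ ^ 2 = coordsIn F u ⬝ᵥ coordsIn F u := by
  rw [← inner_eq_coords hF, real_inner_self_eq_norm_sq]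

theorem norm_eq_coords (hF : F ∈ Matrix.specialOrthogonalGroup (Fin 4) ℝ) (u : R4) :
    ‖u‖ = √(coordsIn F u ⬝ᵥ coordsIn F u) := by
  rw [← norm_sq_eq_coords hF, Real.sqrt_sq (norm_nonneg _)]

theorem coordsIn_perp (hF : F ∈ Matrix.specialOrthogonalGroup (Fin 4) ℝ) (u v : R4) :
    coordsIn F (perp u v) = coordsIn F v - ((coordsIn F u ⬝ᵥ coordsIn F v) /
      (coordsIn F u ⬝ᵥ coordsIn F u)) • coordsIn F u := by
  rw [perp, coordsIn_sub, coordsIn_smul, inner_eq_coords hF, inner_eq_coords hF]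

end Coords

/-! ## Adapted frames -/

/-- The frame of the tetrahedron `A₁A₂BC` at the edge `BC`. -/
structure Adapted (F : Matrix (Fin 4) (Fin 4) ℝ) (a₁ a₂ b c : R4) : Prop where
  mem : F ∈ Matrix.specialOrthogonalGroup (Fin 4) ℝ
  dist_pos : 0 < dist b c
  edge : coordsIn F (c - b) = ![dist b c, 0, 0, 0]
  fst : ∃ x y, 0 < y ∧ coordsIn F (a₁ - b) = ![x, y, 0, 0]
  snd : ∃ x y z, 0 < z ∧ coordsIn F (a₂ - b) = ![x, y, z, 0]

/-- The first two vectors of the frame form an oriented basis of the plane `ABC`. -/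
structure PlaneFrame (F : Matrix (Fin 4) (Fin 4) ℝ) (a b c : R4) : Prop where
  mem : F ∈ Matrix.specialOrthogonalGroup (Fin 4) ℝ
  plane : ∃ b₀ b₁ c₀ c₁, 0 < b₀ * c₁ - b₁ * c₀ ∧ coordsIn F (b - a) = ![b₀, b₁, 0, 0] ∧
    coordsIn F (c - a) = ![c₀, c₁, 0, 0]

/-- The signed exterior angle between two vectors of the plane. -/
noncomputable def planeAngle (z w z' w' : ℝ) : ℝ :=
  (if z * w' - w * z' < 0 then -1 else 1) *
    (Real.pi - Real.arccos ((z * z' + w * w') / (√(z ^ 2 + w ^ 2) * √(z' ^ 2 + w' ^ 2))))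

theorem planeAngle_comm_neg (z w z' w' : ℝ) : planeAngle z' (-w') z (-w) = planeAngle z w z' w' := by
  rw [planeAngle, planeAngle, show z' * -w - -w' * z = z * w' - w * z' by ring,
    show z' * z + -w' * -w = z * z' + w * w' by ring, neg_sq, neg_sq, mul_comm √(z' ^ 2 + w' ^ 2)]

theorem lagrange_sq_le (z w z' w' : ℝ) :
    (z * z' + w * w') ^ 2 + (z * w' - w * z') ^ 2 = (z ^ 2 + w ^ 2) * (z' ^ 2 + w' ^ 2) := by ring

/-- By Lagrange's identity the normalized scalar and vector products are a cosine and a sine. The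
arccosine loses the sign of the sine, and the sign prefixed in `planeAngle` restores it; the minus
before the scalar product is due to the angle being exterior. -/
theorem planeAngle_cos_sin {z w z' w' : ℝ} (h : z ^ 2 + w ^ 2 ≠ 0) (h' : z' ^ 2 + w' ^ 2 ≠ 0) :
    Real.cos (planeAngle z w z' w') * (√(z ^ 2 + w ^ 2) * √(z' ^ 2 + w' ^ 2)) =
      -(z * z' + w * w') ∧
    Real.sin (planeAngle z w z' w') * (√(z ^ 2 + w ^ 2) * √(z' ^ 2 + w' ^ 2)) =
      z * w' - w * z' := by
  have p : 0 < √(z ^ 2 + w ^ 2) := Real.sqrt_pos.2 (lt_of_le_of_ne (by positivity) h.symm)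
  have p' : 0 < √(z' ^ 2 + w' ^ 2) := Real.sqrt_pos.2 (lt_of_le_of_ne (by positivity) h'.symm)
  set r := √(z ^ 2 + w ^ 2) * √(z' ^ 2 + w' ^ 2) with hr
  have pr : 0 < r := mul_pos p p'
  have hr2 : r ^ 2 = (z * z' + w * w') ^ 2 + (z * w' - w * z') ^ 2 := by
    rw [lagrange_sq_le, hr, mul_pow, Real.sq_sqrt (by positivity), Real.sq_sqrt (by positivity)]
  set s := (z * z' + w * w') / r with hs
  have hs2 : s ^ 2 + ((z * w' - w * z') / r) ^ 2 = 1 := by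
    rw [hs, div_pow, div_pow, ← add_div, ← hr2, div_self (by positivity)]
  have hs1 : -1 ≤ s ∧ s ≤ 1 := by
    constructor <;> nlinarith [sq_nonneg ((z * w' - w * z') / r)]
  have hsin : √(1 - s ^ 2) = |z * w' - w * z'| / r := by
    rw [show 1 - s ^ 2 = ((z * w' - w * z') / r) ^ 2 by linarith, Real.sqrt_sq_eq_abs, abs_div,
      abs_of_pos pr]
  have hsr : s * r = z * z' + w * w' := by rw [hs]; field_simp
  unfold planeAngle
  rw [← hr, ← hs]
  split_ifs with hneg
  · rw [neg_one_mul, Real.cos_neg, Real.sin_neg, Real.cos_pi_sub, Real.sin_pi_sub,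
      Real.cos_arccos hs1.1 hs1.2, Real.sin_arccos, hsin, abs_of_neg hneg]
    constructor
    · linarith
    · field_simp
      try ring
  · rw [one_mul, Real.cos_pi_sub, Real.sin_pi_sub,
      Real.cos_arccos hs1.1 hs1.2, Real.sin_arccos, hsin, abs_of_nonneg (not_lt.1 hneg)]
    constructor
    · linarith
    · field_simp

theorem planeAngle_self {z w : ℝ} (h : z ^ 2 + w ^ 2 ≠ 0) : planeAngle z w z w = Real.pi := by
  rw [planeAngle, Real.mul_self_sqrt (by positivity), ← sq, ← sq, div_self h, Real.arccos_one]
  simp [mul_comm]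

theorem coordsIn_mul (F R : Matrix (Fin 4) (Fin 4) ℝ) (v : R4) :
    coordsIn (F * R) v = Rᵀ *ᵥ coordsIn F v := by
  rw [coordsIn, coordsIn, Matrix.transpose_mul, Matrix.mulVec_mulVec]

namespace PlaneFrame

variable {F : Matrix (Fin 4) (Fin 4) ℝ} {a b c : R4}

/-- The two orthogonalizations together project along the plane `ABC`, which is spanned by the first
two axes. -/
theorem coords_perp (h : PlaneFrame F a b c) (d : R4) :
    coordsIn F (perp (perp (b - a) (c - a)) (perp (b - a) (d - a))) =
      ![0, 0, coordsIn F (d - a) 2, coordsIn F (d - a) 3] := by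
  obtain ⟨hF, b₀, b₁, c₀, c₁, hd, hb, hc⟩ := h
  rw [coordsIn_perp hF, coordsIn_perp hF, coordsIn_perp hF, hb, hc]
  generalize coordsIn F (d - a) = x
  have hU : b₀ * b₀ + b₁ * b₁ ≠ 0 := by
    intro h0
    have h1 : b₀ = 0 := by nlinarith [mul_self_nonneg b₀, mul_self_nonneg b₁]
    have h2 : b₁ = 0 := by nlinarith [mul_self_nonneg b₀, mul_self_nonneg b₁]
    simp [h1, h2] at hd
  set D := b₀ * c₁ - b₁ * c₀ with hD
  set U := b₀ * b₀ + b₁ * b₁ with hUU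
  have e1 : (![c₀, c₁, 0, 0] - (![b₀, b₁, 0, 0] ⬝ᵥ ![c₀, c₁, 0, 0] /
      (![b₀, b₁, 0, 0] ⬝ᵥ ![b₀, b₁, 0, 0])) • ![b₀, b₁, 0, 0] : Fin 4 → ℝ) =
      ![-b₁ * (D / U), b₀ * (D / U), 0, 0] := by
    ext i
    fin_cases i <;> simp [dotProduct, Fin.sum_univ_four] <;> rw [← hUU] <;> field_simp <;>
      rw [hUU, hD] <;> ring
  have e2 : (x - (![b₀, b₁, 0, 0] ⬝ᵥ x /
      (![b₀, b₁, 0, 0] ⬝ᵥ ![b₀, b₁, 0, 0])) • ![b₀, b₁, 0, 0] : Fin 4 → ℝ) =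
      ![-b₁ * ((b₀ * x 1 - b₁ * x 0) / U), b₀ * ((b₀ * x 1 - b₁ * x 0) / U), x 2, x 3] := by
    ext i
    fin_cases i <;> simp [dotProduct, Fin.sum_univ_four]
    · rw [← hUU]; field_simp; rw [hUU]; ring
    · rw [← hUU]; field_simp; rw [hUU]; ring
  rw [e1, e2]
  set X := b₀ * x 1 - b₁ * x 0
  have hD0 : D ≠ 0 := hd.ne'
  have e3 : (![-b₁ * (D / U), b₀ * (D / U), 0, 0] : Fin 4 → ℝ) ⬝ᵥ
      ![-b₁ * (X / U), b₀ * (X / U), x 2, x 3] = D * X / U := by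
    simp [dotProduct, Fin.sum_univ_four]
    field_simp
    rw [hUU]; ring
  have e4 : (![-b₁ * (D / U), b₀ * (D / U), 0, 0] : Fin 4 → ℝ) ⬝ᵥ
      ![-b₁ * (D / U), b₀ * (D / U), 0, 0] = D * D / U := by
    simp [dotProduct, Fin.sum_univ_four]
    field_simp
    rw [hUU]; ring
  rw [e3, e4]
  ext i
  fin_cases i <;> simp
  · field_simp; ring
  · field_simp; ring

/-- The first two axes give the plane `ABC` its orientation, so the volume of `ABCDE` has the sign
of the 2×2 determinant of the remaining coordinates of `D` and `E`. Thus `theta` is an angle in the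
plane orthogonal to the face. -/
theorem theta_eq (h : PlaneFrame F a b c) (d e : R4) : theta a b c d e =
    planeAngle (coordsIn F (d - a) 2) (coordsIn F (d - a) 3)
      (coordsIn F (e - a) 2) (coordsIn F (e - a) 3) := by
  have hp := h.coords_perp
  obtain ⟨hF, b₀, b₁, c₀, c₁, hd, hb, hc⟩ := h
  rw [theta, planeAngle, innerAngle, InnerProductGeometry.angle, inner_eq_coords hF,
    norm_eq_coords hF, norm_eq_coords hF, hp, hp]
  have hv : vol4 a b c d e < 0 ↔ coordsIn F (d - a) 2 * coordsIn F (e - a) 3 -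
      coordsIn F (d - a) 3 * coordsIn F (e - a) 2 < 0 := by
    rw [vol4, det_coords hF, hb, hc, det_fin_four]
    simp only [Matrix.of_apply, Matrix.cons_val]
    generalize coordsIn F (d - a) = x
    generalize coordsIn F (e - a) = y
    rw [show (1 : ℝ) / 24 * (b₀ * (c₁ * (x 2 * y 3 - x 3 * y 2) - 0 * (x 1 * y 3 - x 3 * y 1) +
        0 * (x 1 * y 2 - x 2 * y 1)) - b₁ * (c₀ * (x 2 * y 3 - x 3 * y 2) -
        0 * (x 0 * y 3 - x 3 * y 0) + 0 * (x 0 * y 2 - x 2 * y 0)) +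
        0 * (c₀ * (x 1 * y 3 - x 3 * y 1) - c₁ * (x 0 * y 3 - x 3 * y 0) +
        0 * (x 0 * y 1 - x 1 * y 0)) - 0 * (c₀ * (x 1 * y 2 - x 2 * y 1) -
        c₁ * (x 0 * y 2 - x 2 * y 0) + 0 * (x 0 * y 1 - x 1 * y 0))) =
        (b₀ * c₁ - b₁ * c₀) / 24 * (x 2 * y 3 - x 3 * y 2) by ring]
    exact smul_neg_iff_of_pos_left (show (0 : ℝ) < (b₀ * c₁ - b₁ * c₀) / 24 by positivity)
  have hv' : (if vol4 a b c d e < 0 then (-1 : ℝ) else 1) = if coordsIn F (d - a) 2 *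
      coordsIn F (e - a) 3 - coordsIn F (d - a) 3 * coordsIn F (e - a) 2 < 0 then -1 else 1 := by
    simp only [hv]
  rw [hv']
  simp [dotProduct, Fin.sum_univ_four, ← sq]

theorem rotate (h : PlaneFrame F a b c) : PlaneFrame F b c a := by
  obtain ⟨hF, b₀, b₁, c₀, c₁, hd, hb, hc⟩ := h
  refine ⟨hF, c₀ - b₀, c₁ - b₁, -b₀, -b₁, by linarith, ?_, ?_⟩
  · rw [show c - b = (c - a) - (b - a) by abel, coordsIn_sub, hb, hc]
    ext i; fin_cases i <;> simp
  · rw [show a - b = (-1 : ℝ) • (b - a) by module, coordsIn_smul, hb]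
    ext i; fin_cases i <;> simp

theorem theta_rotate (h : PlaneFrame F a b c) (d e : R4) :
    theta b c a d e = theta a b c d e := by
  rw [h.theta_eq, h.rotate.theta_eq]
  obtain ⟨hF, b₀, b₁, c₀, c₁, hd, hb, hc⟩ := h
  have : ∀ x : R4, coordsIn F (x - b) 2 = coordsIn F (x - a) 2 ∧
      coordsIn F (x - b) 3 = coordsIn F (x - a) 3 := by
    intro x
    rw [show x - b = (x - a) - (b - a) by abel, coordsIn_sub, hb]
    simp
  rw [(this d).1, (this d).2, (this e).1, (this e).2]

/-- Exchanging `A` and `B` reverses the orientation of the plane. Reversing the second and fourth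
axes together keeps the determinant equal to one, at the price of the sign of the fourth coordinate.
-/
theorem exists_swap (h : PlaneFrame F a b c) : ∃ F', PlaneFrame F' b a c ∧
    ∀ x, coordsIn F' (x - b) 2 = coordsIn F (x - a) 2 ∧
      coordsIn F' (x - b) 3 = -coordsIn F (x - a) 3 := by
  obtain ⟨hF, b₀, b₁, c₀, c₁, hd, hb, hc⟩ := h
  let R : Matrix (Fin 4) (Fin 4) ℝ := Matrix.diagonal ![1, -1, 1, -1]
  have hR : ∀ v, coordsIn (F * R) v = ![coordsIn F v 0, -coordsIn F v 1, coordsIn F v 2,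
      -coordsIn F v 3] := by
    intro v
    rw [coordsIn_mul]
    ext i; fin_cases i <;> simp [R, Matrix.mulVec_diagonal]
  have key : ∀ x, coordsIn F (x - b) = coordsIn F (x - a) - ![b₀, b₁, 0, 0] := by
    intro x
    rw [show x - b = (x - a) - (b - a) by abel, coordsIn_sub, hb]
  refine ⟨F * R, ⟨mem_of_eqs ?_ ?_, -b₀, b₁, c₀ - b₀, -(c₁ - b₁), by linarith, ?_, ?_⟩, ?_⟩
  · rw [Matrix.transpose_mul, Matrix.mul_assoc, ← Matrix.mul_assoc R]
    have : R * Rᵀ = 1 := by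
      rw [Matrix.diagonal_transpose, Matrix.diagonal_mul_diagonal, ← Matrix.diagonal_one]
      congr 1; ext i; fin_cases i <;> simp
    rw [this, Matrix.one_mul, mul_transpose_of_mem hF]
  · rw [Matrix.det_mul, det_of_mem hF, Matrix.det_diagonal]
    simp [Fin.prod_univ_four]
  · rw [hR, key]
    ext i; fin_cases i <;> simp [coordsIn]
  · rw [hR, key, hc]
    ext i; fin_cases i <;> simp
  · intro x
    rw [hR, key]
    simp

/-- This makes the angle at a face independent of which of its two tetrahedra is called `EABC`:
exchanging them exchanges `D` with `E` and reverses `ABC`. -/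
theorem theta_swap (h : PlaneFrame F a b c) (d e : R4) :
    theta b a c e d = theta a b c d e := by
  obtain ⟨F', hF', hx⟩ := h.exists_swap
  rw [h.theta_eq, hF'.theta_eq, (hx d).1, (hx d).2, (hx e).1, (hx e).2, planeAngle_comm_neg]

end PlaneFrame

theorem linearIndependent_of_coords_ne {F : Matrix (Fin 4) (Fin 4) ℝ}
    (hF : F ∈ Matrix.specialOrthogonalGroup (Fin 4) ℝ) {u v : R4} (h : coordsIn F u = coordsIn F v) :
    u = v := by
  have := congrArg (fun x => F *ᵥ x) h
  simp only [mul_coordsIn hF] at this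
  ext i
  exact congrFun this i

/-- Gram–Schmidt orthogonalization with the given signs of the axes. -/
theorem exists_triangular_frame {u v w : R4} (h : LinearIndependent ℝ ![u, v, w]) :
    ∃ F ∈ Matrix.specialOrthogonalGroup (Fin 4) ℝ,
      (∃ x, 0 < x ∧ coordsIn F u = ![x, 0, 0, 0]) ∧
      (∃ x y, 0 < y ∧ coordsIn F v = ![x, y, 0, 0]) ∧
      ∃ x y z, 0 < z ∧ coordsIn F w = ![x, y, z, 0] := by
  -- The fourth vector is a filler; the orthonormal basis supplies a fourth axis by itself.
  let f : Fin 4 → R4 := ![u, v, w, 0]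
  have hcard : Module.finrank ℝ R4 = Fintype.card (Fin 4) := by simp [R4]
  let b := InnerProductSpace.gramSchmidtOrthonormalBasis hcard f
  have hne : ∀ n : Fin 4, n ≠ 3 → InnerProductSpace.gramSchmidt ℝ f n ≠ 0 := by
    intro n hn
    apply InnerProductSpace.gramSchmidt_ne_zero_coe
    have hlt : ∀ i : Set.Iic n, (i : Fin 4).1 < 3 := by
      intro i
      have := i.2
      simp only [Set.mem_Iic] at this
      omega
    have : f ∘ ((↑) : Set.Iic n → Fin 4) = ![u, v, w] ∘ fun i : Set.Iic n => ⟨i.1.1, hlt i⟩ := by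
      funext i
      obtain ⟨⟨i, hi⟩, hi'⟩ := i
      have h3 := hlt ⟨⟨i, hi⟩, hi'⟩
      simp only at h3
      interval_cases i <;> rfl
    rw [this]
    refine h.comp _ fun i j hij => ?_
    ext
    simpa using hij
  have hpos : ∀ n : Fin 4, n ≠ 3 → 0 < inner ℝ (b n) (f n) := by
    intro n hn
    have h0 := hne n hn
    have h1 : InnerProductSpace.gramSchmidtNormed ℝ f n ≠ 0 := by
      simpa [InnerProductSpace.gramSchmidtNormed] using h0
    have hin : inner ℝ (InnerProductSpace.gramSchmidt ℝ f n) (f n) =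
        ‖InnerProductSpace.gramSchmidt ℝ f n‖ ^ 2 := by
      conv_lhs => rw [InnerProductSpace.gramSchmidt_def'' ℝ f n]
      rw [inner_add_right, inner_sum, Finset.sum_eq_zero, add_zero, real_inner_self_eq_norm_sq]
      intro i hi
      rw [inner_smul_right, InnerProductSpace.gramSchmidt_orthogonal ℝ f, mul_zero]
      exact (Finset.mem_Iio.1 hi).ne'
    simp only [b, InnerProductSpace.gramSchmidtOrthonormalBasis_apply hcard h1]
    rw [InnerProductSpace.gramSchmidtNormed, inner_smul_left, hin]
    have := norm_pos_iff.2 h0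
    simp only [RCLike.ofReal_real_eq_id, id, map_inv₀, conj_trivial]
    positivity
  have htri : ∀ i j : Fin 4, i < j → inner ℝ (b j) (f i) = 0 := fun i j hij =>
    InnerProductSpace.gramSchmidtOrthonormalBasis_inv_triangular hcard f hij
  let G : Matrix (Fin 4) (Fin 4) ℝ := Matrix.of fun i j => b j i
  have hG : ∀ x, ∀ j, coordsIn G x j = inner ℝ (b j) x := by
    intro x j
    rw [inner_eq_dotProduct]
    rfl
  have hGG : Gᵀ * G = 1 := by
    ext i j
    have := orthonormal_iff_ite.1 b.orthonormal i j
    rw [inner_eq_dotProduct] at this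
    rw [Matrix.one_apply, ← this]
    rfl
  have hdet : G.det * G.det = 1 := by
    have := congrArg Matrix.det hGG
    rwa [Matrix.det_mul, Matrix.det_transpose, Matrix.det_one] at this
  -- The fourth axis is free up to sign, and the sign is used to make the determinant equal to one.
  let s : Fin 4 → ℝ := ![1, 1, 1, G.det]
  have hs : ∀ i, s i * s i = 1 := by intro i; fin_cases i <;> simp [s, hdet]
  refine ⟨G * Matrix.diagonal s, mem_of_eqs ?_ ?_, ?_⟩
  · rw [Matrix.transpose_mul, Matrix.mul_assoc, ← Matrix.mul_assoc (Matrix.diagonal s),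
      Matrix.diagonal_transpose, Matrix.diagonal_mul_diagonal]
    simp only [hs]
    rw [Matrix.diagonal_one, Matrix.one_mul]
    exact mul_eq_one_comm.1 hGG
  · rw [Matrix.det_mul, Matrix.det_diagonal]
    simp [Fin.prod_univ_four, s, hdet]
  have hc : ∀ x, coordsIn (G * Matrix.diagonal s) x = fun j => s j * inner ℝ (b j) x := by
    intro x
    rw [coordsIn_mul]
    funext j
    rw [Matrix.diagonal_transpose, Matrix.mulVec_diagonal, hG]
  refine ⟨⟨_, hpos 0 (by decide), ?_⟩, ⟨inner ℝ (b 0) v, _, hpos 1 (by decide), ?_⟩,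
    ⟨inner ℝ (b 0) w, inner ℝ (b 1) w, _, hpos 2 (by decide), ?_⟩⟩
  · rw [hc]
    have h1 := htri 0 1 (by decide)
    have h2 := htri 0 2 (by decide)
    have h3 := htri 0 3 (by decide)
    simp only [f, Matrix.cons_val] at h1 h2 h3
    ext i; fin_cases i <;> simp [s, f, h1, h2, h3]
  · rw [hc]
    have h2 := htri 1 2 (by decide)
    have h3 := htri 1 3 (by decide)
    simp only [f, Matrix.cons_val] at h2 h3
    ext i; fin_cases i <;> simp [s, f, h2, h3]
  · rw [hc]
    have h3 := htri 2 3 (by decide)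
    simp only [f, Matrix.cons_val] at h3
    ext i; fin_cases i <;> simp [s, f, h3]

theorem exists_adapted {a₁ a₂ b c : R4} (h : LinearIndependent ℝ ![c - b, a₁ - b, a₂ - b]) :
    ∃ F, Adapted F a₁ a₂ b c := by
  obtain ⟨F, hF, ⟨x, hx, hu⟩, hv, hw⟩ := exists_triangular_frame h
  have hd : dist b c = x := by
    rw [dist_comm, dist_eq_norm, norm_eq_coords hF, hu]
    simp [dotProduct, Fin.sum_univ_four, Real.sqrt_mul_self hx.le]
  exact ⟨F, hF, hd ▸ hx, hd ▸ hu, hv, hw⟩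

namespace Adapted

variable {F : Matrix (Fin 4) (Fin 4) ℝ} {a₁ a₂ a₃ b c : R4}

/-- The last column of a rotation is determined by the others. -/
theorem eq_of_columns {F F' : Matrix (Fin 4) (Fin 4) ℝ}
    (hF : F ∈ Matrix.specialOrthogonalGroup (Fin 4) ℝ)
    (hF' : F' ∈ Matrix.specialOrthogonalGroup (Fin 4) ℝ)
    (h : ∀ i, ∀ j : Fin 4, j ≠ 3 → F i j = F' i j) : F = F' := by
  have key : ∀ G ∈ Matrix.specialOrthogonalGroup (Fin 4) ℝ, ∀ i,
      G i 3 = (Gᵀ.updateRow 3 (Pi.single i 1)).det := by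
    intro G hG i
    have h1 := Matrix.mul_adjugate G
    rw [det_of_mem hG, one_smul] at h1
    have h2 : Gᵀ = G.adjugate := by
      calc Gᵀ = Gᵀ * (G * G.adjugate) := by rw [h1, Matrix.mul_one]
        _ = G.adjugate := by rw [← Matrix.mul_assoc, transpose_mul_of_mem hG, Matrix.one_mul]
    rw [← Matrix.adjugate_apply, ← Matrix.adjugate_transpose, ← h2]
    rfl
  ext i j
  by_cases hj : j = 3
  · subst hj
    rw [key F hF, key F' hF']
    congr 1
    ext k l
    by_cases hk : k = 3
    · subst hk; simp
    · simp [Matrix.updateRow_ne hk, h l k hk]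
  · exact h i j hj

/-- The first three columns of the transition matrix between two such frames are upper triangular
with positive diagonal. Being orthonormal they are unit vectors, and the determinant fixes the
fourth column. -/
theorem unique {F' : Matrix (Fin 4) (Fin 4) ℝ} (h : Adapted F a₁ a₂ b c)
    (h' : Adapted F' a₁ a₂ b c) : F = F' := by
  obtain ⟨x, y, hy, ha⟩ := h.fst
  obtain ⟨x', y', hy', ha'⟩ := h'.fst
  obtain ⟨p, q, z, hz, hb⟩ := h.snd
  obtain ⟨p', q', z', hz', hb'⟩ := h'.snd
  set R := Fᵀ * F' with hR
  have hRR : Rᵀ * R = 1 := by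
    rw [hR, Matrix.transpose_mul, Matrix.transpose_transpose, Matrix.mul_assoc,
      ← Matrix.mul_assoc F, mul_transpose_of_mem h.mem, Matrix.one_mul, transpose_mul_of_mem h'.mem]
  have hc : ∀ v, coordsIn F v = R *ᵥ coordsIn F' v := by
    intro v
    rw [hR, ← Matrix.mulVec_mulVec, mul_coordsIn h'.mem, coordsIn]
  have hcol : ∀ i j, ∑ k, R k i * R k j = if i = j then 1 else 0 := by
    intro i j
    rw [← Matrix.one_apply, ← hRR, Matrix.mul_apply]
    rfl
  have e0 := hc (c - b)
  have e1 := hc (a₁ - b)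
  have e2 := hc (a₂ - b)
  rw [h.edge, h'.edge] at e0
  rw [ha, ha'] at e1
  rw [hb, hb'] at e2
  have hd := h.dist_pos
  have f0 := fun i => congrFun e0 i
  have f1 := fun i => congrFun e1 i
  have f2 := fun i => congrFun e2 i
  simp only [Matrix.mulVec, dotProduct, Fin.sum_univ_four, Matrix.cons_val, mul_zero,
    add_zero] at f0 f1 f2
  have r00 : R 0 0 = 1 := by
    have := f0 0; simp only [Matrix.cons_val] at this
    exact mul_right_cancel₀ hd.ne' (by linarith)
  have r0 : ∀ i, i ≠ 0 → R i 0 = 0 := by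
    intro i hi
    have := f0 i
    have h3 : R i 0 * dist b c = 0 := by
      rw [← this]; fin_cases i <;> simp at hi ⊢
    exact (mul_eq_zero.1 h3).resolve_right hd.ne'
  have r10 := r0 1 (by decide)
  have r20 := r0 2 (by decide)
  have r30 := r0 3 (by decide)
  have c01 := hcol 0 1
  have c02 := hcol 0 2
  simp [Fin.sum_univ_four, r00, r10, r20, r30] at c01 c02
  have g1 := f1 1; have g2 := f1 2; have g3 := f1 3
  simp only [Matrix.cons_val, r10, r20, r30, zero_mul, zero_add] at g1 g2 g3
  have r21 : R 2 1 = 0 := by simpa [hy'.ne'] using g2.symm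
  have r31 : R 3 1 = 0 := by simpa [hy'.ne'] using g3.symm
  have c11 := hcol 1 1
  simp [Fin.sum_univ_four, c01, r21, r31] at c11
  have r11p : 0 < R 1 1 := by
    by_contra hn; nlinarith
  have r11 : R 1 1 = 1 := by nlinarith
  have c12 := hcol 1 2
  simp [Fin.sum_univ_four, c01, r21, r31, r11] at c12
  have g2 := f2 2; have g3 := f2 3
  simp only [Matrix.cons_val, r20, r30, r21, r31, zero_mul, zero_add] at g2 g3
  have r32 : R 3 2 = 0 := by simpa [hz'.ne'] using g3.symm
  have c22 := hcol 2 2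
  simp [Fin.sum_univ_four, c02, c12, r32] at c22
  have r22p : 0 < R 2 2 := by
    by_contra hn; nlinarith
  have r22 : R 2 2 = 1 := by nlinarith
  have hF' : F' = F * R := by
    rw [hR, ← Matrix.mul_assoc, mul_transpose_of_mem h.mem, Matrix.one_mul]
  refine eq_of_columns h.mem h'.mem fun i j hj => ?_
  rw [hF', Matrix.mul_apply, Fin.sum_univ_four]
  fin_cases j
  · simp [r00, r10, r20, r30]
  · simp [c01, r11, r21, r31]
  · simp [c02, c12, r22, r32]
  · exact absurd rfl hj

end Adapted

/-- The diagonal entries are cut off in the definition. This matters because the edge joining a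
vertex to itself has no meaning. -/
theorem dihedral_congr {L L' : Fin 4 → Fin 4 → ℝ} (h : ∀ i j, i ≠ j → L i j = L' i j) :
    dihedral L = dihedral L' := by
  simp only [dihedral]
  rw [h 0 2 (by decide), h 1 2 (by decide), h 3 2 (by decide), h 0 1 (by decide),
    h 0 3 (by decide), h 1 3 (by decide)]
  simp

/-- The matrix of distances between the points. -/
noncomputable def distMat {ι : Type*} (x : ι → R4) (i j : ι) : ℝ := dist (x i) (x j)

theorem dist_sq_polar (u v w : R4) :
    (dist u w ^ 2 + dist v w ^ 2 - dist u v ^ 2) / 2 = inner ℝ (u - w) (v - w) := by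
  rw [dist_eq_norm, dist_eq_norm, dist_eq_norm, real_inner_eq_norm_mul_self_add_norm_mul_self_sub_norm_sub_mul_self_div_two,
    sub_sub_sub_cancel_right]
  ring

/-- The dihedral angle in terms of the inner products. -/
noncomputable def gramAngle (g : Fin 4 → Fin 4 → ℝ) : ℝ :=
  Real.arccos ((g 0 1 * g 3 3 - g 0 3 * g 1 3) /
    (√(g 0 0 * g 3 3 - g 0 3 ^ 2) * √(g 1 1 * g 3 3 - g 1 3 ^ 2)))

theorem dihedral_eq_gramAngle (L : Fin 4 → Fin 4 → ℝ) : dihedral L = gramAngle fun i j =>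
    (L i 2 ^ 2 + L j 2 ^ 2 - (if i = j then 0 else L i j ^ 2)) / 2 := rfl

theorem dihedral_distMat (x : Fin 4 → R4) : dihedral (distMat x) =
    Real.arccos ((inner ℝ (x 0 - x 2) (x 1 - x 2) * inner ℝ (x 3 - x 2) (x 3 - x 2) -
      inner ℝ (x 0 - x 2) (x 3 - x 2) * inner ℝ (x 1 - x 2) (x 3 - x 2)) /
      (√(inner ℝ (x 0 - x 2) (x 0 - x 2) * inner ℝ (x 3 - x 2) (x 3 - x 2) -
        inner ℝ (x 0 - x 2) (x 3 - x 2) ^ 2) *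
      √(inner ℝ (x 1 - x 2) (x 1 - x 2) * inner ℝ (x 3 - x 2) (x 3 - x 2) -
        inner ℝ (x 1 - x 2) (x 3 - x 2) ^ 2))) := by
  have : ∀ i j, (distMat x i 2 ^ 2 + distMat x j 2 ^ 2 -
      (if i = j then 0 else distMat x i j ^ 2)) / 2 = inner ℝ (x i - x 2) (x j - x 2) := by
    intro i j
    rw [← dist_sq_polar]
    split_ifs with h
    · subst h; simp [distMat]
    · rfl
  have h2 : (fun i j => (distMat x i 2 ^ 2 + distMat x j 2 ^ 2 -
      (if i = j then 0 else distMat x i j ^ 2)) / 2) =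
      fun i j => inner ℝ (x i - x 2) (x j - x 2) := by funext i j; exact this i j
  rw [dihedral_eq_gramAngle, h2, gramAngle]

namespace Adapted

variable {F : Matrix (Fin 4) (Fin 4) ℝ} {a₁ a₂ a₃ b c : R4}

/-- In an adapted frame the part of `a₁ - b` orthogonal to the edge points along the second axis, so
the dihedral angle is the polar angle of `a₂ - b` in the plane of the second and third axes. -/
theorem dihedral_cos_sin (h : Adapted F a₁ a₂ b c) :
    ∃ r, 0 < r ∧ r ^ 2 = coordsIn F (a₂ - b) 1 ^ 2 + coordsIn F (a₂ - b) 2 ^ 2 ∧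
    Real.cos (dihedral (distMat ![a₁, a₂, b, c])) * r = coordsIn F (a₂ - b) 1 ∧
    Real.sin (dihedral (distMat ![a₁, a₂, b, c])) * r = coordsIn F (a₂ - b) 2 := by
  obtain ⟨x, y, hy, ha⟩ := h.fst
  obtain ⟨p, q, z, hz, hb⟩ := h.snd
  have hl := h.dist_pos
  rw [dihedral_distMat]
  simp only [Matrix.cons_val, inner_eq_coords h.mem, ha, hb, h.edge]
  set l := dist b c
  simp only [dotProduct, Fin.sum_univ_four, Matrix.cons_val]
  set r := √(q ^ 2 + z ^ 2) with hr
  have hrp : 0 < r := Real.sqrt_pos.2 (by positivity)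
  have hr2 : r ^ 2 = q ^ 2 + z ^ 2 := Real.sq_sqrt (by positivity)
  have e1 : √((x * x + y * y + 0 * 0 + 0 * 0) * (l * l + 0 * 0 + 0 * 0 + 0 * 0) -
      (x * l + y * 0 + 0 * 0 + 0 * 0) ^ 2) = l * y := by
    rw [← Real.sqrt_sq (mul_pos hl hy).le]; congr 1; ring
  have e2 : √((p * p + q * q + z * z + 0 * 0) * (l * l + 0 * 0 + 0 * 0 + 0 * 0) -
      (p * l + q * 0 + z * 0 + 0 * 0) ^ 2) = l * r := by
    rw [← Real.sqrt_sq (mul_pos hl hrp).le, mul_pow, hr2]; congr 1; ring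
  rw [e1, e2]
  have e3 : ((x * p + y * q + 0 * z + 0 * 0) * (l * l + 0 * 0 + 0 * 0 + 0 * 0) -
      (x * l + y * 0 + 0 * 0 + 0 * 0) * (p * l + q * 0 + z * 0 + 0 * 0)) / (l * y * (l * r)) =
      q / r := by field_simp; ring
  rw [e3]
  have hle : (q / r) ^ 2 ≤ 1 := by
    rw [div_pow, div_le_one (by positivity), hr2]; nlinarith
  refine ⟨r, hrp, hr2, ?_, ?_⟩
  · rw [Real.cos_arccos (by nlinarith) (by nlinarith)]; field_simp
  · rw [Real.sin_arccos, show 1 - (q / r) ^ 2 = (z / r) ^ 2 by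
      rw [div_pow, div_pow]; field_simp; linarith, Real.sqrt_sq (by positivity)]
    field_simp

theorem rot_coords₁₂ (t : ℝ) (v : Fin 4 → ℝ) : (rot 1 2 t)ᵀ *ᵥ v =
    ![v 0, Real.cos t * v 1 + Real.sin t * v 2, -Real.sin t * v 1 + Real.cos t * v 2, v 3] := by
  ext i
  fin_cases i <;> simp [rot, Matrix.mulVec, dotProduct, Fin.sum_univ_four]

theorem rot_coords₂₃ (t : ℝ) (v : Fin 4 → ℝ) : (rot 2 3 t)ᵀ *ᵥ v =
    ![v 0, v 1, Real.cos t * v 2 + Real.sin t * v 3, -Real.sin t * v 2 + Real.cos t * v 3] := by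
  ext i
  fin_cases i <;> simp [rot, Matrix.mulVec, dotProduct, Fin.sum_univ_four]

theorem rot_mem₁₂ (t : ℝ) : rot 1 2 t ∈ Matrix.specialOrthogonalGroup (Fin 4) ℝ := by
  refine mem_of_eqs ?_ ?_
  · ext i j
    have := Real.sin_sq_add_cos_sq t
    fin_cases i <;> fin_cases j <;>
      simp [rot, Matrix.mul_apply, Fin.sum_univ_four] <;> nlinarith
  · rw [det_fin_four]
    simp [rot]
    nlinarith [Real.sin_sq_add_cos_sq t]

theorem rot_mem₂₃ (t : ℝ) : rot 2 3 t ∈ Matrix.specialOrthogonalGroup (Fin 4) ℝ := by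
  refine mem_of_eqs ?_ ?_
  · ext i j
    have := Real.sin_sq_add_cos_sq t
    fin_cases i <;> fin_cases j <;>
      simp [rot, Matrix.mul_apply, Fin.sum_univ_four] <;> nlinarith
  · rw [det_fin_four]
    simp [rot]
    nlinarith [Real.sin_sq_add_cos_sq t]

/-- The geometric content of the deficit rotation. Turning through the dihedral angle brings the
second axis into the plane `a₂bc`; the third axis then points away from `a₁`. The exterior angle at
the face is measured from exactly this direction, so the second rotation turns the third axis into
the hyperplane of the next tetrahedron, to the side of `a₃`. -/
theorem step (h : Adapted F a₁ a₂ b c) (hl : LinearIndependent ℝ ![c - b, a₂ - b, a₃ - b]) :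
    Adapted (F * (rot 1 2 (dihedral (distMat ![a₁, a₂, b, c])) *
      rot 2 3 (theta a₂ b c a₃ a₁))) a₂ a₃ b c := by
  obtain ⟨x, y, hy, ha⟩ := h.fst
  obtain ⟨p, q, z, hz, hb⟩ := h.snd
  obtain ⟨r, hr, hr2, hcos, hsin⟩ := h.dihedral_cos_sin
  have hd := h.dist_pos
  set φ := dihedral (distMat ![a₁, a₂, b, c])
  simp only [hb, Matrix.cons_val] at hr2 hcos hsin
  set G := F * rot 1 2 φ with hG
  have hGm : G ∈ Matrix.specialOrthogonalGroup (Fin 4) ℝ := mul_mem h.mem (rot_mem₁₂ φ)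
  have g0 : coordsIn G (c - b) = ![dist b c, 0, 0, 0] := by
    rw [hG, coordsIn_mul, h.edge, rot_coords₁₂]; simp
  have g1 : coordsIn G (a₁ - b) = ![x, Real.cos φ * y, -Real.sin φ * y, 0] := by
    rw [hG, coordsIn_mul, ha, rot_coords₁₂]; simp
  have hsp : 0 < Real.sin φ := by
    by_contra hn; nlinarith
  have g2 : coordsIn G (a₂ - b) = ![p, r, 0, 0] := by
    rw [hG, coordsIn_mul, hb, rot_coords₁₂]
    have e1 : Real.cos φ * q + Real.sin φ * z = r := by
      have := Real.sin_sq_add_cos_sq φ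
      rw [← hcos, ← hsin]; linear_combination r * this
    have e2 : -Real.sin φ * q + Real.cos φ * z = 0 := by
      rw [← hcos, ← hsin]; ring
    simp only [Matrix.cons_val, e1, e2]
  have hsub : ∀ v, coordsIn G (v - a₂) = coordsIn G (v - b) - ![p, r, 0, 0] := by
    intro v
    rw [show v - a₂ = (v - b) - (a₂ - b) by abel, coordsIn_sub, g2]
  have hP : PlaneFrame G a₂ b c := by
    refine ⟨hGm, -p, -r, dist b c - p, -r, by nlinarith, ?_, ?_⟩
    · rw [hsub, sub_self]
      ext i; fin_cases i <;> simp [coordsIn]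
    · rw [hsub, g0]
      ext i; fin_cases i <;> simp
  have hth := hP.theta_eq a₃ a₁
  set v := coordsIn G (a₃ - b) with hv
  rw [hsub, hsub, g1, ← hv] at hth
  simp only [Pi.sub_apply, Matrix.cons_val, sub_zero] at hth
  -- Otherwise `a₃` would lie in the plane of `a₂`, `b`, `c`.
  have hv0 : v 2 ^ 2 + v 3 ^ 2 ≠ 0 := by
    intro h0
    have v2 : v 2 = 0 := by nlinarith [sq_nonneg (v 2), sq_nonneg (v 3)]
    have v3 : v 3 = 0 := by nlinarith [sq_nonneg (v 2), sq_nonneg (v 3)]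
    have hrel : a₃ - b = ((v 0 - v 1 / r * p) / dist b c) • (c - b) + (v 1 / r) • (a₂ - b) := by
      apply linearIndependent_of_coords_ne hGm
      have : coordsIn G (((v 0 - v 1 / r * p) / dist b c) • (c - b) + (v 1 / r) • (a₂ - b)) =
          ((v 0 - v 1 / r * p) / dist b c) • coordsIn G (c - b) +
            (v 1 / r) • coordsIn G (a₂ - b) := by
        rw [← coordsIn_smul, ← coordsIn_smul, coordsIn, coordsIn, coordsIn, ← Matrix.mulVec_add]
        rfl
      rw [this, g0, g2, ← hv]
      ext i
      fin_cases i
      · simp; field_simp; ring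
      · simp; field_simp
      · simpa using v2
      · simpa using v3
    have := Fintype.linearIndependent_iff.1 hl
      ![(v 0 - v 1 / r * p) / dist b c, v 1 / r, -1] (by
        simp only [Fin.sum_univ_three, Matrix.cons_val, hrel]
        module) 2
    simp at this
  have hu0 : (-Real.sin φ * y) ^ 2 + (0 : ℝ) ^ 2 ≠ 0 := by
    rw [show (-Real.sin φ * y) ^ 2 + (0 : ℝ) ^ 2 = (Real.sin φ * y) ^ 2 by ring]
    exact pow_ne_zero 2 (mul_pos hsp hy).ne'
  obtain ⟨k1, k2⟩ := planeAngle_cos_sin hv0 hu0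
  rw [← hth] at k1 k2
  set θ := theta a₂ b c a₃ a₁
  have hsq : √((-Real.sin φ * y) ^ 2 + (0 : ℝ) ^ 2) = Real.sin φ * y := by
    rw [show (-Real.sin φ * y) ^ 2 + (0 : ℝ) ^ 2 = (Real.sin φ * y) ^ 2 by ring,
      Real.sqrt_sq (mul_pos hsp hy).le]
  rw [hsq] at k1 k2
  set ρ := √(v 2 ^ 2 + v 3 ^ 2) with hρ
  have hρ0 : 0 < ρ := Real.sqrt_pos.2 (lt_of_le_of_ne (by positivity) hv0.symm)
  have hsy := mul_pos hsp hy
  -- Since `a₁` has third coordinate `-sin φ · y` and fourth coordinate zero, the signs in the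
  -- formulas for the exterior angle cancel and `θ` is the polar angle of `a₃`.
  have m1 : Real.cos θ * ρ = v 2 := mul_right_cancel₀ hsy.ne' (by linarith)
  have m2 : Real.sin θ * ρ = v 3 := mul_right_cancel₀ hsy.ne' (by linarith)
  rw [← Matrix.mul_assoc, ← hG]
  refine ⟨mul_mem hGm (rot_mem₂₃ θ), hd, ?_, ⟨p, r, hr, ?_⟩, ⟨v 0, v 1, ρ, hρ0, ?_⟩⟩
  · rw [coordsIn_mul, g0, rot_coords₂₃]; simp
  · rw [coordsIn_mul, g2, rot_coords₂₃]; simp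
  · rw [coordsIn_mul, ← hv, rot_coords₂₃]
    have e1 : Real.cos θ * v 2 + Real.sin θ * v 3 = ρ := by
      have := Real.sin_sq_add_cos_sq θ
      rw [← m1, ← m2]; linear_combination ρ * this
    have e2 : -Real.sin θ * v 2 + Real.cos θ * v 3 = 0 := by
      rw [← m1, ← m2]; ring
    simp only [e1, e2]

end Adapted

/-! ## Bivectors of faces and tetrahedra -/

/-- The area of the parallelogram spanned by two vectors. -/
noncomputable def parallelogramArea (u v : R4) : ℝ :=
  √(inner ℝ u u * inner ℝ v v - inner ℝ u v ^ 2)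

/-- The unit bivector of the plane which contains the directions orthogonal to `BC` in the
tetrahedron `A₁A₂BC`. -/
noncomputable def dihedralBivector (a₁ a₂ b c : R4) : Matrix (Fin 4) (Fin 4) ℝ :=
  (parallelogramArea (perp (c - b) (a₁ - b)) (perp (c - b) (a₂ - b)))⁻¹ •
    wedge ⇑(perp (c - b) (a₁ - b)) ⇑(perp (c - b) (a₂ - b))

/-- The unit bivector orthogonal to the triangle `ABC`. -/
noncomputable def faceBivector (a b c : R4) : Matrix (Fin 4) (Fin 4) ℝ :=
  (area2 b c a)⁻¹ • dualWedge ⇑(c - b) ⇑(a - b)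

theorem dihedralBivector_swap (a₁ a₂ b c : R4) :
    dihedralBivector a₂ a₁ b c = -dihedralBivector a₁ a₂ b c := by
  rw [dihedralBivector, dihedralBivector, wedge_swap, parallelogramArea, parallelogramArea,
    real_inner_comm (perp (c - b) (a₁ - b)) (perp (c - b) (a₂ - b)), mul_comm, smul_neg]

theorem area2_eq (a b c : R4) : area2 a b c = parallelogramArea (b - a) (c - a) := by
  generalize hu : b - a = u
  generalize hv : c - a = v
  have h : area2 a b c = ‖u‖ * ‖perp u v‖ := by rw [area2, hu, hv]
  rw [h, parallelogramArea]
  by_cases h0 : u = 0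
  · simp [h0]
  have hu0 : inner ℝ u u ≠ 0 := inner_self_ne_zero.2 h0
  rw [← Real.sqrt_sq (mul_nonneg (norm_nonneg u) (norm_nonneg _)), mul_pow,
    ← real_inner_self_eq_norm_sq, ← real_inner_self_eq_norm_sq]
  congr 1
  rw [perp, inner_sub_left, inner_sub_right, inner_sub_right, inner_smul_left, inner_smul_right,
    inner_smul_left, inner_smul_right, real_inner_comm u v]
  simp only [conj_trivial]
  field_simp
  ring

theorem area2_rotate (a b c : R4) : area2 b c a = area2 a b c := by
  rw [area2_eq, area2_eq, parallelogramArea, parallelogramArea]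
  congr 1
  have h1 : c - b = (c - a) - (b - a) := by abel
  have h2 : a - b = -(b - a) := by abel
  rw [h1, h2]
  generalize c - a = v
  generalize b - a = u
  simp only [inner_sub_left, inner_sub_right, inner_neg_left, inner_neg_right, real_inner_comm u v]
  ring

theorem area2_swap (a b c : R4) : area2 a c b = area2 a b c := by
  rw [area2_eq, area2_eq, parallelogramArea, parallelogramArea, mul_comm,
    real_inner_comm (b - a) (c - a)]

namespace Adapted

variable {F : Matrix (Fin 4) (Fin 4) ℝ} {a₁ a₂ a₃ b c : R4}

/-- With `faceBivector_eq` this identifies the two unit bivectors as the generators of the rotations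
`rot 1 2` and `rot 2 3` of the frame, written in the standard coordinates. -/
theorem dihedralBivector_eq (h : Adapted F a₁ a₂ b c) :
    dihedralBivector a₁ a₂ b c = F * skew 1 2 * Fᵀ := by
  obtain ⟨x, y, hy, ha⟩ := h.fst
  obtain ⟨p, q, z, hz, hb⟩ := h.snd
  have hl := h.dist_pos
  have e1 : coordsIn F (perp (c - b) (a₁ - b)) = y • Pi.single 1 1 := by
    rw [coordsIn_perp h.mem, h.edge, ha]
    ext i; fin_cases i <;> simp [dotProduct, Fin.sum_univ_four]
    field_simp; ring
  have e2 : coordsIn F (perp (c - b) (a₂ - b)) = q • Pi.single 1 1 + z • Pi.single 2 1 := by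
    rw [coordsIn_perp h.mem, h.edge, hb]
    ext i; fin_cases i <;> simp [dotProduct, Fin.sum_univ_four]
    field_simp; ring
  have e3 : parallelogramArea (perp (c - b) (a₁ - b)) (perp (c - b) (a₂ - b)) = y * z := by
    rw [parallelogramArea, inner_eq_coords h.mem, inner_eq_coords h.mem, inner_eq_coords h.mem,
      e1, e2, ← Real.sqrt_sq (mul_pos hy hz).le]
    congr 1
    simp [dotProduct, Fin.sum_univ_four]
    ring
  rw [dihedralBivector, e3, ← mul_coordsIn h.mem (perp (c - b) (a₁ - b)),
    ← mul_coordsIn h.mem (perp (c - b) (a₂ - b)), wedge_conj, e1, e2, wedge_smul_left,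
    wedge_add_right, wedge_smul_right, wedge_smul_right, wedge_self, smul_zero, zero_add,
    wedge_single, Matrix.mul_smul, Matrix.mul_smul, Matrix.smul_mul, Matrix.smul_mul, smul_smul,
    smul_smul, mul_assoc, inv_mul_cancel₀ (mul_pos hy hz).ne', one_smul]

theorem area2_pos (h : Adapted F a₁ a₂ b c) : 0 < area2 b c a₁ := by
  obtain ⟨x, y, hy, ha⟩ := h.fst
  have hl := h.dist_pos
  rw [area2_eq, parallelogramArea, inner_eq_coords h.mem, inner_eq_coords h.mem,
    inner_eq_coords h.mem, h.edge, ha]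
  apply Real.sqrt_pos.2
  simp only [dotProduct, Fin.sum_univ_four, Matrix.cons_val]
  have := mul_pos (mul_pos hl hl) (mul_pos hy hy)
  nlinarith

theorem faceBivector_eq (h : Adapted F a₁ a₂ b c) :
    faceBivector a₁ b c = F * skew 2 3 * Fᵀ := by
  obtain ⟨x, y, hy, ha⟩ := h.fst
  have hl := h.dist_pos
  have e1 : coordsIn F (c - b) = dist b c • Pi.single 0 1 := by
    rw [h.edge]
    ext i; fin_cases i <;> simp
  have e2 : coordsIn F (a₁ - b) = x • Pi.single 0 1 + y • Pi.single 1 1 := by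
    rw [ha]
    ext i; fin_cases i <;> simp
  have e3 : area2 b c a₁ = dist b c * y := by
    rw [area2_eq, parallelogramArea, inner_eq_coords h.mem, inner_eq_coords h.mem,
      inner_eq_coords h.mem, h.edge, ha, ← Real.sqrt_sq (mul_pos hl hy).le]
    congr 1
    simp [dotProduct, Fin.sum_univ_four]
    ring
  rw [faceBivector, e3, ← mul_coordsIn h.mem (c - b), ← mul_coordsIn h.mem (a₁ - b),
    dualWedge_conj h.mem, e1, e2, dualWedge_smul_left, dualWedge_add_right, dualWedge_smul_right,
    dualWedge_smul_right, dualWedge_self, smul_zero, zero_add, dualWedge_single, Matrix.mul_smul,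
    Matrix.mul_smul, Matrix.smul_mul, Matrix.smul_mul, smul_smul, smul_smul, mul_assoc,
    inv_mul_cancel₀ (mul_pos hl hy).ne', one_smul]

end Adapted

/-! ## Derivatives of distances and dihedral angles -/

section Dist

variable {ι : Type*} [Fintype ι]

/-- The differential of the distance between two of the points. -/
noncomputable def distDeriv (x : ι → R4) (i j : ι) : (ι → R4) →L[ℝ] ℝ :=
  (dist (x i) (x j))⁻¹ • (innerSL ℝ (x i - x j)).comp
    (ContinuousLinearMap.proj (R := ℝ) (φ := fun _ : ι => R4) i - ContinuousLinearMap.proj j)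

theorem distDeriv_apply (x : ι → R4) (i j : ι) (v : ι → R4) :
    distDeriv x i j v = (dist (x i) (x j))⁻¹ * inner ℝ (x i - x j) (v i - v j) := by
  rfl

theorem hasFDerivAt_dist {x : ι → R4} {i j : ι} (h : i = j ∨ x i ≠ x j) :
    HasFDerivAt (fun q : ι → R4 => dist (q i) (q j)) (distDeriv x i j) x := by
  rcases h with rfl | h
  · have : distDeriv x i i = 0 := by ext v; simp [distDeriv_apply]
    rw [this]
    simpa using hasFDerivAt_const (0 : ℝ) x
  · have h1 : HasFDerivAt (fun q : ι → R4 => q i - q j)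
        (ContinuousLinearMap.proj (R := ℝ) (φ := fun _ : ι => R4) i -
          ContinuousLinearMap.proj j) x :=
      (ContinuousLinearMap.proj (R := ℝ) (φ := fun _ : ι => R4) i -
          ContinuousLinearMap.proj j).hasFDerivAt
    have h2 := h1.norm_sq
    have h0 : ‖x i - x j‖ ^ 2 ≠ 0 := by
      have := norm_pos_iff.2 (sub_ne_zero.2 h); positivity
    have h3 := h2.sqrt h0
    have e : (fun q : ι → R4 => dist (q i) (q j)) = fun q => √(‖q i - q j‖ ^ 2) := by
      funext q; rw [Real.sqrt_sq (norm_nonneg _), dist_eq_norm]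
    rw [e]
    refine h3.congr_fderiv (ContinuousLinearMap.ext fun v => ?_)
    rw [distDeriv_apply, _root_.smul_apply, _root_.smul_apply,
      ContinuousLinearMap.comp_apply, Real.sqrt_sq (norm_nonneg _), dist_eq_norm, smul_eq_mul]
    simp only [innerSL_apply_apply, _root_.sub_apply, ContinuousLinearMap.proj_apply, nsmul_eq_mul]
    push_cast
    ring

end Dist

theorem AffineIndependent.linearIndependent_sub {x : Fin 4 → R4} (h : AffineIndependent ℝ x)
    (s : Equiv.Perm (Fin 4)) :
    LinearIndependent ℝ ![x (s 3) - x (s 2), x (s 0) - x (s 2), x (s 1) - x (s 2)] := by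
  have h1 := (affineIndependent_iff_linearIndependent_vsub ℝ x (s 2)).1 h
  have ne : ∀ i : Fin 4, i ≠ 2 → s i ≠ s 2 := fun i hi => fun h => hi (s.injective h)
  let g : Fin 3 → {i // i ≠ s 2} := ![⟨s 3, ne 3 (by decide)⟩, ⟨s 0, ne 0 (by decide)⟩,
    ⟨s 1, ne 1 (by decide)⟩]
  have hg : Function.Injective g := by
    have h30 : s 3 ≠ s 0 := fun h => absurd (s.injective h) (by decide)
    have h31 : s 3 ≠ s 1 := fun h => absurd (s.injective h) (by decide)
    have h01 : s 0 ≠ s 1 := fun h => absurd (s.injective h) (by decide)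
    intro i j hij
    fin_cases i <;> fin_cases j <;> simp [g, h30, h31, h01, h30.symm, h31.symm, h01.symm] at hij ⊢
  have h2 := h1.comp g hg
  have h3 : (fun i : {i // i ≠ s 2} => x i -ᵥ x (s 2)) ∘ g =
      ![x (s 3) - x (s 2), x (s 0) - x (s 2), x (s 1) - x (s 2)] := by
    funext i
    fin_cases i <;> rfl
  rwa [h3] at h2

theorem AffineIndependent.exists_adapted {x : Fin 4 → R4} (h : AffineIndependent ℝ x)
    (s : Equiv.Perm (Fin 4)) :
    ∃ F, Adapted F (x (s 0)) (x (s 1)) (x (s 2)) (x (s 3)) :=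
  _root_.exists_adapted (h.linearIndependent_sub s)

/-- In an adapted frame the radicands are squares of positive numbers, and the argument of the
arccosine is `q / √(q² + z²)` with `z > 0`, hence strictly between `-1` and `1`. -/
theorem differentiableAt_dihedral {x : Fin 4 → R4} (h : AffineIndependent ℝ x) :
    DifferentiableAt ℝ dihedral (distMat x) := by
  obtain ⟨F, hF⟩ := h.exists_adapted (Equiv.refl _)
  simp only [Equiv.refl_apply] at hF
  obtain ⟨a, y, hy, ha⟩ := hF.fst
  obtain ⟨p, q, z, hz, hb⟩ := hF.snd
  have hl := hF.dist_pos
  let G : (Fin 4 → Fin 4 → ℝ) → Fin 4 → Fin 4 → ℝ := fun L i j =>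
    (L i 2 ^ 2 + L j 2 ^ 2 - (if i = j then 0 else L i j ^ 2)) / 2
  have hG : Differentiable ℝ G := by
    refine differentiable_pi.2 fun i => differentiable_pi.2 fun j => ?_
    simp only [G]
    split_ifs <;> fun_prop
  have hGx : ∀ i j, G (distMat x) i j = inner ℝ (x i - x 2) (x j - x 2) := by
    intro i j
    simp only [G]
    rw [← dist_sq_polar]
    split_ifs with h
    · subst h; simp [distMat]
    · rfl
  have hcomp : dihedral = gramAngle ∘ G := by
    funext L; exact dihedral_eq_gramAngle L
  rw [hcomp]
  refine DifferentiableAt.comp _ ?_ hG.differentiableAt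
  set g := G (distMat x) with hg
  set l := dist (x 2) (x 3)
  have g00 : g 0 0 = a * a + y * y := by
    rw [hGx, inner_eq_coords hF.mem, ha]; simp [dotProduct, Fin.sum_univ_four]
  have g01 : g 0 1 = a * p + y * q := by
    rw [hGx, inner_eq_coords hF.mem, ha, hb]; simp [dotProduct, Fin.sum_univ_four]
  have g11 : g 1 1 = p * p + q * q + z * z := by
    rw [hGx, inner_eq_coords hF.mem, hb]; simp [dotProduct, Fin.sum_univ_four]
  have g03 : g 0 3 = a * l := by
    rw [hGx, inner_eq_coords hF.mem, ha, hF.edge]; simp [dotProduct, Fin.sum_univ_four, l]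
  have g13 : g 1 3 = p * l := by
    rw [hGx, inner_eq_coords hF.mem, hb, hF.edge]; simp [dotProduct, Fin.sum_univ_four, l]
  have g33 : g 3 3 = l * l := by
    rw [hGx, inner_eq_coords hF.mem, hF.edge]; simp [dotProduct, Fin.sum_univ_four, l]
  have e1 : g 0 0 * g 3 3 - g 0 3 ^ 2 = (l * y) ^ 2 := by rw [g00, g33, g03]; ring
  set r := √(q ^ 2 + z ^ 2) with hr
  have hrp : 0 < r := Real.sqrt_pos.2 (by positivity)
  have hr2 : r ^ 2 = q ^ 2 + z ^ 2 := Real.sq_sqrt (by positivity)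
  have e2 : g 1 1 * g 3 3 - g 1 3 ^ 2 = (l * r) ^ 2 := by
    rw [g11, g33, g13, mul_pow l r, hr2]; ring
  have e3 : g 0 1 * g 3 3 - g 0 3 * g 1 3 = l * y * (l * q) := by rw [g01, g33, g03, g13]; ring
  have n1 : g 0 0 * g 3 3 - g 0 3 ^ 2 ≠ 0 := by rw [e1]; positivity
  have n2 : g 1 1 * g 3 3 - g 1 3 ^ 2 ≠ 0 := by rw [e2]; positivity
  have hq : (q / r) ^ 2 < 1 := by
    rw [div_pow, div_lt_one (by positivity), hr2]; nlinarith
  have hval : (g 0 1 * g 3 3 - g 0 3 * g 1 3) /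
      (√(g 0 0 * g 3 3 - g 0 3 ^ 2) * √(g 1 1 * g 3 3 - g 1 3 ^ 2)) = q / r := by
    rw [e1, e2, e3, Real.sqrt_sq (by positivity), Real.sqrt_sq (by positivity)]
    field_simp
  have harc : DifferentiableAt ℝ Real.arccos ((g 0 1 * g 3 3 - g 0 3 * g 1 3) /
      (√(g 0 0 * g 3 3 - g 0 3 ^ 2) * √(g 1 1 * g 3 3 - g 1 3 ^ 2))) := by
    rw [hval]
    exact Real.differentiableAt_arccos.2 ⟨by nlinarith, by nlinarith⟩
  refine harc.comp (f := fun g : Fin 4 → Fin 4 → ℝ => (g 0 1 * g 3 3 - g 0 3 * g 1 3) /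
      (√(g 0 0 * g 3 3 - g 0 3 ^ 2) * √(g 1 1 * g 3 3 - g 1 3 ^ 2))) g ?_
  have d1 : DifferentiableAt ℝ (fun g : Fin 4 → Fin 4 → ℝ => g 0 0 * g 3 3 - g 0 3 ^ 2) g := by
    fun_prop
  have d2 : DifferentiableAt ℝ (fun g : Fin 4 → Fin 4 → ℝ => g 1 1 * g 3 3 - g 1 3 ^ 2) g := by
    fun_prop
  have d0 : DifferentiableAt ℝ
      (fun g : Fin 4 → Fin 4 → ℝ => g 0 1 * g 3 3 - g 0 3 * g 1 3) g := by
    fun_prop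
  have p1 : 0 < √(g 0 0 * g 3 3 - g 0 3 ^ 2) :=
    Real.sqrt_pos.2 (lt_of_le_of_ne (by rw [e1]; positivity) n1.symm)
  have p2 : 0 < √(g 1 1 * g 3 3 - g 1 3 ^ 2) :=
    Real.sqrt_pos.2 (lt_of_le_of_ne (by rw [e2]; positivity) n2.symm)
  simp only [div_eq_mul_inv]
  exact d0.fun_mul (((d1.sqrt n1).fun_mul (d2.sqrt n2)).fun_inv (mul_pos p1 p2).ne')

/-! ## Derivatives of the angles at faces -/

/-- The Gram matrix of the components orthogonal to the `k`-th vector. -/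
noncomputable def perpGram {ι : Type*} (k : ι) (g : ι → ι → ℝ) (i j : ι) : ℝ :=
  g i j - g k i * g k j * (g k k)⁻¹

theorem inner_perp_perp (u x y : R4) : inner ℝ (perp u x) (perp u y) =
    inner ℝ x y - inner ℝ u x * inner ℝ u y * (inner ℝ u u)⁻¹ := by
  rw [perp, perp]
  by_cases h0 : u = 0
  · simp [h0]
  have hu0 : inner ℝ u u ≠ 0 := inner_self_ne_zero.2 h0
  rw [inner_sub_left, inner_sub_right, inner_sub_right, inner_smul_left, inner_smul_right,
    inner_smul_left, inner_smul_right, real_inner_comm u x]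
  simp only [conj_trivial]
  field_simp
  ring

theorem differentiableAt_perpGram {ι : Type*} [Fintype ι] (k : ι) {g : ι → ι → ℝ} (h : g k k ≠ 0) :
    DifferentiableAt ℝ (perpGram k) g := by
  have d : ∀ a b, DifferentiableAt ℝ (fun g : ι → ι → ℝ => g a b) g := fun a b => by fun_prop
  refine differentiableAt_pi.2 fun i => differentiableAt_pi.2 fun j => ?_
  exact (d i j).sub (((d k i).mul (d k j)).mul ((d k k).inv h))

/-- The inner dihedral angle at the face `ABC` of a four-simplex with the Gram matrix `g` of the
vectors going from `A` to the other vertices. -/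
noncomputable def foldAngle (g : Fin 5 → Fin 5 → ℝ) : ℝ :=
  Real.arccos (perpGram 2 (perpGram 1 g) 3 4 *
    (√(perpGram 2 (perpGram 1 g) 3 3) * √(perpGram 2 (perpGram 1 g) 4 4))⁻¹)

theorem perpGram_inner {x : Fin 5 → R4} {g : Fin 5 → Fin 5 → ℝ}
    (hg : ∀ i j, g i j = inner ℝ (x i - x 0) (x j - x 0)) (i j : Fin 5) :
    perpGram 2 (perpGram 1 g) i j =
      inner ℝ (perp (perp (x 1 - x 0) (x 2 - x 0)) (perp (x 1 - x 0) (x i - x 0)))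
        (perp (perp (x 1 - x 0) (x 2 - x 0)) (perp (x 1 - x 0) (x j - x 0))) := by
  simp only [inner_perp_perp, perpGram, hg]

theorem innerAngle_eq_foldAngle {x : Fin 5 → R4} {g : Fin 5 → Fin 5 → ℝ}
    (hg : ∀ i j, g i j = inner ℝ (x i - x 0) (x j - x 0)) :
    innerAngle (x 0) (x 1) (x 2) (x 3) (x 4) = foldAngle g := by
  rw [innerAngle, InnerProductGeometry.angle, foldAngle, perpGram_inner hg, perpGram_inner hg,
    perpGram_inner hg, div_eq_mul_inv, real_inner_self_eq_norm_sq, real_inner_self_eq_norm_sq,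
    Real.sqrt_sq (norm_nonneg _), Real.sqrt_sq (norm_nonneg _)]

theorem linearIndependent_det {u v w z : R4} (h : LinearIndependent ℝ ![u, v, w, z]) :
    (Matrix.of ![⇑u, ⇑v, ⇑w, ⇑z]).det ≠ 0 := by
  have h1 := h.map' (EuclideanSpace.equiv (Fin 4) ℝ).toLinearEquiv.toLinearMap (LinearEquiv.ker _)
  have h2 : LinearIndependent ℝ (Matrix.of ![⇑u, ⇑v, ⇑w, ⇑z]).row := by
    have e : (⇑(EuclideanSpace.equiv (Fin 4) ℝ).toLinearEquiv.toLinearMap ∘ ![u, v, w, z]) =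
        (Matrix.of ![⇑u, ⇑v, ⇑w, ⇑z]).row := by
      funext i
      fin_cases i <;> rfl
    exact e ▸ h1
  have h3 := Matrix.linearIndependent_rows_iff_isUnit.1 h2
  exact ((Matrix.isUnit_iff_isUnit_det _).1 h3).ne_zero

theorem AffineIndependent.linearIndependent_sub_zero {x : Fin 5 → R4} (h : AffineIndependent ℝ x) :
    LinearIndependent ℝ ![x 1 - x 0, x 2 - x 0, x 3 - x 0, x 4 - x 0] := by
  have h1 := (affineIndependent_iff_linearIndependent_vsub ℝ x 0).1 h
  have h2 := h1.comp (fun i : Fin 4 => (⟨i.succ, Fin.succ_ne_zero i⟩ : {i : Fin 5 // i ≠ 0}))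
    fun i j hij => Fin.succ_injective _ (Subtype.ext_iff.1 hij)
  have h3 : (fun i : {i : Fin 5 // i ≠ 0} => x i -ᵥ x 0) ∘
      (fun i : Fin 4 => (⟨i.succ, Fin.succ_ne_zero i⟩ : {i : Fin 5 // i ≠ 0})) =
      ![x 1 - x 0, x 2 - x 0, x 3 - x 0, x 4 - x 0] := by
    funext i
    fin_cases i <;> rfl
  rwa [h3] at h2

theorem vol4_ne_zero {x : Fin 5 → R4} (h : AffineIndependent ℝ x) :
    vol4 (x 0) (x 1) (x 2) (x 3) (x 4) ≠ 0 :=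
  mul_ne_zero (by norm_num) (linearIndependent_det h.linearIndependent_sub_zero)

/-- The differentials of distances, combined with the given coefficients. -/
noncomputable def distComb {ι : Type*} [Fintype ι] (x : ι → R4) (c : ι → ι → ℝ) :
    (ι → R4) →L[ℝ] ℝ :=
  ∑ i, ∑ j, c i j • distDeriv x i j

theorem distComb_apply {ι : Type*} [Fintype ι] (x : ι → R4) (c : ι → ι → ℝ) (v : ι → R4) :
    distComb x c v = ∑ i, ∑ j, c i j * distDeriv x i j v := by
  simp [distComb]

theorem hasFDerivAt_distMat_comp {ι : Type*} [Fintype ι] [DecidableEq ι] {x : ι → R4} (hx : Function.Injective x)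
    {Φ : (ι → ι → ℝ) → ℝ} (hΦ : DifferentiableAt ℝ Φ (distMat x)) :
    HasFDerivAt (fun q : ι → R4 => Φ (distMat q))
      (distComb x fun i j => fderiv ℝ Φ (distMat x) (Pi.single i (Pi.single j 1))) x := by
  have h1 : HasFDerivAt (fun q : ι → R4 => distMat q)
      (ContinuousLinearMap.pi fun i => ContinuousLinearMap.pi fun j => distDeriv x i j) x :=
    hasFDerivAt_pi.2 fun i => hasFDerivAt_pi.2 fun j => hasFDerivAt_dist <| by
      by_cases h : i = j
      · exact Or.inl h
      · exact Or.inr (hx.ne h)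
  refine (hΦ.hasFDerivAt.comp x h1).congr_fderiv (ContinuousLinearMap.ext fun v => ?_)
  rw [ContinuousLinearMap.comp_apply, distComb_apply]
  have h2 : (ContinuousLinearMap.pi fun i => ContinuousLinearMap.pi fun j => distDeriv x i j) v =
      ∑ i, ∑ j, distDeriv x i j v • Pi.single (M := fun _ : ι => ι → ℝ) i (Pi.single (M := fun _ : ι => ℝ) j (1 : ℝ)) := by
    ext a b
    simp [Finset.sum_apply, Pi.single_apply, apply_ite, ite_apply]
  rw [h2, map_sum]
  refine Finset.sum_congr rfl fun i _ => ?_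
  rw [map_sum]
  refine Finset.sum_congr rfl fun j _ => ?_
  rw [map_smul, smul_eq_mul, mul_comm]

/-- Away from degenerate positions `theta` is, up to a locally constant sign, a smooth function of
the Gram matrix and so of the distances. A differential which is a combination of differentials of
distances vanishes on infinitesimal motions and refers to the 4-simplex only. -/
theorem exists_hasFDerivAt_theta {x : Fin 5 → R4} (h : AffineIndependent ℝ x) :
    ∃ c, HasFDerivAt (fun q : Fin 5 → R4 => theta (q 0) (q 1) (q 2) (q 3) (q 4))
      (distComb x c) x := by
  have li := h.linearIndependent_sub_zero
  have hv := vol4_ne_zero h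
  let G : (Fin 5 → Fin 5 → ℝ) → Fin 5 → Fin 5 → ℝ := fun L i j =>
    (L i 0 ^ 2 + L j 0 ^ 2 - L i j ^ 2) / 2
  have hG : Differentiable ℝ G := by
    refine differentiable_pi.2 fun i => differentiable_pi.2 fun j => ?_
    simp only [G]
    fun_prop
  have hGq : ∀ q : Fin 5 → R4, ∀ i j, G (distMat q) i j = inner ℝ (q i - q 0) (q j - q 0) :=
    fun q i j => dist_sq_polar _ _ _
  obtain ⟨F, hF, ⟨X, hX, h1⟩, ⟨p₂, Y, hY, h2⟩, ⟨p₃, q₃, Z, hZ, h3⟩⟩ := exists_triangular_frame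
    (u := x 1 - x 0) (v := x 2 - x 0) (w := x 3 - x 0) (by
      have := li.comp ![0, 1, 2] (by decide)
      convert this using 1
      funext i; fin_cases i <;> rfl)
  have hP : PlaneFrame F (x 0) (x 1) (x 2) :=
    ⟨hF, X, 0, p₂, Y, by nlinarith [mul_pos hX hY], h1, h2⟩
  obtain ⟨z', hz'⟩ : ∃ z', coordsIn F (x 4 - x 0) 2 = z' := ⟨_, rfl⟩
  obtain ⟨w', hw'⟩ : ∃ w', coordsIn F (x 4 - x 0) 3 = w' := ⟨_, rfl⟩
  -- The five points do not lie in a hyperplane, which keeps the arccosine away from its singular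
  -- values.
  have hw0 : w' ≠ 0 := by
    intro h0
    apply hv
    rw [vol4, det_coords hF, det_fin_four, h1, h2, h3]
    simp [hw', h0]
  set g := G (distMat x) with hg
  have k33 : perpGram 2 (perpGram 1 g) 3 3 = Z ^ 2 := by
    rw [perpGram_inner (hGq x), inner_eq_coords hF, hP.coords_perp, h3]
    simp [dotProduct, Fin.sum_univ_four, sq]
  have k34 : perpGram 2 (perpGram 1 g) 3 4 = Z * z' := by
    rw [perpGram_inner (hGq x), inner_eq_coords hF, hP.coords_perp, hP.coords_perp, h3, hz']
    simp [dotProduct, Fin.sum_univ_four]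
  have k44 : perpGram 2 (perpGram 1 g) 4 4 = z' ^ 2 + w' ^ 2 := by
    rw [perpGram_inner (hGq x), inner_eq_coords hF, hP.coords_perp, hz', hw']
    simp [dotProduct, Fin.sum_univ_four, sq]
  have g11 : g 1 1 = X ^ 2 := by
    rw [hg, hGq, inner_eq_coords hF, h1]; simp [dotProduct, Fin.sum_univ_four, sq]
  have g12 : g 1 2 = X * p₂ := by
    rw [hg, hGq, inner_eq_coords hF, h1, h2]; simp [dotProduct, Fin.sum_univ_four]
  have g22 : g 2 2 = p₂ ^ 2 + Y ^ 2 := by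
    rw [hg, hGq, inner_eq_coords hF, h2]; simp [dotProduct, Fin.sum_univ_four, sq]
  have k22 : perpGram 1 g 2 2 = Y ^ 2 := by
    rw [perpGram, g11, g12, g22]; field_simp; ring
  have hgd : DifferentiableAt ℝ (fun g : Fin 5 → Fin 5 → ℝ => perpGram 2 (perpGram 1 g)) g :=
    DifferentiableAt.comp (g := perpGram 2) g
      (differentiableAt_perpGram 2 (by rw [k22]; positivity))
      (differentiableAt_perpGram 1 (by rw [g11]; positivity))
  have d : ∀ i j, DifferentiableAt ℝ
      (fun g : Fin 5 → Fin 5 → ℝ => perpGram 2 (perpGram 1 g) i j) g := fun i j =>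
    differentiableAt_pi.1 (differentiableAt_pi.1 hgd i) j
  set r := √(z' ^ 2 + w' ^ 2) with hr
  have hrp : 0 < r := Real.sqrt_pos.2 (by positivity)
  have hr2 : r ^ 2 = z' ^ 2 + w' ^ 2 := Real.sq_sqrt (by positivity)
  have hq : (z' / r) ^ 2 < 1 := by
    rw [div_pow, div_lt_one (by positivity), hr2]
    have : 0 < w' ^ 2 := by positivity
    linarith
  have hval : perpGram 2 (perpGram 1 g) 3 4 *
    (√(perpGram 2 (perpGram 1 g) 3 3) * √(perpGram 2 (perpGram 1 g) 4 4))⁻¹ = z' / r := by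
    rw [k33, k34, k44, Real.sqrt_sq hZ.le, ← hr]
    field_simp
  have harc : DifferentiableAt ℝ Real.arccos (perpGram 2 (perpGram 1 g) 3 4 *
      (√(perpGram 2 (perpGram 1 g) 3 3) * √(perpGram 2 (perpGram 1 g) 4 4))⁻¹) := by
    rw [hval]
    exact Real.differentiableAt_arccos.2 ⟨by nlinarith, by nlinarith⟩
  have hfold : DifferentiableAt ℝ foldAngle g := by
    refine harc.comp (f := fun g => perpGram 2 (perpGram 1 g) 3 4 *
      (√(perpGram 2 (perpGram 1 g) 3 3) * √(perpGram 2 (perpGram 1 g) 4 4))⁻¹) g ?_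
    refine (d 3 4).mul ((((d 3 3).sqrt ?_).mul ((d 4 4).sqrt ?_)).inv ?_)
    · rw [k33]; positivity
    · rw [k44]; positivity
    · show √(perpGram 2 (perpGram 1 g) 3 3) * √(perpGram 2 (perpGram 1 g) 4 4) ≠ 0
      rw [k33, k44, Real.sqrt_sq hZ.le, ← hr]; positivity
  have hinj : Function.Injective x := h.injective
  set ε : ℝ := if vol4 (x 0) (x 1) (x 2) (x 3) (x 4) < 0 then -1 else 1 with hε
  have hΦ : DifferentiableAt ℝ (fun L => ε * (Real.pi - foldAngle (G L))) (distMat x) :=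
    ((DifferentiableAt.comp (g := foldAngle) (distMat x) hfold hG.differentiableAt).const_sub
      Real.pi).const_mul ε
  refine ⟨_, (hasFDerivAt_distMat_comp hinj hΦ).congr_of_eventuallyEq ?_⟩
  have hcont : Continuous fun q : Fin 5 → R4 => vol4 (q 0) (q 1) (q 2) (q 3) (q 4) := by
    unfold vol4
    refine continuous_const.mul (Continuous.matrix_det ?_)
    refine continuous_matrix fun i j => ?_
    fin_cases i <;> simp <;> fun_prop
  -- A nonzero volume does not change sign under small displacements.
  have hsign : ∀ᶠ q in nhds x, (if vol4 (q 0) (q 1) (q 2) (q 3) (q 4) < 0 then (-1 : ℝ) else 1) = ε := by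
    rcases lt_or_gt_of_ne hv with hlt | hgt
    · filter_upwards [hcont.continuousAt.eventually_lt_const hlt] with q hq
      rw [hε, if_pos hq, if_pos hlt]
    · filter_upwards [hcont.continuousAt.eventually_const_lt hgt] with q hq
      rw [hε, if_neg hq.not_gt, if_neg hgt.not_gt]
  filter_upwards [hsign] with q hq
  show theta _ _ _ _ _ = _
  rw [theta, hq, innerAngle_eq_foldAngle (hGq q)]

/-! ## Additivity of the angles at a face -/

/-- The quantity is the squared distance from the fourth point to the plane. It is the same in every
frame and is positive in a triangular one. -/
theorem PlaneFrame.coords_ne {F : Matrix (Fin 4) (Fin 4) ℝ} {a b c d : R4}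
    (h : PlaneFrame F a b c) (hl : LinearIndependent ℝ ![b - a, c - a, d - a]) :
    coordsIn F (d - a) 2 ^ 2 + coordsIn F (d - a) 3 ^ 2 ≠ 0 := by
  obtain ⟨F', hF', ⟨X, hX, h1⟩, ⟨p₂, Y, hY, h2⟩, ⟨p₃, q₃, Z, hZ, h3⟩⟩ :=
    exists_triangular_frame hl
  have h' : PlaneFrame F' a b c := ⟨hF', X, 0, p₂, Y, by nlinarith [mul_pos hX hY], h1, h2⟩
  have e1 := inner_eq_coords h.mem (perp (perp (b - a) (c - a)) (perp (b - a) (d - a)))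
    (perp (perp (b - a) (c - a)) (perp (b - a) (d - a)))
  have e2 := inner_eq_coords h'.mem (perp (perp (b - a) (c - a)) (perp (b - a) (d - a)))
    (perp (perp (b - a) (c - a)) (perp (b - a) (d - a)))
  rw [h.coords_perp] at e1
  rw [h'.coords_perp, h3, e1] at e2
  simp [dotProduct, Fin.sum_univ_four] at e2
  rw [sq, sq, e2]
  positivity

/-- With `ζ = z + iw` the exponential of `i · planeAngle` is `-ζ ζ̄' / |ζ ζ'|`. The product of two
such factors is minus the third, so the two sides differ by an odd multiple of `π`. -/
theorem planeAngle_add {z w z' w' z'' w'' : ℝ} (h : z ^ 2 + w ^ 2 ≠ 0) (h' : z' ^ 2 + w' ^ 2 ≠ 0)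
    (h'' : z'' ^ 2 + w'' ^ 2 ≠ 0) :
    Real.cos (planeAngle z w z' w' + planeAngle z' w' z'' w'' - planeAngle z w z'' w'') = -1 ∧
    Real.sin (planeAngle z w z' w' + planeAngle z' w' z'' w'' - planeAngle z w z'' w'') = 0 := by
  obtain ⟨c1, s1⟩ := planeAngle_cos_sin h h'
  obtain ⟨c2, s2⟩ := planeAngle_cos_sin h' h''
  obtain ⟨c3, s3⟩ := planeAngle_cos_sin h h''
  have p : 0 < √(z ^ 2 + w ^ 2) := Real.sqrt_pos.2 (lt_of_le_of_ne (by positivity) h.symm)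
  have p' : 0 < √(z' ^ 2 + w' ^ 2) := Real.sqrt_pos.2 (lt_of_le_of_ne (by positivity) h'.symm)
  have p'' : 0 < √(z'' ^ 2 + w'' ^ 2) := Real.sqrt_pos.2 (lt_of_le_of_ne (by positivity) h''.symm)
  have q : √(z ^ 2 + w ^ 2) ^ 2 = z ^ 2 + w ^ 2 := Real.sq_sqrt (by positivity)
  have q' : √(z' ^ 2 + w' ^ 2) ^ 2 = z' ^ 2 + w' ^ 2 := Real.sq_sqrt (by positivity)
  have q'' : √(z'' ^ 2 + w'' ^ 2) ^ 2 = z'' ^ 2 + w'' ^ 2 := Real.sq_sqrt (by positivity)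
  generalize planeAngle z w z' w' = t1 at *
  generalize planeAngle z' w' z'' w'' = t2 at *
  generalize planeAngle z w z'' w'' = t3 at *
  generalize √(z ^ 2 + w ^ 2) = r at *
  generalize √(z' ^ 2 + w' ^ 2) = r' at *
  generalize √(z'' ^ 2 + w'' ^ 2) = r'' at *
  have e1 : Real.cos (t1 + t2) * (r' ^ 2 * (r * r'')) = (z' ^ 2 + w' ^ 2) * (z * z'' + w * w'') := by
    rw [Real.cos_add]
    linear_combination (Real.cos t2 * (r' * r'')) * c1 - (z * z' + w * w') * c2 -
      (Real.sin t2 * (r' * r'')) * s1 - (z * w' - w * z') * s2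
  have e2 : Real.sin (t1 + t2) * (r' ^ 2 * (r * r'')) = -(z' ^ 2 + w' ^ 2) * (z * w'' - w * z'') := by
    rw [Real.sin_add]
    linear_combination (Real.cos t2 * (r' * r'')) * s1 + (z * w' - w * z') * c2 +
      (Real.sin t2 * (r' * r'')) * c1 - (z * z' + w * w') * s2
  have n' : r' ^ 2 ≠ 0 := by positivity
  have n : r * r'' ≠ 0 := by positivity
  have f1 : Real.cos (t1 + t2) = -Real.cos t3 := by
    apply mul_right_cancel₀ n
    apply mul_right_cancel₀ n'
    linear_combination e1 + r' ^ 2 * c3 - (z * z'' + w * w'') * q'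
  have f2 : Real.sin (t1 + t2) = -Real.sin t3 := by
    apply mul_right_cancel₀ n
    apply mul_right_cancel₀ n'
    linear_combination e2 + r' ^ 2 * s3 + (z * w'' - w * z'') * q'
  rw [Real.cos_sub, Real.sin_sub, f1, f2]
  have := Real.sin_sq_add_cos_sq t3
  constructor
  · linarith
  · ring

theorem theta_add {a b c d e f : R4} (hd : LinearIndependent ℝ ![b - a, c - a, d - a])
    (he : LinearIndependent ℝ ![b - a, c - a, e - a])
    (hf : LinearIndependent ℝ ![b - a, c - a, f - a]) :
    Real.cos (theta a b c d e + theta a b c e f - theta a b c d f) = -1 ∧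
    Real.sin (theta a b c d e + theta a b c e f - theta a b c d f) = 0 := by
  obtain ⟨F, hF, ⟨X, hX, h1⟩, ⟨p₂, Y, hY, h2⟩, -⟩ := exists_triangular_frame hd
  have h : PlaneFrame F a b c := ⟨hF, X, 0, p₂, Y, by nlinarith [mul_pos hX hY], h1, h2⟩
  rw [h.theta_eq, h.theta_eq, h.theta_eq]
  exact planeAngle_add (h.coords_ne hd) (h.coords_ne he) (h.coords_ne hf)

theorem theta_self {a b c d : R4} (hd : LinearIndependent ℝ ![b - a, c - a, d - a]) :
    theta a b c d d = Real.pi := by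
  obtain ⟨F, hF, ⟨X, hX, h1⟩, ⟨p₂, Y, hY, h2⟩, -⟩ := exists_triangular_frame hd
  have h : PlaneFrame F a b c := ⟨hF, X, 0, p₂, Y, by nlinarith [mul_pos hX hY], h1, h2⟩
  rw [h.theta_eq]
  exact planeAngle_self (h.coords_ne hd)

section Eventually

variable {ι : Type*} [Fintype ι] {x : ι → R4} {a b c d e f : ι}

theorem eventually_linearIndependent (h : LinearIndependent ℝ ![x b - x a, x c - x a, x d - x a]) :
    ∀ᶠ q : ι → R4 in nhds x, LinearIndependent ℝ ![q b - q a, q c - q a, q d - q a] := by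
  have hc : Continuous fun q : ι → R4 => ![q b - q a, q c - q a, q d - q a] := by
    refine continuous_pi fun i => ?_
    fin_cases i <;> simp <;> fun_prop
  exact hc.continuousAt.eventually (isOpen_setOfPred_linearIndependent.mem_nhds h)

theorem hasFDerivAt_theta_self (hd : LinearIndependent ℝ ![x b - x a, x c - x a, x d - x a]) :
    HasFDerivAt (fun q : ι → R4 => theta (q a) (q b) (q c) (q d) (q d)) (0 : (ι → R4) →L[ℝ] ℝ) x := by
  refine (hasFDerivAt_const Real.pi x).congr_of_eventuallyEq ?_
  filter_upwards [eventually_linearIndependent hd] with q hq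
  exact theta_self hq

/-- The combination `ϑ₁ + ϑ₂ - ϑ₃` may be any odd multiple of `π`, so its sine, which vanishes
identically nearby, is differentiated; the cosine is `-1`, and no branch has to be chosen. -/
theorem hasFDerivAt_theta_add {D₁ D₂ D₃ : (ι → R4) →L[ℝ] ℝ}
    (hd : LinearIndependent ℝ ![x b - x a, x c - x a, x d - x a])
    (he : LinearIndependent ℝ ![x b - x a, x c - x a, x e - x a])
    (hf : LinearIndependent ℝ ![x b - x a, x c - x a, x f - x a])
    (h₁ : HasFDerivAt (fun q : ι → R4 => theta (q a) (q b) (q c) (q d) (q e)) D₁ x)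
    (h₂ : HasFDerivAt (fun q : ι → R4 => theta (q a) (q b) (q c) (q e) (q f)) D₂ x)
    (h₃ : HasFDerivAt (fun q : ι → R4 => theta (q a) (q b) (q c) (q d) (q f)) D₃ x) :
    D₁ + D₂ = D₃ := by
  have h := (((h₁.fun_add h₂).fun_sub h₃).sin).unique
    ((hasFDerivAt_const (0 : ℝ) x).congr_of_eventuallyEq (by
      filter_upwards [eventually_linearIndependent hd, eventually_linearIndependent he,
        eventually_linearIndependent hf] with q h1 h2 h3
      exact (theta_add h1 h2 h3).2))
  rw [(theta_add hd he hf).1] at h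
  refine sub_eq_zero.1 (ContinuousLinearMap.ext fun v => ?_)
  have := congrArg (fun D => D v) h
  simp at this ⊢
  linarith

end Eventually

/-! ## The differential of the developing map around an edge -/

section Development

variable {Y : Type*} [NormedAddCommGroup Y] [NormedSpace ℝ Y] {y₀ : Y}

/-- The matrix-valued function `M` has the differential `M'`, entry by entry. -/
def HasMatrixDeriv (M M' : Y → Matrix (Fin 4) (Fin 4) ℝ) (y₀ : Y) : Prop :=
  ∀ i j, ∃ D : Y →L[ℝ] ℝ, (∀ v, D v = M' v i j) ∧ HasFDerivAt (fun y => M y i j) D y₀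

namespace HasMatrixDeriv

variable {M M' N N' : Y → Matrix (Fin 4) (Fin 4) ℝ}

theorem congr_deriv {M'' : Y → Matrix (Fin 4) (Fin 4) ℝ} (h : HasMatrixDeriv M M' y₀) (e : ∀ v, M' v = M'' v) :
    HasMatrixDeriv M M'' y₀ := fun i j => by
  obtain ⟨D, h1, h2⟩ := h i j
  exact ⟨D, fun v => by rw [h1, e], h2⟩

theorem const (A : Matrix (Fin 4) (Fin 4) ℝ) (y₀ : Y) :
    HasMatrixDeriv (fun _ => A) (fun _ => 0) y₀ := fun _ _ =>
  ⟨0, fun _ => rfl, hasFDerivAt_const _ _⟩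

theorem mul (h : HasMatrixDeriv M M' y₀) (h' : HasMatrixDeriv N N' y₀) :
    HasMatrixDeriv (fun y => M y * N y) (fun v => M' v * N y₀ + M y₀ * N' v) y₀ := by
  intro i j
  choose D hD hM using h
  choose D' hD' hN using h'
  refine ⟨∑ k, (M y₀ i k • D' k j + N y₀ k j • D i k), fun v => ?_, ?_⟩
  · simp only [sum_apply, add_apply, smul_apply, smul_eq_mul, hD, hD', Matrix.add_apply,
      Matrix.mul_apply, ← Finset.sum_add_distrib]
    exact Finset.sum_congr rfl fun k _ => by ring
  · have : (fun y => (M y * N y) i j) = fun y => ∑ k, M y i k * N y k j := rfl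
    rw [this]
    exact HasFDerivAt.fun_sum fun k _ => (hM i k).fun_mul (hN k j)

/-- Every entry of the rotation has the form `α + β cos t + γ sin t`. The minus sign comes from
`skew i j` having `+1` where the rotation has `-sin t`. -/
theorem rot {i j : Fin 4} (h : i = 1 ∧ j = 2 ∨ i = 2 ∧ j = 3) {φ : Y → ℝ} {φ' : Y →L[ℝ] ℝ}
    (hφ : HasFDerivAt φ φ' y₀) : HasMatrixDeriv (fun y => rot i j (φ y))
      (fun v => φ' v • -(rot i j (φ y₀) * skew i j)) y₀ := by
  have key : ∀ a b, ∃ α β γ : ℝ, (∀ t, _root_.rot i j t a b = α + β * Real.cos t + γ * Real.sin t) ∧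
      ∀ t, (_root_.rot i j t * skew i j) a b = β * Real.sin t - γ * Real.cos t := by
    intro a b
    rcases h with ⟨rfl, rfl⟩ | ⟨rfl, rfl⟩ <;> fin_cases a <;> fin_cases b <;>
      simp [_root_.rot, skew, Matrix.single, Matrix.mul_apply, Fin.sum_univ_four]
    all_goals first
      | (refine ⟨1, 0, 0, ?_, ?_⟩ <;> simp; done)
      | (refine ⟨0, 0, 0, ?_, ?_⟩ <;> simp; done)
      | (refine ⟨0, 1, 0, ?_, ?_⟩ <;> simp; done)
      | (refine ⟨0, 0, 1, ?_, ?_⟩ <;> simp; done)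
      | (refine ⟨0, 0, -1, ?_, ?_⟩ <;> simp)
  intro a b
  obtain ⟨α, β, γ, h1, h2⟩ := key a b
  refine ⟨β • (-Real.sin (φ y₀) • φ') + γ • (Real.cos (φ y₀) • φ'), fun v => ?_, ?_⟩
  · simp only [add_apply, smul_apply, smul_eq_mul, Matrix.smul_apply, Matrix.neg_apply, h2]
    ring
  · simp only [h1]
    exact ((hφ.cos.const_mul β).const_add α).fun_add (hφ.sin.const_mul γ)

end HasMatrixDeriv

theorem skew_mul_rot (t : ℝ) : skew 1 2 * rot 1 2 t = rot 1 2 t * skew 1 2 := by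
  ext a b
  fin_cases a <;> fin_cases b <;>
    simp [rot, skew, Matrix.single, Matrix.mul_apply, Fin.sum_univ_four]

/-- The product telescopes into the factors `F k * M k y * (F (k + 1))ᵀ`, each of which is the unit
matrix at `y₀`. Hence the differentials of the factors simply add. -/
theorem hasMatrixDeriv_conj_prod {n : ℕ} {M M' B : Fin n → Y → Matrix (Fin 4) (Fin 4) ℝ}
    {F : Fin (n + 1) → Matrix (Fin 4) (Fin 4) ℝ}
    (hF : ∀ k, F k * (F k)ᵀ = 1) (hs : ∀ k : Fin n, F k.succ = F k.castSucc * M k y₀)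
    (hM : ∀ k, HasMatrixDeriv (M k) (M' k) y₀)
    (hB : ∀ k v, F k.castSucc * M' k v * (F k.succ)ᵀ = B k v) :
    F 0 * (List.ofFn fun k => M k y₀).prod * (F (Fin.last n))ᵀ = 1 ∧
    HasMatrixDeriv (fun y => F 0 * (List.ofFn fun k => M k y).prod * (F (Fin.last n))ᵀ)
      (fun v => ∑ k, B k v) y₀ := by
  induction n with
  | zero =>
    have h0 : F (Fin.last 0) = F 0 := rfl
    simp only [List.ofFn_zero, List.prod_nil, mul_one, h0, hF, true_and]
    exact HasMatrixDeriv.const _ _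
  | succ n ih =>
    obtain ⟨i1, i2⟩ := ih (M := fun k => M k.succ) (M' := fun k => M' k.succ)
      (F := fun k => F k.succ) (B := fun k => B k.succ) (fun k => hF _) (fun k => hs k.succ)
      (fun k => hM k.succ) (fun k v => hB k.succ v)
    have e : ∀ y, F 0 * (List.ofFn fun k => M k y).prod * (F (Fin.last (n + 1)))ᵀ =
        (F 0 * M 0 y * (F 1)ᵀ) * (F (Fin.succ 0) * (List.ofFn fun k : Fin n => M k.succ y).prod *
          (F (Fin.last n).succ)ᵀ) := by
      intro y
      have h1 : (F 1)ᵀ * F 1 = 1 := mul_eq_one_comm.1 (hF 1)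
      have h2 : F (Fin.succ (0 : Fin (n + 1))) = F 1 := rfl
      have h3 : F (Fin.last n).succ = F (Fin.last (n + 1)) := rfl
      rw [List.ofFn_succ, List.prod_cons, h2, h3]
      simp only [mul_assoc]
      rw [← mul_assoc (F 1)ᵀ (F 1), h1, one_mul]
    have e0 : F 0 * M 0 y₀ * (F 1)ᵀ = 1 := by
      have := hs 0
      rw [Fin.castSucc_zero] at this
      rw [← this]
      exact hF 1
    refine ⟨by rw [e, e0, i1, one_mul], ?_⟩
    simp only [e]
    refine ((((HasMatrixDeriv.const (F 0) y₀).mul (hM 0)).mul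
      (HasMatrixDeriv.const (F 1)ᵀ y₀)).mul i2).congr_deriv fun v => ?_
    have h2 := hB 0 v
    rw [Fin.castSucc_zero, Fin.succ_zero_eq_one] at h2
    rw [e0, i1, Fin.sum_univ_succ, zero_mul, zero_add, mul_zero, add_zero, mul_one, one_mul, h2]

/-- The differential of the product of the successive rotations around an edge. -/
theorem hasMatrixDeriv_development {F₀ : Matrix (Fin 4) (Fin 4) ℝ} {a : ℕ → R4} {b c : R4} {n : ℕ}
    (hF : Adapted F₀ (a 0) (a 1) b c)
    (hl : ∀ k, LinearIndependent ℝ ![c - b, a (k + 1) - b, a (k + 2) - b])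
    (h₀ : a n = a 0) (h₁ : a (n + 1) = a 1) {φ θ : Fin n → Y → ℝ} {φ' θ' : Fin n → Y →L[ℝ] ℝ}
    (hφ : ∀ k, HasFDerivAt (φ k) (φ' k) y₀) (hθ : ∀ k, HasFDerivAt (θ k) (θ' k) y₀)
    (hφ₀ : ∀ k : Fin n, φ k y₀ = dihedral (distMat ![a k, a (k + 1), b, c]))
    (hθ₀ : ∀ k : Fin n, θ k y₀ = theta (a (k + 1)) b c (a (k + 2)) (a k)) :
    HasMatrixDeriv (fun y => F₀ *
        (List.ofFn fun k => rot 1 2 (φ k y) * rot 2 3 (θ k y)).prod * F₀ᵀ)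
      (fun v => -∑ k : Fin n, (φ' k v • dihedralBivector (a k) (a (k + 1)) b c +
        θ' k v • faceBivector (a (k + 1)) b c)) y₀ := by
  -- The frames of the successive tetrahedra at the actual lengths and angles.
  let F : ℕ → Matrix (Fin 4) (Fin 4) ℝ := fun m => Nat.rec F₀ (fun k G =>
    G * (rot 1 2 (dihedral (distMat ![a k, a (k + 1), b, c])) *
      rot 2 3 (theta (a (k + 1)) b c (a (k + 2)) (a k)))) m
  have hFs : ∀ k, F (k + 1) = F k * (rot 1 2 (dihedral (distMat ![a k, a (k + 1), b, c])) *
      rot 2 3 (theta (a (k + 1)) b c (a (k + 2)) (a k))) := fun k => rfl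
  have hA : ∀ k, Adapted (F k) (a k) (a (k + 1)) b c := by
    intro k
    induction k with
    | zero => exact hF
    | succ k ih =>
      rw [hFs]
      exact ih.step (hl k)
  -- The frame obtained after a full turn is adapted to the initial tetrahedron again, and such a
  -- frame is unique.
  have hn : F n = F₀ := by
    have := hA n
    rw [h₀, h₁] at this
    exact this.unique hF
  have h12 : (1 : Fin 4) = 1 ∧ (2 : Fin 4) = 2 ∨ (1 : Fin 4) = 2 ∧ (2 : Fin 4) = 3 := by decide
  have h23 : (2 : Fin 4) = 1 ∧ (3 : Fin 4) = 2 ∨ (2 : Fin 4) = 2 ∧ (3 : Fin 4) = 3 := by decide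
  obtain ⟨-, h⟩ := hasMatrixDeriv_conj_prod (F := fun k : Fin (n + 1) => F k)
    (B := fun k v => -(φ' k v • dihedralBivector (a k) (a (k + 1)) b c +
      θ' k v • faceBivector (a (k + 1)) b c))
    (M := fun k y => rot 1 2 (φ k y) * rot 2 3 (θ k y))
    (fun k => mul_transpose_of_mem (hA k).mem) (fun k => by
      simp only [Fin.val_succ, Fin.val_castSucc, hφ₀, hθ₀, hFs])
    (fun k => (HasMatrixDeriv.rot h12 (hφ k)).mul (HasMatrixDeriv.rot h23 (hθ k))) (by
    intro k v
    have e3 := hFs k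
    rw [← hφ₀, ← hθ₀] at e3
    have r1 := mul_transpose_of_mem (Adapted.rot_mem₁₂ (φ k y₀))
    have r2 := mul_transpose_of_mem (Adapted.rot_mem₂₃ (θ k y₀))
    have s1 := skew_mul_rot (φ k y₀)
    simp only [Fin.val_succ, Fin.val_castSucc]
    rw [(hA k).dihedralBivector_eq, (hA (k + 1)).faceBivector_eq, e3]
    simp only [Matrix.transpose_mul, mul_add, add_mul, mul_neg, neg_mul, smul_neg,
      Matrix.mul_smul, Matrix.smul_mul, neg_add]
    -- A rotation commutes with its generator, so the dihedral term can be written in the frame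
    -- before the rotation. The face term is written in the frame after both rotations.
    have t1 : F k * (rot 1 2 (φ k y₀) * skew 1 2 * rot 2 3 (θ k y₀)) *
        ((rot 2 3 (θ k y₀))ᵀ * (rot 1 2 (φ k y₀))ᵀ * (F k)ᵀ) = F k * skew 1 2 * (F k)ᵀ := by
      rw [← s1]
      calc _ = F k * skew 1 2 * (rot 1 2 (φ k y₀) * (rot 2 3 (θ k y₀) * (rot 2 3 (θ k y₀))ᵀ) *
            (rot 1 2 (φ k y₀))ᵀ) * (F k)ᵀ := by simp only [mul_assoc]
        _ = _ := by rw [r2, mul_one, r1, mul_one]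
    simp only [mul_assoc] at t1 ⊢
    rw [t1])
  simp only [Fin.val_last, hn, Finset.sum_neg_distrib] at h
  exact h

end Development

/-! ## Identities for five points in general position -/

theorem exists_inner_eq {κ : Type*} {w : κ → R4} (hw : LinearIndependent ℝ w)
    (g : κ → ℝ) : ∃ u : R4, ∀ k, inner ℝ (w k) u = g k := by
  obtain ⟨φ, hφ⟩ := ((Module.Basis.span hw).constr ℝ g).exists_extend
  refine ⟨(InnerProductSpace.toDual ℝ R4).symm (LinearMap.toContinuousLinearMap φ), fun k => ?_⟩
  rw [real_inner_comm, InnerProductSpace.toDual_symm_apply]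
  have h1 := LinearMap.congr_fun hφ (Module.Basis.span hw k)
  rw [Module.Basis.constr_basis] at h1
  rw [← h1]
  simp [Module.Basis.span_apply]

theorem distDeriv_comm {ι : Type*} [Fintype ι] (x : ι → R4) (i j : ι) (v : ι → R4) :
    distDeriv x i j v = distDeriv x j i v := by
  rw [distDeriv_apply, distDeriv_apply, dist_comm, ← neg_sub (x j), ← neg_sub (v j),
    inner_neg_neg]

theorem distDeriv_self {ι : Type*} [Fintype ι] (x : ι → R4) (i : ι) (v : ι → R4) :
    distDeriv x i i v = 0 := by
  rw [distDeriv_apply]; simp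

theorem distDeriv_comp {ι κ : Type*} [Fintype ι] [Fintype κ] (x : ι → R4) (σ : κ → ι) (i j : κ)
    (v : ι → R4) : distDeriv (x ∘ σ) i j (v ∘ σ) = distDeriv x (σ i) (σ j) v := rfl

/-- Any first-order change of the distances between affinely independent points is realized by a
motion of the points. -/
theorem exists_distDeriv_eq {n : ℕ} {x : Fin n → R4} (hx : AffineIndependent ℝ x)
    {L : Fin n → Fin n → ℝ} (hL : ∀ i j, L i j = L j i) :
    ∃ v : Fin n → R4, ∀ i j, i ≠ j → distDeriv x i j v = L i j := by
  induction n with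
  | zero => exact ⟨0, fun i => i.elim0⟩
  | succ n ih =>
    obtain ⟨v, hv⟩ := ih (x := x ∘ Fin.castSucc) (L := fun i j => L i.castSucc j.castSucc)
      (hx.comp_embedding Fin.castSuccEmb) (fun i j => hL _ _)
    have h1 := (affineIndependent_iff_linearIndependent_vsub ℝ x (Fin.last n)).1 hx
    have h2 := h1.comp (fun i : Fin n => (⟨i.castSucc, (Fin.castSucc_lt_last i).ne⟩ :
      {i : Fin (n + 1) // i ≠ Fin.last n}))
      fun i j hij => Fin.castSucc_injective _ (Subtype.ext_iff.1 hij)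
    -- The velocity of the last point has to satisfy one linear equation for each other point. Their
    -- left-hand sides are inner products with independent vectors, so the system is solvable.
    obtain ⟨u, hu⟩ := exists_inner_eq h2 (fun i => inner ℝ (x i.castSucc - x (Fin.last n)) (v i) -
      dist (x i.castSucc) (x (Fin.last n)) * L i.castSucc (Fin.last n))
    refine ⟨Fin.snoc v u, ?_⟩
    have key : ∀ i : Fin n, distDeriv x i.castSucc (Fin.last n) (Fin.snoc v u : Fin (n + 1) → R4) =
        L i.castSucc (Fin.last n) := by
      intro i
      have h3 : dist (x i.castSucc) (x (Fin.last n)) ≠ 0 :=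
        dist_ne_zero.2 (hx.injective.ne (Fin.castSucc_lt_last i).ne)
      have h4 : inner ℝ (x i.castSucc - x (Fin.last n)) u = _ := hu i
      rw [distDeriv_apply, Fin.snoc_castSucc, Fin.snoc_last, inner_sub_right, h4]
      field_simp
      ring
    intro i j hij
    induction i using Fin.lastCases with
    | last =>
      induction j using Fin.lastCases with
      | last => exact absurd rfl hij
      | cast j => rw [distDeriv_comm, key, hL]
    | cast i =>
      induction j using Fin.lastCases with
      | last => exact key i
      | cast j =>
        rw [← hv i j (fun h => hij (by rw [h]))]
        rw [distDeriv_apply, distDeriv_apply, Fin.snoc_castSucc, Fin.snoc_castSucc]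
        rfl

/-- The differential of a dihedral angle as a function of the edge lengths. -/
noncomputable def dihedralDeriv (x : Fin 4 → R4) (L : Fin 4 → Fin 4 → ℝ) : ℝ :=
  fderiv ℝ dihedral (distMat x) L

theorem AffineIndependent.linearIndependent_of_injective {ι : Type*} {x : ι → R4}
    (h : AffineIndependent ℝ x) {a b c d : ι} (hi : Function.Injective ![a, b, c, d]) :
    LinearIndependent ℝ ![x b - x a, x c - x a, x d - x a] := by
  -- The permutation sends `2, 3, 0, 1` to `0, 1, 2, 3`, so that the base point becomes `a`.
  have h1 := (h.comp_embedding ⟨_, hi⟩).linearIndependent_sub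
    (Equiv.swap (0 : Fin 4) 2 * Equiv.swap 1 3)
  exact h1

theorem hasFDerivAt_dihedral_comp {ι : Type*} [Fintype ι] {x : ι → R4} {s : Fin 4 → ι}
    (h : AffineIndependent ℝ (x ∘ s)) :
    ∃ D : (ι → R4) →L[ℝ] ℝ, HasFDerivAt (fun q : ι → R4 => dihedral (distMat (q ∘ s))) D x ∧
      ∀ v, D v = dihedralDeriv (x ∘ s) (fun i j => distDeriv x (s i) (s j) v) := by
  have h1 : HasFDerivAt (fun q : ι → R4 => distMat (q ∘ s))
      (ContinuousLinearMap.pi fun i => ContinuousLinearMap.pi fun j => distDeriv x (s i) (s j)) x :=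
    hasFDerivAt_pi.2 fun i => hasFDerivAt_pi.2 fun j => hasFDerivAt_dist <| by
      by_cases hij : i = j
      · exact Or.inl (hij ▸ rfl)
      · exact Or.inr (h.injective.ne hij)
  exact ⟨_, HasFDerivAt.comp (g := dihedral) x (differentiableAt_dihedral h).hasFDerivAt h1,
    fun v => rfl⟩

/-- The compatibility of the angles of the three tetrahedra with a common edge in the boundary of
a four-simplex. -/
theorem sum_three_tetrahedra {ι : Type*} [Fintype ι] {x : ι → R4} {a : Fin 3 → ι} {b c : ι}
    (h : AffineIndependent ℝ (x ∘ ![a 0, a 1, a 2, b, c]))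
    {Θ : Fin 3 → (ι → R4) →L[ℝ] ℝ}
    (hΘ : ∀ k, HasFDerivAt
      (fun q : ι → R4 => theta (q (a (k + 1))) (q b) (q c) (q (a (k + 2))) (q (a k))) (Θ k) x)
    (v : ι → R4) :
    ∑ k : Fin 3, (dihedralDeriv (x ∘ ![a k, a (k + 1), b, c])
        (fun i j => distDeriv x (![a k, a (k + 1), b, c] i) (![a k, a (k + 1), b, c] j) v) •
        dihedralBivector (x (a k)) (x (a (k + 1))) (x b) (x c) +
      Θ k v • faceBivector (x (a (k + 1))) (x b) (x c)) = 0 := by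
  let d : Fin 3 → Fin 5 := Fin.castLE (by decide)
  have hdec : ∀ k : Fin 3, Function.Injective ![d k, d (k + 1), 3, 4] := by decide
  have hdec' : ∀ k : Fin 3, Function.Injective ![3, 4, d k, d (k + 1)] := by decide
  have hd : ∀ k, ![a 0, a 1, a 2, b, c] (d k) = a k := by
    intro k; fin_cases k <;> rfl
  have ai : ∀ k : Fin 3, AffineIndependent ℝ (x ∘ ![a k, a (k + 1), b, c]) := by
    intro k
    have : ![a k, a (k + 1), b, c] = ![a 0, a 1, a 2, b, c] ∘ ![d k, d (k + 1), 3, 4] := by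
      funext i
      fin_cases k <;> fin_cases i <;> rfl
    rw [this]
    exact h.comp_embedding ⟨_, hdec k⟩
  have li : ∀ k : Fin 3, ∀ᶠ q : ι → R4 in nhds x,
      LinearIndependent ℝ ![q c - q b, q (a k) - q b, q (a (k + 1)) - q b] := fun k =>
    eventually_linearIndependent (by
      have := h.linearIndependent_of_injective (hdec' k)
      simp only [Function.comp_apply, hd] at this
      exact this)
  -- The three opposite vertices repeated with period three.
  let A : (ι → R4) → ℕ → R4 := fun q k => q (a (Fin.ofNat 3 k))
  choose D hD hD' using fun k : Fin 3 =>
    hasFDerivAt_dihedral_comp (s := ![a k, a (k + 1), b, c]) (ai k)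
  have hcomp : ∀ (q : ι → R4) (k : Fin 3),
      q ∘ ![a k, a (k + 1), b, c] = ![q (a k), q (a (k + 1)), q b, q c] := by
    intro q k; funext i; fin_cases i <;> rfl
  obtain ⟨G, hG⟩ := exists_adapted (li 0).self_of_nhds
  have hlA : ∀ {q : ι → R4}, (∀ k : Fin 3, LinearIndependent ℝ
      ![q c - q b, q (a k) - q b, q (a (k + 1)) - q b]) → ∀ k,
      LinearIndependent ℝ ![q c - q b, A q (k + 1) - q b, A q (k + 2) - q b] := by
    intro q hq k
    have := hq (Fin.ofNat 3 (k + 1))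
    have e : (Fin.ofNat 3 (k + 1) + 1) = Fin.ofNat 3 (k + 2) := by
      ext; simp [Fin.ofNat, Fin.val_add]
    rwa [e] at this
  have key := hasMatrixDeriv_development (Y := ι → R4) (y₀ := x) (F₀ := G) (a := A x) (b := x b) (c := x c) (n := 3)
    hG (hlA fun k => (li k).self_of_nhds) rfl rfl hD hΘ
    (fun k => by rw [hcomp]; fin_cases k <;> rfl) (fun k => by fin_cases k <;> rfl)
  -- The three tetrahedra are parts of the boundary of one 4-simplex in `ℝ⁴`, so the development
  -- around the edge closes up for all nearby positions. Differentiating this constant product gives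
  -- the identity.
  have one : ∀ᶠ q : ι → R4 in nhds x, G * (List.ofFn fun k : Fin 3 =>
      rot 1 2 (dihedral (distMat (q ∘ ![a k, a (k + 1), b, c]))) *
      rot 2 3 (theta (q (a (k + 1))) (q b) (q c) (q (a (k + 2))) (q (a k)))).prod * Gᵀ = 1 := by
    filter_upwards [li 0, li 1, li 2] with q h0 h1 h2
    obtain ⟨H, hH⟩ := exists_adapted h0
    have h3 := ((hH.step h1).step h2).step h0
    -- Three steps lead back to a frame adapted to the first tetrahedron.
    have e := h3.unique hH
    have e' : (List.ofFn fun k : Fin 3 =>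
        rot 1 2 (dihedral (distMat (q ∘ ![a k, a (k + 1), b, c]))) *
        rot 2 3 (theta (q (a (k + 1))) (q b) (q c) (q (a (k + 2))) (q (a k)))).prod = 1 := by
      have t := transpose_mul_of_mem hH.mem
      simp only [hcomp]
      rw [List.ofFn_succ, List.ofFn_succ, List.ofFn_succ, List.ofFn_zero]
      simp only [List.prod_cons, List.prod_nil, mul_one]
      have e2 := congrArg (fun M => Hᵀ * M) e
      simp only [mul_assoc] at e2
      rw [← mul_assoc Hᵀ H, t, one_mul] at e2
      simp only [mul_assoc]
      exact e2
    rw [e', mul_one, mul_transpose_of_mem hG.mem]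
  ext i j
  obtain ⟨D₀, h1, h2⟩ := key i j
  have h3 := h2.unique ((hasFDerivAt_const ((1 : Matrix (Fin 4) (Fin 4) ℝ) i j) x).congr_of_eventuallyEq
    (one.mono fun q hq => congrFun (congrFun hq i) j))
  have h4 := h1 v
  rw [h3] at h4
  simp only [hD'] at h4
  have e : ∀ k : Fin 3, A x k = x (a k) ∧ A x (k + 1) = x (a (k + 1)) := by
    intro k; fin_cases k <;> exact ⟨rfl, rfl⟩
  simp only [e] at h4
  rw [Matrix.neg_apply] at h4
  rw [Matrix.zero_apply]
  simpa using h4.symm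

theorem exists_hasFDerivAt_theta_comp {ι : Type*} [Fintype ι] {x : ι → R4} {σ : Fin 5 → ι}
    (h : AffineIndependent ℝ (x ∘ σ)) :
    ∃ (c : Fin 5 → Fin 5 → ℝ) (D : (ι → R4) →L[ℝ] ℝ), HasFDerivAt
      (fun q : ι → R4 => theta (q (σ 0)) (q (σ 1)) (q (σ 2)) (q (σ 3)) (q (σ 4))) D x ∧
      ∀ v, D v = ∑ i, ∑ j, c i j * distDeriv x (σ i) (σ j) v := by
  obtain ⟨c, hc⟩ := exists_hasFDerivAt_theta h
  let L : (ι → R4) →L[ℝ] (Fin 5 → R4) :=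
    ContinuousLinearMap.pi fun i => ContinuousLinearMap.proj (σ i)
  refine ⟨c, (distComb (x ∘ σ) c).comp L, ?_, fun v => distComb_apply (x ∘ σ) c (v ∘ σ)⟩
  exact HasFDerivAt.comp (g := fun q : Fin 5 → R4 => theta (q 0) (q 1) (q 2) (q 3) (q 4)) (f := L)
    x hc L.hasFDerivAt

/-! ## Flags and the curvature form -/

theorem AffineIndependent.exists_planeFrame {ι : Type*} {x : ι → R4} (h : AffineIndependent ℝ x)
    {a b c d : ι} (hi : Function.Injective ![a, b, c, d]) :
    ∃ F, PlaneFrame F (x a) (x b) (x c) := by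
  obtain ⟨F, hF, ⟨X, hX, h1⟩, ⟨p₂, Y, hY, h2⟩, -⟩ :=
    exists_triangular_frame (h.linearIndependent_of_injective hi)
  exact ⟨F, hF, X, 0, p₂, Y, by nlinarith [mul_pos hX hY], h1, h2⟩

theorem eq_vec_of_zero {c : Fin 4 → ℝ} (h₂ : c 2 = 0) (h₃ : c 3 = 0) : c = ![c 0, c 1, 0, 0] := by
  ext i; fin_cases i
  exacts [rfl, rfl, h₂, h₃]

theorem eq_vec_of_zero' {c : Fin 4 → ℝ} (h₃ : c 3 = 0) : c = ![c 0, c 1, c 2, 0] := by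
  ext i; fin_cases i
  exacts [rfl, rfl, rfl, h₃]

theorem perm_injective_vec (s : Equiv.Perm (Fin 4)) (τ : Equiv.Perm (Fin 4)) :
    Function.Injective ![s (τ 0), s (τ 1), s (τ 2), s (τ 3)] := by
  have : ![s (τ 0), s (τ 1), s (τ 2), s (τ 3)] = ⇑(s * τ) := by
    funext i; fin_cases i <;> rfl
  rw [this]
  exact (s * τ).injective

/-- The cyclic permutations of the face opposite to the first vertex; `theta` is invariant under
them. -/
theorem even_perm_fixing_zero : ∀ τ : Equiv.Perm (Fin 4), Equiv.Perm.sign τ = 1 → τ 0 = 0 →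
    (τ 1 = 1 ∧ τ 2 = 2 ∧ τ 3 = 3) ∨ (τ 1 = 2 ∧ τ 2 = 3 ∧ τ 3 = 1) ∨
    (τ 1 = 3 ∧ τ 2 = 1 ∧ τ 3 = 2) := by decide

/-- Orderings moving the last vertex to the front without changing the orientation of the
tetrahedron; they reverse the remaining face, which is the situation of `PlaneFrame.theta_swap`. -/
theorem even_perm_zero_to_three : ∀ τ : Equiv.Perm (Fin 4), Equiv.Perm.sign τ = 1 → τ 0 = 3 →
    (τ 1 = 1 ∧ τ 2 = 0 ∧ τ 3 = 2) ∨ (τ 1 = 0 ∧ τ 2 = 2 ∧ τ 3 = 1) ∨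
    (τ 1 = 2 ∧ τ 2 = 1 ∧ τ 3 = 0) := by decide

theorem even_perm_fixing_two : ∀ τ : Equiv.Perm (Fin 4), Equiv.Perm.sign τ = 1 → τ 2 = 2 →
    τ 3 = 3 → τ = 1 := by decide

namespace TetComplex

variable {V E F T : Type*} {K : TetComplex V E F T}

/-- Edges have well-defined ends. -/
structure IsRegular (K : TetComplex V E F T) : Prop where
  edge_symm : ∀ t i j, K.edge t i j = K.edge t j i
  edge_ends : ∀ t i j, i ≠ j →
    (K.src (K.edge t i j) = K.vert t i ∧ K.tgt (K.edge t i j) = K.vert t j) ∨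
    (K.src (K.edge t i j) = K.vert t j ∧ K.tgt (K.edge t i j) = K.vert t i)

/-- No tetrahedron degenerates. -/
def Nondeg (K : TetComplex V E F T) (q : V → R4) : Prop :=
  ∀ t, AffineIndependent ℝ (q ∘ K.vert t)

theorem Nondeg.injective {q : V → R4} (h : K.Nondeg q) (t : T) : Function.Injective (K.vert t) :=
  (h t).injective.of_comp

theorem Nondeg.eventually [Fintype V] [Finite T] {q : V → R4} (h : K.Nondeg q) :
    ∀ᶠ q' : V → R4 in nhds q, K.Nondeg q' := by
  refine Filter.eventually_all.2 fun t => ?_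
  have hc : Continuous fun q' : V → R4 => q' ∘ K.vert t :=
    continuous_pi fun i => continuous_apply _
  exact hc.continuousAt.eventually (isOpen_setOfPred_affineIndependent.mem_nhds (h t))

theorem IsRegular.dist_edge (hK : K.IsRegular) (q : V → R4) (t : T) {i j : Fin 4} (hij : i ≠ j) :
    dist (q (K.src (K.edge t i j))) (q (K.tgt (K.edge t i j))) =
      dist (q (K.vert t i)) (q (K.vert t j)) := by
  rcases hK.edge_ends t i j hij with ⟨h1, h2⟩ | ⟨h1, h2⟩
  · rw [h1, h2]
  · rw [h1, h2, dist_comm]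

/-- Frees the angle from the names chosen in the star of the face: any right-oriented ordering of
either of the two tetrahedra which begins with the vertex opposite to the face gives the same value.
-/
theorem FaceStar.theta_eq {f : F} (σ : K.FaceStar f) {q : V → R4} {t t' : T}
    {s : Equiv.Perm (Fin 4)} {x : Fin 4} (hs : Equiv.Perm.sign s = K.ori t)
    (hf : K.face t (s 0) = f) (hf' : K.face t' x = f) (hne : t' ≠ t)
    (h : AffineIndependent ℝ (q ∘ K.vert t)) :
    theta (q (K.vert σ.left (σ.lord 1))) (q (K.vert σ.left (σ.lord 2)))
      (q (K.vert σ.left (σ.lord 3))) (q (K.vert σ.right (σ.rord 3)))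
      (q (K.vert σ.left (σ.lord 0))) =
    theta (q (K.vert t (s 1))) (q (K.vert t (s 2))) (q (K.vert t (s 3))) (q (K.vert t' x))
      (q (K.vert t (s 0))) := by
  rcases σ.covers t (s 0) hf with ⟨rfl, h0⟩ | ⟨rfl, h0⟩
  · obtain ⟨rfl, rfl⟩ : t' = σ.right ∧ x = σ.rord 3 := by
      rcases σ.covers t' x hf' with ⟨h1, -⟩ | h1
      · exact absurd h1 hne
      · exact h1
    obtain ⟨τ, rfl⟩ : ∃ τ, s = σ.lord * τ := ⟨σ.lord⁻¹ * s, by simp⟩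
    have hτ : Equiv.Perm.sign τ = 1 := by
      rw [Equiv.Perm.sign_mul, ← σ.left_oriented] at hs
      simpa using hs
    obtain ⟨G, hG⟩ := h.exists_planeFrame (a := σ.lord 1) (b := σ.lord 2) (c := σ.lord 3)
      (d := σ.lord 0) (perm_injective_vec σ.lord (finRotate 4))
    simp only [Equiv.Perm.mul_apply] at h0 ⊢
    rw [h0]
    rcases even_perm_fixing_zero τ hτ (σ.lord.injective h0) with ⟨h1, h2, h3⟩ | ⟨h1, h2, h3⟩ | ⟨h1, h2, h3⟩ <;>
      rw [h1, h2, h3]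
    · exact (hG.theta_rotate _ _).symm
    · exact ((hG.rotate.theta_rotate _ _).trans (hG.theta_rotate _ _)).symm
  · obtain ⟨rfl, rfl⟩ : t' = σ.left ∧ x = σ.lord 0 := by
      rcases σ.covers t' x hf' with h1 | ⟨h1, -⟩
      · exact h1
      · exact absurd h1 hne
    have g1 := σ.vert_glue 0
    have g2 := σ.vert_glue 1
    have g3 := σ.vert_glue 2
    simp only [Fin.succ_zero_eq_one, Fin.succ_one_eq_two, Fin.castSucc_zero, Fin.castSucc_one] at g1 g2
    change K.vert σ.left (σ.lord 3) = K.vert σ.right (σ.rord 2) at g3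
    rw [g1, g2, g3]
    obtain ⟨τ, rfl⟩ : ∃ τ, s = σ.rord * τ := ⟨σ.rord⁻¹ * s, by simp⟩
    have hτ : Equiv.Perm.sign τ = 1 := by
      rw [Equiv.Perm.sign_mul, ← σ.right_oriented] at hs
      simpa using hs
    obtain ⟨G, hG⟩ := h.exists_planeFrame (a := σ.rord 0) (b := σ.rord 1) (c := σ.rord 2)
      (d := σ.rord 3) (perm_injective_vec σ.rord 1)
    obtain ⟨G', hG'⟩ := h.exists_planeFrame (a := σ.rord 1) (b := σ.rord 0) (c := σ.rord 2)
      (d := σ.rord 3) (perm_injective_vec σ.rord (Equiv.swap 0 1))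
    have e1 := hG.theta_swap (q (K.vert σ.right (σ.rord 3))) (q (K.vert σ.left (σ.lord 0)))
    simp only [Function.comp_apply] at e1
    simp only [Equiv.Perm.mul_apply] at h0 ⊢
    rw [h0, ← e1]
    rcases even_perm_zero_to_three τ hτ (σ.rord.injective h0) with ⟨h1, h2, h3⟩ | ⟨h1, h2, h3⟩ | ⟨h1, h2, h3⟩ <;>
      rw [h1, h2, h3]
    · exact (hG'.theta_rotate _ _).symm
    · exact ((hG'.rotate.theta_rotate _ _).trans (hG'.theta_rotate _ _)).symm

/-- The right-oriented orderings of the tetrahedra containing the directed edge `e` which end with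
this edge. -/
def IsFlag (K : TetComplex V E F T) (e : E) (t : T) (s : Equiv.Perm (Fin 4)) : Prop :=
  Equiv.Perm.sign s = K.ori t ∧ K.edge t (s 2) (s 3) = e ∧ K.vert t (s 2) = K.src e ∧
    K.vert t (s 3) = K.tgt e

/-- The contribution of a flag to the differential of the deficit angle. -/
noncomputable def flagForm (K : TetComplex V E F T) (p : V → R4) (y : E ⊕ F → ℝ) (t : T)
    (s : Equiv.Perm (Fin 4)) : Matrix (Fin 4) (Fin 4) ℝ :=
  dihedralDeriv (p ∘ K.vert t ∘ s)
      (fun i j => if i = j then 0 else y (Sum.inl (K.edge t (s i) (s j)))) •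
    dihedralBivector (p (K.vert t (s 0))) (p (K.vert t (s 1))) (p (K.vert t (s 2)))
      (p (K.vert t (s 3))) +
  y (Sum.inr (K.face t (s 0))) •
    faceBivector (p (K.vert t (s 1))) (p (K.vert t (s 2))) (p (K.vert t (s 3)))

open Classical in
/-- Minus the differential of the deficit angle around the edge `e`, a bivector. -/
noncomputable def curvature [Fintype T] (K : TetComplex V E F T) (p : V → R4) (e : E)
    (y : E ⊕ F → ℝ) : Matrix (Fin 4) (Fin 4) ℝ :=
  ∑ t, ∑ s : Equiv.Perm (Fin 4), if K.IsFlag e t s then K.flagForm p y t s else 0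

namespace EdgeStar

variable {e : E} (σ : K.EdgeStar e)

theorem tet_injective : Function.Injective σ.tet := by
  intro k l h
  have := σ.covers (σ.tet l) (σ.ord l 2) (σ.ord l 3) ((σ.ord l).injective.ne (by decide))
    (σ.edge_eq l)
  exact this.unique h rfl

theorem isFlag (k : Fin σ.n) : K.IsFlag e (σ.tet k) (σ.ord k) :=
  ⟨σ.oriented k, σ.edge_eq k, σ.src_eq k, σ.tgt_eq k⟩

/-- A right-oriented ordering is determined by its last two vertices. -/
theorem exists_of_isFlag (hK : ∀ t, Function.Injective (K.vert t)) {t : T}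
    {s : Equiv.Perm (Fin 4)} (h : K.IsFlag e t s) : ∃ k, σ.tet k = t ∧ σ.ord k = s := by
  obtain ⟨h0, h1, h2, h3⟩ := h
  obtain ⟨k, rfl, -⟩ := σ.covers t (s 2) (s 3) (s.injective.ne (by decide)) h1
  refine ⟨k, rfl, ?_⟩
  have e2 : σ.ord k 2 = s 2 := hK _ ((σ.src_eq k).trans h2.symm)
  have e3 : σ.ord k 3 = s 3 := hK _ ((σ.tgt_eq k).trans h3.symm)
  have := even_perm_fixing_two (s⁻¹ * σ.ord k)
    (by rw [Equiv.Perm.sign_mul, Equiv.Perm.sign_inv, h0, σ.oriented]; simp)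
    (by simp [e2]) (by simp [e3])
  exact (inv_mul_eq_one.1 this).symm

-- The cyclic enumeration around an edge is replaced by a sum over flags, which involves neither the
-- initial tetrahedron nor the order of the others. This is what makes complexes before and after a
-- move comparable.
open Classical in
theorem sum_eq [Fintype T] (hK : ∀ t, Function.Injective (K.vert t)) {M : Type*} [AddCommMonoid M]
    (g : T → Equiv.Perm (Fin 4) → M) : ∑ k, g (σ.tet k) (σ.ord k) =
      ∑ t, ∑ s : Equiv.Perm (Fin 4), if K.IsFlag e t s then g t s else 0 := by
  rw [← Finset.sum_product', Finset.univ_product_univ, ← Finset.sum_filter]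
  refine Finset.sum_bij (fun k _ => (σ.tet k, σ.ord k)) (fun k _ => ?_) (fun k _ l _ h => ?_)
    (fun x hx => ?_) (fun _ _ => rfl)
  · simpa using σ.isFlag k
  · exact σ.tet_injective (Prod.ext_iff.1 h).1
  · obtain ⟨k, h1, h2⟩ := σ.exists_of_isFlag hK (Finset.mem_filter.1 hx).2
    exact ⟨k, Finset.mem_univ _, Prod.ext h1 h2⟩

/-- A tetrahedron following itself around an edge would contribute both of its faces at the edge to
the same face, which belongs to two different tetrahedra. -/
theorem tet_ne (f : ∀ f, K.FaceStar f) (k : Fin σ.n) : σ.tet (finRotate σ.n k) ≠ σ.tet k := by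
  intro h
  have hk := σ.tet_injective h
  have hg := σ.face_glue k
  have h1 : σ.ord k 0 ≠ σ.ord k 1 := (σ.ord k).injective.ne (by decide)
  rw [hk] at hg
  let φ := f (K.face (σ.tet k) (σ.ord k 0))
  rcases φ.covers _ _ rfl with ⟨a1, a2⟩ | ⟨a1, a2⟩ <;>
    rcases φ.covers _ _ hg.symm with ⟨b1, b2⟩ | ⟨b1, b2⟩
  · exact h1 (a2.trans b2.symm)
  · exact φ.left_ne_right (a1.symm.trans b1)
  · exact φ.left_ne_right (b1.symm.trans a1)
  · exact h1 (a2.trans b2.symm)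

end EdgeStar

end TetComplex

/-! ## The matrix of deficit angles -/

theorem fderiv_eq_of_hasMatrixDeriv {Y : Type*} [NormedAddCommGroup Y] [NormedSpace ℝ Y] {y₀ : Y}
    {M M' : Y → Matrix (Fin 4) (Fin 4) ℝ} (h : HasMatrixDeriv M M' y₀) (i j : Fin 4) (v : Y) :
    fderiv ℝ (fun y => M y i j) y₀ v = M' v i j := by
  obtain ⟨D, h1, h2⟩ := h i j
  rw [h2.fderiv, h1]

namespace Presentation

variable {V E F T : Type*} {K : TetComplex V E F T} {p : V → R4}

theorem angle_eq (P : Presentation K p) {q : V → R4} {t t' : T}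
    {s : Equiv.Perm (Fin 4)} {x : Fin 4} (hs : Equiv.Perm.sign s = K.ori t)
    (hf' : K.face t' x = K.face t (s 0)) (hne : t' ≠ t) (h : AffineIndependent ℝ (q ∘ K.vert t)) :
    P.angle (K.face t (s 0)) q = theta (q (K.vert t (s 1))) (q (K.vert t (s 2)))
      (q (K.vert t (s 3))) (q (K.vert t' x)) (q (K.vert t (s 0))) :=
  (P.faceStar _).theta_eq hs rfl hf' hne h

/-- The meaningless diagonal variables are replaced by zero, which does not alter the function of
lengths but makes its argument at the actual lengths the matrix of distances. -/
theorem hasFDerivAt_flag_dihedral (hK : K.IsRegular) (hp : K.Nondeg p) (P : Presentation K p)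
    [Fintype E] [Fintype F] (t : T) (s : Equiv.Perm (Fin 4)) :
    (dihedral fun i j => P.measure p (Sum.inl (K.edge t (s i) (s j)))) =
      dihedral (distMat (p ∘ K.vert t ∘ s)) ∧
    ∃ D : (E ⊕ F → ℝ) →L[ℝ] ℝ, HasFDerivAt (fun y : E ⊕ F → ℝ =>
      dihedral fun i j => y (Sum.inl (K.edge t (s i) (s j)))) D (P.measure p) ∧
      ∀ v, D v = dihedralDeriv (p ∘ K.vert t ∘ s)
        (fun i j => if i = j then 0 else v (Sum.inl (K.edge t (s i) (s j)))) := by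
  have hd : ∀ i j, i ≠ j → P.measure p (Sum.inl (K.edge t (s i) (s j))) =
      distMat (p ∘ K.vert t ∘ s) i j := fun i j hij => hK.dist_edge p t (s.injective.ne hij)
  refine ⟨dihedral_congr hd, ?_⟩
  have hai : AffineIndependent ℝ (p ∘ K.vert t ∘ s) := (hp t).comp_embedding s.toEmbedding
  let L : (E ⊕ F → ℝ) →L[ℝ] (Fin 4 → Fin 4 → ℝ) := ContinuousLinearMap.pi fun i =>
    ContinuousLinearMap.pi fun j => if i = j then 0 else
      ContinuousLinearMap.proj (Sum.inl (K.edge t (s i) (s j)))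
  have hL : ∀ v, L v = fun i j => if i = j then 0 else v (Sum.inl (K.edge t (s i) (s j))) := by
    intro v
    ext i j
    by_cases h : i = j <;> simp [L, h]
  have hL₀ : L (P.measure p) = distMat (p ∘ K.vert t ∘ s) := by
    rw [hL]
    ext i j
    split_ifs with h
    · subst h; simp [distMat]
    · exact hd i j h
  have hdiff : HasFDerivAt dihedral (fderiv ℝ dihedral (distMat (p ∘ K.vert t ∘ s)))
      (L (P.measure p)) := by
    rw [hL₀]; exact (differentiableAt_dihedral hai).hasFDerivAt
  have hcomp := HasFDerivAt.comp (g := dihedral) (f := L) _ hdiff L.hasFDerivAt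
  refine ⟨_, hcomp.congr_of_eventuallyEq (Filter.Eventually.of_forall fun y => ?_), fun v => ?_⟩
  · refine dihedral_congr fun i j hij => ?_
    rw [hL]; simp [hij]
  · rw [ContinuousLinearMap.comp_apply, hL]; rfl

/-- The star of the edge is fed into `hasMatrixDeriv_development`; the right-hand side becomes a sum
over flags. -/
theorem hasMatrixDeriv_deficit [Fintype E] [Fintype F] [Fintype T] (hK : K.IsRegular)
    (hp : K.Nondeg p) (P : Presentation K p) (e : E) :
    HasMatrixDeriv (P.deficit e) (fun y => -K.curvature p e y) (P.measure p) := by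
  obtain ⟨σ, hσ⟩ : ∃ σ, P.edgeStar e = σ := ⟨_, rfl⟩
  have hn := σ.pos
  -- The star is continued periodically, so that the two tetrahedra after the last one are defined
  -- even when the star has a single member.
  let idx : ℕ → Fin σ.n := fun k => ⟨k % σ.n, Nat.mod_lt _ hn⟩
  have hidx : ∀ k, finRotate σ.n (idx k) = idx (k + 1) := by
    intro k
    obtain ⟨m, hm⟩ : ∃ m, σ.n = m + 1 := ⟨σ.n - 1, by omega⟩
    have : ∀ (n : ℕ) (hn : 0 < n) (m : ℕ) (_ : n = m + 1) (k : ℕ),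
        finRotate n ⟨k % n, Nat.mod_lt _ hn⟩ = ⟨(k + 1) % n, Nat.mod_lt _ hn⟩ := by
      rintro _ hn m rfl k
      rw [finRotate_apply]
      ext
      simp [Fin.val_add]
    exact this _ hn m hm k
  have hidx' : ∀ k : Fin σ.n, idx k = k := fun k => Fin.ext (Nat.mod_eq_of_lt k.2)
  let a : ℕ → R4 := fun k => p (K.vert (σ.tet (idx k)) (σ.ord (idx k) 0))
  have ha1 : ∀ k, a (k + 1) = p (K.vert (σ.tet (idx k)) (σ.ord (idx k) 1)) := by
    intro k
    rw [σ.vert_glue, hidx]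
  have ha2 : ∀ k, a (k + 2) = p (K.vert (σ.tet (idx (k + 1))) (σ.ord (idx (k + 1)) 1)) := fun k =>
    ha1 (k + 1)
  have hb : ∀ k, p (K.vert (σ.tet k) (σ.ord k 2)) = p (K.src e) := fun k => by rw [σ.src_eq]
  have hc : ∀ k, p (K.vert (σ.tet k) (σ.ord k 3)) = p (K.tgt e) := fun k => by rw [σ.tgt_eq]
  have hli : ∀ k, LinearIndependent ℝ ![p (K.tgt e) - p (K.src e), a k - p (K.src e),
      a (k + 1) - p (K.src e)] := by
    intro k
    have := (hp (σ.tet (idx k))).linearIndependent_sub (σ.ord (idx k))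
    simp only [Function.comp_apply] at this
    rwa [hb, hc, ← ha1] at this
  have hF : Adapted (P.frame e) (a 0) (a 1) (p (K.src e)) (p (K.tgt e)) := by
    have i0 : idx 0 = ⟨0, hn⟩ := Fin.ext (Nat.zero_mod _)
    have f1 := P.frame_fst e _ rfl
    have f2 := P.frame_snd e _ rfl
    subst hσ
    refine ⟨P.frame_mem e, ?_, P.frame_edge e, ?_, ?_⟩
    · rw [dist_pos]
      intro h
      have := (hli 0).ne_zero 0
      simp [h] at this
    · have e1 : a 0 = p (K.vert ((P.edgeStar e).tet ⟨0, hn⟩) ((P.edgeStar e).ord ⟨0, hn⟩ 0)) := by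
        simp only [a, i0]
      rw [e1]
      exact ⟨_, _, f1.1, eq_vec_of_zero f1.2.1 f1.2.2⟩
    · have e1 : a 1 = p (K.vert ((P.edgeStar e).tet ⟨0, hn⟩) ((P.edgeStar e).ord ⟨0, hn⟩ 1)) := by
        rw [ha1 0, i0]
      rw [e1]
      exact ⟨_, _, _, f2.1, eq_vec_of_zero' f2.2⟩
  choose h0 D hD hD' using fun k : Fin σ.n =>
    hasFDerivAt_flag_dihedral hK hp P (σ.tet k) (σ.ord k)
  have hx : ∀ k, p ∘ K.vert (σ.tet k) ∘ σ.ord k =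
      ![a k, a (k + 1), p (K.src e), p (K.tgt e)] := by
    intro k
    funext i
    fin_cases i
    · simp only [a, hidx']; rfl
    · show _ = a (k + 1)
      rw [ha1, hidx']; rfl
    · exact hb k
    · exact hc k
  have key := hasMatrixDeriv_development (y₀ := P.measure p) hF (fun k => hli (k + 1)) (n := σ.n)
    (by simp only [a, idx, Nat.mod_self, Nat.zero_mod])
    (by simp only [a, idx, Nat.add_mod_left])
    (φ := fun k y => dihedral fun i j => y (Sum.inl (K.edge (σ.tet k) (σ.ord k i) (σ.ord k j))))
    (θ := fun k y => y (Sum.inr (K.face (σ.tet k) (σ.ord k 0)))) hD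
    (fun k => (ContinuousLinearMap.proj (R := ℝ) (φ := fun _ : E ⊕ F => ℝ)
      (Sum.inr (K.face (σ.tet k) (σ.ord k 0)))).hasFDerivAt)
    (fun k => by rw [h0, hx]) (fun k => by
      have := P.angle_eq (q := p) (σ.oriented k) (σ.face_glue k).symm
        (σ.tet_ne P.faceStar k) (hp _)
      rw [hb, hc] at this
      refine this.trans ?_
      rw [ha1, ha2, ← hidx, hidx']
      simp only [a, hidx'])
  have hdef : P.deficit e = fun y => P.frame e * (List.ofFn fun k : Fin σ.n =>
      rot 1 2 (dihedral fun i j => y (Sum.inl (K.edge (σ.tet k) (σ.ord k i) (σ.ord k j)))) *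
      rot 2 3 (y (Sum.inr (K.face (σ.tet k) (σ.ord k 0))))).prod * (P.frame e)ᵀ := by
    subst hσ; rfl
  rw [hdef]
  refine key.congr_deriv fun v => ?_
  rw [TetComplex.curvature, ← σ.sum_eq hp.injective]
  refine congrArg Neg.neg (Finset.sum_congr rfl fun k _ => ?_)
  rw [TetComplex.flagForm, hD', hb, hc, ha1, hidx']
  simp only [a, hidx']
  rfl

/-- The component of a bivector in the plane of the given axes. -/
def component (A B : Matrix (Fin 4) (Fin 4) ℝ) (m : Fin 3) : ℝ :=
  (Aᵀ * B * A) (axisPos m).1 (axisPos m).2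

section

variable [Fintype V] [Fintype E] [Fintype F] [Fintype T] [DecidableEq V] [DecidableEq E]
  [DecidableEq F]

theorem f₃_apply (hK : K.IsRegular) (hp : K.Nondeg p) (P : Presentation K p) (e : E) (m : Fin 3)
    (c : E ⊕ F) : P.f₃ (e, m) c = -component (P.axes e) (K.curvature p e (Pi.single c 1)) m := by
  have h := ((HasMatrixDeriv.const (P.axes e)ᵀ (P.measure p)).mul
    (P.hasMatrixDeriv_deficit hK hp e)).mul (HasMatrixDeriv.const (P.axes e) (P.measure p))
  refine (fderiv_eq_of_hasMatrixDeriv h _ _ _).trans ?_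
  simp [component]

end

end Presentation

/-! ## Columns of faces -/

theorem faceBivector_swap (a b c : R4) : faceBivector a c b = -faceBivector a b c := by
  have h0 : area2 c b a = area2 b c a := by rw [area2_rotate a c b, area2_swap, area2_rotate a b c]
  rw [faceBivector, faceBivector, h0, ← smul_neg]
  congr 1
  have h1 : b - c = -(c - b) := by abel
  have h2 : a - c = (a - b) + -(c - b) := by abel
  have h3 : (⇑(b - c) : Fin 4 → ℝ) = (-1 : ℝ) • ⇑(c - b) := by rw [h1]; ext i; simp
  have h4 : (⇑(a - c) : Fin 4 → ℝ) = ⇑(a - b) + (-1 : ℝ) • ⇑(c - b) := by rw [h2]; ext i; simp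
  rw [h3, h4, dualWedge_smul_left, dualWedge_add_right, dualWedge_smul_right, dualWedge_self]
  simp

theorem faceBivector_rotate (a b c : R4) : faceBivector b c a = faceBivector a b c := by
  rw [faceBivector, faceBivector, area2_rotate b c a]
  congr 1
  have h2 : (⇑(a - c) : Fin 4 → ℝ) = ⇑(a - b) + (-1 : ℝ) • ⇑(c - b) := by ext i; simp
  have h3 : (⇑(b - c) : Fin 4 → ℝ) = (-1 : ℝ) • ⇑(c - b) := by ext i; simp
  rw [h2, h3, dualWedge_smul_right, dualWedge_add_left, dualWedge_smul_left, dualWedge_self,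
    dualWedge_swap]
  simp

theorem faceBivector_reverse (a b c : R4) : faceBivector c b a = -faceBivector a b c := by
  rw [← faceBivector_rotate, faceBivector_swap, faceBivector_rotate]

theorem faceBivector_transpose (a b c : R4) : (faceBivector a b c)ᵀ = -faceBivector a b c := by
  rw [faceBivector, Matrix.transpose_smul, dualWedge_transpose, smul_neg]

theorem faceBivector_mulVec (a b c : R4) : faceBivector a b c *ᵥ ⇑(c - b) = 0 := by
  rw [faceBivector, Matrix.smul_mulVec, dualWedge_mulVec_left, smul_zero]

theorem matrix_eq_zero_of_eq_neg {B : Matrix (Fin 4) (Fin 4) ℝ} (h : B = -B) : B = 0 := by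
  ext i j
  have := congrFun (congrFun h i) j
  rw [Matrix.neg_apply] at this
  exact self_eq_neg.1 this

theorem dihedralDeriv_zero (x : Fin 4 → R4) : dihedralDeriv x (fun _ _ => 0) = 0 :=
  map_zero (fderiv ℝ dihedral (distMat x))

namespace TetComplex

variable {V E F T : Type*} {K : TetComplex V E F T} {p : V → R4}

theorem flagForm_add (y z : E ⊕ F → ℝ) (t : T) (s : Equiv.Perm (Fin 4)) :
    K.flagForm p (y + z) t s = K.flagForm p y t s + K.flagForm p z t s := by
  have : (fun i j => if i = j then 0 else (y + z) (Sum.inl (K.edge t (s i) (s j)))) =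
      (fun i j => if i = j then 0 else y (Sum.inl (K.edge t (s i) (s j)))) +
      fun i j => if i = j then 0 else z (Sum.inl (K.edge t (s i) (s j))) := by
    ext i j
    simp only [Pi.add_apply]
    split_ifs <;> simp
  rw [flagForm, this, dihedralDeriv, map_add, flagForm, flagForm, dihedralDeriv, dihedralDeriv,
    Pi.add_apply]
  module

theorem flagForm_smul (r : ℝ) (y : E ⊕ F → ℝ) (t : T) (s : Equiv.Perm (Fin 4)) :
    K.flagForm p (r • y) t s = r • K.flagForm p y t s := by
  have : (fun i j => if i = j then 0 else (r • y) (Sum.inl (K.edge t (s i) (s j)))) =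
      r • (fun i j => if i = j then 0 else y (Sum.inl (K.edge t (s i) (s j)))) := by
    ext i j
    simp only [Pi.smul_apply]
    split_ifs <;> simp
  rw [flagForm, this, dihedralDeriv, map_smul, flagForm, dihedralDeriv, Pi.smul_apply, smul_add,
    smul_smul, smul_smul, smul_eq_mul, smul_eq_mul]

theorem flagForm_single_face [DecidableEq E] [DecidableEq F] (f : F) (t : T)
    (s : Equiv.Perm (Fin 4)) : K.flagForm p (Pi.single (Sum.inr f) 1) t s =
      if K.face t (s 0) = f then
        faceBivector (p (K.vert t (s 1))) (p (K.vert t (s 2))) (p (K.vert t (s 3))) else 0 := by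
  have : (fun i j => if i = j then 0 else
      (Pi.single (Sum.inr f) 1 : E ⊕ F → ℝ) (Sum.inl (K.edge t (s i) (s j)))) =
      fun _ _ => 0 := by
    ext i j; simp
  rw [flagForm, this, dihedralDeriv_zero, zero_smul, zero_add]
  by_cases h : K.face t (s 0) = f
  · simp [h]
  · simp [h]

section Curvature

variable [Fintype T]

/-- The curvature form around an edge, as a linear map. -/
noncomputable def curvatureLin (K : TetComplex V E F T) (p : V → R4) (e : E) :
    (E ⊕ F → ℝ) →ₗ[ℝ] Matrix (Fin 4) (Fin 4) ℝ where
  toFun := K.curvature p e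
  map_add' y z := by
    simp only [curvature, ← Finset.sum_add_distrib]
    refine Finset.sum_congr rfl fun t _ => Finset.sum_congr rfl fun s _ => ?_
    split_ifs
    · exact flagForm_add _ _ _ _
    · simp
  map_smul' r y := by
    simp only [curvature, Finset.smul_sum, RingHom.id_apply]
    refine Finset.sum_congr rfl fun t _ => Finset.sum_congr rfl fun s _ => ?_
    split_ifs
    · exact flagForm_smul _ _ _ _
    · simp

end Curvature

/-- The ordering `s` of the vertices of `t` ends with the directed edge `e`. -/
def EndsWith (K : TetComplex V E F T) (e : E) (t : T) (s : Equiv.Perm (Fin 4)) : Prop :=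
  K.edge t (s 2) (s 3) = e ∧ K.vert t (s 2) = K.src e ∧ K.vert t (s 3) = K.tgt e

/-- The unit bivector orthogonal to the face opposite to the first vertex. -/
noncomputable def orderBivector (K : TetComplex V E F T) (p : V → R4) (t : T)
    (s : Equiv.Perm (Fin 4)) : Matrix (Fin 4) (Fin 4) ℝ :=
  faceBivector (p (K.vert t (s 1))) (p (K.vert t (s 2))) (p (K.vert t (s 3)))

open Classical in
/-- The bivector with which the face of `t` opposite to `x` contributes to the edge `e`. -/
noncomputable def cornerForm (K : TetComplex V E F T) (p : V → R4) (t : T) (x : Fin 4) (e : E) :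
    Matrix (Fin 4) (Fin 4) ℝ :=
  ∑ s : Equiv.Perm (Fin 4), if s 0 = x ∧ K.EndsWith e t s then K.orderBivector p t s else 0

open Classical in
/-- The part of `cornerForm` coming from the orderings of a given sign. -/
noncomputable def signedCornerForm (K : TetComplex V E F T) (p : V → R4) (t : T) (x : Fin 4)
    (ε : ℤˣ) (e : E) : Matrix (Fin 4) (Fin 4) ℝ :=
  ∑ s : Equiv.Perm (Fin 4), if Equiv.Perm.sign s = ε ∧ s 0 = x ∧ K.EndsWith e t s then
    K.orderBivector p t s else 0

theorem cornerForm_eq_add (t : T) (x : Fin 4) (e : E) (ε : ℤˣ) : K.cornerForm p t x e =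
    K.signedCornerForm p t x ε e + K.signedCornerForm p t x (-ε) e := by
  simp only [cornerForm, signedCornerForm, ← Finset.sum_add_distrib]
  refine Finset.sum_congr rfl fun s _ => ?_
  have hne : ε ≠ -ε := by
    intro h
    rcases Int.units_eq_one_or ε with h' | h' <;> rw [h'] at h <;> exact absurd h (by decide)
  by_cases hc : s 0 = x ∧ K.EndsWith e t s
  · have hor : Equiv.Perm.sign s = ε ∨ Equiv.Perm.sign s = -ε := by
      rcases Int.units_eq_one_or ε with h' | h' <;>
        rcases Int.units_eq_one_or (Equiv.Perm.sign s) with h | h <;> rw [h, h'] <;> decide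
    rcases hor with h | h
    · rw [if_pos hc, if_pos ⟨h, hc⟩, if_neg fun hh => hne (h.symm.trans hh.1), add_zero]
    · rw [if_pos hc, if_neg fun hh => hne (hh.1.symm.trans h), if_pos ⟨h, hc⟩, zero_add]
  · rw [if_neg hc, if_neg fun hh => hc hh.2, if_neg fun hh => hc hh.2, add_zero]

namespace FaceStar

variable {f : F} (σ : K.FaceStar f)

/-- Passage from the labels in the right tetrahedron to those in the left one. -/
def transfer : Equiv.Perm (Fin 4) := σ.lord * finRotate 4 * σ.rord⁻¹

theorem vert_transfer {i : Fin 4} (hi : i ≠ σ.rord 3) :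
    K.vert σ.left (σ.transfer i) = K.vert σ.right i := by
  obtain ⟨a, rfl⟩ : ∃ a, i = σ.rord a := ⟨σ.rord⁻¹ i, by simp⟩
  have ha : a ≠ 3 := fun h => hi (by rw [h])
  have e : σ.transfer (σ.rord a) = σ.lord (finRotate 4 a) := by simp [transfer]
  rw [e]
  fin_cases a
  · exact σ.vert_glue 0
  · exact σ.vert_glue 1
  · exact σ.vert_glue 2
  · exact absurd rfl ha

theorem edge_transfer {i j : Fin 4} (hi : i ≠ σ.rord 3) (hj : j ≠ σ.rord 3) (hij : i ≠ j) :
    K.edge σ.left (σ.transfer i) (σ.transfer j) = K.edge σ.right i j := by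
  obtain ⟨a, rfl⟩ : ∃ a, i = σ.rord a := ⟨σ.rord⁻¹ i, by simp⟩
  obtain ⟨b, rfl⟩ : ∃ b, j = σ.rord b := ⟨σ.rord⁻¹ j, by simp⟩
  have ha : a ≠ 3 := fun h => hi (by rw [h])
  have hb : b ≠ 3 := fun h => hj (by rw [h])
  have hab : a ≠ b := fun h => hij (by rw [h])
  have e : ∀ a, σ.transfer (σ.rord a) = σ.lord (finRotate 4 a) := fun a => by simp [transfer]
  have hs : ∀ a : Fin 4, a ≠ 3 → ∃ a' : Fin 3, a = a'.castSucc ∧ finRotate 4 a = a'.succ := by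
    decide
  obtain ⟨a', rfl, h1⟩ := hs a ha
  obtain ⟨b', rfl, h2⟩ := hs b hb
  rw [e, e, h1, h2]
  exact σ.edge_glue a' b' fun h => hab (by rw [h])

/-- The passage between the two labellings of a face has sign opposite to the product of the signs
of the two orderings, since the cyclic shift of four letters is odd. The gluing reverses
orientation: right-oriented orderings on one side correspond to left-oriented ones on the other. -/
theorem signedCornerForm_right (ε : ℤˣ) (e : E) :
    K.signedCornerForm p σ.right (σ.rord 3) ε e =
      K.signedCornerForm p σ.left (σ.lord 0)
        (-(Equiv.Perm.sign σ.lord * Equiv.Perm.sign σ.rord * ε)) e := by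
  classical
  refine Fintype.sum_equiv (Equiv.mulLeft σ.transfer) _ _ fun s => ?_
  have hsign : Equiv.Perm.sign (σ.transfer * s) =
      -(Equiv.Perm.sign σ.lord * Equiv.Perm.sign σ.rord * Equiv.Perm.sign s) := by
    rw [transfer, Equiv.Perm.sign_mul, Equiv.Perm.sign_mul, Equiv.Perm.sign_mul,
      Equiv.Perm.sign_inv, sign_finRotate, show ((-1 : ℤˣ) ^ 3) = -1 by decide]
    simp [mul_assoc]
  have h0 : (σ.transfer * s) 0 = σ.lord 0 ↔ s 0 = σ.rord 3 := by
    have : σ.transfer (σ.rord 3) = σ.lord 0 := by simp [transfer]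
    rw [← this, Equiv.Perm.mul_apply, σ.transfer.injective.eq_iff]
  rw [Equiv.coe_mulLeft]
  by_cases hs : s 0 = σ.rord 3
  · have hn : ∀ i, i ≠ 0 → s i ≠ σ.rord 3 := fun i hi h => hi (s.injective (h.trans hs.symm))
    have v : ∀ i, i ≠ 0 → K.vert σ.left ((σ.transfer * s) i) = K.vert σ.right (s i) := fun i hi =>
      σ.vert_transfer (hn i hi)
    have ed : K.edge σ.left ((σ.transfer * s) 2) ((σ.transfer * s) 3) =
        K.edge σ.right (s 2) (s 3) :=
      σ.edge_transfer (hn 2 (by decide)) (hn 3 (by decide)) (s.injective.ne (by decide))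
    have hb : K.orderBivector p σ.left (σ.transfer * s) = K.orderBivector p σ.right s := by
      rw [orderBivector, orderBivector, v 1 (by decide), v 2 (by decide), v 3 (by decide)]
    have he : K.EndsWith e σ.left (σ.transfer * s) ↔ K.EndsWith e σ.right s := by
      rw [EndsWith, EndsWith, ed, v 2 (by decide), v 3 (by decide)]
    rw [hb, hsign]
    refine if_congr ?_ rfl rfl
    rw [h0, he, neg_inj, mul_right_inj]
  · rw [if_neg fun h => hs h.2.1, if_neg fun h => hs (h0.1 h.2.1)]

theorem cornerForm_right (e : E) :
    K.cornerForm p σ.right (σ.rord 3) e = K.cornerForm p σ.left (σ.lord 0) e := by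
  rw [cornerForm_eq_add _ _ _ 1, cornerForm_eq_add σ.left _ _
    (-(Equiv.Perm.sign σ.lord * Equiv.Perm.sign σ.rord * 1)), signedCornerForm_right,
    signedCornerForm_right]
  congr 2
  simp

theorem cornerForm_eq (σ : K.FaceStar f) {t : T} {x : Fin 4} (h : K.face t x = f) (e : E) :
    K.cornerForm p t x e = K.cornerForm p σ.left (σ.lord 0) e := by
  rcases σ.covers t x h with ⟨rfl, rfl⟩ | ⟨rfl, rfl⟩
  · rfl
  · exact σ.cornerForm_right e

/-- The right-oriented orderings of the two tetrahedra at the face are together all orderings of one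
of them. The column of a face can thus be computed from whichever tetrahedron is more convenient,
without orientations. -/
theorem curvature_face (σ : K.FaceStar f) [Fintype T] [DecidableEq E] [DecidableEq F] {t : T} {x : Fin 4}
    (h : K.face t x = f) (e : E) :
    K.curvature p e (Pi.single (Sum.inr f) 1) = K.cornerForm p t x e := by
  classical
  rw [σ.cornerForm_eq h, cornerForm_eq_add _ _ _ (K.ori σ.left), curvature]
  -- The left-oriented orderings of the left tetrahedron stand for the right-oriented ones of the
  -- right tetrahedron.
  have hr : K.signedCornerForm p σ.left (σ.lord 0) (-K.ori σ.left) e =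
      K.signedCornerForm p σ.right (σ.rord 3) (K.ori σ.right) e := by
    rw [signedCornerForm_right, σ.left_oriented, σ.right_oriented, mul_assoc,
      Int.units_mul_self, mul_one]
  rw [hr, Fintype.sum_eq_add σ.left σ.right σ.left_ne_right]
  · congr 1
    · refine Finset.sum_congr rfl fun s _ => ?_
      rw [flagForm_single_face]
      have hf : K.face σ.left (s 0) = f ↔ s 0 = σ.lord 0 := by
        constructor
        · intro hs
          rcases σ.covers _ _ hs with h | h
          · exact h.2
          · exact absurd h.1 σ.left_ne_right
        · intro hs; rw [hs, σ.left_face]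
      rw [← ite_and]
      refine if_congr ?_ rfl rfl
      rw [hf, IsFlag, EndsWith]
      tauto
    · refine Finset.sum_congr rfl fun s _ => ?_
      rw [flagForm_single_face]
      have hf : K.face σ.right (s 0) = f ↔ s 0 = σ.rord 3 := by
        constructor
        · intro hs
          rcases σ.covers _ _ hs with h | h
          · exact absurd h.1.symm σ.left_ne_right
          · exact h.2
        · intro hs; rw [hs, σ.right_face]
      rw [← ite_and]
      refine if_congr ?_ rfl rfl
      rw [hf, IsFlag, EndsWith]
      tauto
  · rintro t' ⟨h1, h2⟩
    refine Finset.sum_eq_zero fun s _ => ?_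
    rw [flagForm_single_face]
    have : K.face t' (s 0) ≠ f := by
      intro hs
      rcases σ.covers _ _ hs with h | h
      · exact h1 h.1
      · exact h2 h.1
    simp [this]

end FaceStar

/-- Three of the four labels being prescribed, a single ordering contributes. -/
theorem cornerForm_eq_orderBivector {t : T} (hv : Function.Injective (K.vert t)) {e : E}
    {s : Equiv.Perm (Fin 4)} (hs : K.EndsWith e t s) :
    K.cornerForm p t (s 0) e = K.orderBivector p t s := by
  classical
  rw [cornerForm, Finset.sum_eq_single s]
  · rw [if_pos ⟨rfl, hs⟩]
  · rintro s' - hne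
    rw [if_neg]
    rintro ⟨h0, -, h2, h3⟩
    apply hne
    have e2 : s' 2 = s 2 := hv (h2.trans hs.2.1.symm)
    have e3 : s' 3 = s 3 := hv (h3.trans hs.2.2.symm)
    have key : ∀ τ : Equiv.Perm (Fin 4), τ 0 = 0 → τ 2 = 2 → τ 3 = 3 → τ = 1 := by decide
    have := key (s⁻¹ * s') (by simp [h0]) (by simp [e2]) (by simp [e3])
    exact (inv_mul_eq_one.1 this).symm
  · simp

theorem cornerForm_eq_zero {t : T} {x : Fin 4} {e : E}
    (h : ∀ s : Equiv.Perm (Fin 4), s 0 = x → ¬ K.EndsWith e t s) : K.cornerForm p t x e = 0 := by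
  classical
  rw [cornerForm]
  exact Finset.sum_eq_zero fun s _ => if_neg fun hs => h s hs.1 hs.2

/-- Antisymmetric matrices annihilating the direction of the edge `e`. -/
def IsEdgeBivector (K : TetComplex V E F T) (p : V → R4) (e : E)
    (B : Matrix (Fin 4) (Fin 4) ℝ) : Prop :=
  Bᵀ = -B ∧ B *ᵥ ⇑(p (K.tgt e) - p (K.src e)) = 0

theorem isEdgeBivector_cornerForm (t : T) (x : Fin 4) (e : E) :
    K.IsEdgeBivector p e (K.cornerForm p t x e) := by
  classical
  constructor
  · rw [cornerForm, Matrix.transpose_sum, ← Finset.sum_neg_distrib]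
    refine Finset.sum_congr rfl fun s _ => ?_
    split_ifs
    · exact faceBivector_transpose _ _ _
    · simp
  · rw [cornerForm, Matrix.sum_mulVec]
    refine Finset.sum_eq_zero fun s _ => ?_
    split_ifs with h
    · rw [← h.2.2.1, ← h.2.2.2]
      exact faceBivector_mulVec _ _ _
    · simp

theorem orderBivector_swap_two_three (t : T) (s : Equiv.Perm (Fin 4)) :
    K.orderBivector p t (s * Equiv.swap 2 3) = -K.orderBivector p t s :=
  faceBivector_swap _ _ _

theorem orderBivector_swap_one_three (t : T) (s : Equiv.Perm (Fin 4)) :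
    K.orderBivector p t (s * Equiv.swap 1 3) = -K.orderBivector p t s :=
  faceBivector_reverse _ _ _

/-- A face contributes one and the same bivector to its three edges when they are directed around
its boundary. At each vertex one edge enters and one leaves, so the contributions to `dρ` cancel. -/
theorem sum_cornerForm [Fintype E] [DecidableEq V] (hK : K.IsRegular) {t : T}
    (hv : Function.Injective (K.vert t)) (x : Fin 4) (v : V) :
    ∑ e, ((if K.src e = v then (1 : ℝ) else 0) - (if K.tgt e = v then 1 else 0)) •
      K.cornerForm p t x e = 0 := by
  classical
  let B := K.orderBivector p t
  let D : Equiv.Perm (Fin 4) → Prop := fun s =>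
    K.src (K.edge t (s 2) (s 3)) = K.vert t (s 2) ∧ K.tgt (K.edge t (s 2) (s 3)) = K.vert t (s 3)
  let h : Equiv.Perm (Fin 4) → Matrix (Fin 4) (Fin 4) ℝ := fun s =>
    if s 0 = x then ((if K.vert t (s 2) = v then (1 : ℝ) else 0) -
      (if K.vert t (s 3) = v then 1 else 0)) • B s else 0
  let g : Equiv.Perm (Fin 4) → Matrix (Fin 4) (Fin 4) ℝ := fun s =>
    if s 0 = x ∧ K.vert t (s 2) = v then B s else 0
  -- Orderings are paired by exchanging the two face vertices different from `v`; the bivector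
  -- changes sign.
  have hg : ∑ s, g s = 0 := by
    have h1 : ∑ s, g s = ∑ s, g (s * Equiv.swap 1 3) :=
      (Fintype.sum_equiv (Equiv.mulRight (Equiv.swap 1 3)) _ _ fun s => rfl).symm
    have h2 : ∀ s : Equiv.Perm (Fin 4), g (s * Equiv.swap 1 3) = -g s := by
      intro s
      have e0 : (s * Equiv.swap 1 3 : Equiv.Perm (Fin 4)) 0 = s 0 := rfl
      have e2 : (s * Equiv.swap 1 3 : Equiv.Perm (Fin 4)) 2 = s 2 := rfl
      simp only [g, e0, e2]
      split_ifs
      · exact K.orderBivector_swap_one_three t s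
      · simp
    simp only [h2, Finset.sum_neg_distrib] at h1
    exact matrix_eq_zero_of_eq_neg h1
  have hh : ∑ s, h s = 0 := by
    have h1 : ∀ s : Equiv.Perm (Fin 4), h s = g s + g (s * Equiv.swap 2 3) := by
      intro s
      have e0 : (s * Equiv.swap 2 3 : Equiv.Perm (Fin 4)) 0 = s 0 := rfl
      have e2 : (s * Equiv.swap 2 3 : Equiv.Perm (Fin 4)) 2 = s 3 := rfl
      have e3 : B (s * Equiv.swap 2 3) = -B s := K.orderBivector_swap_two_three t s
      simp only [g, h, e0, e2, e3]
      by_cases c0 : s 0 = x <;> by_cases c2 : K.vert t (s 2) = v <;>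
        by_cases c3 : K.vert t (s 3) = v <;> simp [c0, c2, c3]
    have h2 : ∑ s, g s = ∑ s, g (s * Equiv.swap 2 3) :=
      (Fintype.sum_equiv (Equiv.mulRight (Equiv.swap 2 3)) _ _ fun s => rfl).symm
    simp only [h1, Finset.sum_add_distrib, ← h2, hg, add_zero]
  -- Exactly one of two orderings differing in the direction of the last edge agrees with the chosen
  -- direction of that edge.
  have hD : ∀ s : Equiv.Perm (Fin 4), (if D s then h s else 0) +
      (if D (s * Equiv.swap 2 3) then h (s * Equiv.swap 2 3) else 0) = h s := by
    intro s
    have e2 : (s * Equiv.swap 2 3 : Equiv.Perm (Fin 4)) 2 = s 3 := rfl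
    have e3 : (s * Equiv.swap 2 3 : Equiv.Perm (Fin 4)) 3 = s 2 := rfl
    have e0 : (s * Equiv.swap 2 3 : Equiv.Perm (Fin 4)) 0 = s 0 := rfl
    have eB : B (s * Equiv.swap 2 3) = -B s := K.orderBivector_swap_two_three t s
    have eh : h (s * Equiv.swap 2 3) = h s := by
      simp only [h, e0, e2, e3, eB]
      split_ifs <;> simp
    have hne : K.vert t (s 2) ≠ K.vert t (s 3) := hv.ne (s.injective.ne (by decide))
    rw [eh]
    rcases hK.edge_ends t (s 2) (s 3) (s.injective.ne (by decide)) with h1 | h1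
    · have d1 : D s := h1
      have d2 : ¬ D (s * Equiv.swap 2 3) := fun h2 => by
        simp only [D, e2, e3] at h2
        rw [hK.edge_symm] at h2
        exact hne (h1.1.symm.trans h2.1)
      rw [if_pos d1, if_neg d2, add_zero]
    · have d1 : ¬ D s := fun h2 => hne (h2.1.symm.trans h1.1)
      have d2 : D (s * Equiv.swap 2 3) := by
        simp only [D, e2, e3]
        rw [hK.edge_symm]
        exact h1
      rw [if_neg d1, if_pos d2, zero_add]
  -- The sum over the agreeing orderings is half of the sum over all.
  have hsum : ∑ s, (if D s then h s else 0) = 0 := by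
    have h1 : ∑ s, (if D s then h s else 0) =
        ∑ s, (if D (s * Equiv.swap 2 3) then h (s * Equiv.swap 2 3) else 0) :=
      (Fintype.sum_equiv (Equiv.mulRight (Equiv.swap 2 3)) _ _ fun s => rfl).symm
    have h2 : ∑ s, (if D s then h s else 0) + ∑ s, (if D s then h s else 0) = 0 := by
      nth_rewrite 2 [h1]
      rw [← Finset.sum_add_distrib, Finset.sum_congr rfl fun s _ => hD s, hh]
    exact matrix_eq_zero_of_eq_neg (eq_neg_of_add_eq_zero_left h2)
  rw [← hsum]
  simp only [cornerForm, Finset.smul_sum]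
  rw [Finset.sum_comm]
  refine Finset.sum_congr rfl fun s _ => ?_
  rw [Finset.sum_eq_single (K.edge t (s 2) (s 3))]
  · by_cases hc : s 0 = x ∧ K.EndsWith (K.edge t (s 2) (s 3)) t s
    · have hd : D s := ⟨hc.2.2.1.symm, hc.2.2.2.symm⟩
      rw [if_pos hc, if_pos hd]
      simp only [h, if_pos hc.1, hd.1, hd.2, B]
    · rw [if_neg hc, smul_zero]
      by_cases hd : D s
      · rw [if_pos hd]
        have c0 : s 0 ≠ x := fun c0 => hc ⟨c0, rfl, hd.1.symm, hd.2.symm⟩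
        exact (if_neg c0).symm
      · rw [if_neg hd]
  · rintro e - hne
    rw [if_neg (fun hc : s 0 = x ∧ K.EndsWith e t s => hne hc.2.1.symm), smul_zero]
  · simp

end TetComplex

/-! ## Compositions of consecutive matrices -/

theorem sum_axisPos_skew {C : Matrix (Fin 4) (Fin 4) ℝ} (h : Cᵀ = -C)
    (h0 : C *ᵥ Pi.single 0 1 = 0) :
    ∑ m, C (axisPos m).1 (axisPos m).2 • skew (axisPos m).1 (axisPos m).2 = C := by
  have hs : ∀ i j, C j i = -C i j := fun i j => congrFun (congrFun h i) j
  have hc : ∀ i, C i 0 = 0 := by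
    intro i
    have := congrFun h0 i
    simpa using this
  have hr : ∀ i, C 0 i = 0 := by
    intro i
    rw [hs, hc, neg_zero]
  have hd : ∀ i, C i i = 0 := fun i => self_eq_neg.1 (hs i i)
  rw [Fin.sum_univ_three]
  ext i j
  fin_cases i <;> fin_cases j <;>
    simp [axisPos, skew, Matrix.single, hc, hr, hd, hs 1 2, hs 2 3, hs 1 3]

theorem sum_soPos_skew {C : Matrix (Fin 4) (Fin 4) ℝ} (h : Cᵀ = -C) :
    ∑ m, C (soPos m).1 (soPos m).2 • skew (soPos m).1 (soPos m).2 = C := by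
  have hs : ∀ i j, C j i = -C i j := fun i j => congrFun (congrFun h i) j
  have hd : ∀ i, C i i = 0 := fun i => self_eq_neg.1 (hs i i)
  rw [Fin.sum_univ_six]
  ext i j
  fin_cases i <;> fin_cases j <;>
    simp [soPos, skew, Matrix.single, hd, hs 0 1, hs 0 2, hs 0 3, hs 1 2, hs 2 3, hs 1 3]

theorem skew_transpose (i j : Fin 4) : (skew i j)ᵀ = -skew i j := by
  simp [skew]

theorem conj_transpose {B : Matrix (Fin 4) (Fin 4) ℝ} (h : Bᵀ = -B)
    (A : Matrix (Fin 4) (Fin 4) ℝ) : (A * B * Aᵀ)ᵀ = -(A * B * Aᵀ) := by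
  simp [Matrix.transpose_mul, h, mul_assoc]

theorem axisPos_skew_mulVec (m : Fin 3) :
    skew (axisPos m).1 (axisPos m).2 *ᵥ Pi.single 0 1 = 0 := by
  ext i
  fin_cases m <;> fin_cases i <;> simp [axisPos, skew, Matrix.single]

namespace Presentation

variable {V E F T : Type*} {K : TetComplex V E F T} {p : V → R4}

/-- The bivector of the `m`-th component in the given axes. -/
def axisBivector (A : Matrix (Fin 4) (Fin 4) ℝ) (m : Fin 3) : Matrix (Fin 4) (Fin 4) ℝ :=
  A * skew (axisPos m).1 (axisPos m).2 * Aᵀ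

theorem axisBivector_transpose (A : Matrix (Fin 4) (Fin 4) ℝ) (m : Fin 3) :
    (axisBivector A m)ᵀ = -axisBivector A m := conj_transpose (skew_transpose _ _) A

theorem sub_eq_axes (P : Presentation K p) (e : E) :
    (⇑(p (K.tgt e) - p (K.src e)) : Fin 4 → ℝ) =
      dist (p (K.src e)) (p (K.tgt e)) • (P.axes e *ᵥ Pi.single 0 1) := by
  rw [← mul_coordsIn (P.axes_mem e), P.axes_edge e, ← Matrix.mulVec_smul]
  congr 1
  ext i; fin_cases i <;> simp

theorem isEdgeBivector_axisBivector (P : Presentation K p) (e : E) (m : Fin 3) :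
    K.IsEdgeBivector p e (axisBivector (P.axes e) m) := by
  refine ⟨axisBivector_transpose _ _, ?_⟩
  rw [P.sub_eq_axes, axisBivector, Matrix.mulVec_smul, Matrix.mulVec_mulVec, mul_assoc,
    transpose_mul_of_mem (P.axes_mem e), mul_one, ← Matrix.mulVec_mulVec, axisPos_skew_mulVec,
    Matrix.mulVec_zero, smul_zero]

theorem dist_ne (P : Presentation K p) (hp : K.Nondeg p) (e : E) :
    dist (p (K.src e)) (p (K.tgt e)) ≠ 0 := by
  have σ := P.edgeStar e
  rw [← σ.src_eq ⟨0, σ.pos⟩, ← σ.tgt_eq ⟨0, σ.pos⟩]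
  exact dist_ne_zero.2 ((hp _).injective.ne ((σ.ord _).injective.ne (by decide)))

/-- An edge bivector is determined by its components. -/
theorem sum_component (P : Presentation K p) (hp : K.Nondeg p) {e : E}
    {B : Matrix (Fin 4) (Fin 4) ℝ} (hB : K.IsEdgeBivector p e B) :
    ∑ m, component (P.axes e) B m • axisBivector (P.axes e) m = B := by
  set A := P.axes e with hA
  have h1 := mul_transpose_of_mem (P.axes_mem e)
  rw [← hA] at h1
  have h2 : (Aᵀ * B * A)ᵀ = -(Aᵀ * B * A) := by
    have := conj_transpose hB.1 Aᵀ
    rwa [Matrix.transpose_transpose] at this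
  have h3 : (Aᵀ * B * A) *ᵥ Pi.single 0 1 = 0 := by
    have := hB.2
    rw [P.sub_eq_axes, Matrix.mulVec_smul, smul_eq_zero] at this
    rw [← Matrix.mulVec_mulVec, ← Matrix.mulVec_mulVec,
      this.resolve_left (P.dist_ne hp e), Matrix.mulVec_zero]
  have h4 := sum_axisPos_skew h2 h3
  have h5 : A * (Aᵀ * B * A) * Aᵀ = B := by
    calc _ = (A * Aᵀ) * B * (A * Aᵀ) := by simp only [mul_assoc]
      _ = B := by rw [h1, one_mul, mul_one]
  rw [← h4] at h5
  conv_rhs => rw [← h5]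
  rw [Matrix.mul_sum, Matrix.sum_mul]
  refine Finset.sum_congr rfl fun m _ => ?_
  rw [axisBivector, component, Matrix.mul_smul, Matrix.smul_mul]

section

variable [Fintype V] [Fintype E] [Fintype F] [Fintype T] [DecidableEq V] [DecidableEq E]
  [DecidableEq F]

theorem f₄_apply (P : Presentation K p) (v : V) (r : Fin 6) (e : E) (m : Fin 3) :
    P.f₄ (v, r) (e, m) = ((if K.src e = v then 1 else 0) - (if K.tgt e = v then 1 else 0)) *
      axisBivector (P.axes e) m (soPos r).1 (soPos r).2 := rfl

/-- In terms of bivectors `f₄` is a signed sum over edges; the axes in which the components were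
taken drop out. -/
theorem sum_f₄_component (P : Presentation K p) (hp : K.Nondeg p)
    {B : E → Matrix (Fin 4) (Fin 4) ℝ} (hB : ∀ e, K.IsEdgeBivector p e (B e)) (v : V) (r : Fin 6) :
    ∑ c : E × Fin 3, P.f₄ (v, r) c * component (P.axes c.1) (B c.1) c.2 =
      (∑ e, ((if K.src e = v then (1 : ℝ) else 0) - (if K.tgt e = v then 1 else 0)) • B e)
        (soPos r).1 (soPos r).2 := by
  rw [Fintype.sum_prod_type, Matrix.sum_apply]
  refine Finset.sum_congr rfl fun e _ => ?_
  conv_rhs => rw [← P.sum_component hp (hB e)]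
  rw [Matrix.smul_apply, Matrix.sum_apply, smul_eq_mul, Finset.mul_sum]
  refine Finset.sum_congr rfl fun m _ => ?_
  rw [f₄_apply, Matrix.smul_apply, smul_eq_mul]
  ring

theorem f₃_face (hK : K.IsRegular) (hp : K.Nondeg p) (P : Presentation K p) {t : T} {x : Fin 4}
    {f : F} (h : K.face t x = f) (e : E) (m : Fin 3) :
    P.f₃ (e, m) (Sum.inr f) = -component (P.axes e) (K.cornerForm p t x e) m := by
  rw [P.f₃_apply hK hp, (P.faceStar f).curvature_face h]

/-- Only columns of faces are needed: for the new faces this relation is part of `Extension`, and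
the columns of lengths are taken care of by the equivalence in `Extension.isComplex_iff`. -/
theorem sum_f₄_f₃_face (hK : K.IsRegular) (hp : K.Nondeg p) (P : Presentation K p) {t : T}
    {x : Fin 4} {f : F} (h : K.face t x = f) (r : V × Fin 6) :
    ∑ c, P.f₄ r c * P.f₃ c (Sum.inr f) = 0 := by
  have h1 : ∀ c, P.f₄ r c * P.f₃ c (Sum.inr f) =
      -(P.f₄ r c * component (P.axes c.1) (K.cornerForm p t x c.1) c.2) := by
    rintro ⟨e, m⟩
    rw [P.f₃_face hK hp h, mul_neg]
  obtain ⟨v, k⟩ := r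
  rw [Finset.sum_congr rfl fun c _ => h1 c, Finset.sum_neg_distrib,
    P.sum_f₄_component hp (fun e => K.isEdgeBivector_cornerForm t x e),
    K.sum_cornerForm hK (hp.injective t)]
  simp

theorem sum_ends (a b : V) (g : V → ℝ) :
    ∑ v, ((if a = v then (1 : ℝ) else 0) - (if b = v then 1 else 0)) * g v = g a - g b := by
  simp [sub_mul, Finset.sum_sub_distrib]

/-- A bivector at an edge enters `dρ` at the two ends with opposite signs, so it drops out of `dα`.
In `dβ` it is applied to the edge vector, which it annihilates. -/
theorem f₅_mul_f₄ (P : Presentation K p) : P.f₅ * P.f₄ = 0 := by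
  ext r c
  obtain ⟨e, n⟩ := c
  rw [Matrix.mul_apply, Fintype.sum_prod_type, Matrix.zero_apply]
  rcases r with m | k
  · have : ∀ v, ∑ r, P.f₅ (Sum.inl m) (v, r) * P.f₄ (v, r) (e, n) =
        ((if K.src e = v then 1 else 0) - (if K.tgt e = v then 1 else 0)) *
          (fun _ => axisBivector (P.axes e) n (soPos m).1 (soPos m).2) v := by
      intro v
      simp [f₅, f₄_apply]
    simp only [this]
    rw [sum_ends, sub_self]
  · have : ∀ v, ∑ r, P.f₅ (Sum.inr k) (v, r) * P.f₄ (v, r) (e, n) =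
        ((if K.src e = v then 1 else 0) - (if K.tgt e = v then 1 else 0)) *
          (fun v => (axisBivector (P.axes e) n *ᵥ ⇑(p v)) k) v := by
      intro v
      simp only
      conv_rhs => rw [← sum_soPos_skew (axisBivector_transpose (P.axes e) n)]
      rw [Matrix.sum_mulVec, Finset.sum_apply, Finset.mul_sum]
      refine Finset.sum_congr rfl fun r _ => ?_
      rw [f₄_apply, Matrix.smul_mulVec, Pi.smul_apply, smul_eq_mul]
      simp only [f₅, Matrix.of_apply, Sum.elim_inr]
      ring
    simp only [this]
    rw [sum_ends]
    have h2 := congrFun (P.isEdgeBivector_axisBivector e n).2 k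
    rw [show (⇑(p (K.tgt e) - p (K.src e)) : Fin 4 → ℝ) = ⇑(p (K.tgt e)) - ⇑(p (K.src e)) from rfl,
      Matrix.mulVec_sub, Pi.sub_apply, Pi.zero_apply] at h2
    linarith

/-- The field of displacements of a basic infinitesimal motion. -/
noncomputable def motion (P : Presentation K p) (c : Fin 4 ⊕ Fin 6) : V → R4 := fun v =>
  WithLp.toLp 2 fun j => P.f₁ (v, j) c

/-- A translation cancels in the difference of velocities, and an antisymmetric matrix maps a vector
to an orthogonal one. -/
theorem distDeriv_motion (P : Presentation K p) (a b : V) (c : Fin 4 ⊕ Fin 6) :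
    distDeriv p a b (P.motion c) = 0 := by
  rw [distDeriv_apply]
  have : inner ℝ (p a - p b) (P.motion c a - P.motion c b) = 0 := by
    rw [inner_eq_dotProduct]
    rcases c with k | m
    · have : (⇑(P.motion (Sum.inl k) a - P.motion (Sum.inl k) b) : Fin 4 → ℝ) = 0 := by
        ext j; simp [motion, f₁]
      rw [this, dotProduct_zero]
    · have h1 : (⇑(P.motion (Sum.inr m) a - P.motion (Sum.inr m) b) : Fin 4 → ℝ) =
          skew (soPos m).1 (soPos m).2 *ᵥ ⇑(p a - p b) := by
        ext j
        show P.f₁ (a, j) (Sum.inr m) - P.f₁ (b, j) (Sum.inr m) = _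
        rw [show (⇑(p a - p b) : Fin 4 → ℝ) = ⇑(p a) - ⇑(p b) from rfl, Matrix.mulVec_sub]
        rfl
      rw [h1]
      have h2 := Matrix.dotProduct_mulVec (⇑(p a - p b)) (skew (soPos m).1 (soPos m).2)
        (⇑(p a - p b))
      rw [← Matrix.mulVec_transpose, skew_transpose, Matrix.neg_mulVec, neg_dotProduct,
        dotProduct_comm (skew (soPos m).1 (soPos m).2 *ᵥ _)] at h2
      exact self_eq_neg.1 h2
  rw [this, mul_zero]

theorem f₂_apply_of_hasFDerivAt (P : Presentation K p) {r : E ⊕ F} {D : (V → R4) →L[ℝ] ℝ}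
    (h : HasFDerivAt (fun q : V → R4 => P.measure q r) D p) (c : V × Fin 4) :
    P.f₂ r c = D (Pi.single c.1 (EuclideanSpace.single c.2 1)) := by
  rw [f₂, Matrix.of_apply, h.fderiv]

theorem sum_single_eq (D : (V → R4) →L[ℝ] ℝ) (w : V → R4) :
    ∑ c : V × Fin 4, D (Pi.single c.1 (EuclideanSpace.single c.2 1)) * w c.1 c.2 = D w := by
  have h : w = ∑ c : V × Fin 4, w c.1 c.2 •
      (Pi.single c.1 (EuclideanSpace.single c.2 1) : V → R4) := by
    rw [Fintype.sum_prod_type]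
    ext v j
    rw [Finset.sum_apply]
    simp only [Finset.sum_apply, Pi.smul_apply, Pi.single_apply]
    rw [Finset.sum_eq_single v]
    · simp [Finset.sum_apply, Pi.single_apply]
    · intro b _ hb; simp [hb.symm]
    · simp
  conv_rhs => rw [h]
  rw [map_sum]
  refine Finset.sum_congr rfl fun c _ => ?_
  rw [map_smul, smul_eq_mul, mul_comm]

theorem hasFDerivAt_length (P : Presentation K p) (hp : K.Nondeg p) (e : E) :
    HasFDerivAt (fun q : V → R4 => P.measure q (Sum.inl e)) (distDeriv p (K.src e) (K.tgt e)) p :=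
  hasFDerivAt_dist (Or.inr (dist_ne_zero.1 (P.dist_ne hp e)))

/-- A row of `f₂` annihilates infinitesimal motions when it is a combination of differentials of
distances. -/
theorem sum_f₂_f₁ (P : Presentation K p) {r : E ⊕ F} {D : (V → R4) →L[ℝ] ℝ}
    (h : HasFDerivAt (fun q : V → R4 => P.measure q r) D p)
    (hD : ∀ v, (∀ i j, distDeriv p i j v = 0) → D v = 0) (c : Fin 4 ⊕ Fin 6) :
    ∑ k, P.f₂ r k * P.f₁ k c = 0 := by
  have h1 : ∀ k : V × Fin 4, P.f₁ k c = P.motion c k.1 k.2 := fun k => rfl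
  simp only [P.f₂_apply_of_hasFDerivAt h, h1]
  rw [sum_single_eq]
  exact hD _ fun i j => P.distDeriv_motion i j c

end

end Presentation

/-! ## Change of axes -/

theorem wedge_transpose (x y : Fin 4 → ℝ) : (wedge x y)ᵀ = -wedge x y := by
  ext i j; simp [wedge, Matrix.vecMulVec]; ring

theorem inner_perp_self (u v : R4) : inner ℝ (perp u v) u = 0 := by
  by_cases h0 : u = 0
  · simp [h0]
  have hu0 : inner ℝ u u ≠ 0 := inner_self_ne_zero.2 h0
  rw [perp, inner_sub_left, inner_smul_left, real_inner_comm]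
  simp only [conj_trivial]
  field_simp
  ring

theorem wedge_mulVec_of_inner_eq_zero {u v w : R4} (hu : inner ℝ u w = 0) (hv : inner ℝ v w = 0) :
    wedge ⇑u ⇑v *ᵥ ⇑w = 0 := by
  rw [inner_eq_dotProduct] at hu hv
  rw [wedge, Matrix.sub_mulVec, Matrix.vecMulVec_mulVec, Matrix.vecMulVec_mulVec, hu, hv]
  simp

theorem dihedralBivector_transpose (a₁ a₂ b c : R4) :
    (dihedralBivector a₁ a₂ b c)ᵀ = -dihedralBivector a₁ a₂ b c := by
  rw [dihedralBivector, Matrix.transpose_smul, wedge_transpose, smul_neg]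

theorem dihedralBivector_mulVec (a₁ a₂ b c : R4) : dihedralBivector a₁ a₂ b c *ᵥ ⇑(c - b) = 0 := by
  rw [dihedralBivector, Matrix.smul_mulVec,
    wedge_mulVec_of_inner_eq_zero (inner_perp_self _ _) (inner_perp_self _ _), smul_zero]

theorem TetComplex.isEdgeBivector_curvature {V E F T : Type*} [Fintype T] {K : TetComplex V E F T}
    {p : V → R4} (e : E) (y : E ⊕ F → ℝ) : K.IsEdgeBivector p e (K.curvature p e y) := by
  classical
  constructor
  · simp only [curvature, Matrix.transpose_sum, ← Finset.sum_neg_distrib]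
    refine Finset.sum_congr rfl fun t _ => Finset.sum_congr rfl fun s _ => ?_
    split_ifs
    · rw [flagForm, Matrix.transpose_add, Matrix.transpose_smul, Matrix.transpose_smul,
        dihedralBivector_transpose, faceBivector_transpose]
      module
    · simp
  · simp only [curvature, Matrix.sum_mulVec]
    refine Finset.sum_eq_zero fun t _ => Finset.sum_eq_zero fun s _ => ?_
    split_ifs with h
    · rw [flagForm, ← h.2.2.1, ← h.2.2.2, Matrix.add_mulVec, Matrix.smul_mulVec,
        Matrix.smul_mulVec, dihedralBivector_mulVec, faceBivector_mulVec]
      simp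
    · simp

theorem trace_mul_skew {B : Matrix (Fin 4) (Fin 4) ℝ} (h : Bᵀ = -B) (i j : Fin 4) :
    (B * skew i j).trace = -2 * B i j := by
  have hs : B j i = -B i j := congrFun (congrFun h i) j
  rw [skew, mul_sub, Matrix.trace_sub, Matrix.trace_mul_comm B, Matrix.trace_mul_comm B,
    Matrix.trace_single_mul, Matrix.trace_single_mul, hs]
  simp; ring

/-- The components of a combination of bivectors. -/
theorem Presentation.component_sum {ι : Type*} (s : Finset ι) (A : Matrix (Fin 4) (Fin 4) ℝ)
    (r : ι → ℝ) (B : ι → Matrix (Fin 4) (Fin 4) ℝ) (m : Fin 3) :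
    Presentation.component A (∑ i ∈ s, r i • B i) m =
      ∑ i ∈ s, r i * Presentation.component A (B i) m := by
  simp only [Presentation.component, Matrix.mul_sum, Matrix.sum_mul, Matrix.sum_apply,
    Matrix.mul_smul, Matrix.smul_mul, Matrix.smul_apply, smul_eq_mul]

theorem LiftChain.exists_of_change {I₀ I₁ I₂ I₃ I₄ I₅ J₁ J₂ J₃ J₄ : Type*} [Fintype I₀]
    [Fintype I₁] [Fintype I₂] [Fintype I₃] [Fintype I₄] [Fintype I₅] [Fintype J₁] [Fintype J₂]
    [Fintype J₃] [Fintype J₄] [DecidableEq I₀] [DecidableEq I₁] [DecidableEq I₂] [DecidableEq I₃]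
    [DecidableEq I₄] [DecidableEq I₅] [DecidableEq J₁] [DecidableEq J₂] [DecidableEq J₃]
    [DecidableEq J₄] {g₁ : Matrix I₁ I₀ ℝ} {g₂ : Matrix I₂ I₁ ℝ} {g₃ : Matrix I₃ I₂ ℝ}
    {g₄ : Matrix I₄ I₃ ℝ} {g₅ : Matrix I₅ I₄ ℝ} {c₁ : UnitChange I₁ J₁} {c₂ : UnitChange I₂ J₂}
    {c₃ : UnitChange I₃ J₃} {c₄ : UnitChange I₄ J₄} {k₁ : Matrix J₁ I₀ ℝ} {k₂ : Matrix J₂ J₁ ℝ}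
    {k₃ : Matrix J₃ J₂ ℝ} {k₄ : Matrix J₄ J₃ ℝ} {k₅ : Matrix I₅ J₄ ℝ}
    (h₁ : c₁.W * g₁ = k₁) (h₂ : c₂.W * g₂ * c₁.U = k₂) (h₃ : c₃.W * g₃ * c₂.U = k₃)
    (h₄ : c₄.W * g₄ * c₃.U = k₄) (h₅ : g₅ * c₄.U = k₅) (d : LiftChain k₁ k₂ k₃ k₄ k₅) :
    ∃ d' : LiftChain g₁ g₂ g₃ g₄ g₅, d'.torsion = d.torsion := by
  subst h₁ h₂ h₃ h₄ h₅
  exact d.exists_change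

namespace Presentation

variable {V E F T : Type*} {K : TetComplex V E F T} {p : V → R4}

/-- Up to the factor `-1/2` both sides are the trace of the product of the two bivectors. -/
theorem component_axisBivector_comm (A A' : Matrix (Fin 4) (Fin 4) ℝ) (m m' : Fin 3) :
    component A (axisBivector A' m') m = component A' (axisBivector A m) m' := by
  have key : ∀ (A A' : Matrix (Fin 4) (Fin 4) ℝ) (m m' : Fin 3),
      -2 * component A (axisBivector A' m') m =
        (axisBivector A' m' * axisBivector A m).trace := by
    intro A A' m m'
    have h := conj_transpose (axisBivector_transpose A' m') Aᵀ
    rw [Matrix.transpose_transpose] at h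
    rw [component, ← trace_mul_skew h, Matrix.mul_assoc, Matrix.trace_mul_comm,
      Matrix.trace_mul_comm (axisBivector A' m'), axisBivector, axisBivector]
    have e1 : A * skew (axisPos m).1 (axisPos m).2 * (Aᵀ * (A' * skew (axisPos m').1 (axisPos m').2 * A'ᵀ)) =
        A * skew (axisPos m).1 (axisPos m).2 * Aᵀ * (A' * skew (axisPos m').1 (axisPos m').2 * A'ᵀ) := by
      simp only [mul_assoc]
    rw [e1]
  have h1 := key A A' m m'
  have h2 := key A' A m' m
  rw [Matrix.trace_mul_comm] at h2
  linarith

theorem component_axisBivector_self {A : Matrix (Fin 4) (Fin 4) ℝ}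
    (hA : A ∈ Matrix.specialOrthogonalGroup (Fin 4) ℝ) (m m' : Fin 3) :
    component A (axisBivector A m') m = if m = m' then 1 else 0 := by
  have h := transpose_mul_of_mem hA
  have e1 : Aᵀ * (A * skew (axisPos m').1 (axisPos m').2 * Aᵀ) * A =
      (Aᵀ * A) * skew (axisPos m').1 (axisPos m').2 * (Aᵀ * A) := by simp only [mul_assoc]
  rw [component, axisBivector, e1, h, one_mul, mul_one]
  fin_cases m <;> fin_cases m' <;> simp [axisPos, skew, Matrix.single]

/-- The presentation with other axes for the components of deficit angles. -/
def withAxes (P : Presentation K p) (A : E → Matrix (Fin 4) (Fin 4) ℝ)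
    (h₁ : ∀ e, A e ∈ Matrix.specialOrthogonalGroup (Fin 4) ℝ)
    (h₂ : ∀ e, coordsIn (A e) (p (K.tgt e) - p (K.src e)) =
      ![dist (p (K.src e)) (p (K.tgt e)), 0, 0, 0]) : Presentation K p :=
  { P with axes := A, axes_mem := h₁, axes_edge := h₂ }

variable [Fintype V] [Fintype E] [Fintype F] [Fintype T] [DecidableEq V] [DecidableEq E]
  [DecidableEq F]

/-- The matrix passing from components in the axes of `P'` to those in the axes of `P`. -/
def axesMatrix (P P' : Presentation K p) : Matrix (E × Fin 3) (E × Fin 3) ℝ :=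
  Matrix.of fun r c => if r.1 = c.1 then
    component (P.axes r.1) (axisBivector (P'.axes c.1) c.2) r.2 else 0

theorem axesMatrix_transpose (P P' : Presentation K p) :
    (axesMatrix P P')ᵀ = axesMatrix P' P := by
  ext ⟨e, m⟩ ⟨e', m'⟩
  simp only [axesMatrix, Matrix.transpose_apply, Matrix.of_apply]
  by_cases h : e = e'
  · subst h
    rw [if_pos rfl, if_pos rfl, component_axisBivector_comm]
  · rw [if_neg h, if_neg (Ne.symm h)]

theorem axesMatrix_mul_apply (P P' : Presentation K p) {J : Type*} (N : Matrix (E × Fin 3) J ℝ)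
    (e : E) (m : Fin 3) (j : J) : (axesMatrix P P' * N) (e, m) j =
      ∑ m', component (P.axes e) (axisBivector (P'.axes e) m') m * N (e, m') j := by
  rw [Matrix.mul_apply, Fintype.sum_prod_type, Finset.sum_eq_single e]
  · simp [axesMatrix]
  · intro e' _ hne
    simp [axesMatrix, hne.symm]
  · simp

theorem axesMatrix_mul (hp : K.Nondeg p) (P P' : Presentation K p) :
    axesMatrix P P' * axesMatrix P' P = 1 := by
  ext ⟨e, m⟩ ⟨e', m'⟩
  rw [axesMatrix_mul_apply]
  by_cases h : e = e'
  · subst h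
    have h1 := component_sum Finset.univ (P.axes e)
      (fun k => component (P'.axes e) (axisBivector (P.axes e) m') k)
      (fun k => axisBivector (P'.axes e) k) m
    rw [P'.sum_component hp (P.isEdgeBivector_axisBivector e m'),
      component_axisBivector_self (P.axes_mem e)] at h1
    simp only [axesMatrix, Matrix.of_apply, if_true]
    rw [Matrix.one_apply]
    simp only [Prod.mk.injEq, true_and]
    rw [h1]
    exact Finset.sum_congr rfl fun k _ => mul_comm _ _
  · simp [axesMatrix, h]

/-- The change of basis in the space of deficit angles caused by a change of axes. -/
def axesUnitChange (hp : K.Nondeg p) (P P' : Presentation K p) :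
    UnitChange (E × Fin 3) (E × Fin 3) :=
  UnitChange.ofEquiv (Equiv.refl _) (axesMatrix P P') (axesMatrix P' P) (axesMatrix_mul hp P P') (by
    have h := congrArg Matrix.det (axesMatrix_mul hp P P')
    rw [← axesMatrix_transpose P P', Matrix.det_mul, Matrix.det_transpose, Matrix.det_one] at h
    have := abs_mul_abs_self (axesMatrix P P').det
    rw [h] at this
    nlinarith [abs_nonneg (axesMatrix P P').det])

/-- The weight by which the torsion is multiplied. -/
noncomputable def weight (P : Presentation K p) : ℝ :=
  (∏ e : E, P.length e p ^ 3) / ∏ f : F, P.doubleArea f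

/-- A change of axes is an orthogonal change of basis in the space of deficit angles, mapping `f₃`
and `f₄` accordingly. It allows the old edges to be given the same axes in both complexes. -/
theorem withAxes_iff (hK : K.IsRegular) (hp : K.Nondeg p) (P : Presentation K p)
    (A : E → Matrix (Fin 4) (Fin 4) ℝ)
    (h₁ : ∀ e, A e ∈ Matrix.specialOrthogonalGroup (Fin 4) ℝ)
    (h₂ : ∀ e, coordsIn (A e) (p (K.tgt e) - p (K.src e)) =
      ![dist (p (K.src e)) (p (K.tgt e)), 0, 0, 0]) :
    (P.Acyclic ↔ (P.withAxes A h₁ h₂).Acyclic) ∧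
      ∀ I, P.Acyclic → (P.withAxes A h₁ h₂).HasInvariant I → P.HasInvariant I := by
  set P' := P.withAxes A h₁ h₂ with hP'
  let c₃ := axesUnitChange hp P P'
  have e3 : c₃.W * P.f₃ = P'.f₃ := by
    ext ⟨e, m⟩ r
    show (axesMatrix P' P * P.f₃) _ _ = _
    rw [axesMatrix_mul_apply, P'.f₃_apply hK hp]
    have hB : K.IsEdgeBivector p e (K.curvature p e (Pi.single r 1)) :=
      K.isEdgeBivector_curvature e _
    have h1 := component_sum Finset.univ (P'.axes e)
      (fun k => component (P.axes e) (K.curvature p e (Pi.single r 1)) k)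
      (fun k => axisBivector (P.axes e) k) m
    rw [P.sum_component hp hB] at h1
    rw [h1, ← Finset.sum_neg_distrib]
    refine Finset.sum_congr rfl fun k _ => ?_
    rw [P.f₃_apply hK hp]
    ring
  have e4 : P.f₄ * c₃.U = P'.f₄ := by
    ext ⟨v, k⟩ ⟨e, m⟩
    show (P.f₄ * axesMatrix P P') _ _ = _
    have h1 := P.sum_component hp (P'.isEdgeBivector_axisBivector e m)
    have h2 := congrFun (congrFun h1 (soPos k).1) (soPos k).2
    rw [P'.f₄_apply, ← h2, Matrix.sum_apply, Finset.mul_sum, Matrix.mul_apply,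
      Fintype.sum_prod_type, Finset.sum_eq_single e]
    · refine Finset.sum_congr rfl fun j _ => ?_
      rw [P.f₄_apply, Matrix.smul_apply, smul_eq_mul]
      simp only [axesMatrix, Matrix.of_apply, if_true]
      ring
    · intro e' _ hne
      refine Finset.sum_eq_zero fun j _ => ?_
      simp [axesMatrix, hne]
    · simp
  have a1 : (UnitChange.refl (V × Fin 4)).W * P.f₁ = P'.f₁ := Matrix.one_mul _
  have a2 : (UnitChange.refl (E ⊕ F)).W * P.f₂ * (UnitChange.refl (V × Fin 4)).U = P'.f₂ := by
    rw [UnitChange.refl, UnitChange.refl, Matrix.one_mul, Matrix.mul_one]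
    rfl
  have a3 : c₃.W * P.f₃ * (UnitChange.refl (E ⊕ F)).U = P'.f₃ := by
    rw [UnitChange.refl, Matrix.mul_one, e3]
  have a4 : (UnitChange.refl (V × Fin 6)).W * P.f₄ * c₃.U = P'.f₄ := by
    rw [UnitChange.refl, Matrix.one_mul, e4]
  have a5 : P.f₅ * (UnitChange.refl (V × Fin 6)).U = P'.f₅ := Matrix.mul_one _
  have hiff := ExactSeq.change_iff P.f₁ P.f₂ P.f₃ P.f₄ P.f₅ (UnitChange.refl _)
    (UnitChange.refl _) c₃ (UnitChange.refl _)
  rw [a1, a2, a3, a4, a5] at hiff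
  refine ⟨hiff, ?_⟩
  rintro I hac ⟨t, ht, rfl⟩
  obtain ⟨d⟩ := (hiff.1 hac).nonempty_liftChain
  have h1 := (hiff.1 hac).hasTorsion d
  obtain ⟨c⟩ := ht.1
  have ht' : t = d.torsion := (ht.2 c).symm.trans (h1.2 c)
  obtain ⟨d', hd'⟩ := LiftChain.exists_of_change a1 a2 a3 a4 a5 d
  exact ⟨t, by rw [ht', ← hd']; exact ExactSeq.hasTorsion hac d', rfl⟩

/-- Two complexes of which one becomes an extension of the other after a unimodular change of
bases, in such a way that the change of the torsion is compensated by the weights. -/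
theorem invariant_of_extension {V' E' F' T' : Type*} {K' : TetComplex V' E' F' T'} {p' : V' → R4}
    [Fintype V'] [Fintype E'] [Fintype F'] [DecidableEq V'] [DecidableEq E'] [DecidableEq F']
    {J₁ J₂ Q J₃ J₄ : Type*} [Fintype J₁] [Fintype J₂] [Fintype Q]
    [Fintype J₃] [Fintype J₄] [DecidableEq J₁] [DecidableEq J₂] [DecidableEq Q] [DecidableEq J₃]
    [DecidableEq J₄] (P : Presentation K p) (P' : Presentation K' p')
    (x : Extension P.f₁ P.f₄ P.f₅ J₁ J₂ Q J₃ J₄)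
    (c₁ : UnitChange (V' × Fin 4) (V × Fin 4 ⊕ J₁))
    (c₂ : UnitChange (E' ⊕ F') ((E ⊕ F) ⊕ (J₂ ⊕ Q)))
    (c₃ : UnitChange (E' × Fin 3) (E × Fin 3 ⊕ J₃))
    (c₄ : UnitChange (V' × Fin 6) (V × Fin 6 ⊕ J₄))
    (h₁ : c₁.W * P'.f₁ = x.G₁) (h₂ : c₂.W * P'.f₂ * c₁.U = x.G₂ P.f₂)
    (h₃ : c₃.W * P'.f₃ * c₂.U = x.G₃ P.f₃) (h₄ : c₄.W * P'.f₄ * c₃.U = x.G₄)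
    (h₅ : P'.f₅ * c₄.U = x.G₅) (h0 : P.weight ≠ 0)
    (hw : absDet x.M * absDet (x.Z * x.S) / absDet (Matrix.fromCols x.N x.S) * P'.weight =
      P.weight) :
    (P.Acyclic ↔ P'.Acyclic) ∧
      (P.Acyclic → ∃ I : ℝ, I ≠ 0 ∧ P.HasInvariant I ∧ P'.HasInvariant I) := by
  have hiff := ExactSeq.change_iff P'.f₁ P'.f₂ P'.f₃ P'.f₄ P'.f₅ c₁ c₂ c₃ c₄
  have hiff' : P.Acyclic ↔ P'.Acyclic := by
    rw [Acyclic, Acyclic, hiff, h₁, h₂, h₃, h₄, h₅, x.exactSeq_iff]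
  refine ⟨hiff', fun hac => ?_⟩
  obtain ⟨d⟩ := ExactSeq.nonempty_liftChain hac
  obtain ⟨d', hd'⟩ := x.exists_liftChain d
  obtain ⟨d'', hd''⟩ : ∃ d'' : LiftChain P'.f₁ P'.f₂ P'.f₃ P'.f₄ P'.f₅,
      d''.torsion = d'.torsion := LiftChain.exists_of_change h₁ h₂ h₃ h₄ h₅ d'
  refine ⟨d.torsion * P.weight, mul_ne_zero d.torsion_pos.ne' h0,
    ⟨_, ExactSeq.hasTorsion hac d, rfl⟩,
    ⟨_, ExactSeq.hasTorsion (hiff'.1 hac) d'', ?_⟩⟩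
  rw [hd'', hd', mul_assoc, ← weight, hw]

end Presentation

/-! ## Insertion of a vertex -/

/-- A renumbering of the basis after a unipotent transformation `1 - C * D`. -/
def UnitChange.unipotent {I J k : Type*} [Fintype I] [Fintype J] [Fintype k] [DecidableEq I]
    [DecidableEq J] [DecidableEq k] (e : J ≃ I) (C : Matrix J k ℝ) (D : Matrix k J ℝ)
    (h : D * C = 0) : UnitChange I J :=
  UnitChange.ofEquiv e ((1 - C * D).submatrix e.symm e.symm) ((1 + C * D).submatrix e.symm e.symm)
    (by
      rw [Matrix.submatrix_mul_equiv]
      have : (1 - C * D) * (1 + C * D) = 1 := by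
        have h2 : C * D * (C * D) = 0 := by
          rw [← Matrix.mul_assoc, Matrix.mul_assoc C, h, Matrix.mul_zero, Matrix.zero_mul]
        rw [sub_mul, mul_add, one_mul, mul_add, h2]
        simp
      rw [this, Matrix.submatrix_one_equiv])
    (by
      rw [Matrix.det_submatrix_equiv_self, sub_eq_add_neg, ← Matrix.neg_mul,
        Matrix.det_one_add_mul_comm, Matrix.mul_neg, h]
      simp)

section Unipotent

variable {I J k m : Type*} [Fintype I] [Fintype J] [Fintype k] [Fintype m] [DecidableEq I]
    [DecidableEq J] [DecidableEq k] [DecidableEq m]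

theorem UnitChange.unipotent_W_mul (e : J ≃ I) (C : Matrix J k ℝ) (D : Matrix k J ℝ)
    (h : D * C = 0) (g : Matrix I m ℝ) :
    (UnitChange.unipotent e C D h).W * g = (1 + C * D) * g.submatrix e id := by
  ext i j
  simp only [unipotent, ofEquiv, Matrix.mul_apply, Matrix.submatrix_apply, id,
    Equiv.symm_apply_apply]
  exact (Fintype.sum_equiv e _ _ fun x => by simp).symm

theorem UnitChange.mul_unipotent_U (e : J ≃ I) (C : Matrix J k ℝ) (D : Matrix k J ℝ)
    (h : D * C = 0) (g : Matrix m I ℝ) :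
    g * (UnitChange.unipotent e C D h).U = g.submatrix id e * (1 - C * D) := by
  ext i j
  simp only [unipotent, ofEquiv, Matrix.mul_apply, Matrix.submatrix_apply, id,
    Equiv.symm_apply_apply]
  exact (Fintype.sum_equiv e _ _ fun x => by simp).symm

/-- A renumbering of the basis. -/
def UnitChange.reindex (e : J ≃ I) : UnitChange I J :=
  UnitChange.ofEquiv e 1 1 (mul_one 1) (by simp)

theorem UnitChange.reindex_W_mul (e : J ≃ I) (g : Matrix I m ℝ) :
    (UnitChange.reindex e).W * g = g.submatrix e id := by
  ext i j
  simp [reindex, ofEquiv, Matrix.mul_apply, Matrix.one_apply]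

theorem UnitChange.mul_reindex_U (e : J ≃ I) (g : Matrix m I ℝ) :
    g * (UnitChange.reindex e).U = g.submatrix id e := by
  ext i j
  simp [reindex, ofEquiv, Matrix.mul_apply, Matrix.one_apply]

end Unipotent

/-- The coordinates at an added point are listed after the others. -/
def optionProd (V m : Type*) : (V × m) ⊕ m ≃ Option V × m where
  toFun := Sum.elim (fun c => (some c.1, c.2)) fun k => (none, k)
  invFun
    | (some v, k) => Sum.inl (v, k)
    | (none, k) => Sum.inr k
  left_inv := by rintro (⟨v, k⟩ | k) <;> rfl
  right_inv := by rintro ⟨_ | v, k⟩ <;> rfl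

theorem sum_option_prod {V m : Type*} [Fintype V] [Fintype m] (f : Option V × m → ℝ) :
    ∑ c, f c = (∑ c : V × m, f (some c.1, c.2)) + ∑ k, f (none, k) := by
  rw [← Fintype.sum_equiv (optionProd V m) _ f fun c => rfl, Fintype.sum_sum_type]
  rfl

theorem sum_sum_prod {E R m : Type*} [Fintype E] [Fintype R] [Fintype m] (f : (E ⊕ R) × m → ℝ) :
    ∑ c, f c = (∑ c : E × m, f (Sum.inl c.1, c.2)) + ∑ c : R × m, f (Sum.inr c.1, c.2) := by
  simp only [Fintype.sum_prod_type, Fintype.sum_sum_type]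

theorem Pi.single_some {V : Type*} [DecidableEq V] (v : V) (a : R4) :
    (fun u => (Pi.single (some v) a : Option V → R4) (some u)) = Pi.single v a := by
  funext u
  by_cases h : u = v
  · subst h; simp
  · rw [Pi.single_eq_of_ne h, Pi.single_eq_of_ne (by simpa using h)]

theorem Pi.single_none {V : Type*} [DecidableEq V] (a : R4) :
    (fun u => (Pi.single none a : Option V → R4) (some u)) = 0 := by
  funext u
  simp

namespace Presentation

variable {V E F T T' R Φ J Q : Type*} {K : TetComplex V E F T}
  {K' : TetComplex (Option V) (E ⊕ R) (F ⊕ Φ) T'} {p : Option V → R4}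
  [Fintype V] [Fintype E] [Fintype F] [Fintype T] [Fintype T'] [Fintype R] [Fintype Φ] [Fintype J]
  [Fintype Q] [DecidableEq V] [DecidableEq E] [DecidableEq F] [DecidableEq R] [DecidableEq Φ]
  [DecidableEq J] [DecidableEq Q]

/-- Invariance under the insertion of a vertex, when the angles of the new complex are expressed
through the old ones and through the lengths by the coefficients `C`. -/
theorem insertion (hK : K.IsRegular) (hK' : K'.IsRegular) (hp : K.Nondeg fun v => p (some v))
    (hp' : K'.Nondeg p) (P : Presentation K fun v => p (some v)) (P' : Presentation K' p)
    (hs : ∀ e, K'.src (Sum.inl e) = some (K.src e))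
    (ht : ∀ e, K'.tgt (Sum.inl e) = some (K.tgt e))
    (ι : (E ⊕ F) ⊕ (J ⊕ Q) ≃ (E ⊕ R) ⊕ (F ⊕ Φ))
    (ιE : ∀ e, ι (Sum.inl (Sum.inl e)) = Sum.inl (Sum.inl e))
    (ιF : ∀ f, ι (Sum.inl (Sum.inr f)) = Sum.inr (Sum.inl f))
    (ιQ : ∀ q, ∃ φ t i, ι (Sum.inr (Sum.inr q)) = Sum.inr φ ∧ K'.face t i = φ)
    (cJ : Fintype.card J = 4) (cR : Fintype.card R * 3 = Fintype.card Q + 6)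
    (D : E ⊕ F → (V → R4) →L[ℝ] ℝ)
    (hD : ∀ r, HasFDerivAt (fun q => P.measure q r) (D r) fun v => p (some v))
    (D' : (E ⊕ R) ⊕ (F ⊕ Φ) → (Option V → R4) →L[ℝ] ℝ)
    (hD' : ∀ r, HasFDerivAt (fun q => P'.measure q r) (D' r) p)
    (hv : ∀ r v, (∀ i j, distDeriv p i j v = 0) → D' r v = 0)
    (C : Matrix (F ⊕ Q) (E ⊕ J) ℝ)
    (hE : ∀ e v, D' (Sum.inl (Sum.inl e)) v = D (Sum.inl e) fun u => v (some u))
    (hF : ∀ f v, D' (Sum.inr (Sum.inl f)) v + ∑ k, C (Sum.inl f) k * D' (ι (Sum.map Sum.inl Sum.inl k)) v =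
      D (Sum.inr f) fun u => v (some u))
    (hQ : ∀ q v, D' (ι (Sum.inr (Sum.inr q))) v +
      ∑ k, C (Sum.inr q) k * D' (ι (Sum.map Sum.inl Sum.inl k)) v = 0)
    (kF : ∀ f e, K'.curvature p (Sum.inl e) (Pi.single (Sum.inr (Sum.inl f)) 1) =
      K.curvature (fun v => p (some v)) e (Pi.single (Sum.inr f) 1))
    (kF' : ∀ f j, K'.curvature p (Sum.inr j) (Pi.single (Sum.inr (Sum.inl f)) 1) = 0)
    (kC : ∀ k e', K'.curvature p e' (Pi.single (ι (Sum.map Sum.inl Sum.inl k)) 1) -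
      ∑ r, C r k • K'.curvature p e' (Pi.single (ι (Sum.map Sum.inr Sum.inr r)) 1) =
        Sum.elim (fun e => Sum.elim (fun e₁ => K.curvature (fun v => p (some v)) e
          (Pi.single (Sum.inl e₁) 1)) (fun _ => 0) k) (fun _ => 0) e')
    (M : Matrix J (Fin 4) ℝ)
    (hM : M = P'.f₂.submatrix (fun j => ι (Sum.inr (Sum.inl j))) fun k => (none, k))
    (N : Matrix (R × Fin 3) Q ℝ)
    (hN : N = P'.f₃.submatrix (fun c => (Sum.inr c.1, c.2)) fun q => ι (Sum.inr (Sum.inr q)))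
    (Z : Matrix (Fin 6) (R × Fin 3) ℝ)
    (hZ : Z = P'.f₄.submatrix (fun k => (none, k)) fun c => (Sum.inr c.1, c.2))
    (S : Matrix (R × Fin 3) (Fin 6) ℝ)
    (hw : absDet M * absDet (Z * S) / absDet (Matrix.fromCols N S) * P'.weight = P.weight)
    (h0 : P.weight ≠ 0) :
    (P.Acyclic ↔ P'.Acyclic) ∧
      (P.Acyclic → ∃ I : ℝ, I ≠ 0 ∧ P.HasInvariant I ∧ P'.HasInvariant I) := by
  have ha₁ : ∀ e, P'.axes (Sum.inl e) ∈ Matrix.specialOrthogonalGroup (Fin 4) ℝ :=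
    fun e => P'.axes_mem _
  have ha₂ : ∀ e, coordsIn (P'.axes (Sum.inl e)) (p (some (K.tgt e)) - p (some (K.src e))) =
      ![dist (p (some (K.src e))) (p (some (K.tgt e))), 0, 0, 0] := fun e => by
    rw [← hs, ← ht]; exact P'.axes_edge _
  obtain ⟨i₁, i₂⟩ := P.withAxes_iff hK hp (fun e => P'.axes (Sum.inl e)) ha₁ ha₂
  set P₀ := P.withAxes (fun e => P'.axes (Sum.inl e)) ha₁ ha₂ with hP₀
  suffices h : (P₀.Acyclic ↔ P'.Acyclic) ∧
      (P₀.Acyclic → ∃ I : ℝ, I ≠ 0 ∧ P₀.HasInvariant I ∧ P'.HasInvariant I) by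
    refine ⟨i₁.trans h.1, fun hac => ?_⟩
    obtain ⟨I, hI, h1, h2⟩ := h.2 (i₁.1 hac)
    exact ⟨I, hI, i₂ I hac h1, h2⟩
  -- Division by zero gives zero, so the quotient being nonzero includes the nonvanishing of its
  -- denominator.
  have hne : absDet M * absDet (Z * S) / absDet (Matrix.fromCols N S) ≠ 0 :=
    left_ne_zero_of_mul (hw ▸ h0)
  have hD₀ : ∀ r, HasFDerivAt (fun q => P₀.measure q r) (D r) fun v => p (some v) := hD
  -- the blocks
  have b₁ : ∀ v k c, P'.f₁ (some v, k) c = P₀.f₁ (v, k) c := fun v k c => rfl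
  have b₂ : ∀ r c, P'.f₂ r c = D' r (Pi.single c.1 (EuclideanSpace.single c.2 1)) :=
    fun r c => P'.f₂_apply_of_hasFDerivAt (hD' r) c
  have b₂' : ∀ r c, P₀.f₂ r c = D r (Pi.single c.1 (EuclideanSpace.single c.2 1)) :=
    fun r c => P₀.f₂_apply_of_hasFDerivAt (hD₀ r) c
  have b₃ : ∀ e m c, P'.f₃ (Sum.inl e, m) c =
      -component (P₀.axes e) (K'.curvature p (Sum.inl e) (Pi.single c 1)) m :=
    fun e m c => P'.f₃_apply hK' hp' _ m c
  have b₄ : ∀ v k e m, P'.f₄ (some v, k) (Sum.inl e, m) = P₀.f₄ (v, k) (e, m) := by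
    intro v k e m
    rw [P'.f₄_apply, P₀.f₄_apply, hs, ht]
    simp only [Option.some.injEq]
    rfl
  have b₄' : ∀ k e m, P'.f₄ (none, k) (Sum.inl e, m) = 0 := by
    intro k e m
    rw [P'.f₄_apply, hs, ht]
    simp
  have b₅ : ∀ r v k, P'.f₅ r (some v, k) = P₀.f₅ r (v, k) := fun r v k => rfl
  -- The columns of the new faces are annihilated by `f₄` whether or not the complex is acyclic.
  have fN : ∀ r q, ∑ c, P'.f₄ r c * P'.f₃ c (ι (Sum.inr (Sum.inr q))) = 0 := by
    intro r q
    obtain ⟨φ, t, i, h1, h2⟩ := ιQ q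
    rw [h1]
    exact P'.sum_f₄_f₃_face hK' hp' h2 r
  let x : Extension P₀.f₁ P₀.f₄ P₀.f₅ (Fin 4) J Q (R × Fin 3) (Fin 6) :=
    { B₁ := P'.f₁.submatrix (fun k => (none, k)) id
      B₂ := P'.f₂.submatrix (fun j => ι (Sum.inr (Sum.inl j))) fun c => (some c.1, c.2)
      M := M
      X := P'.f₃.submatrix (fun c => (Sum.inl c.1, c.2)) fun q => ι (Sum.inr (Sum.inr q))
      N := N
      Y := P'.f₄.submatrix (fun c => (some c.1, c.2)) fun c => (Sum.inr c.1, c.2)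
      Z := Z
      B₅ := P'.f₅.submatrix id fun k => (none, k)
      S := S
      h₂₁ := by
        ext j c
        have := P'.sum_f₂_f₁ (hD' (ι (Sum.inr (Sum.inl j)))) (hv _) c
        rw [sum_option_prod] at this
        subst hM
        exact this
      h₄₃ := by
        ext r q
        have := fN (some r.1, r.2) q
        rw [sum_sum_prod] at this
        subst hN
        simp only [Matrix.add_apply, Matrix.mul_apply, Matrix.submatrix_apply, Matrix.zero_apply]
        rw [← this]
        congr 1
        exact Finset.sum_congr rfl fun c _ => by rw [b₄]
      hZN := by
        ext r q
        have := fN (none, r) q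
        rw [sum_sum_prod, Finset.sum_eq_zero (fun c _ => by rw [b₄', zero_mul]), zero_add] at this
        subst hN hZ
        exact this
      h₅₄ := by
        ext r c
        have := congrFun (congrFun P'.f₅_mul_f₄ r) (Sum.inr c.1, c.2)
        rw [Matrix.mul_apply, sum_option_prod] at this
        subst hZ
        exact this
      card₁ := by simpa using cJ
      card₃ := by simpa using cR
      hM := fun h => hne (by rw [h]; simp)
      hNS := fun h => hne (by rw [h]; simp)
      hZS := fun h => hne (by rw [h]; simp) }
  -- Corrections are applied to the old angles and to `Q`, and they are combinations of the old
  -- lengths and `J`. As these two sets of coordinates are disjoint, the transformation is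
  -- unipotent.
  let Ĉ : Matrix ((E ⊕ F) ⊕ (J ⊕ Q)) (E ⊕ J) ℝ :=
    Matrix.of fun r k => Sum.elim (Sum.elim (fun _ => 0) fun f => C (Sum.inl f) k)
      (Sum.elim (fun _ => 0) fun q => C (Sum.inr q) k) r
  let Pr : Matrix (E ⊕ J) ((E ⊕ F) ⊕ (J ⊕ Q)) ℝ :=
    Matrix.of fun k r => if r = Sum.map Sum.inl Sum.inl k then 1 else 0
  have hPC : Pr * Ĉ = 0 := by
    ext k k'
    rw [Matrix.mul_apply]
    simp only [Pr, Matrix.of_apply, ite_mul, one_mul, zero_mul, Finset.sum_ite_eq',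
      Finset.mem_univ, if_true]
    rcases k with k | k <;> rfl
  have hl : ∀ (g : Matrix ((E ⊕ F) ⊕ (J ⊕ Q)) (Option V × Fin 4) ℝ) r c,
      ((1 + Ĉ * Pr) * g : Matrix _ _ ℝ) r c = g r c + ∑ k, Ĉ r k * g (Sum.map Sum.inl Sum.inl k) c := by
    intro g r c
    rw [Matrix.add_mul, Matrix.one_mul, Matrix.mul_assoc, Matrix.add_apply, Matrix.mul_apply]
    congr 1
    refine Finset.sum_congr rfl fun k _ => ?_
    rw [Matrix.mul_apply]
    simp [Pr]
  have hr : ∀ (g : Matrix ((E × Fin 3) ⊕ (R × Fin 3)) ((E ⊕ F) ⊕ (J ⊕ Q)) ℝ) r c,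
      (g * (1 - Ĉ * Pr) : Matrix _ _ ℝ) r c = g r c - ∑ k, (if c = Sum.map Sum.inl Sum.inl k then
        ∑ y, g r (Sum.map Sum.inr Sum.inr y) * C y k else 0) := by
    intro g r c
    rw [Matrix.mul_sub, Matrix.mul_one, ← Matrix.mul_assoc, Matrix.sub_apply, Matrix.mul_apply]
    congr 1
    refine Finset.sum_congr rfl fun k _ => ?_
    simp only [Pr, Matrix.of_apply, mul_ite, mul_one, mul_zero]
    congr 1
    rw [Matrix.mul_apply]
    simp [Ĉ, Fintype.sum_sum_type]
  refine invariant_of_extension P₀ P' x (UnitChange.reindex (optionProd V (Fin 4)))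
    (UnitChange.unipotent ι Ĉ Pr hPC) (UnitChange.reindex (Equiv.sumProdDistrib E R (Fin 3)).symm)
    (UnitChange.reindex (optionProd V (Fin 6))) ?_ ?_ ?_ ?_ ?_ h0 hw
  · rw [UnitChange.reindex_W_mul]
    ext (⟨v, k⟩ | k) c <;> rfl
  -- The corrected old rows depend only on the old vertices, so their derivatives along the new
  -- vertex vanish.
  · have q₁ : ∀ r v k, D r (fun u => (Pi.single (some v) (EuclideanSpace.single k 1) :
        Option V → R4) (some u)) = P₀.f₂ r (v, k) := fun r v k => by rw [Pi.single_some, b₂']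
    have q₂ : ∀ r (k : Fin 4), D r (fun u => (Pi.single none (EuclideanSpace.single k 1) :
        Option V → R4) (some u)) = 0 := fun r k => by rw [Pi.single_none, map_zero]
    rw [UnitChange.mul_reindex_U, UnitChange.unipotent_W_mul]
    ext r c
    rw [Matrix.submatrix_apply, hl]
    simp only [Matrix.submatrix_apply, id, b₂]
    rcases r with (e | f) | (j | q)
    · have : ∀ k, Ĉ (Sum.inl (Sum.inl e)) k = 0 := fun k => rfl
      simp only [this, zero_mul, Finset.sum_const_zero, add_zero, ιE, hE]
      rcases c with ⟨v, k⟩ | k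
      · exact q₁ _ v k
      · exact q₂ _ k
    · rw [ιF]
      refine (hF f _).trans ?_
      rcases c with ⟨v, k⟩ | k
      · exact q₁ _ v k
      · exact q₂ _ k
    · have : ∀ k, Ĉ (Sum.inr (Sum.inl j)) k = 0 := fun k => rfl
      simp only [this, zero_mul, Finset.sum_const_zero, add_zero, ← b₂]
      subst hM
      rcases c with ⟨v, k⟩ | k <;> rfl
    · refine (hQ q _).trans ?_
      rcases c with ⟨v, k⟩ | k <;> rfl
  -- The dual effect on columns: a change of a coordinate in `E ⊕ J` is accompanied by the opposite
  -- of its correction in the angles, which is the combination evaluated by `kC`.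
  · have q : ∀ e' m k, P'.f₃ (e', m) (ι (Sum.map Sum.inl Sum.inl k)) -
        ∑ y, P'.f₃ (e', m) (ι (Sum.map Sum.inr Sum.inr y)) * C y k =
        -component (P'.axes e') (Sum.elim (fun e => Sum.elim (fun e₁ =>
          K.curvature (fun v => p (some v)) e (Pi.single (Sum.inl e₁) 1)) (fun _ => 0) k)
            (fun _ => 0) e') m := by
      intro e' m k
      rw [← kC, sub_eq_add_neg (K'.curvature _ _ _), ← Finset.sum_neg_distrib]
      simp only [P'.f₃_apply hK' hp', ← neg_smul]
      have h1 := component_sum Finset.univ (P'.axes e') (fun r => -C r k) (fun r =>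
        K'.curvature p e' (Pi.single (ι (Sum.map Sum.inr Sum.inr r)) 1)) m
      have h2 : ∀ A B B' : Matrix (Fin 4) (Fin 4) ℝ, component A (B + B') m =
          component A B m + component A B' m := by
        intro A B B'
        simp [component, Matrix.mul_add, Matrix.add_mul]
      rw [h2, h1, neg_add, sub_eq_add_neg, ← Finset.sum_neg_distrib, ← Finset.sum_neg_distrib]
      congr 1
      exact Finset.sum_congr rfl fun y _ => by ring
    have z : ∀ A m, component A 0 m = 0 := by simp [component]
    rw [UnitChange.reindex_W_mul, UnitChange.mul_unipotent_U]
    ext r c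
    rw [hr]
    simp only [Matrix.submatrix_apply, id]
    have hk₁ : ∀ e k, (Sum.inl (Sum.inl e) : (E ⊕ F) ⊕ (J ⊕ Q)) = Sum.map Sum.inl Sum.inl k ↔
        Sum.inl e = k := by
      rintro e (k | k) <;> simp
    have hk₂ : ∀ j k, (Sum.inr (Sum.inl j) : (E ⊕ F) ⊕ (J ⊕ Q)) = Sum.map Sum.inl Sum.inl k ↔
        Sum.inr j = k := by
      rintro e (k | k) <;> simp
    have hk₃ : ∀ f (k : E ⊕ J), ¬(Sum.inl (Sum.inr f) : (E ⊕ F) ⊕ (J ⊕ Q)) =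
        Sum.map Sum.inl Sum.inl k := by
      rintro e (k | k) <;> simp
    have hk₄ : ∀ q (k : E ⊕ J), ¬(Sum.inr (Sum.inr q) : (E ⊕ F) ⊕ (J ⊕ Q)) =
        Sum.map Sum.inl Sum.inl k := by
      rintro e (k | k) <;> simp
    rcases c with (e₁ | f) | (j | y)
    · simp only [hk₁, Finset.sum_ite_eq, Finset.mem_univ, if_true]
      rcases r with ⟨e, m⟩ | ⟨j, m⟩
      · refine (q (Sum.inl e) m (Sum.inl e₁)).trans ?_
        exact (P₀.f₃_apply hK hp e m _).symm
      · exact (q (Sum.inr j) m (Sum.inl e₁)).trans (by simp [z]; rfl)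
    · simp only [hk₃, if_false, Finset.sum_const_zero, sub_zero, ιF]
      rcases r with ⟨e, m⟩ | ⟨j, m⟩
      · refine (b₃ e m _).trans ?_
        rw [kF]
        exact (P₀.f₃_apply hK hp e m _).symm
      · refine (P'.f₃_apply hK' hp' _ m _).trans ?_
        rw [kF', z, neg_zero]
        rfl
    · simp only [hk₂, Finset.sum_ite_eq, Finset.mem_univ, if_true]
      rcases r with ⟨e, m⟩ | ⟨i, m⟩
      · exact (q (Sum.inl e) m (Sum.inr j)).trans (by simp [z]; rfl)
      · exact (q (Sum.inr i) m (Sum.inr j)).trans (by simp [z]; rfl)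
    · simp only [hk₄, if_false, Finset.sum_const_zero, sub_zero]
      subst hN
      rcases r with ⟨e, m⟩ | ⟨j, m⟩ <;> rfl
  · rw [UnitChange.reindex_W_mul, UnitChange.mul_reindex_U]
    subst hZ
    ext (⟨v, k⟩ | k) (⟨e, m⟩ | c)
    · exact b₄ v k e m
    · rfl
    · exact b₄' k e m
    · rfl
  · rw [UnitChange.mul_reindex_U]
    ext r (⟨v, k⟩ | k) <;> rfl

end Presentation

/-! ## The edges at the inserted vertex -/

/-- Contraction of a dual bivector with a bivector, in the coordinates `soPos`. -/
theorem det_compound (a : Fin 4 → Fin 4 → ℝ) :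
    |(Matrix.of fun k k' : Fin 6 =>
      dualWedge (a (soPos k').1) (a (soPos k').2) (soPos k).1 (soPos k).2).det| =
    |(Matrix.of a).det| ^ 3 := by
  set Δ : Matrix (Fin 6) (Fin 6) ℝ := Matrix.of fun k k' : Fin 6 =>
    dualWedge (a (soPos k').1) (a (soPos k').2) (soPos k).1 (soPos k).2 with hΔ
  let ε : Fin 6 → ℝ := ![1, -1, 1, 1, -1, 1]
  -- The wedge pairing on bivectors: with `soPos`, complementary pairs of indices are exchanged by
  -- `Fin.rev`, and `ε` contains the signs.
  let J : Matrix (Fin 6) (Fin 6) ℝ := Matrix.of fun k k' => if k' = Fin.rev k then ε k else 0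
  have hJ : J * J = 1 := by
    ext k k'
    rw [Matrix.mul_apply]
    simp only [J, Matrix.of_apply, ite_mul, zero_mul, Finset.sum_ite_eq', Finset.mem_univ, if_true,
      Fin.rev_rev]
    fin_cases k <;> fin_cases k' <;> simp [ε, Fin.rev]
  have hJd : |J.det| = 1 := by
    have := congrArg Matrix.det hJ
    rw [Matrix.det_mul, Matrix.det_one] at this
    rcases mul_self_eq_one_iff.1 this with h | h <;> simp [h]
  -- The wedge product of the bivectors of two pairs is the determinant of the four vectors; it
  -- vanishes unless the pairs are complementary.
  have key : Δᵀ * J * Δ = (Matrix.of a).det • J := by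
    have hx : ∀ k k', (Δᵀ * J * Δ) k k' =
        (Matrix.of ![a (soPos k).1, a (soPos k).2, a (soPos k').1, a (soPos k').2]).det := by
      intro k k'
      rw [Matrix.mul_assoc, Matrix.mul_apply]
      have : ∀ l, (J * Δ) l k' = ε l * Δ (Fin.rev l) k' := by
        intro l
        simp [J, Matrix.mul_apply]
      simp only [this]
      simp only [Fin.sum_univ_six, Matrix.transpose_apply, hΔ, Matrix.of_apply, ε]
      generalize a (soPos k).1 = x
      generalize a (soPos k).2 = y
      generalize a (soPos k').1 = u
      generalize a (soPos k').2 = v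
      rw [det_fin_four]
      simp [soPos, Fin.rev, dualWedge]
      ring
    ext k k'
    rw [hx, det_fin_four, Matrix.smul_apply, det_fin_four]
    fin_cases k <;> fin_cases k' <;> simp [J, ε, soPos, Fin.rev] <;> ring
  have h := congrArg (fun M => |M.det|) key
  simp only [Matrix.det_mul, Matrix.det_transpose, Matrix.det_smul, abs_mul, hJd, Fintype.card_fin,
    abs_pow, mul_one] at h
  -- Taking determinants of 6×6 matrices yields the sixth power of `det a`.
  have h2 : |Δ.det| ^ 2 = (|(Matrix.of a).det| ^ 3) ^ 2 := by rw [sq, h]; ring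
  exact (pow_left_inj₀ (abs_nonneg _) (by positivity) two_ne_zero).1 h2

namespace Presentation

variable {V E F T : Type*} {K : TetComplex V E F T} {p : V → R4}

/-- In the axes of the edge `a i` is `(l, 0, 0, 0)`, so the components of the bivectors are `l`
times the transversal coordinates of the other vectors. This gives `l³` times a 3×3 minor, while the
expansion of `det a` along the row `i` is `±l` times the same minor. -/
theorem abs_det_component (P : Presentation K p) (e : E) (a : Fin 4 → Fin 4 → ℝ) (i : Fin 4)
    (ha : a i = ⇑(p (K.tgt e) - p (K.src e))) :
    |(Matrix.of fun m c : Fin 3 =>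
      component (P.axes e) (dualWedge (a i) (a (i.succAbove c))) m).det| =
    dist (p (K.src e)) (p (K.tgt e)) ^ 2 * |(Matrix.of a).det| := by
  set A := P.axes e with hA
  have hm := P.axes_mem e
  rw [← hA] at hm
  set l := dist (p (K.src e)) (p (K.tgt e)) with hl
  let y : Fin 4 → Fin 4 → ℝ := fun k => Aᵀ *ᵥ a k
  have hy : y i = ![l, 0, 0, 0] := by
    have := P.axes_edge e
    rw [coordsIn, ← ha] at this
    exact this
  have hAy : ∀ k, A *ᵥ y k = a k := fun k => by
    rw [Matrix.mulVec_mulVec, mul_transpose_of_mem hm, Matrix.one_mulVec]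
  have hc : ∀ c m, component A (dualWedge (a i) (a (i.succAbove c))) m =
      l * y (i.succAbove c) m.succ := by
    intro c m
    have e1 : Aᵀ * (A * dualWedge (y i) (y (i.succAbove c)) * Aᵀ) * A =
        (Aᵀ * A) * dualWedge (y i) (y (i.succAbove c)) * (Aᵀ * A) := by simp only [Matrix.mul_assoc]
    rw [component, ← hAy i, ← hAy (i.succAbove c), dualWedge_conj hm, e1,
      transpose_mul_of_mem hm, Matrix.one_mul, Matrix.mul_one, hy]
    fin_cases m <;> simp [axisPos, dualWedge]
  have hd : (Matrix.of a).det = (Matrix.of y).det := by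
    have : Matrix.of y = Matrix.of a * A := by
      ext k j
      simp [y, Matrix.mul_apply, Matrix.mulVec, dotProduct, mul_comm]
    rw [this, Matrix.det_mul, det_of_mem hm, mul_one]
  have e2 : (Matrix.of fun m c : Fin 3 => l * y (i.succAbove c) m.succ) =
      l • ((Matrix.of y).submatrix i.succAbove (Fin.succAbove 0))ᵀ := by
    ext m c; simp
  simp only [hc]
  rw [e2, Matrix.det_smul, Matrix.det_transpose, hd, Matrix.det_succ_row _ i,
    Finset.sum_eq_single 0]
  · rw [Matrix.of_apply, hy, abs_mul, abs_mul, abs_mul]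
    simp only [Fintype.card_fin, abs_pow, abs_neg, abs_one, one_pow, one_mul]
    rw [show |l| = l from abs_of_nonneg dist_nonneg]
    simp only [Matrix.cons_val_zero]
    rw [show |l| = l from abs_of_nonneg dist_nonneg]
    ring
  · intro b _ hb
    rw [Matrix.of_apply, hy]
    fin_cases b <;> simp at hb ⊢
  · simp

variable {R Q : Type*} [Fintype R] [Fintype Q] [DecidableEq R] [DecidableEq Q]

/-- The torsion of the complex formed by the deficit angles at the edges joining a vertex to
several others, the angles at the faces containing two of these edges, and `so(4)`. Here `u q` lists
the numbers of the edges of the face `q`, and `x` numbers the pairs consisting of such an edge and a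
vector different from it. -/
theorem absDet_star (P : Presentation K p) (hp : K.Nondeg p) (e : R → E) (ρ : R → Fin 4)
    (a : Fin 4 → Fin 4 → ℝ)
    (ha : ∀ j, a (ρ j) = ⇑(p (K.tgt (e j)) - p (K.src (e j)))) (u : Q → Fin 4 × Fin 4)
    (hu : Function.Injective u) (hlt : ∀ q, (u q).1 < (u q).2) (x : Q ⊕ Fin 6 ≃ R × Fin 3)
    (hx₁ : ∀ q, ρ (x (Sum.inl q)).1 = (u q).2 ∧
      (ρ (x (Sum.inl q)).1).succAbove (x (Sum.inl q)).2 = (u q).1)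
    (hx₂ : ∀ k, ρ (x (Sum.inr k)).1 = (soPos k).1 ∧
      (ρ (x (Sum.inr k)).1).succAbove (x (Sum.inr k)).2 = (soPos k).2)
    (n : Q → ℝ) (N : Matrix (R × Fin 3) Q ℝ)
    (hN : ∀ j m q, N (j, m) q = n q *
      if ρ j = (u q).1 then component (P.axes (e j)) (dualWedge (a (u q).1) (a (u q).2)) m
      else if ρ j = (u q).2 then component (P.axes (e j)) (dualWedge (a (u q).2) (a (u q).1)) m
      else 0)
    (Z : Matrix (Fin 6) (R × Fin 3) ℝ)
    (hZ : ∀ k j m, Z k (j, m) = -axisBivector (P.axes (e j)) m (soPos k).1 (soPos k).2) :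
    ∃ S : Matrix (R × Fin 3) (Fin 6) ℝ, absDet (Z * S) = |(Matrix.of a).det| ^ 3 ∧
      absDet (Matrix.fromCols N S) =
        (∏ j, dist (p (K.src (e j))) (p (K.tgt (e j))) ^ 2 * |(Matrix.of a).det|) *
          ∏ q, |n q| := by
  let flag : R × Fin 3 → Fin 4 × Fin 4 := fun c => (ρ c.1, (ρ c.1).succAbove c.2)
  -- The columns are numbered by flags: an edge at the vertex together with another of the four
  -- vectors. At each edge the three bivectors form a basis, so this matrix is block diagonal.
  let β : Matrix (R × Fin 3) (R × Fin 3) ℝ := Matrix.of fun r c => if r.1 = c.1 then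
    component (P.axes (e c.1)) (dualWedge (a (ρ c.1)) (a ((ρ c.1).succAbove c.2))) r.2 else 0
  have hβ : absDet β = ∏ j, dist (p (K.src (e j))) (p (K.tgt (e j))) ^ 2 * |(Matrix.of a).det| := by
    have h1 : β = (Matrix.blockDiagonal fun j => Matrix.of fun m c : Fin 3 =>
        component (P.axes (e j)) (dualWedge (a (ρ j)) (a ((ρ j).succAbove c))) m).submatrix
          (Equiv.prodComm R (Fin 3)) (Equiv.prodComm R (Fin 3)) := by
      ext ⟨j, m⟩ ⟨j', c⟩
      by_cases h : j = j'
      · subst h; simp [β, Matrix.blockDiagonal_apply]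
      · simp [β, Matrix.blockDiagonal_apply, h]
    rw [absDet_square, h1, Matrix.det_submatrix_equiv_self, Matrix.det_blockDiagonal,
      Finset.abs_prod]
    exact Finset.prod_congr rfl fun j _ => P.abs_det_component (e j) a (ρ j) (ha j)
  have hflag : ∀ q, flag (x (Sum.inl q)) = (u q).swap := fun q => Prod.ext (hx₁ q).1 (hx₁ q).2
  have hflag' : ∀ k, flag (x (Sum.inr k)) = soPos k := fun k => Prod.ext (hx₂ k).1 (hx₂ k).2
  have hso : ∀ k, (soPos k).1 < (soPos k).2 := by decide
  -- For each pair of vectors the lift of its bivector is placed at the first of them. The columns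
  -- of `N` mix the two flags of a face.
  let S : Matrix (R × Fin 3) (Fin 6) ℝ := Matrix.of fun r k => β r (x (Sum.inr k))
  let C : Matrix (R × Fin 3) (Q ⊕ Fin 6) ℝ := Matrix.of fun c => Sum.elim
    (fun q => n q * if flag c = u q ∨ flag c = (u q).swap then 1 else 0)
    (fun k => if c = x (Sum.inr k) then 1 else 0)
  have hS : Matrix.fromCols N S = β * C := by
    ext ⟨j, m⟩ (q | k)
    · rw [Matrix.mul_apply, Fintype.sum_prod_type, Finset.sum_eq_single j]
      · simp only [Matrix.fromCols_apply_inl, hN, β, C, Matrix.of_apply, if_true, Sum.elim_inl,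
          flag, Prod.ext_iff, Prod.fst_swap, Prod.snd_swap]
        have hne := (hlt q).ne
        have hsum : ∀ (w : Fin 4), w ≠ ρ j → ∑ c, component (P.axes (e j))
            (dualWedge (a (ρ j)) (a ((ρ j).succAbove c))) m *
              (n q * if (ρ j).succAbove c = w then 1 else 0) =
            n q * component (P.axes (e j)) (dualWedge (a (ρ j)) (a w)) m := by
          intro w hw
          obtain ⟨c, rfl⟩ := Fin.exists_succAbove_eq hw
          rw [Finset.sum_eq_single c]
          · simp [mul_comm]
          · intro c' _ hc
            simp [hc]
          · simp
        by_cases h1 : ρ j = (u q).1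
        · have h2 : ¬ρ j = (u q).2 := fun h => hne (h1.symm.trans h)
          simp only [if_true, false_and, or_false, h1, true_and, hne] at hsum ⊢
          exact (hsum _ hne.symm).symm
        · by_cases h2 : ρ j = (u q).2
          · simp only [h2, if_true, false_and, false_or, true_and, hne.symm, if_false] at hsum ⊢
            exact (hsum _ hne).symm
          · simp [h1, h2]
      · intro j' _ hj
        simp [β, hj.symm]
      · simp
    · simp [Matrix.mul_apply, C, S]
  have hC : absDet C = ∏ q, |n q| := by
    rw [absDet_eq _ x]
    -- The ordering `x` lists the reversed flags of faces before the increasing flags. A reversed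
    -- flag of a face occurs only in the column of that face, so the matrix is triangular with
    -- diagonal entries `n q` and `1`.
    have : C.submatrix x id = Matrix.fromBlocks (Matrix.diagonal n) 0
        (Matrix.of fun k q => C (x (Sum.inr k)) (Sum.inl q)) 1 := by
      ext (q | k) (q' | k')
      · simp only [C, Matrix.submatrix_apply, Matrix.of_apply, id, Sum.elim_inl, hflag,
          Matrix.fromBlocks_apply₁₁, Matrix.diagonal_apply, Prod.swap_inj]
        have h1 : (u q).swap ≠ u q' := by
          intro h
          have h2 := hlt q'
          rw [← h] at h2
          exact lt_asymm h2 (hlt q)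
        simp only [h1, false_or, hu.eq_iff]
        by_cases h : q = q'
        · subst h; simp
        · simp [h]
      · simp [C]
      · rfl
      · simp [C, Matrix.one_apply]
    rw [this, Matrix.det_fromBlocks_zero₁₂, Matrix.det_one, mul_one, Matrix.det_diagonal,
      Finset.abs_prod]
  refine ⟨S, ?_, ?_⟩
  · rw [absDet_square, ← det_compound, ← abs_neg, ← one_mul (-_)]
    -- Summing over the edges reassembles each bivector from its components at a single edge.
    have h1 : Z * S = -Matrix.of fun k k' : Fin 6 =>
        dualWedge (a (soPos k').1) (a (soPos k').2) (soPos k).1 (soPos k).2 := by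
      ext k k'
      obtain ⟨h2, h3⟩ := hx₂ k'
      rw [Matrix.mul_apply, Fintype.sum_prod_type, Finset.sum_eq_single (x (Sum.inr k')).1]
      · simp only [S, β, Matrix.of_apply, if_true, hZ, Matrix.neg_apply]
        rw [← h2, ← h3]
        set c := x (Sum.inr k')
        have h4 := P.sum_component hp (e := e c.1)
          (B := dualWedge (a (ρ c.1)) (a ((ρ c.1).succAbove c.2)))
          ⟨dualWedge_transpose _ _, by rw [← ha]; exact dualWedge_mulVec_left _ _⟩
        conv_rhs => rw [← h4]
        rw [Matrix.sum_apply, ← Finset.sum_neg_distrib]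
        refine Finset.sum_congr rfl fun m _ => ?_
        rw [Matrix.smul_apply, smul_eq_mul]
        ring
      · intro j _ hj
        simp [S, β, hj]
      · simp
    rw [h1, Matrix.det_neg]
    simp
  · rw [hS, absDet_mul_left _ _ (by simpa using (Fintype.card_congr x).symm), hβ, hC]

end Presentation

/-! ## General position -/

/-- General position speaks of five vertices, so a fifth one has to be supplied in order to say
something about four. -/
theorem GeneralPosition.affineIndependent {V : Type*} {p : V → R4} (hp : GeneralPosition p)
    {s : Fin 4 → V} (hs : Function.Injective s) {u : V} (hu : ∀ i, s i ≠ u) :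
    AffineIndependent ℝ (p ∘ s) := by
  have h := hp (Fin.cons u s) (Fin.cons_injective_iff.2 ⟨by rintro ⟨i, hi⟩; exact hu i hi, hs⟩)
  exact h.comp_embedding (Fin.succEmb 4)

theorem GeneralPosition.linearIndependent {V : Type*} {p : V → R4} (hp : GeneralPosition p)
    {a b c d u : V} (hi : Function.Injective ![a, b, c, d]) (hu : ∀ i, ![a, b, c, d] i ≠ u) :
    LinearIndependent ℝ ![p b - p a, p c - p a, p d - p a] :=
  (hp.affineIndependent hi hu).linearIndependent_of_injective (a := 0) (b := 1) (c := 2) (d := 3)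
    (by decide)

namespace TetComplex

variable {V E F T : Type*} {K : TetComplex V E F T}

theorem IsClosedPseudotriangulation.isRegular (hK : K.IsClosedPseudotriangulation) :
    K.IsRegular := ⟨hK.edge_symm, hK.edge_ends⟩

section Inflate

variable [DecidableEq T] {t₀ : T} {i₀ : Fin 4}

theorem IsRegular.inflate (hK : K.IsRegular) : (K.inflate t₀ i₀).IsRegular where
  edge_symm := by
    rintro (t | b) i j
    · exact congrArg Sum.inl (hK.edge_symm t i j)
    · simp only [TetComplex.inflate]
      by_cases hi : i = i₀ <;> by_cases hj : j = i₀ <;> simp [hi, hj, hK.edge_symm t₀ i j]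
  edge_ends := by
    rintro (t | b) i j hij
    · simpa [TetComplex.inflate] using hK.edge_ends t i j hij
    · by_cases hi : i = i₀ <;> by_cases hj : j = i₀
      · exact absurd (hi.trans hj.symm) hij
      · simp [TetComplex.inflate, hi, hj]
      · simp [TetComplex.inflate, hi, hj]
      · simpa [TetComplex.inflate, hi, hj] using hK.edge_ends t₀ i j hij

theorem inflate_vert_injective (hK : ∀ t, Function.Injective (K.vert t)) (t) :
    Function.Injective ((K.inflate t₀ i₀).vert t) := by
  rcases t with t | b
  · exact (Option.some_injective _).comp (hK t)
  · intro i j h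
    by_cases hi : i = i₀ <;> by_cases hj : j = i₀ <;> simp [inflate, hi, hj] at h ⊢
    exact hK t₀ h

/-- The fifth vertex is the new one for an old tetrahedron, and the replaced vertex of `t₀` for a
new tetrahedron. -/
theorem inflate_nondeg (hK : ∀ t, Function.Injective (K.vert t)) {p : Option V → R4}
    (hp : GeneralPosition p) : (K.inflate t₀ i₀).Nondeg p := by
  rintro (t | b)
  · exact hp.affineIndependent (inflate_vert_injective hK (Sum.inl t)) (u := none) (by simp [inflate])
  · refine hp.affineIndependent (inflate_vert_injective hK (Sum.inr b))
      (u := some (K.vert t₀ i₀)) fun i => ?_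
    by_cases hi : i = i₀
    · simp [inflate, hi]
    · simpa [inflate, hi] using (hK t₀).ne hi

end Inflate

section Subdivide

variable {t₀ : T}

theorem IsRegular.subdivide (hK : K.IsRegular) : (K.subdivide t₀).IsRegular where
  edge_symm := by
    rintro (t | a) i j
    · exact congrArg Sum.inl (hK.edge_symm t i j)
    · simp only [TetComplex.subdivide]
      by_cases hi : i = a <;> by_cases hj : j = a <;> simp [hi, hj, hK.edge_symm t₀ i j]
  edge_ends := by
    rintro (t | a) i j hij
    · simpa [TetComplex.subdivide] using hK.edge_ends t i j hij
    · by_cases hi : i = a <;> by_cases hj : j = a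
      · exact absurd (hi.trans hj.symm) hij
      · simp [TetComplex.subdivide, hi, hj]
      · simp [TetComplex.subdivide, hi, hj]
      · simpa [TetComplex.subdivide, hi, hj] using hK.edge_ends t₀ i j hij

theorem subdivide_vert_injective (hK : ∀ t, Function.Injective (K.vert t)) (t) :
    Function.Injective ((K.subdivide t₀).vert t) := by
  rcases t with t | a
  · exact (Option.some_injective _).comp (hK t)
  · intro i j h
    by_cases hi : i = a <;> by_cases hj : j = a <;> simp [subdivide, hi, hj] at h ⊢
    exact hK t₀ h

theorem subdivide_nondeg (hK : ∀ t, Function.Injective (K.vert t)) {p : Option V → R4}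
    (hp : GeneralPosition p) : (K.subdivide t₀).Nondeg p := by
  rintro (t | a)
  · exact hp.affineIndependent (subdivide_vert_injective hK (Sum.inl t)) (u := none)
      (by simp [subdivide])
  · refine hp.affineIndependent (subdivide_vert_injective hK (Sum.inr a))
      (u := some (K.vert t₀ a)) fun i => ?_
    by_cases hi : i = a
    · simp [subdivide, hi]
    · simpa [subdivide, hi] using (hK t₀).ne hi

end Subdivide

theorem nondeg_restrict (hK : ∀ t, Function.Injective (K.vert t)) {p : Option V → R4}
    (hp : GeneralPosition p) : K.Nondeg fun v => p (some v) := fun t =>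
  hp.affineIndependent (s := fun i => some (K.vert t i)) ((Option.some_injective _).comp (hK t))
    (u := none) (by simp)

end TetComplex

/-! ## Values and differentials of angles and areas -/

theorem area2_perm (g : Fin 3 → R4) {i j k : Fin 3} (hij : i ≠ j) (hik : i ≠ k) (hjk : j ≠ k) :
    area2 (g i) (g j) (g k) = area2 (g 0) (g 1) (g 2) := by
  have h : ∀ i j k : Fin 3, i ≠ j → i ≠ k → j ≠ k →
      (i = 0 ∧ j = 1 ∧ k = 2) ∨ (i = 0 ∧ j = 2 ∧ k = 1) ∨ (i = 1 ∧ j = 0 ∧ k = 2) ∨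
      (i = 1 ∧ j = 2 ∧ k = 0) ∨ (i = 2 ∧ j = 0 ∧ k = 1) ∨ (i = 2 ∧ j = 1 ∧ k = 0) := by decide
  rcases h i j k hij hik hjk with ⟨rfl, rfl, rfl⟩ | ⟨rfl, rfl, rfl⟩ | ⟨rfl, rfl, rfl⟩ |
    ⟨rfl, rfl, rfl⟩ | ⟨rfl, rfl, rfl⟩ | ⟨rfl, rfl, rfl⟩
  · rfl
  · exact area2_swap _ _ _
  · rw [area2_swap, area2_rotate]
  · exact area2_rotate _ _ _
  · rw [area2_rotate, area2_rotate]
  · rw [area2_swap, area2_rotate, area2_rotate, area2_swap]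

theorem AffineIndependent.area2_pos {ι : Type*} {x : ι → R4} (h : AffineIndependent ℝ x)
    {a b c d : ι} (hi : Function.Injective ![a, b, c, d]) : 0 < area2 (x a) (x b) (x c) := by
  have h1 := h.linearIndependent_of_injective hi
  obtain ⟨G, hG⟩ := _root_.exists_adapted (a₁ := x c) (a₂ := x d) (b := x a) (c := x b) h1
  exact hG.area2_pos

namespace Presentation

variable {V E F T : Type*} {K : TetComplex V E F T} {p : V → R4}

/-- The area depends only on the unordered triangle, and both tetrahedra at the face see the same
triangle. -/
theorem doubleArea_eq (P : Presentation K p) {f : F} {t : T} (s : Equiv.Perm (Fin 4))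
    (h : K.face t (s 0) = f) :
    P.doubleArea f = area2 (p (K.vert t (s 1))) (p (K.vert t (s 2))) (p (K.vert t (s 3))) := by
  rw [doubleArea]
  set σ := P.faceStar f
  have key : ∀ (ρ : Fin 3 → Fin 4) (y : Fin 4), (∀ i, i ≠ y → ∃ c, ρ c = i) → s 0 = y →
      area2 (p (K.vert t (s 1))) (p (K.vert t (s 2))) (p (K.vert t (s 3))) =
      area2 (p (K.vert t (ρ 0))) (p (K.vert t (ρ 1))) (p (K.vert t (ρ 2))) := by
    intro ρ y hρ hy
    have hs : ∀ k, k ≠ 0 → ∃ c, ρ c = s k := fun k hk => hρ _ (by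
      rw [← hy]; exact s.injective.ne hk)
    obtain ⟨i, hi⟩ := hs 1 (by decide)
    obtain ⟨j, hj⟩ := hs 2 (by decide)
    obtain ⟨k, hk⟩ := hs 3 (by decide)
    rw [← hi, ← hj, ← hk]
    refine area2_perm (fun c => p (K.vert t (ρ c))) ?_ ?_ ?_ <;> rintro rfl
    · exact absurd (s.injective (hi.symm.trans hj)) (by decide)
    · exact absurd (s.injective (hi.symm.trans hk)) (by decide)
    · exact absurd (s.injective (hj.symm.trans hk)) (by decide)
  rcases σ.covers t (s 0) h with ⟨rfl, h0⟩ | ⟨rfl, h0⟩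
  · refine (key (fun c => σ.lord c.succ) _ (fun i hi => ?_) h0).symm
    obtain ⟨k, rfl⟩ := σ.lord.surjective i
    obtain ⟨c, rfl⟩ := Fin.exists_succ_eq.2 (fun h => hi (congrArg _ h))
    exact ⟨c, rfl⟩
  · rw [key (fun c => σ.rord c.castSucc) _ (fun i hi => ?_) h0]
    · have := σ.vert_glue
      exact congr (congr (congrArg area2 (congrArg p (this 0))) (congrArg p (this 1)))
        (congrArg p (this 2))
    · obtain ⟨k, rfl⟩ := σ.rord.surjective i
      obtain ⟨c, rfl⟩ := Fin.exists_castSucc_eq.2 (fun h => hi (congrArg _ h))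
      exact ⟨c, rfl⟩

theorem doubleArea_pos (P : Presentation K p) (hp : K.Nondeg p) (f : F) : 0 < P.doubleArea f := by
  set σ := P.faceStar f with hσ
  rw [P.doubleArea_eq σ.lord σ.left_face]
  exact (hp σ.left).area2_pos (a := σ.lord 1) (b := σ.lord 2) (c := σ.lord 3) (d := σ.lord 0)
    (by
      have := perm_injective_vec σ.lord (finRotate 4)
      exact this)

theorem weight_ne_zero [Fintype E] [Fintype F] (P : Presentation K p) (hp : K.Nondeg p) :
    P.weight ≠ 0 :=
  div_ne_zero (Finset.prod_ne_zero_iff.2 fun e _ => pow_ne_zero _ (P.dist_ne hp e))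
    (Finset.prod_ne_zero_iff.2 fun f _ => (P.doubleArea_pos hp f).ne')

/-- If the two tetrahedra have the same opposite vertex, the angle is constantly `π` near `p`.
Otherwise five different vertices are involved and general position applies. -/
theorem exists_hasFDerivAt_angle [Fintype V] (P : Presentation K p) (hK : K.Nondeg p)
    (hp : GeneralPosition p) (f : F) : ∃ D : (V → R4) →L[ℝ] ℝ,
      HasFDerivAt (fun q : V → R4 => P.angle f q) D p ∧
      ∀ v, (∀ i j, distDeriv p i j v = 0) → D v = 0 := by
  set σ := P.faceStar f with hσ
  have hl := (hK.injective σ.left).comp σ.lord.injective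
  by_cases h : K.vert σ.right (σ.rord 3) = K.vert σ.left (σ.lord 0)
  · refine ⟨0, ?_, fun v _ => rfl⟩
    have := hasFDerivAt_theta_self (x := p) ((hK σ.left).linearIndependent_of_injective
      (perm_injective_vec σ.lord (finRotate 4)))
    simp only [angle, ← hσ, h]
    exact this
  · have hr := (hK.injective σ.right).comp σ.rord.injective
    let u : Fin 5 → V := Fin.cons (K.vert σ.right (σ.rord 3)) (K.vert σ.left ∘ σ.lord)
    have hu : Function.Injective u := by
      refine Fin.cons_injective_iff.2 ⟨?_, hl⟩
      rintro ⟨i, hi⟩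
      refine Fin.cases (fun hi => h hi.symm) (fun i hi => ?_) i hi
      have h2 := (σ.vert_glue i).symm.trans hi
      exact absurd (hr h2) (Fin.castSucc_lt_last i).ne
    obtain ⟨c, D, hD, hD'⟩ := exists_hasFDerivAt_theta_comp (σ := u ∘ ![2, 3, 4, 0, 1])
      (hp _ (hu.comp (by decide)))
    exact ⟨D, hD, fun v hv => by simp [hD', hv]⟩

theorem exists_hasFDerivAt_measure [Fintype V] [Fintype E] [Fintype F] [Fintype T] [DecidableEq V]
    [DecidableEq E] [DecidableEq F] (P : Presentation K p) (hK : K.Nondeg p)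
    (hp : GeneralPosition p) (r : E ⊕ F) : ∃ D : (V → R4) →L[ℝ] ℝ,
      HasFDerivAt (fun q : V → R4 => P.measure q r) D p ∧
      ∀ v, (∀ i j, distDeriv p i j v = 0) → D v = 0 := by
  rcases r with e | f
  · exact ⟨_, P.hasFDerivAt_length hK e, fun v hv => hv _ _⟩
  · exact P.exists_hasFDerivAt_angle hK hp f

end Presentation

/-! ### Restriction to the old vertices -/

/-- Forgetting the position of the inserted vertex. -/
def restrictPoints (V : Type*) : (Option V → R4) →L[ℝ] (V → R4) :=
  ContinuousLinearMap.pi fun u => ContinuousLinearMap.proj (some u)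

theorem HasFDerivAt.comp_restrictPoints {V : Type*} [Fintype V] {g : (V → R4) → ℝ}
    {D : (V → R4) →L[ℝ] ℝ} {p : Option V → R4} (h : HasFDerivAt g D fun v => p (some v)) :
    HasFDerivAt (fun q : Option V → R4 => g fun v => q (some v)) (D.comp (restrictPoints V)) p :=
  HasFDerivAt.comp (g := g) (f := restrictPoints V) p h (restrictPoints V).hasFDerivAt

/-! ## The gradient of an angle and other local facts -/

/-- An identity without square roots, valid also at the origin; it lets the angle be differentiated
implicitly. -/
theorem planeAngle_relation {z' w' : ℝ} (h' : z' ^ 2 + w' ^ 2 ≠ 0) (z w : ℝ) :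
    Real.cos (planeAngle z w z' w') * (z * w' - w * z') +
      Real.sin (planeAngle z w z' w') * (z * z' + w * w') = 0 := by
  by_cases h : z ^ 2 + w ^ 2 = 0
  · obtain rfl : z = 0 := by nlinarith [sq_nonneg z, sq_nonneg w]
    obtain rfl : w = 0 := by nlinarith [sq_nonneg w]
    simp
  · obtain ⟨h1, h2⟩ := planeAngle_cos_sin h h'
    rw [← h2, ← neg_neg (z * z' + w * w'), ← h1]
    ring

/-- The product of the area of a triangle by the distance to its plane and by the norm of the
gradient of an angle. -/
theorem abs_det_theta_gradient {ι : Type*} [Fintype ι] [DecidableEq ι] {x : ι → R4}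
    {a b c d e : ι} (hd : LinearIndependent ℝ ![x b - x a, x c - x a, x d - x a])
    (he : LinearIndependent ℝ ![x b - x a, x c - x a, x e - x a])
    (hda : a ≠ d) (hdb : b ≠ d) (hdc : c ≠ d) (hde : e ≠ d) {D : (ι → R4) →L[ℝ] ℝ}
    (h : HasFDerivAt (fun q : ι → R4 => theta (q a) (q b) (q c) (q d) (q e)) D x) :
    |(Matrix.of ![⇑(x d - x a), ⇑(x d - x b), ⇑(x d - x c),
      fun k => D (Pi.single d (EuclideanSpace.single k 1))]).det| = area2 (x a) (x b) (x c) := by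
  obtain ⟨F, hF, ⟨X, hX, h1⟩, ⟨p₂, Y, hY, h2⟩, -⟩ := exists_triangular_frame hd
  have hP : PlaneFrame F (x a) (x b) (x c) := ⟨hF, X, 0, p₂, Y, by nlinarith [mul_pos hX hY], h1, h2⟩
  set z := coordsIn F (x d - x a) 2 with hz
  set w := coordsIn F (x d - x a) 3 with hw
  set z' := coordsIn F (x e - x a) 2
  set w' := coordsIn F (x e - x a) 3
  have hr : z ^ 2 + w ^ 2 ≠ 0 := hP.coords_ne hd
  have hr' : z' ^ 2 + w' ^ 2 ≠ 0 := hP.coords_ne he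
  -- The angle varies with the moving point as a polar angle in the plane orthogonal to the face.
  have key : ∀ v : R4, D (Pi.single d v) =
      (z * coordsIn F v 3 - w * coordsIn F v 2) / (z ^ 2 + w ^ 2) := by
    intro v
    set v₂ := coordsIn F v 2
    set v₃ := coordsIn F v 3
    let θ : ℝ → ℝ := fun t => planeAngle (z + t * v₂) (w + t * v₃) z' w'
    have hl : HasDerivAt (fun t : ℝ => x + t • (Pi.single d v : ι → R4)) (Pi.single d v) 0 := by
      simpa using ((hasDerivAt_id (0 : ℝ)).smul_const (Pi.single d v : ι → R4)).const_add x
    have hθ : HasDerivAt θ (D (Pi.single d v)) 0 := by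
      have h3 := HasFDerivAt.comp_hasDerivAt (x := (0 : ℝ))
        (l := fun q : ι → R4 => theta (q a) (q b) (q c) (q d) (q e)) (by simpa using h) hl
      refine h3.congr_of_eventuallyEq (Filter.Eventually.of_forall fun t => ?_)
      simp only [θ, Function.comp_apply, Pi.add_apply, Pi.smul_apply, Pi.single_eq_same,
        Pi.single_eq_of_ne hda, Pi.single_eq_of_ne hdb, Pi.single_eq_of_ne hdc,
        Pi.single_eq_of_ne hde, smul_zero, add_zero]
      rw [hP.theta_eq, show x d + t • v - x a = (x d - x a) + t • v by abel]
      have : ∀ i, coordsIn F (x d - x a + t • v) i = coordsIn F (x d - x a) i + t * coordsIn F v i := by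
        intro i
        simp [coordsIn, Matrix.mulVec_add, Matrix.mulVec_smul]
      rw [this, this]
    have hz' : HasDerivAt (fun t => z + t * v₂) v₂ 0 := by
      simpa using ((hasDerivAt_id (0 : ℝ)).mul_const v₂).const_add z
    have hw' : HasDerivAt (fun t => w + t * v₃) v₃ 0 := by
      simpa using ((hasDerivAt_id (0 : ℝ)).mul_const v₃).const_add w
    have hN := (hz'.mul_const w').sub (hw'.mul_const z')
    have hM := (hz'.mul_const z').add (hw'.mul_const w')
    have hR := (hθ.cos.mul hN).add (hθ.sin.mul hM)
    have h0 := hR.unique ((hasDerivAt_const (0 : ℝ) (0 : ℝ)).congr_of_eventuallyEq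
      (Filter.Eventually.of_forall fun t => planeAngle_relation hr' (z + t * v₂) (w + t * v₃)))
    simp only [Pi.sub_apply, Pi.add_apply, zero_mul, add_zero, θ] at h0
    obtain ⟨c1, c2⟩ := planeAngle_cos_sin hr hr'
    set ρ := √(z ^ 2 + w ^ 2) * √(z' ^ 2 + w' ^ 2)
    rw [eq_div_iff hr]
    refine mul_right_cancel₀ hr' ?_
    set C := Real.cos (planeAngle z w z' w')
    set S := Real.sin (planeAngle z w z' w')
    set δ := D (Pi.single d v)
    have h5 := congrArg (fun t => ρ * t) h0
    simp only [mul_zero] at h5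
    have h6 : -(S * ρ) * δ * (z * w' - w * z') + (C * ρ) * (v₂ * w' - v₃ * z') +
        ((C * ρ) * δ * (z * z' + w * w') + (S * ρ) * (v₂ * z' + v₃ * w')) = 0 := by
      rw [← h5]; ring
    rw [c1, c2] at h6
    linear_combination -h6
  -- The gradient is `(-w, z) / (z² + w²)` in that plane: orthogonal to the radius, with norm
  -- inverse to the distance.
  have hg : coordsIn F (WithLp.toLp 2 fun k => D (Pi.single d (EuclideanSpace.single k 1))) =
      ![0, 0, -w / (z ^ 2 + w ^ 2), z / (z ^ 2 + w ^ 2)] := by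
    have h3 : ∀ i, coordsIn F (WithLp.toLp 2 fun k => D (Pi.single d (EuclideanSpace.single k 1))) i =
        D (Pi.single d (WithLp.toLp 2 fun k => F k i)) := by
      intro i
      have e : (Pi.single d (WithLp.toLp 2 fun k => F k i) : ι → R4) =
          ∑ k, F k i • Pi.single d (EuclideanSpace.single k 1) := by
        funext u
        by_cases hu : u = d
        · subst hu
          ext k
          simp [Finset.sum_apply, Pi.single_apply]
        · simp [hu, Finset.sum_apply]
      rw [e, map_sum]
      simp [coordsIn, Matrix.mulVec, dotProduct]
    have h4 : ∀ i j, coordsIn F (WithLp.toLp 2 fun k => F k i) j = if i = j then 1 else 0 := by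
      intro i j
      have := congrFun (congrFun (transpose_mul_of_mem hF) j) i
      rw [Matrix.one_apply, Matrix.mul_apply] at this
      simpa [coordsIn, Matrix.mulVec, dotProduct, eq_comm] using this
    funext i
    rw [h3, key, h4, h4]
    fin_cases i <;> simp
  have hdet := det_coords hF (x d - x a) (x d - x b) (x d - x c)
    (WithLp.toLp 2 fun k => D (Pi.single d (EuclideanSpace.single k 1)))
  refine (congrArg abs hdet).trans ?_
  rw [hg, show x d - x b = (x d - x a) - (x b - x a) by abel,
    show x d - x c = (x d - x a) - (x c - x a) by abel,
    coordsIn_sub (x d - x a) (x b - x a), coordsIn_sub (x d - x a) (x c - x a), h1, h2,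
    det_fin_four]
  have hA : area2 (x a) (x b) (x c) = X * Y := by
    rw [area2, norm_eq_coords hF, norm_eq_coords hF, coordsIn_perp hF, h1, h2]
    have e1 : √(![X, 0, 0, 0] ⬝ᵥ ![X, 0, 0, 0]) = X := by
      refine (congrArg Real.sqrt ?_).trans (Real.sqrt_sq hX.le)
      simp [sq]
    rw [e1]
    congr 1
    refine (congrArg Real.sqrt ?_).trans (Real.sqrt_sq hY.le)
    simp [dotProduct, Fin.sum_univ_four]
    field_simp
    ring
  rw [hA]
  simp only [Matrix.of_apply, Matrix.cons_val', Matrix.cons_val_zero, Matrix.cons_val_one,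
    Matrix.cons_val, Pi.sub_apply, ← hz, ← hw]
  rw [← abs_of_pos (mul_pos hX hY)]
  set u₀ := coordsIn F (x d - x a) 0
  set u₁ := coordsIn F (x d - x a) 1
  congr 1
  field_simp
  ring

/-- The formula in `dihedral` is symmetric only on symmetric matrices of lengths, so derivatives
cannot be exchanged directly. The given direction is realized by a motion of the points, along which
the two functions coincide. -/
theorem dihedralDeriv_swap {x : Fin 4 → R4} (hx : AffineIndependent ℝ x) {L : Fin 4 → Fin 4 → ℝ}
    (hL : ∀ i j, L i j = L j i) (h0 : ∀ i, L i i = 0) :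
    dihedralDeriv (x ∘ Equiv.swap 0 1) (fun i j => L (Equiv.swap 0 1 i) (Equiv.swap 0 1 j)) =
      dihedralDeriv x L := by
  obtain ⟨v, hv⟩ := exists_distDeriv_eq hx hL
  have hv' : ∀ i j, distDeriv x i j v = L i j := by
    intro i j
    by_cases h : i = j
    · subst h; rw [h0, distDeriv_self]
    · exact hv i j h
  obtain ⟨D₁, h1, h1'⟩ := hasFDerivAt_dihedral_comp (x := x) (s := id) hx
  obtain ⟨D₂, h2, h2'⟩ := hasFDerivAt_dihedral_comp (x := x) (s := Equiv.swap 0 1)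
    (hx.comp_embedding (Equiv.swap (0 : Fin 4) 1).toEmbedding)
  have h3 : D₁ = D₂ := by
    refine h1.unique (h2.congr_of_eventuallyEq (Filter.Eventually.of_forall fun q => ?_))
    have e : Equiv.swap (0 : Fin 4) 1 2 = 2 := by decide
    have e' : Equiv.swap (0 : Fin 4) 1 3 = 3 := by decide
    simp only [dihedral, distMat, Function.comp_apply, id, Equiv.swap_apply_left,
      Equiv.swap_apply_right, e, e', dist_comm (q 1) (q 0)]
    congr 1
    simp only [reduceIte, Fin.reduceEq]
    ring_nf
  have h4 := h1' v
  rw [h3, h2'] at h4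
  simpa only [hv', id, Function.comp_id] using h4

namespace TetComplex

variable {V E F T : Type*} {K : TetComplex V E F T} {p : V → R4}

/-- The neighbour across a face. Its opposite vertex differs from the vertices of the face because
they all belong to one tetrahedron. -/
theorem FaceStar.exists_other {f : F} (σ : K.FaceStar f) (hK : ∀ t, Function.Injective (K.vert t))
    {t : T} {x : Fin 4} (h : K.face t x = f) :
    ∃ t' x', t' ≠ t ∧ K.face t' x' = f ∧ ∀ j, j ≠ x → K.vert t j ≠ K.vert t' x' := by
  rcases σ.covers t x h with ⟨rfl, rfl⟩ | ⟨rfl, rfl⟩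
  · refine ⟨σ.right, σ.rord 3, σ.left_ne_right.symm, σ.right_face, fun j hj he => ?_⟩
    obtain ⟨k, rfl⟩ := σ.lord.surjective j
    obtain ⟨c, rfl⟩ := Fin.exists_succ_eq.2 (fun h => hj (congrArg _ h))
    rw [σ.vert_glue] at he
    exact absurd (σ.rord.injective (hK _ he)) (Fin.castSucc_lt_last c).ne
  · refine ⟨σ.left, σ.lord 0, σ.left_ne_right, σ.left_face, fun j hj he => ?_⟩
    obtain ⟨k, rfl⟩ := σ.rord.surjective j
    obtain ⟨c, rfl⟩ := Fin.exists_castSucc_eq.2 (fun h => hj (congrArg _ h))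
    rw [← σ.vert_glue] at he
    exact absurd (σ.lord.injective (hK _ he)) (Fin.succ_ne_zero c)

/-- Both vectors start from or end at the last vertex of the ordering; in the moves this is the new
vertex, so the rows of the matrix `a` appear. -/
theorem orderBivector_eq (P : Presentation K p) (t : T) (s : Equiv.Perm (Fin 4)) :
    K.orderBivector p t s = -((P.doubleArea (K.face t (s 0)))⁻¹ •
      dualWedge ⇑(p (K.vert t (s 3)) - p (K.vert t (s 2)))
        ⇑(p (K.vert t (s 3)) - p (K.vert t (s 1)))) := by
  rw [P.doubleArea_eq s rfl, orderBivector, faceBivector,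
    area2_rotate (p (K.vert t (s 1))) (p (K.vert t (s 2))) (p (K.vert t (s 3))), ← smul_neg]
  congr 1
  have : (⇑(p (K.vert t (s 1)) - p (K.vert t (s 2))) : Fin 4 → ℝ) =
      ⇑(p (K.vert t (s 3)) - p (K.vert t (s 2))) +
        (-1 : ℝ) • ⇑(p (K.vert t (s 3)) - p (K.vert t (s 1))) := by
    ext k; simp
  rw [this, dualWedge_add_right, dualWedge_self, dualWedge_smul_right]
  simp

end TetComplex

theorem exists_perm_zero : ∀ (ε : ℤˣ) (i : Fin 4), ∃ s : Equiv.Perm (Fin 4),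
    Equiv.Perm.sign s = ε ∧ s 0 = i := by decide

/-! ## The move 0 → 2 -/

theorem exists_perm_zero_two_three : ∀ y j i : Fin 4, y ≠ j → y ≠ i → j ≠ i →
    ∃ s : Equiv.Perm (Fin 4), s 0 = y ∧ s 2 = j ∧ s 3 = i := by decide

theorem GeneralPosition.restrict {V : Type*} {p : Option V → R4} (hp : GeneralPosition p) :
    GeneralPosition fun v => p (some v) := fun s hs =>
  hp (fun i => some (s i)) ((Option.some_injective _).comp hs)

namespace Presentation

variable {V E F T : Type*} {K : TetComplex V E F T} {p : V → R4} [Fintype V] [Fintype E]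
  [Fintype F] [Fintype T] [DecidableEq V] [DecidableEq E] [DecidableEq F]

theorem component_smul (A B : Matrix (Fin 4) (Fin 4) ℝ) (r : ℝ) (m : Fin 3) :
    component A (r • B) m = r * component A B m := by
  simp [component]

theorem f₃_flag (hK : K.IsRegular) (hp : K.Nondeg p) (P : Presentation K p) {t : T} {e : E}
    {s : Equiv.Perm (Fin 4)} (h : K.EndsWith e t s) (m : Fin 3) :
    P.f₃ (e, m) (Sum.inr (K.face t (s 0))) = (P.doubleArea (K.face t (s 0)))⁻¹ *
      component (P.axes e) (dualWedge ⇑(p (K.vert t (s 3)) - p (K.vert t (s 2)))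
        ⇑(p (K.vert t (s 3)) - p (K.vert t (s 1)))) m := by
  rw [P.f₃_face hK hp rfl, TetComplex.cornerForm_eq_orderBivector (hp.injective t) h,
    TetComplex.orderBivector_eq P, ← neg_smul, component_smul]
  ring

theorem f₃_eq_zero (hK : K.IsRegular) (hp : K.Nondeg p) (P : Presentation K p) {t : T} {x : Fin 4}
    {e : E} (h : ∀ s : Equiv.Perm (Fin 4), s 0 = x → ¬K.EndsWith e t s) (m : Fin 3) :
    P.f₃ (e, m) (Sum.inr (K.face t x)) = 0 := by
  rw [P.f₃_face hK hp rfl, TetComplex.cornerForm_eq_zero h]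
  simp [component]

end Presentation

namespace TetComplex

variable {V E F T : Type*} {K : TetComplex V E F T}

theorem flagForm_swap (hK : K.IsRegular) {p : V → R4} (hp : K.Nondeg p) {y : E ⊕ F → ℝ}
    (hy : ∀ f, y (Sum.inr f) = 0) (t : T) (s : Equiv.Perm (Fin 4)) :
    K.flagForm p y t (s * Equiv.swap 0 1) = -K.flagForm p y t s := by
  have h2 : (s * Equiv.swap 0 1 : Equiv.Perm (Fin 4)) 2 = s 2 := congrArg s (by decide)
  have h3 : (s * Equiv.swap 0 1 : Equiv.Perm (Fin 4)) 3 = s 3 := congrArg s (by decide)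
  have h0 : (s * Equiv.swap 0 1 : Equiv.Perm (Fin 4)) 0 = s 1 := congrArg s (by decide)
  have h1 : (s * Equiv.swap 0 1 : Equiv.Perm (Fin 4)) 1 = s 0 := congrArg s (by decide)
  have hd := dihedralDeriv_swap (x := p ∘ K.vert t ∘ s) ((hp t).comp_embedding s.toEmbedding)
    (L := fun i j => if i = j then 0 else y (Sum.inl (K.edge t (s i) (s j))))
    (fun i j => by simp only [eq_comm (a := i), hK.edge_symm t (s i)]) (fun i => if_pos rfl)
  simp only [EmbeddingLike.apply_eq_iff_eq] at hd
  rw [flagForm, flagForm, hy, hy, zero_smul, zero_smul, add_zero, add_zero, h0, h1, h2, h3,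
    dihedralBivector_swap, smul_neg]
  congr 2

/-! ### Flags and bivectors at a doubled face. -/

section Inflate

variable [DecidableEq T] {t₀ : T} {i₀ : Fin 4} {p : Option V → R4}

theorem inflate_vert_of_ne {b : Bool} {i : Fin 4} (hi : i ≠ i₀) :
    (K.inflate t₀ i₀).vert (Sum.inr b) i = some (K.vert t₀ i) := by simp [inflate, hi]

theorem inflate_vert_self {b : Bool} : (K.inflate t₀ i₀).vert (Sum.inr b) i₀ = none := by
  simp [inflate]

theorem inflate_face_of_ne {t : T} (i : Fin 4) (h : t ≠ t₀) :
    (K.inflate t₀ i₀).face (Sum.inl t) i = Sum.inl (K.face t i) := by simp [inflate, h]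

theorem inflate_endsWith_inl_inl {e : E} {t : T} {s : Equiv.Perm (Fin 4)} :
    (K.inflate t₀ i₀).EndsWith (Sum.inl e) (Sum.inl t) s ↔ K.EndsWith e t s := by
  simp [EndsWith, inflate]

theorem inflate_endsWith_inr_inl {j : {j : Fin 4 // j ≠ i₀}} {t : T} {s : Equiv.Perm (Fin 4)} :
    ¬(K.inflate t₀ i₀).EndsWith (Sum.inr j) (Sum.inl t) s := by
  simp [EndsWith, inflate]

theorem inflate_endsWith_inl_inr {e : E} {b : Bool} {s : Equiv.Perm (Fin 4)} :
    (K.inflate t₀ i₀).EndsWith (Sum.inl e) (Sum.inr b) s ↔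
      s 2 ≠ i₀ ∧ s 3 ≠ i₀ ∧ K.EndsWith e t₀ s := by
  have h23 : s 2 ≠ s 3 := s.injective.ne (by decide)
  by_cases h2 : s 2 = i₀
  · have h3 : ¬s 3 = i₀ := fun h => h23 (h2.trans h.symm)
    simp [EndsWith, inflate, h2, h3]
  · by_cases h3 : s 3 = i₀ <;> simp [EndsWith, inflate, h2, h3]

theorem inflate_endsWith_inr_inr {j : {j : Fin 4 // j ≠ i₀}} {b : Bool}
    {s : Equiv.Perm (Fin 4)} :
    (K.inflate t₀ i₀).EndsWith (Sum.inr j) (Sum.inr b) s ↔ s 2 = j ∧ s 3 = i₀ := by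
  have h23 : s 2 ≠ s 3 := s.injective.ne (by decide)
  by_cases h2 : s 2 = i₀
  · have h3 : ¬s 3 = i₀ := fun h => h23 (h2.trans h.symm)
    simp [EndsWith, inflate, h2, h3]
  · by_cases h3 : s 3 = i₀
    · simp only [EndsWith, inflate, h2, h3, dite_true, dite_false, if_true, if_false, Sum.inr.injEq,
        and_true, Option.some.injEq, Subtype.ext_iff]
      constructor
      · exact fun h => h.1
      · exact fun h => ⟨h, congrArg _ h⟩
    · simp [EndsWith, inflate, h2, h3]

/-- The two new tetrahedra have the same vertices and edges and opposite orientations. Exchanging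
the first two vertices matches their right-oriented orderings and changes the sign of the dihedral
bivector, so lengths have no effect through them. -/
theorem inflate_sum_new [Fintype T] (hK : K.IsRegular) (hv : ∀ t, Function.Injective (K.vert t))
    (hp : GeneralPosition p)
    {y : (E ⊕ {j : Fin 4 // j ≠ i₀}) ⊕ (F ⊕ Option {j : Fin 4 // j ≠ i₀}) → ℝ}
    (hy : ∀ f, y (Sum.inr f) = 0) (e) : (open Classical in ∑ b : Bool, ∑ s : Equiv.Perm (Fin 4),
      if (K.inflate t₀ i₀).IsFlag e (Sum.inr b) s then
        (K.inflate t₀ i₀).flagForm p y (Sum.inr b) s else 0) = 0 := by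
  classical
  have h2 : ∀ s : Equiv.Perm (Fin 4), (s * Equiv.swap 0 1 : Equiv.Perm (Fin 4)) 2 = s 2 :=
    fun s => congrArg s (by decide)
  have h3 : ∀ s : Equiv.Perm (Fin 4), (s * Equiv.swap 0 1 : Equiv.Perm (Fin 4)) 3 = s 3 :=
    fun s => congrArg s (by decide)
  rw [Fintype.sum_bool, ← Equiv.sum_comp (Equiv.mulRight (Equiv.swap (0 : Fin 4) 1)),
    ← Finset.sum_add_distrib]
  refine Finset.sum_eq_zero fun s _ => ?_
  have hf : (K.inflate t₀ i₀).IsFlag e (Sum.inr true) (s * Equiv.swap 0 1) ↔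
      (K.inflate t₀ i₀).IsFlag e (Sum.inr false) s := by
    rw [IsFlag, IsFlag, h2, h3, Equiv.Perm.sign_mul, Equiv.Perm.sign_swap (by decide)]
    simp [inflate]
  rw [Equiv.coe_mulRight]
  simp only [hf]
  split_ifs
  · rw [flagForm_swap hK.inflate (inflate_nondeg hv hp) hy]
    have : (K.inflate t₀ i₀).flagForm p y (Sum.inr true) s =
        (K.inflate t₀ i₀).flagForm p y (Sum.inr false) s := by
      rw [flagForm, flagForm, hy, hy]
      rfl
    rw [this, neg_add_cancel]
  · rw [add_zero]

theorem inflate_curvature_edge [Fintype T] [DecidableEq E] [DecidableEq F] (hK : K.IsRegular)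
    (hv : ∀ t, Function.Injective (K.vert t)) (hp : GeneralPosition p) (e e₁ : E) :
    (K.inflate t₀ i₀).curvature p (Sum.inl e) (Pi.single (Sum.inl (Sum.inl e₁)) 1) =
      K.curvature (fun v => p (some v)) e (Pi.single (Sum.inl e₁) 1) := by
  classical
  rw [curvature, Fintype.sum_sum_type, inflate_sum_new hK hv hp (by simp), add_zero, curvature]
  refine Finset.sum_congr rfl fun t _ => Finset.sum_congr rfl fun s _ => ?_
  refine if_congr (and_congr Iff.rfl inflate_endsWith_inl_inl) ?_ rfl
  have h1 : ∀ e₂ : E, (Pi.single (Sum.inl (Sum.inl e₁)) (1 : ℝ) :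
      (E ⊕ {j : Fin 4 // j ≠ i₀}) ⊕ (F ⊕ Option {j : Fin 4 // j ≠ i₀}) → ℝ)
        (Sum.inl (Sum.inl e₂)) = (Pi.single (Sum.inl e₁) (1 : ℝ) : E ⊕ F → ℝ) (Sum.inl e₂) := by
    intro e₂
    simp [Pi.single_apply]
  rw [flagForm, flagForm, Pi.single_eq_of_ne (by simp), Pi.single_eq_of_ne (by simp)]
  exact congrArg₂ _ (congrArg₂ _ (congrArg _ (funext fun i => funext fun j =>
    congrArg _ (h1 _))) rfl) (by simp)

theorem inflate_curvature_new [Fintype T] [DecidableEq E] [DecidableEq F] (hK : K.IsRegular)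
    (hv : ∀ t, Function.Injective (K.vert t)) (hp : GeneralPosition p)
    (r : E ⊕ {j : Fin 4 // j ≠ i₀}) (e : E ⊕ {j : Fin 4 // j ≠ i₀})
    (h : (∃ j, e = Sum.inr j) ∨ ∃ j, r = Sum.inr j) :
    (K.inflate t₀ i₀).curvature p e (Pi.single (Sum.inl r) 1) = 0 := by
  classical
  rw [curvature, Fintype.sum_sum_type, inflate_sum_new hK hv hp (by simp), add_zero]
  refine Finset.sum_eq_zero fun t _ => Finset.sum_eq_zero fun s _ => ?_
  rcases h with ⟨j, rfl⟩ | ⟨j, rfl⟩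
  · exact if_neg fun h => inflate_endsWith_inr_inl h.2
  · split_ifs
    · have h1 : ∀ e₂ : E, (Pi.single (Sum.inl (Sum.inr j)) (1 : ℝ) :
          (E ⊕ {j : Fin 4 // j ≠ i₀}) ⊕ (F ⊕ Option {j : Fin 4 // j ≠ i₀}) → ℝ)
          (Sum.inl (Sum.inl e₂)) = 0 := fun e₂ => Pi.single_eq_of_ne (by simp) _
      rw [flagForm, Pi.single_eq_of_ne (by simp), zero_smul, add_zero]
      simp only [inflate, h1, ite_self]
      rw [dihedralDeriv_zero, zero_smul]
    · rfl

theorem inflate_cornerForm_inl (t : T) (x : Fin 4) (e : E) :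
    (K.inflate t₀ i₀).cornerForm p (Sum.inl t) x (Sum.inl e) =
      K.cornerForm (fun v => p (some v)) t x e := by
  classical
  rw [cornerForm, cornerForm]
  exact Finset.sum_congr rfl fun s _ =>
    if_congr (and_congr Iff.rfl inflate_endsWith_inl_inl) rfl rfl

/-- The old edges in question are those of `ABC`, which the new tetrahedra share with `t₀`; the
copies of the face therefore have the same bivectors. -/
theorem inflate_cornerForm_inr (b : Bool) (e : E) :
    (K.inflate t₀ i₀).cornerForm p (Sum.inr b) i₀ (Sum.inl e) =
      K.cornerForm (fun v => p (some v)) t₀ i₀ e := by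
  classical
  rw [cornerForm, cornerForm]
  refine Finset.sum_congr rfl fun s _ => ?_
  have hne : s 0 = i₀ → ∀ k, k ≠ 0 → s k ≠ i₀ := fun h k hk => h ▸ s.injective.ne hk
  have hc : (s 0 = i₀ ∧ (K.inflate t₀ i₀).EndsWith (Sum.inl e) (Sum.inr b) s) ↔
      (s 0 = i₀ ∧ K.EndsWith e t₀ s) := by
    rw [inflate_endsWith_inl_inr]
    exact and_congr_right fun h => ⟨fun h' => h'.2.2, fun h' =>
      ⟨hne h 2 (by decide), hne h 3 (by decide), h'⟩⟩
  simp only [hc]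
  split_ifs with h
  · rw [orderBivector, orderBivector, inflate_vert_of_ne (hne h.1 1 (by decide)),
      inflate_vert_of_ne (hne h.1 2 (by decide)), inflate_vert_of_ne (hne h.1 3 (by decide))]
  · rfl

end Inflate

end TetComplex

theorem Equiv.exists_sumSumSumComm {E F R Φ J Q : Type*} (ε : J ⊕ Q ≃ R ⊕ Φ) :
    ∃ ι : (E ⊕ F) ⊕ (J ⊕ Q) ≃ (E ⊕ R) ⊕ (F ⊕ Φ),
      (∀ e, ι (Sum.inl (Sum.inl e)) = Sum.inl (Sum.inl e)) ∧
      (∀ f, ι (Sum.inl (Sum.inr f)) = Sum.inr (Sum.inl f)) ∧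
      ∀ y, ι (Sum.inr y) = Sum.map Sum.inr Sum.inr (ε y) := by
  refine ⟨(Equiv.sumCongr (Equiv.refl _) ε).trans (Equiv.sumSumSumComm E F R Φ), fun e => rfl,
    fun f => rfl, fun y => ?_⟩
  simp only [Equiv.trans_apply, Equiv.sumCongr_apply, Sum.map_inr]
  generalize ε y = z
  rcases z with z | z <;> rfl

theorem injective_vec_four {α : Type*} {a b c d : α} (h₁ : a ≠ b) (h₂ : a ≠ c) (h₃ : a ≠ d)
    (h₄ : b ≠ c) (h₅ : b ≠ d) (h₆ : c ≠ d) : Function.Injective ![a, b, c, d] := by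
  intro i j h
  fin_cases i <;> fin_cases j <;> simp_all

/-! ### Angles before and after a move, and invariance under 0 → 2. -/

namespace Presentation

variable {V E F T : Type*} {K : TetComplex V E F T}

/-- Derivatives require equality of functions near `p`, not only at `p`; nondegeneracy persists
there, so any convenient right-oriented ordering may be used for the angle. -/
theorem nondeg_eventually_angle [Fintype V] [Fintype T] {p : V → R4} (hp : K.Nondeg p)
    (P : Presentation K p) {t t' : T} {s : Equiv.Perm (Fin 4)} {x : Fin 4} {f : F}
    (hs : Equiv.Perm.sign s = K.ori t) (hf : K.face t (s 0) = f)
    (hf' : K.face t' x = f) (hne : t' ≠ t) {D : (V → R4) →L[ℝ] ℝ}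
    (h : HasFDerivAt (fun q : V → R4 => P.measure q (Sum.inr f)) D p) :
    HasFDerivAt (fun q : V → R4 => theta (q (K.vert t (s 1))) (q (K.vert t (s 2)))
      (q (K.vert t (s 3))) (q (K.vert t' x)) (q (K.vert t (s 0)))) D p := by
  refine h.congr_of_eventuallyEq ?_
  filter_upwards [hp.eventually] with q hq
  subst hf
  exact (P.angle_eq hs hf' hne (hq t)).symm

/-- The case `D = E` of the angle, for arbitrary names of the vertices. -/
theorem hasFDerivAt_angle_self [Fintype V] [Fintype T] {p : V → R4} (hp : K.Nondeg p)
    (P : Presentation K p) {t t' : T} {s : Equiv.Perm (Fin 4)} {x : Fin 4} {f : F}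
    (hs : Equiv.Perm.sign s = K.ori t) (hf : K.face t (s 0) = f)
    (hf' : K.face t' x = f) (hne : t' ≠ t) (hx : K.vert t' x = K.vert t (s 0))
    {D : (V → R4) →L[ℝ] ℝ}
    (h : HasFDerivAt (fun q : V → R4 => P.measure q (Sum.inr f)) D p) : D = 0 := by
  have h1 := P.nondeg_eventually_angle hp hs hf hf' hne h
  simp only [hx] at h1
  refine h1.unique (hasFDerivAt_theta_self ?_)
  exact (hp t).linearIndependent_of_injective (perm_injective_vec s (finRotate 4))

/-- Old angles far from the place of the move do not change. -/
theorem angle_restrict [Fintype V] [Fintype T] {E' F' T' : Type*} [Fintype T']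
    {K' : TetComplex (Option V) E' F' T'} {p : Option V → R4}
    (hp' : K'.Nondeg p) (P : Presentation K fun v => p (some v)) (P' : Presentation K' p)
    {f : F} {f' : F'} {τ : T → T'} (hτ : ∀ t t', t ≠ t' → τ t ≠ τ t')
    (hvert : ∀ t i, K.face t i = f → ∀ j, K'.vert (τ t) j = some (K.vert t j))
    (hface : ∀ t i, K.face t i = f → K'.face (τ t) i = f')
    (hori : ∀ t i, K.face t i = f → K'.ori (τ t) = K.ori t)
    {D : (V → R4) →L[ℝ] ℝ}
    (h : HasFDerivAt (fun q : V → R4 => P.measure q (Sum.inr f)) D fun v => p (some v))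
    {D' : (Option V → R4) →L[ℝ] ℝ}
    (h' : HasFDerivAt (fun q : Option V → R4 => P'.measure q (Sum.inr f')) D' p) :
    D' = D.comp (restrictPoints V) := by
  set σ := P.faceStar f with hσ
  have h1 := P'.nondeg_eventually_angle hp' (t := τ σ.left) (t' := τ σ.right) (s := σ.lord)
    (x := σ.rord 3) (σ.left_oriented.trans (hori _ _ σ.left_face).symm) (hface _ _ σ.left_face)
    (hface _ _ σ.right_face) (hτ _ _ σ.left_ne_right.symm) h'
  simp only [hvert _ _ σ.left_face, hvert _ _ σ.right_face] at h1
  refine h1.unique ?_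
  exact h.comp_restrictPoints

/-- At least one side of every face is away from the place of the move, and columns and areas of
faces can be computed from that side. -/
theorem exists_corner_ne {p : V → R4} (P : Presentation K p) (f : F) (t₀ : T) : ∃ t i, t ≠ t₀ ∧ K.face t i = f := by
  set σ := P.faceStar f
  by_cases h : σ.left = t₀
  · exact ⟨σ.right, _, fun h' => σ.left_ne_right (h.trans h'.symm), σ.right_face⟩
  · exact ⟨σ.left, _, h, σ.left_face⟩

variable [Fintype V] [Fintype E] [Fintype F] [Fintype T] [DecidableEq V] [DecidableEq E]
  [DecidableEq F] [DecidableEq T]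

/-- Invariance under the move 0 → 2. -/
theorem inflate_invariant (hK : K.IsClosedPseudotriangulation) {p : Option V → R4}
    (hp : GeneralPosition p) (P : Presentation K fun v => p (some v)) (t₀ : T) (i₀ : Fin 4)
    (P' : Presentation (K.inflate t₀ i₀) p) :
    (P.Acyclic ↔ P'.Acyclic) ∧
      (P.Acyclic → ∃ I : ℝ, I ≠ 0 ∧ P.HasInvariant I ∧ P'.HasInvariant I) := by
  classical
  have hr := hK.isRegular
  have hr' : (K.inflate t₀ i₀).IsRegular := hr.inflate
  have hv := hK.vert_injective
  have hn := TetComplex.nondeg_restrict hv hp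
  have hn' : (K.inflate t₀ i₀).Nondeg p := TetComplex.inflate_nondeg hv hp
  obtain ⟨s₀, hs₀, hs₀'⟩ := exists_perm_zero (K.ori t₀) i₀
  let κ : Fin 3 ≃ {j : Fin 4 // j ≠ i₀} := (finSuccAboveEquiv 0).trans
    (s₀.subtypeEquiv fun k => by rw [← hs₀', s₀.injective.ne_iff])
  -- `J` consists of the three new lengths and, as its last member, the angle at `(ABC)'`; `Q`
  -- consists of the angles at the three faces through the new vertex.
  let ε₀ : Fin 4 ⊕ Fin 3 ≃ Fin 3 ⊕ Option (Fin 3) := Equiv.ofBijective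
    (Sum.elim ![Sum.inl 0, Sum.inl 1, Sum.inl 2, Sum.inr none]
      fun q => Sum.inr (some q)) (by decide)
  obtain ⟨ι, ιE, ιF, ι'⟩ := Equiv.exists_sumSumSumComm (E := E) (F := F)
    (ε₀.trans (Equiv.sumCongr κ (Equiv.optionCongr κ)))
  have ιQ : ∀ q, ι (Sum.inr (Sum.inr q)) = Sum.inr (Sum.inr (some (κ q))) := fun q => ι' _
  have ι3 : ι (Sum.inr (Sum.inl 3)) = Sum.inr (Sum.inr none) := ι' _
  have ιJ : ∀ j : Fin 3, ι (Sum.inr (Sum.inl j.castSucc)) = Sum.inl (Sum.inr (κ j)) := by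
    intro j
    rw [ι']
    fin_cases j <;> rfl
  have ιk : ∀ k : E ⊕ Fin 4, k ≠ Sum.inr 3 → ∃ r, ι (Sum.map Sum.inl Sum.inl k) = Sum.inl r ∧
      ((∃ e, k = Sum.inl e ∧ r = Sum.inl e) ∨ ∃ (i : Fin 4) (j : _), k = Sum.inr i ∧ r = Sum.inr j) := by
    rintro (e | i) hk
    · exact ⟨_, ιE e, Or.inl ⟨e, rfl, rfl⟩⟩
    · obtain ⟨j, rfl⟩ := Fin.exists_castSucc_eq.2 (show i ≠ Fin.last 3 from fun h => hk (h ▸ rfl))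
      exact ⟨_, ιJ j, Or.inr ⟨_, _, rfl, rfl⟩⟩
  choose D hD _ using P.exists_hasFDerivAt_measure hn hp.restrict
  choose D' hD' hz using P'.exists_hasFDerivAt_measure hn' hp
  set f₀ := K.face t₀ i₀ with hf₀
  have hsk : ∀ k, k ≠ 0 → s₀ k ≠ i₀ := fun k hk => hs₀' ▸ s₀.injective.ne hk
  have hface₀ : (K.inflate t₀ i₀).face (Sum.inl t₀) i₀ = Sum.inr none := by
    simp [TetComplex.inflate]
  have hface₁ : (K.inflate t₀ i₀).face (Sum.inr false) i₀ = Sum.inl f₀ := by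
    simp [TetComplex.inflate, hf₀]
  have hface₂ : (K.inflate t₀ i₀).face (Sum.inr true) i₀ = Sum.inr none := by
    simp [TetComplex.inflate]
  have hfaceκ : ∀ b j, (K.inflate t₀ i₀).face (Sum.inr b) (κ j) = Sum.inr (some (κ j)) := by
    intro b j
    simp [TetComplex.inflate, (κ j).2]
  -- The only correction: the angle at `(ABC)'` is added to the angle at `ABC`.
  let C : Matrix (F ⊕ Fin 3) (E ⊕ Fin 4) ℝ :=
    Matrix.of fun r k => if r = Sum.inl f₀ then (if k = Sum.inr 3 then 1 else 0) else 0
  have hC₁ : ∀ r (X : E ⊕ Fin 4 → ℝ), ∑ k, C r k * X k = if r = Sum.inl f₀ then X (Sum.inr 3) else 0 := by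
    intro r X
    by_cases h : r = Sum.inl f₀ <;> simp [C, h]
  have hC₂ : ∀ k (X : F ⊕ Fin 3 → Matrix (Fin 4) (Fin 4) ℝ), ∑ r, C r k • X r =
      if k = Sum.inr 3 then X (Sum.inl f₀) else 0 := by
    intro k X
    by_cases h : k = Sum.inr 3 <;> simp [C, h]
  -- the angles at the doubled face
  let A : Fin 4 → Option V := fun i => some (K.vert t₀ (s₀ i))
  have hA : ∀ i j, i ≠ j → A i ≠ A j := fun i j h =>
    (Option.some_injective _).ne ((hv t₀).ne (s₀.injective.ne h))
  have hθ₂ : HasFDerivAt (fun q : Option V → R4 => theta (q (A 1)) (q (A 2)) (q (A 3)) (q none)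
      (q (A 0))) (D' (Sum.inr (Sum.inr none))) p := by
    have h := P'.nondeg_eventually_angle hn' (t := Sum.inl t₀) (s := s₀) (t' := Sum.inr true)
      (x := i₀) (f := Sum.inr none) hs₀ (by rw [hs₀']; exact hface₀) hface₂ (by simp) (hD' _)
    rw [TetComplex.inflate_vert_self] at h
    exact h
  obtain ⟨t₁, x₁, ht₁, hx₁, hne₁⟩ := (P.faceStar f₀).exists_other hv (t := t₀) (x := i₀) rfl
  have hne₁' : ∀ k, k ≠ 0 → A k ≠ some (K.vert t₁ x₁) := fun k hk =>
    (Option.some_injective _).ne (hne₁ _ (hsk k hk))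
  have hθ₁ : HasFDerivAt (fun q : Option V → R4 => theta (q (A 1)) (q (A 2)) (q (A 3))
      (q (some (K.vert t₁ x₁))) (q none)) (D' (Sum.inr (Sum.inl f₀))) p := by
    have h := P'.nondeg_eventually_angle hn' (t := Sum.inr false) (s := s₀) (t' := Sum.inl t₁)
      (x := x₁) (f := Sum.inl f₀) hs₀ (by rw [hs₀']; exact hface₁) (by rw [TetComplex.inflate_face_of_ne _ ht₁, hx₁])
      (by simp) (hD' _)
    rw [TetComplex.inflate_vert_of_ne (hsk 1 (by decide)),
      TetComplex.inflate_vert_of_ne (hsk 2 (by decide)),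
      TetComplex.inflate_vert_of_ne (hsk 3 (by decide)), hs₀', TetComplex.inflate_vert_self] at h
    exact h
  have hθ := (P.nondeg_eventually_angle hn hs₀ (congrArg _ hs₀') hx₁ ht₁ (hD _)).comp_restrictPoints
  have li₁ := hp.linearIndependent (a := A 1) (b := A 2) (c := A 3) (d := some (K.vert t₁ x₁))
    (u := none) (injective_vec_four (hA _ _ (by decide)) (hA _ _ (by decide))
      (hne₁' _ (by decide)) (hA _ _ (by decide)) (hne₁' _ (by decide)) (hne₁' _ (by decide)))
    (fun i => by fin_cases i <;> simp [A])
  have li₂ := hp.linearIndependent (a := A 1) (b := A 2) (c := A 3) (d := none) (u := A 0)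
    (injective_vec_four (hA _ _ (by decide)) (hA _ _ (by decide)) (by simp [A])
      (hA _ _ (by decide)) (by simp [A]) (by simp [A]))
    (fun i => by
      fin_cases i
      exacts [hA 1 0 (by decide), hA 2 0 (by decide), hA 3 0 (by decide), by simp [A]])
  have li₃ := hp.linearIndependent (a := A 1) (b := A 2) (c := A 3) (d := A 0) (u := none)
    (injective_vec_four (hA _ _ (by decide)) (hA _ _ (by decide)) (hA _ _ (by decide))
      (hA _ _ (by decide)) (hA _ _ (by decide)) (hA _ _ (by decide)))
    (fun i => by fin_cases i <;> simp [A])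
  -- The direction of the new vertex divides the angle at `ABC` between the two neighbouring
  -- tetrahedra into the angles at the two copies of the face.
  have hadd := hasFDerivAt_theta_add li₁ li₂ li₃ hθ₁ hθ₂ hθ
  -- the edges at the new vertex
  let g : Fin 4 → ℝ := fun i => D' (Sum.inr (Sum.inr none)) (Pi.single none (EuclideanSpace.single i 1))
  -- The gradient of the angle at `(ABC)'` takes the place of a fourth edge vector.
  let a : Fin 4 → Fin 4 → ℝ := Fin.snoc (α := fun _ => Fin 4 → ℝ)
    (fun j : Fin 3 => ⇑(p none - p (some (K.vert t₀ (κ j))))) g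
  have ha₁ : ∀ j : Fin 3, a j.castSucc = ⇑(p none - p (some (K.vert t₀ (κ j)))) := fun j =>
    Fin.snoc_castSucc (α := fun _ => Fin 4 → ℝ) _ _ _
  have ha₂ : a (Fin.last 3) = g := Fin.snoc_last (α := fun _ => Fin 4 → ℝ) _ _
  let l : {j : Fin 4 // j ≠ i₀} → ℝ := fun j => dist (p (some (K.vert t₀ j))) (p none)
  have hl : ∀ j, l j ≠ 0 := fun j => P'.dist_ne hn' (Sum.inr j)
  let M : Matrix (Fin 4) (Fin 4) ℝ :=
    P'.f₂.submatrix (fun j => ι (Sum.inr (Sum.inl j))) fun k => (none, k)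
  have hM : absDet M = |(Matrix.of a).det| * ∏ j, (l j)⁻¹ := by
    have h1 : M = Matrix.diagonal (Fin.snoc (α := fun _ => ℝ) (fun j => (l (κ j))⁻¹) 1) *
        Matrix.of a := by
      ext i k
      rw [Matrix.diagonal_mul, Matrix.of_apply]
      change P'.f₂ (ι (Sum.inr (Sum.inl i))) (none, k) = _
      induction i using Fin.lastCases with
      | last =>
        rw [ha₂, Fin.snoc_last (α := fun _ => ℝ), one_mul]
        exact (congrFun (congrArg P'.f₂ ι3) _).trans (P'.f₂_apply_of_hasFDerivAt (hD' _) _)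
      | cast j =>
        rw [ha₁, Fin.snoc_castSucc (α := fun _ => ℝ), ιJ,
          P'.f₂_apply_of_hasFDerivAt (P'.hasFDerivAt_length hn' _), distDeriv_apply]
        change (l (κ j))⁻¹ * inner ℝ (p (some (K.vert t₀ (κ j))) - p none)
          ((Pi.single none (EuclideanSpace.single k 1) : Option V → R4) (some (K.vert t₀ (κ j))) -
            (Pi.single none (EuclideanSpace.single k 1) : Option V → R4) none) = _
        rw [Pi.single_eq_same, Pi.single_eq_of_ne (by simp), zero_sub, inner_neg_right,
          EuclideanSpace.inner_single_right]
        simp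
    have h2 : ∀ x : ℝ, 0 ≤ x → |x⁻¹| = x⁻¹ := fun x hx => abs_of_nonneg (inv_nonneg.2 hx)
    rw [absDet_square, h1, Matrix.det_mul, abs_mul, Matrix.det_diagonal, Fin.prod_univ_castSucc,
      mul_comm]
    simp only [Fin.snoc_castSucc, Fin.snoc_last, mul_one]
    rw [Finset.abs_prod, ← Equiv.prod_comp κ fun j => (l j)⁻¹]
    congr 1
    exact Finset.prod_congr rfl fun j _ => h2 _ dist_nonneg
  have hdet : |(Matrix.of a).det| = P'.doubleArea (Sum.inr none) := by
    rw [P'.doubleArea_eq (t := Sum.inl t₀) s₀ (by rw [hs₀']; exact hface₀)]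
    refine Eq.trans ?_ (abs_det_theta_gradient li₂ li₃ (by simp [A]) (by simp [A]) (by simp [A])
      (by simp [A]) hθ₂)
    congr 3
    funext i
    fin_cases i
    exacts [ha₁ 0, ha₁ 1, ha₁ 2, ha₂]
  -- There are nine flags at three edges: each of the three pairs of edges gives a reversed one, and
  -- all six increasing pairs of the four vectors begin with an edge.
  let x₀ : Fin 3 ⊕ Fin 6 ≃ Fin 3 × Fin 3 := Equiv.ofBijective
    (Sum.elim ![(2, 1), (2, 0), (1, 0)] ![(0, 0), (0, 1), (0, 2), (1, 1), (1, 2), (2, 2)])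
    (by decide)
  -- The face numbered by a missing vertex contains the edges to the other two.
  let u : Fin 3 → Fin 4 × Fin 4 := ![(1, 2), (0, 2), (0, 1)]
  have hu₁ : ∀ j : Fin 3, j.castSucc ≠ (u j).1 ∧ j.castSucc ≠ (u j).2 := by decide
  have hu₂ : ∀ j q : Fin 3, j ≠ q → ∃ l : Fin 3, l ≠ j ∧ l ≠ q ∧
      ((j.castSucc = (u q).1 ∧ l.castSucc = (u q).2) ∨
        (j.castSucc = (u q).2 ∧ j.castSucc ≠ (u q).1 ∧ l.castSucc = (u q).1)) := by decide
  have hx₁' : ∀ q, (x₀ (Sum.inl q)).1.castSucc = (u q).2 ∧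
      (x₀ (Sum.inl q)).1.castSucc.succAbove (x₀ (Sum.inl q)).2 = (u q).1 := by decide
  have hx₂' : ∀ k, (x₀ (Sum.inr k)).1.castSucc = (soPos k).1 ∧
      (x₀ (Sum.inr k)).1.castSucc.succAbove (x₀ (Sum.inr k)).2 = (soPos k).2 := by decide
  obtain ⟨S, hS₁, hS₂⟩ := P'.absDet_star hn' (fun j => Sum.inr j)
    (fun j => (κ.symm j).castSucc) a
    (fun j => by rw [ha₁, κ.apply_symm_apply]; rfl) u (by decide) (by decide)
    (x₀.trans (Equiv.prodCongr κ (Equiv.refl _)))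
    (fun q => by simpa using hx₁' q) (fun k => by simpa using hx₂' k)
    (fun q => (P'.doubleArea (Sum.inr (some (κ q))))⁻¹)
    (P'.f₃.submatrix (fun c => (Sum.inr c.1, c.2)) fun q => ι (Sum.inr (Sum.inr q)))
    (fun j m q => by
      obtain ⟨j, rfl⟩ := κ.surjective j
      change P'.f₃ (Sum.inr (κ j), m) (ι (Sum.inr (Sum.inr q))) = _
      rw [ιQ, ← hfaceκ false q, κ.symm_apply_apply]
      by_cases hjq : j = q
      · subst hjq
        obtain ⟨h1, h2⟩ := hu₁ j
        rw [if_neg h1, if_neg h2, mul_zero]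
        refine P'.f₃_eq_zero hr' hn' (fun s h0 h => ?_) m
        have := (TetComplex.inflate_endsWith_inr_inr.1 h).1
        exact absurd (s.injective (h0.trans this.symm)) (by decide)
      · obtain ⟨l', hl1, hl2, hu⟩ := hu₂ j q hjq
        have hκ : ∀ {i j}, i ≠ j → (κ i : Fin 4) ≠ κ j := fun h =>
          Subtype.val_injective.ne (κ.injective.ne h)
        obtain ⟨s, h0, h2, h3⟩ := exists_perm_zero_two_three (κ q) (κ j) i₀ (hκ (Ne.symm hjq))
          (κ q).2 (κ j).2
        have h1 : s 1 = κ l' := by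
          obtain ⟨k, hk⟩ := s.surjective (κ l')
          fin_cases k
          · exact absurd (hk.symm.trans h0) (hκ hl2)
          · exact hk
          · exact absurd (hk.symm.trans h2) (hκ hl1)
          · exact absurd (hk.symm.trans h3) (κ l').2
        have := P'.f₃_flag hr' hn' (t := Sum.inr false) (e := Sum.inr (κ j)) (s := s)
          (TetComplex.inflate_endsWith_inr_inr.2 ⟨h2, h3⟩) m
        rw [h0, h1, h2, h3, TetComplex.inflate_vert_self, TetComplex.inflate_vert_of_ne (κ j).2,
          TetComplex.inflate_vert_of_ne (κ l').2, ← ha₁, ← ha₁] at this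
        rw [this, hfaceκ]
        rcases hu with ⟨hj, hl'⟩ | ⟨hj, hj', hl'⟩
        · rw [if_pos hj, hj, hl']
        · rw [if_neg hj', if_pos hj, hj, hl'])
    (P'.f₄.submatrix (fun k => (none, k)) fun c => (Sum.inr c.1, c.2))
    (fun k j m => by
      rw [Matrix.submatrix_apply, P'.f₄_apply]
      simp [TetComplex.inflate])
  refine insertion hr hr' hn hn' P P' (fun e => rfl) (fun e => rfl) ι ιE ιF
    (fun q => ⟨_, _, _, ιQ q, hfaceκ false q⟩) (by simp) (by simp)
    D hD D' hD' hz C ?_ ?_ ?_ ?_ ?_ ?_ M rfl _ rfl _ rfl S ?_ (P.weight_ne_zero hn)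
  · intro e v
    rw [(hD' _).unique (P'.hasFDerivAt_length hn' (Sum.inl e)),
      (hD _).unique (P.hasFDerivAt_length hn e)]
    rfl
  · intro f v
    rw [hC₁]
    by_cases hf : f = f₀
    · rw [if_pos (congrArg _ hf), hf]
      have := congrArg (fun L => L v) hadd
      exact (congrArg (fun r => D' (Sum.inr (Sum.inl f₀)) v + D' r v) ι3).trans this
    · rw [if_neg (by simpa using hf), add_zero,
        P.angle_restrict hn' P' (τ := Sum.inl) (fun t t' h => Sum.inl_injective.ne h)
          (fun t i h j => rfl) (fun t i h => ?_) (fun t i h => rfl) (hD (Sum.inr f)) (hD' _)]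
      · rfl
      · rw [← h]
        refine if_neg ?_
        rintro ⟨rfl, rfl⟩
        exact hf h.symm
  · intro q v
    rw [hC₁, if_neg (by simp), add_zero, ιQ]
    obtain ⟨s, hs, hs'⟩ := exists_perm_zero (K.ori t₀) (κ q)
    -- The two tetrahedra at a face through the new vertex have the same four vertices.
    rw [P'.hasFDerivAt_angle_self hn' (t := Sum.inr false) (t' := Sum.inr true) (s := s)
      (x := κ q) hs (by rw [hs', hfaceκ]) (hfaceκ _ _) (by simp)
      (by rw [hs', TetComplex.inflate_vert_of_ne (κ q).2, TetComplex.inflate_vert_of_ne (κ q).2])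
      (hD' _)]
    rfl
  · intro f e
    obtain ⟨t, i, ht, hti⟩ := P.exists_corner_ne f t₀
    rw [(P'.faceStar _).curvature_face (t := Sum.inl t) (x := i)
      (by rw [TetComplex.inflate_face_of_ne _ ht, hti]), TetComplex.inflate_cornerForm_inl,
      (P.faceStar f).curvature_face hti]
  · intro f j
    obtain ⟨t, i, ht, hti⟩ := P.exists_corner_ne f t₀
    rw [(P'.faceStar _).curvature_face (t := Sum.inl t) (x := i)
      (by rw [TetComplex.inflate_face_of_ne _ ht, hti])]
    exact TetComplex.cornerForm_eq_zero fun s _ => TetComplex.inflate_endsWith_inr_inl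
  · intro k e
    rw [hC₂]
    by_cases hk : k = Sum.inr 3
    · subst hk
      have h1 : ι (Sum.map Sum.inl Sum.inl (Sum.inr 3 : E ⊕ Fin 4)) = Sum.inr (Sum.inr none) := ι3
      have h2 : ι (Sum.map Sum.inr Sum.inr (Sum.inl f₀ : F ⊕ Fin 3)) = Sum.inr (Sum.inl f₀) := ιF f₀
      -- The columns of the two copies of the face coincide, so increasing one angle and decreasing
      -- the other is invisible.
      rw [if_pos rfl, h1, h2, (P'.faceStar _).curvature_face hface₀,
        (P'.faceStar _).curvature_face hface₁]
      rcases e with e | j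
      · rw [TetComplex.inflate_cornerForm_inl, TetComplex.inflate_cornerForm_inr, sub_self]
        rfl
      · rw [TetComplex.cornerForm_eq_zero fun s _ => TetComplex.inflate_endsWith_inr_inl,
          TetComplex.cornerForm_eq_zero, sub_self]
        · rfl
        · intro s h0 h
          have := (TetComplex.inflate_endsWith_inr_inr.1 h).2
          exact absurd (s.injective (h0.trans this.symm)) (by decide)
    · rw [if_neg hk, sub_zero]
      obtain ⟨r, h1, h2⟩ := ιk k hk
      rw [h1]
      rcases h2 with ⟨e₁, rfl, rfl⟩ | ⟨i, j, rfl, rfl⟩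
      · rcases e with e | j
        · exact TetComplex.inflate_curvature_edge hr hv hp e e₁
        · exact TetComplex.inflate_curvature_new hr hv hp _ _ (Or.inl ⟨j, rfl⟩)
      · rw [TetComplex.inflate_curvature_new hr hv hp _ _ (Or.inr ⟨j, rfl⟩)]
        rcases e with e | j <;> rfl
  · have hF : ∀ f, P'.doubleArea (Sum.inl f) = P.doubleArea f := by
      intro f
      obtain ⟨t, i, ht, hti⟩ := P.exists_corner_ne f t₀
      obtain ⟨s, -, hs⟩ := exists_perm_zero (K.ori t) i
      rw [P.doubleArea_eq s (by rw [hs, hti]), P'.doubleArea_eq (t := Sum.inl t) s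
        (by rw [hs, TetComplex.inflate_face_of_ne _ ht, hti])]
      rfl
    have hd : P'.doubleArea (Sum.inr none) ≠ 0 := (P'.doubleArea_pos hn' _).ne'
    have hL : ∏ j, l j ≠ 0 := Finset.prod_ne_zero_iff.2 fun j _ => hl j
    have hF' : ∏ j, P'.doubleArea (Sum.inr (some j)) ≠ 0 :=
      Finset.prod_ne_zero_iff.2 fun j _ => (P'.doubleArea_pos hn' _).ne'
    have hF'' : ∏ f, P.doubleArea f ≠ 0 :=
      Finset.prod_ne_zero_iff.2 fun j _ => (P.doubleArea_pos hn _).ne'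
    have h1 : ∏ q, |(P'.doubleArea (Sum.inr (some (κ q))))⁻¹| =
        (∏ j, P'.doubleArea (Sum.inr (some j)))⁻¹ := by
      rw [← Finset.prod_inv_distrib, ← Equiv.prod_comp κ]
      exact Finset.prod_congr rfl fun q _ =>
        abs_of_nonneg (inv_nonneg.2 (P'.doubleArea_pos hn' _).le)
    have h2 : ∏ j : {j : Fin 4 // j ≠ i₀}, (dist (p ((K.inflate t₀ i₀).src (Sum.inr j)))
        (p ((K.inflate t₀ i₀).tgt (Sum.inr j))) ^ 2 * |(Matrix.of a).det|) =
        (∏ j, l j) ^ 2 * |(Matrix.of a).det| ^ 3 := by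
      rw [Finset.prod_mul_distrib, Finset.prod_const, Finset.card_univ,
        ← Fintype.card_congr κ, Fintype.card_fin, ← Finset.prod_pow]
      rfl
    have h3 : ∏ e, P'.length e p ^ 3 =
        (∏ e, P.length e (fun v => p (some v)) ^ 3) * (∏ j, l j) ^ 3 := by
      rw [Fintype.prod_sum_type, ← Finset.prod_pow]
      rfl
    -- The powers of `|det a|` are `1 + 3 - 3`; the remaining one is the doubled area of `(ABC)'`,
    -- which completes the product over the four new faces.
    rw [hM, hS₁, hS₂, h1, h2, weight, weight, h3, Fintype.prod_sum_type, Fintype.prod_option,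
      Finset.prod_congr rfl fun f _ => hF f, hdet, Finset.prod_inv_distrib]
    field_simp

end Presentation

/-! ## The move 1 → 4 -/

theorem Int.units_neg_iff {a b : ℤˣ} : -a = b ↔ ¬a = b := by
  rcases Int.units_eq_one_or a with rfl | rfl <;> rcases Int.units_eq_one_or b with rfl | rfl <;>
    decide

/-- A sum over all orderings as a sum over the orderings of a given sign. -/
theorem sum_perm_eq_sum_sign {M : Type*} [AddCommMonoid M] (ε : ℤˣ) {a b : Fin 4} (hab : a ≠ b)
    {q : Equiv.Perm (Fin 4) → Prop} [DecidablePred q] (hq : ∀ s, q (s * Equiv.swap a b) ↔ q s)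
    (g : Equiv.Perm (Fin 4) → M) : (∑ s, if q s then g s else 0) =
      ∑ s, if Equiv.Perm.sign s = ε ∧ q s then g s + g (s * Equiv.swap a b) else 0 := by
  have h1 : ∀ s, (if q s then g s else 0) = (if Equiv.Perm.sign s = ε ∧ q s then g s else 0) +
      if ¬Equiv.Perm.sign s = ε ∧ q s then g s else 0 := by
    intro s
    by_cases h : Equiv.Perm.sign s = ε <;> simp [h]
  have h2 : (∑ s, if ¬Equiv.Perm.sign s = ε ∧ q s then g s else 0) =
      ∑ s, if Equiv.Perm.sign s = ε ∧ q s then g (s * Equiv.swap a b) else 0 := by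
    rw [← Equiv.sum_comp (Equiv.mulRight (Equiv.swap a b))]
    refine Finset.sum_congr rfl fun s _ => if_congr ?_ rfl rfl
    rw [Equiv.coe_mulRight, hq, Equiv.Perm.sign_mul, Equiv.Perm.sign_swap hab, mul_neg_one,
      Int.units_neg_iff, not_not]
  rw [Finset.sum_congr rfl fun s _ => h1 s, Finset.sum_add_distrib, h2, ← Finset.sum_add_distrib]
  refine Finset.sum_congr rfl fun s _ => ?_
  split_ifs
  · rfl
  · rw [add_zero]

/-- A sum over orderings vanishes if the sums over the cyclic permutations of three places do. -/
theorem sum_perm_eq_zero {M : Type*} [AddCommGroup M] [Module ℝ M] (c : Equiv.Perm (Fin 4))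
    {q : Equiv.Perm (Fin 4) → Prop} [DecidablePred q] (hq : ∀ s, q (s * c) ↔ q s)
    {g : Equiv.Perm (Fin 4) → M} (hg : ∀ s, q s → g s + g (s * c) + g (s * c * c) = 0) :
    (∑ s, if q s then g s else 0) = 0 := by
  have h1 : ∀ g : Equiv.Perm (Fin 4) → M, (∑ s, if q s then g s else 0) =
      ∑ s, if q s then g (s * c) else 0 := by
    intro g
    rw [← Equiv.sum_comp (Equiv.mulRight c)]
    exact Finset.sum_congr rfl fun s _ => if_congr (hq s) rfl rfl
  have h2 : (3 : ℝ) • (∑ s, if q s then g s else 0) = 0 := by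
    have : (3 : ℝ) = 1 + 1 + 1 := by norm_num
    rw [this, add_smul, add_smul, one_smul]
    -- The three copies of the sum are shifted by different powers of the cyclic permutation and
    -- added term by term.
    nth_rewrite 3 [h1 g, h1]
    nth_rewrite 2 [h1 g]
    rw [← Finset.sum_add_distrib, ← Finset.sum_add_distrib]
    refine Finset.sum_eq_zero fun s _ => ?_
    split_ifs with h
    · exact hg s h
    · simp
  exact (smul_eq_zero.1 h2).resolve_left (by norm_num)

/-- A sum over the pairs of different labels. -/
theorem sum_pairs {M : Type*} [AddCommMonoid M] {g : Fin 4 → Fin 4 → M} (hg : ∀ a b, g a b = g b a)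
    (h0 : ∀ a, g a a = 0) :
    (∑ a, ∑ b, g a b) = 2 • ∑ q : Fin 6, g (soPos q).1 (soPos q).2 := by
  simp only [Fin.sum_univ_four, Fin.sum_univ_six, h0, soPos]
  simp only [Matrix.cons_val, hg 1 0, hg 2 0, hg 3 0, hg 2 1, hg 3 1, hg 3 2, two_nsmul]
  abel

/-- The new faces of the move 1 → 4 are numbered by the pairs of labels. -/
noncomputable def pairEquiv : Fin 6 ≃ {s : Finset (Fin 4) // s.card = 2} :=
  Equiv.ofBijective (fun q => ⟨{(soPos q).1, (soPos q).2}, Finset.card_pair (by revert q; decide)⟩)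
    (by decide)

/-! ### Combinatorics of a divided tetrahedron. -/

namespace TetComplex

variable {V E F T : Type*} {K : TetComplex V E F T} [DecidableEq T] {t₀ : T}

theorem subdivide_vert_of_ne {a i : Fin 4} (hi : i ≠ a) :
    (K.subdivide t₀).vert (Sum.inr a) i = some (K.vert t₀ i) := by simp [subdivide, hi]

theorem subdivide_vert_self {a : Fin 4} : (K.subdivide t₀).vert (Sum.inr a) a = none := by
  simp [subdivide]

theorem subdivide_face_self {a : Fin 4} :
    (K.subdivide t₀).face (Sum.inr a) a = Sum.inl (K.face t₀ a) := by simp [subdivide]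

theorem subdivide_face_of_ne {a i : Fin 4} (h : a ≠ i) : (K.subdivide t₀).face (Sum.inr a) i =
    Sum.inr ⟨{a, i}, Finset.card_pair h⟩ := by simp [subdivide, h]

theorem subdivide_face_comm {a i : Fin 4} (h : a ≠ i) : (K.subdivide t₀).face (Sum.inr a) i =
    (K.subdivide t₀).face (Sum.inr i) a := by
  rw [subdivide_face_of_ne h, subdivide_face_of_ne h.symm]
  simp only [Finset.pair_comm]

theorem subdivide_face_soPos (q : Fin 6) : (K.subdivide t₀).face (Sum.inr (soPos q).1) (soPos q).2 =
    Sum.inr (pairEquiv q) := subdivide_face_of_ne (by revert q; decide)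

theorem subdivide_endsWith_inl_inl {e : E} {t : {t : T // t ≠ t₀}} {s : Equiv.Perm (Fin 4)} :
    (K.subdivide t₀).EndsWith (Sum.inl e) (Sum.inl t) s ↔ K.EndsWith e t s := by
  simp [EndsWith, subdivide]

theorem subdivide_endsWith_inr_inl {j : Fin 4} {t : {t : T // t ≠ t₀}} {s : Equiv.Perm (Fin 4)} :
    ¬(K.subdivide t₀).EndsWith (Sum.inr j) (Sum.inl t) s := by
  simp [EndsWith, subdivide]

/-- An edge of the old tetrahedron survives in the new tetrahedra which replace one of the other two
vertices. -/
theorem subdivide_endsWith_inl_inr {e : E} {a : Fin 4} {s : Equiv.Perm (Fin 4)} :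
    (K.subdivide t₀).EndsWith (Sum.inl e) (Sum.inr a) s ↔
      (a = s 0 ∨ a = s 1) ∧ K.EndsWith e t₀ s := by
  have h23 : s 2 ≠ s 3 := s.injective.ne (by decide)
  obtain ⟨k, rfl⟩ := s.surjective a
  simp only [EndsWith, subdivide, s.injective.eq_iff]
  fin_cases k <;> simp

theorem subdivide_endsWith_inr_inr {j a : Fin 4} {s : Equiv.Perm (Fin 4)} :
    (K.subdivide t₀).EndsWith (Sum.inr j) (Sum.inr a) s ↔ s 2 = j ∧ s 3 = a := by
  have h23 : s 2 ≠ s 3 := s.injective.ne (by decide)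
  obtain ⟨k, rfl⟩ := s.surjective a
  simp only [EndsWith, subdivide, s.injective.eq_iff]
  fin_cases k <;> simp
  exact fun h => congrArg _ h

theorem subdivide_cornerForm_inl {p : Option V → R4} (t : {t : T // t ≠ t₀}) (x : Fin 4) (e : E) :
    (K.subdivide t₀).cornerForm p (Sum.inl t) x (Sum.inl e) =
      K.cornerForm (fun v => p (some v)) t x e := by
  classical
  rw [cornerForm, cornerForm]
  exact Finset.sum_congr rfl fun s _ =>
    if_congr (and_congr Iff.rfl subdivide_endsWith_inl_inl) rfl rfl

theorem subdivide_cornerForm_inr {p : Option V → R4} (x : Fin 4) (e : E) :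
    (K.subdivide t₀).cornerForm p (Sum.inr x) x (Sum.inl e) =
      K.cornerForm (fun v => p (some v)) t₀ x e := by
  classical
  rw [cornerForm, cornerForm]
  refine Finset.sum_congr rfl fun s _ => ?_
  have hc : (s 0 = x ∧ (K.subdivide t₀).EndsWith (Sum.inl e) (Sum.inr x) s) ↔
      (s 0 = x ∧ K.EndsWith e t₀ s) := by
    rw [subdivide_endsWith_inl_inr]
    exact and_congr_right fun h => and_iff_right (Or.inl h.symm)
  simp only [hc]
  split_ifs with h
  · have hne : ∀ k, k ≠ 0 → s k ≠ x := fun k hk => h.1 ▸ s.injective.ne hk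
    rw [orderBivector, orderBivector, subdivide_vert_of_ne (hne 1 (by decide)),
      subdivide_vert_of_ne (hne 2 (by decide)), subdivide_vert_of_ne (hne 3 (by decide))]
  · rfl

end TetComplex

/-- The term of the differential of a deficit angle coming from the dihedral angle at the last two
points of a tetrahedron, when the points move with the velocities `w`. -/
noncomputable def dihedralForm {ι : Type*} [Fintype ι] (x w : ι → R4) (α : Fin 4 → ι) :
    Matrix (Fin 4) (Fin 4) ℝ :=
  dihedralDeriv (x ∘ α) (fun i j => distDeriv x (α i) (α j) w) •
    dihedralBivector (x (α 0)) (x (α 1)) (x (α 2)) (x (α 3))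

section

variable {ι : Type*} [Fintype ι] {x : ι → R4}

theorem dihedralForm_swap (w : ι → R4) {a b c d : ι} (h : AffineIndependent ℝ (x ∘ ![a, b, c, d])) :
    dihedralForm x w ![b, a, c, d] = -dihedralForm x w ![a, b, c, d] := by
  have h1 : ![b, a, c, d] = ![a, b, c, d] ∘ Equiv.swap 0 1 := by
    funext i; fin_cases i <;> rfl
  have h2 := dihedralDeriv_swap h
    (L := fun i j => distDeriv x (![a, b, c, d] i) (![a, b, c, d] j) w)
    (fun i j => distDeriv_comm _ _ _ _) (fun i => distDeriv_self _ _ _)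
  rw [dihedralForm, dihedralForm, h1, ← smul_neg, ← dihedralBivector_swap]
  exact congrArg₂ _ h2 rfl

/-- Additivity with the first and last tetrahedra equal: the two angles have a constant sum. -/
theorem hasFDerivAt_theta_reverse {a b c d e : ι}
    (hd : LinearIndependent ℝ ![x b - x a, x c - x a, x d - x a])
    (he : LinearIndependent ℝ ![x b - x a, x c - x a, x e - x a]) {D D' : (ι → R4) →L[ℝ] ℝ}
    (h : HasFDerivAt (fun q : ι → R4 => theta (q a) (q b) (q c) (q d) (q e)) D x)
    (h' : HasFDerivAt (fun q : ι → R4 => theta (q a) (q b) (q c) (q e) (q d)) D' x) :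
    D' = -D :=
  (neg_eq_of_add_eq_zero_right
    (hasFDerivAt_theta_add hd he hd h h' (hasFDerivAt_theta_self hd))).symm

/-- The division of a flag at an old edge. -/
theorem dihedralForm_divide {e k l i j : ι} (h : AffineIndependent ℝ (x ∘ ![k, e, l, i, j]))
    {Θ D₁ D₂ : (ι → R4) →L[ℝ] ℝ}
    (h₀ : HasFDerivAt (fun q : ι → R4 => theta (q e) (q i) (q j) (q l) (q k)) Θ x)
    (h₁ : HasFDerivAt (fun q : ι → R4 => theta (q l) (q i) (q j) (q e) (q k)) D₁ x)
    (h₂ : HasFDerivAt (fun q : ι → R4 => theta (q k) (q j) (q i) (q e) (q l)) D₂ x) (w : ι → R4) :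
    dihedralForm x w ![e, l, i, j] + dihedralForm x w ![k, e, i, j] -
      dihedralForm x w ![k, l, i, j] =
      D₁ w • faceBivector (x l) (x i) (x j) + D₂ w • faceBivector (x k) (x i) (x j) -
        Θ w • faceBivector (x e) (x i) (x j) := by
  have li : ∀ {a b c d : Fin 5}, Function.Injective ![a, b, c, d] → LinearIndependent ℝ
      ![x (![k, e, l, i, j] b) - x (![k, e, l, i, j] a), x (![k, e, l, i, j] c) -
        x (![k, e, l, i, j] a), x (![k, e, l, i, j] d) - x (![k, e, l, i, j] a)] := fun hi =>
    h.linearIndependent_of_injective hi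
  obtain ⟨c₁, E₁, hE₁, -⟩ := exists_hasFDerivAt_theta_comp (x := x) (σ := ![l, i, j, k, e]) (by
    have : ![l, i, j, k, e] = ![k, e, l, i, j] ∘ ![2, 3, 4, 0, 1] := by
      funext i; fin_cases i <;> rfl
    rw [this]
    exact h.comp_embedding ⟨![2, 3, 4, 0, 1], by decide⟩)
  obtain ⟨c₂, E₂, hE₂, -⟩ := exists_hasFDerivAt_theta_comp (x := x) (σ := ![k, i, j, e, l]) (by
    have : ![k, i, j, e, l] = ![k, e, l, i, j] ∘ ![0, 3, 4, 1, 2] := by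
      funext i; fin_cases i <;> rfl
    rw [this]
    exact h.comp_embedding ⟨![0, 3, 4, 1, 2], by decide⟩)
  have hE₁' := hasFDerivAt_theta_reverse (li (a := 2) (b := 3) (c := 4) (d := 1) (by decide))
    (li (a := 2) (b := 3) (c := 4) (d := 0) (by decide)) h₁ hE₁
  -- The reversal of the triangle is absorbed by exchanging the two opposite vertices.
  have h₂' : HasFDerivAt (fun q : ι → R4 => theta (q k) (q i) (q j) (q l) (q e)) D₂ x := by
    refine h₂.congr_of_eventuallyEq ?_
    filter_upwards [eventually_linearIndependent
      (li (a := 0) (b := 3) (c := 4) (d := 1) (by decide))] with q hq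
    obtain ⟨F, hF, ⟨X, hX, h1⟩, ⟨p₂, Y, hY, h2⟩, -⟩ := exists_triangular_frame hq
    have hP : PlaneFrame F (q k) (q i) (q j) :=
      ⟨hF, X, 0, p₂, Y, by nlinarith [mul_pos hX hY], h1, h2⟩
    obtain ⟨F', hP', -⟩ := hP.exists_swap
    have h3 := hP.theta_swap (q l) (q e)
    have h4 := hP'.theta_rotate (q e) (q l)
    exact (h4.trans h3).symm
  have hE₂' := hasFDerivAt_theta_reverse (li (a := 0) (b := 3) (c := 4) (d := 2) (by decide))
    (li (a := 0) (b := 3) (c := 4) (d := 1) (by decide)) h₂' hE₂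
  -- The edge `ij` is common to the undivided tetrahedron with `k`, `l` and to the two pieces
  -- containing `e`; the flatness of the 4-simplex connects their three dihedral angles.
  have hs := sum_three_tetrahedra (a := ![k, e, l]) (b := i) (c := j) h (Θ := ![Θ, E₁, E₂])
    (by intro m; fin_cases m; exacts [h₀, hE₁, hE₂]) w
  rw [Fin.sum_univ_three] at hs
  have hs' : (dihedralForm x w ![k, e, i, j] + Θ w • faceBivector (x e) (x i) (x j)) +
      (dihedralForm x w ![e, l, i, j] + E₁ w • faceBivector (x l) (x i) (x j)) +
      (dihedralForm x w ![l, k, i, j] + E₂ w • faceBivector (x k) (x i) (x j)) = 0 := hs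
  rw [hE₁', hE₂', dihedralForm_swap (a := k) w (by
    have : ![k, l, i, j] = ![k, e, l, i, j] ∘ ![0, 2, 3, 4] := by
      funext i; fin_cases i <;> rfl
    rw [this]
    exact h.comp_embedding ⟨![0, 2, 3, 4], by decide⟩)] at hs'
  rw [← sub_eq_zero, ← hs', neg_apply, neg_apply, neg_smul,
    neg_smul]
  abel

/-- The three flags at a new edge. -/
theorem dihedralForm_cycle {e j k l m : ι} (h : AffineIndependent ℝ (x ∘ ![k, l, m, j, e]))
    {Θ₀ Θ₁ Θ₂ : (ι → R4) →L[ℝ] ℝ}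
    (h₀ : HasFDerivAt (fun q : ι → R4 => theta (q l) (q j) (q e) (q m) (q k)) Θ₀ x)
    (h₁ : HasFDerivAt (fun q : ι → R4 => theta (q m) (q j) (q e) (q k) (q l)) Θ₁ x)
    (h₂ : HasFDerivAt (fun q : ι → R4 => theta (q k) (q j) (q e) (q l) (q m)) Θ₂ x) (w : ι → R4) :
    (dihedralForm x w ![k, l, j, e] + Θ₀ w • faceBivector (x l) (x j) (x e)) +
      (dihedralForm x w ![l, m, j, e] + Θ₁ w • faceBivector (x m) (x j) (x e)) +
      (dihedralForm x w ![m, k, j, e] + Θ₂ w • faceBivector (x k) (x j) (x e)) = 0 := by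
  have hs := sum_three_tetrahedra (a := ![k, l, m]) (b := j) (c := e) h (Θ := ![Θ₀, Θ₁, Θ₂])
    (by intro m; fin_cases m; exacts [h₀, h₁, h₂]) w
  rw [Fin.sum_univ_three] at hs
  exact hs

end

/-- When a change of lengths comes from velocities of the vertices, its flag terms become geometric
and the identities of a flat 4-simplex apply. -/
theorem TetComplex.flagForm_eq_dihedralForm {V E F T : Type*} [Fintype V] {K : TetComplex V E F T}
    {p w : V → R4} {y : E ⊕ F → ℝ} {t : T} (hy : ∀ f, y (Sum.inr f) = 0)
    (h : ∀ i j, i ≠ j → y (Sum.inl (K.edge t i j)) = distDeriv p (K.vert t i) (K.vert t j) w)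
    (s : Equiv.Perm (Fin 4)) : K.flagForm p y t s = dihedralForm p w (K.vert t ∘ s) := by
  rw [flagForm, hy, zero_smul, add_zero, dihedralForm]
  congr 2
  funext i j
  by_cases hij : i = j
  · rw [if_pos hij, hij, distDeriv_self]
  · rw [if_neg hij, h _ _ (s.injective.ne hij)]
    rfl

namespace TetComplex

variable {V E F T : Type*} {K : TetComplex V E F T} [DecidableEq T] {t₀ : T}

/-- The contributions of the new faces, as a sum over the orderings of the vertices. -/
theorem sum_pair_cornerForm [Fintype T] [DecidableEq E] [DecidableEq F] {p : Option V → R4}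
    (P' : Presentation (K.subdivide t₀) p) (Θ : F ⊕ {s : Finset (Fin 4) // s.card = 2} → ℝ)
    (e : E ⊕ Fin 4) : (open Classical in
    2 • ∑ q, Θ (Sum.inr (pairEquiv q)) •
      (K.subdivide t₀).cornerForm p (Sum.inr (soPos q).1) (soPos q).2 e =
    ∑ s : Equiv.Perm (Fin 4), ∑ b : Fin 4,
      if b ≠ s 0 ∧ (K.subdivide t₀).EndsWith e (Sum.inr b) s then
        Θ ((K.subdivide t₀).face (Sum.inr b) (s 0)) •
          (K.subdivide t₀).orderBivector p (Sum.inr b) s else 0) := by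
  classical
  let g : Fin 4 → Fin 4 → Matrix (Fin 4) (Fin 4) ℝ := fun a b => if a ≠ b then
    Θ ((K.subdivide t₀).face (Sum.inr a) b) • (K.subdivide t₀).cornerForm p (Sum.inr a) b e else 0
  -- An inner face is seen from both of its tetrahedra with the same result; this double counting is
  -- the factor `2` in the statement.
  have hg : ∀ a b, g a b = g b a := by
    intro a b
    by_cases h : a = b
    · rw [h]
    · simp only [g]
      have hc := (P'.faceStar _).curvature_face (p := p) (subdivide_face_comm h) e
      rw [if_pos h, if_pos (Ne.symm h), ← hc, ← (P'.faceStar _).curvature_face rfl e,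
        subdivide_face_comm h]
  have h1 := sum_pairs hg fun a => if_neg (by simp)
  have h2 : ∀ q, g (soPos q).1 (soPos q).2 = Θ (Sum.inr (pairEquiv q)) •
      (K.subdivide t₀).cornerForm p (Sum.inr (soPos q).1) (soPos q).2 e := by
    intro q
    simp only [g]
    rw [if_pos (by revert q; decide), subdivide_face_soPos]
  rw [← Finset.sum_congr rfl fun q _ => h2 q, ← h1]
  have h3 : ∀ a b, g a b = ∑ s : Equiv.Perm (Fin 4), if s 0 = b then
      (if a ≠ s 0 ∧ (K.subdivide t₀).EndsWith e (Sum.inr a) s then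
        Θ ((K.subdivide t₀).face (Sum.inr a) (s 0)) •
          (K.subdivide t₀).orderBivector p (Sum.inr a) s else 0) else 0 := by
    intro a b
    simp only [g]
    by_cases h : a = b
    · rw [if_neg (by simpa using h)]
      refine (Finset.sum_eq_zero fun s _ => ?_).symm
      split_ifs with h1 h2
      · exact absurd (h.trans h1.symm) h2.1
      · rfl
      · rfl
    · rw [if_pos h, cornerForm, Finset.smul_sum]
      refine Finset.sum_congr rfl fun s _ => ?_
      by_cases h1 : s 0 = b
      · subst h1
        by_cases h2 : (K.subdivide t₀).EndsWith e (Sum.inr a) s <;> simp [h, h2]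
      · simp [h1]
  simp only [h3]
  rw [Finset.sum_comm]
  rw [Finset.sum_congr rfl fun b _ => Finset.sum_comm]
  rw [Finset.sum_comm]
  refine Finset.sum_congr rfl fun s _ => ?_
  rw [Finset.sum_comm]
  refine Finset.sum_congr rfl fun a _ => ?_
  rw [Finset.sum_ite_eq]
  simp

end TetComplex

namespace Presentation

variable {V E F T : Type*} {K : TetComplex V E F T} [DecidableEq T] [Fintype V] [Fintype T] {t₀ : T}

theorem hasFDerivAt_angle_pair (hv : ∀ t, Function.Injective (K.vert t)) {p : Option V → R4}
    (hp : GeneralPosition p) (P' : Presentation (K.subdivide t₀) p)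
    {s : Equiv.Perm (Fin 4)} (hs : Equiv.Perm.sign s = K.ori t₀) {m : Fin 4} (hm : m ≠ 0)
    {D : (Option V → R4) →L[ℝ] ℝ}
    (hD : HasFDerivAt (fun q : Option V → R4 => P'.measure q
      (Sum.inr ((K.subdivide t₀).face (Sum.inr (s m)) (s 0)))) D p) :
    HasFDerivAt (fun q : Option V → R4 => theta (q ((K.subdivide t₀).vert (Sum.inr (s m)) (s 1)))
      (q ((K.subdivide t₀).vert (Sum.inr (s m)) (s 2)))
      (q ((K.subdivide t₀).vert (Sum.inr (s m)) (s 3))) (q (some (K.vert t₀ (s m))))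
      (q (some (K.vert t₀ (s 0))))) D p := by
  have hm0 : s m ≠ s 0 := s.injective.ne hm
  have h := P'.nondeg_eventually_angle (TetComplex.subdivide_nondeg hv hp) (t := Sum.inr (s m))
    (t' := Sum.inr (s 0)) (s := s) (x := s m) hs rfl (TetComplex.subdivide_face_comm hm0.symm)
    (fun h => hm0 (Sum.inr_injective h).symm) hD
  rw [TetComplex.subdivide_vert_of_ne hm0, TetComplex.subdivide_vert_of_ne hm0.symm] at h
  exact h

/-- The angle at an old face is divided into two by the new vertex. -/
theorem hasFDerivAt_angle_divide (hv : ∀ t, Function.Injective (K.vert t)) {p : Option V → R4}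
    (hp : GeneralPosition p) (P : Presentation K fun v => p (some v))
    (P' : Presentation (K.subdivide t₀) p)
    {s : Equiv.Perm (Fin 4)} (hs : Equiv.Perm.sign s = K.ori t₀)
    {D : (V → R4) →L[ℝ] ℝ}
    (hD : HasFDerivAt (fun q : V → R4 => P.measure q (Sum.inr (K.face t₀ (s 0)))) D
      fun v => p (some v))
    {D' : (Option V → R4) →L[ℝ] ℝ}
    (hD' : HasFDerivAt (fun q : Option V → R4 => P'.measure q
      (Sum.inr (Sum.inl (K.face t₀ (s 0))))) D' p) :
    HasFDerivAt (fun q : Option V → R4 => theta (q (some (K.vert t₀ (s 1))))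
        (q (some (K.vert t₀ (s 2)))) (q (some (K.vert t₀ (s 3)))) (q none)
        (q (some (K.vert t₀ (s 0))))) (D.comp (restrictPoints V) - D') p ∧
      ∃ c : Fin 5 → Fin 5 → ℝ, ∀ v, (D.comp (restrictPoints V) - D') v = ∑ i, ∑ j, c i j *
        distDeriv p (![some (K.vert t₀ (s 1)), some (K.vert t₀ (s 2)), some (K.vert t₀ (s 3)), none,
          some (K.vert t₀ (s 0))] i) (![some (K.vert t₀ (s 1)), some (K.vert t₀ (s 2)),
          some (K.vert t₀ (s 3)), none, some (K.vert t₀ (s 0))] j) v := by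
  have hn := TetComplex.nondeg_restrict hv hp
  have hn' : (K.subdivide t₀).Nondeg p := TetComplex.subdivide_nondeg hv hp
  let A : Fin 4 → Option V := fun i => some (K.vert t₀ (s i))
  have hA : ∀ i j, i ≠ j → A i ≠ A j := fun i j h =>
    (Option.some_injective _).ne ((hv t₀).ne (s.injective.ne h))
  have hsk : ∀ k, k ≠ 0 → s k ≠ s 0 := fun k hk => s.injective.ne hk
  obtain ⟨t₁, x₁, ht₁, hx₁, hne₁⟩ := (P.faceStar (K.face t₀ (s 0))).exists_other hv (t := t₀)
    (x := s 0) rfl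
  have hne₁' : ∀ k, k ≠ 0 → A k ≠ some (K.vert t₁ x₁) := fun k hk =>
    (Option.some_injective _).ne (hne₁ _ (hsk k hk))
  have hθ₁ : HasFDerivAt (fun q : Option V → R4 => theta (q (A 1)) (q (A 2)) (q (A 3))
      (q (some (K.vert t₁ x₁))) (q none)) D' p := by
    have h := P'.nondeg_eventually_angle hn' (t := Sum.inr (s 0)) (s := s)
      (t' := Sum.inl ⟨t₁, ht₁⟩) (x := x₁) (f := Sum.inl (K.face t₀ (s 0))) hs
      TetComplex.subdivide_face_self (congrArg Sum.inl hx₁) (by simp) hD'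
    rw [TetComplex.subdivide_vert_of_ne (hsk 1 (by decide)),
      TetComplex.subdivide_vert_of_ne (hsk 2 (by decide)),
      TetComplex.subdivide_vert_of_ne (hsk 3 (by decide)), TetComplex.subdivide_vert_self] at h
    exact h
  have hθ := (P.nondeg_eventually_angle hn hs rfl hx₁ ht₁ hD).comp_restrictPoints
  have li₁ := hp.linearIndependent (a := A 1) (b := A 2) (c := A 3) (d := some (K.vert t₁ x₁))
    (u := none) (injective_vec_four (hA _ _ (by decide)) (hA _ _ (by decide))
      (hne₁' _ (by decide)) (hA _ _ (by decide)) (hne₁' _ (by decide)) (hne₁' _ (by decide)))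
    (fun i => by fin_cases i <;> simp [A])
  have li₂ := hp.linearIndependent (a := A 1) (b := A 2) (c := A 3) (d := none) (u := A 0)
    (injective_vec_four (hA _ _ (by decide)) (hA _ _ (by decide)) (by simp [A])
      (hA _ _ (by decide)) (by simp [A]) (by simp [A]))
    (fun i => by
      fin_cases i
      exacts [hA 1 0 (by decide), hA 2 0 (by decide), hA 3 0 (by decide), by simp [A]])
  have li₃ := hp.linearIndependent (a := A 1) (b := A 2) (c := A 3) (d := A 0) (u := none)
    (injective_vec_four (hA _ _ (by decide)) (hA _ _ (by decide)) (hA _ _ (by decide))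
      (hA _ _ (by decide)) (hA _ _ (by decide)) (hA _ _ (by decide)))
    (fun i => by fin_cases i <;> simp [A])
  obtain ⟨c, D₂, hD₂, hc⟩ := exists_hasFDerivAt_theta_comp (x := p)
    (σ := ![A 1, A 2, A 3, none, A 0]) (hp _ (by
      have : ![A 1, A 2, A 3, none, A 0] = Option.map (K.vert t₀ ∘ s) ∘
          ![some 1, some 2, some 3, none, some 0] := by
        funext i; fin_cases i <;> rfl
      rw [this]
      exact (Option.map_injective ((hv t₀).comp s.injective)).comp (by decide)))
  -- The difference of the old and the new angle is an angle inside the 4-simplex of `t₀` and the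
  -- new vertex; the neighbour across the face disappears from it.
  have hadd := hasFDerivAt_theta_add li₁ li₂ li₃ hθ₁ hD₂ hθ
  rw [← hadd, add_sub_cancel_left]
  exact ⟨hD₂, c, hc⟩

end Presentation

theorem Matrix.eq_of_two_nsmul_eq {A B : Matrix (Fin 4) (Fin 4) ℝ} (h : 2 • A = 2 • B) : A = B := by
  ext i j
  have := congrFun (congrFun h i) j
  rw [two_nsmul, two_nsmul, Matrix.add_apply, Matrix.add_apply] at this
  linarith

namespace TetComplex

variable {V E F T : Type*} {K : TetComplex V E F T} [DecidableEq T] {t₀ : T}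

theorem subdivide_vert_comp_zero (s : Equiv.Perm (Fin 4)) :
    (K.subdivide t₀).vert (Sum.inr (s 0)) ∘ s = ![none, some (K.vert t₀ (s 1)),
      some (K.vert t₀ (s 2)), some (K.vert t₀ (s 3))] := by
  funext i
  fin_cases i <;> simp [subdivide]

theorem subdivide_vert_comp_one (s : Equiv.Perm (Fin 4)) :
    (K.subdivide t₀).vert (Sum.inr (s 1)) ∘ s = ![some (K.vert t₀ (s 0)), none,
      some (K.vert t₀ (s 2)), some (K.vert t₀ (s 3))] := by
  funext i
  fin_cases i <;> simp [subdivide]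

theorem subdivide_vert_comp_three (s : Equiv.Perm (Fin 4)) :
    (K.subdivide t₀).vert (Sum.inr (s 3)) ∘ s = ![some (K.vert t₀ (s 0)), some (K.vert t₀ (s 1)),
      some (K.vert t₀ (s 2)), none] := by
  funext i
  fin_cases i <;> simp [subdivide]

/-- The vertices of the divided tetrahedron and the new vertex form a nondegenerate 4-simplex. -/
theorem affineIndependent_cell (hv : ∀ t, Function.Injective (K.vert t)) {p : Option V → R4}
    (hp : GeneralPosition p) (s : Equiv.Perm (Fin 4)) {σ : Fin 5 → Option (Fin 4)}
    (hσ : Function.Injective σ) : AffineIndependent ℝ (p ∘ Option.map (K.vert t₀ ∘ s) ∘ σ) :=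
  hp _ ((Option.map_injective ((hv t₀).comp s.injective)).comp hσ)

variable [Fintype V] [Fintype T] [Fintype E] [Fintype F] [DecidableEq E] [DecidableEq F]
  [DecidableEq V]

/-- The identity at the new edges of the move 1 → 4. -/
theorem subdivide_curvature_inr (hv : ∀ t, Function.Injective (K.vert t)) {p : Option V → R4}
    (hp : GeneralPosition p) (P' : Presentation (K.subdivide t₀) p)
    {D' : (E ⊕ Fin 4) ⊕ (F ⊕ {s : Finset (Fin 4) // s.card = 2}) → (Option V → R4) →L[ℝ] ℝ}
    (hD' : ∀ r, HasFDerivAt (fun q => P'.measure q r) (D' r) p)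
    {y : (E ⊕ Fin 4) ⊕ (F ⊕ {s : Finset (Fin 4) // s.card = 2}) → ℝ}
    (hy : ∀ f, y (Sum.inr f) = 0) {w : Option V → R4}
    (hw : ∀ a i j, i ≠ j → y (Sum.inl ((K.subdivide t₀).edge (Sum.inr a) i j)) =
      distDeriv p ((K.subdivide t₀).vert (Sum.inr a) i) ((K.subdivide t₀).vert (Sum.inr a) j) w)
    (j : Fin 4) : (K.subdivide t₀).curvature p (Sum.inr j) y +
      ∑ q, D' (Sum.inr (Sum.inr (pairEquiv q))) w •
        (K.subdivide t₀).cornerForm p (Sum.inr (soPos q).1) (soPos q).2 (Sum.inr j) = 0 := by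
  classical
  let B : Equiv.Perm (Fin 4) → Fin 4 → Option V := fun s i => some (K.vert t₀ (s i))
  let θ : Equiv.Perm (Fin 4) → (Option V → R4) →L[ℝ] ℝ := fun s =>
    D' (Sum.inr ((K.subdivide t₀).face (Sum.inr (s 3)) (s 0)))
  let g : Equiv.Perm (Fin 4) → Matrix (Fin 4) (Fin 4) ℝ := fun s =>
    θ s w • faceBivector (p (B s 1)) (p (B s 2)) (p none)
  -- At an edge ending in the new vertex the last label of an ordering tells which vertex has been
  -- replaced, so the tetrahedron is determined by the ordering.
  have h1 : (K.subdivide t₀).curvature p (Sum.inr j) y =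
      ∑ s : Equiv.Perm (Fin 4), if Equiv.Perm.sign s = K.ori t₀ ∧ s 2 = j then
        dihedralForm p w ![B s 0, B s 1, B s 2, none] else 0 := by
    rw [curvature, Fintype.sum_sum_type, Finset.sum_eq_zero, zero_add, Finset.sum_comm]
    · refine Finset.sum_congr rfl fun s _ => ?_
      rw [Fintype.sum_eq_single (s 3)]
      · refine if_congr (and_congr Iff.rfl (subdivide_endsWith_inr_inr.trans
          (and_iff_left rfl))) ?_ rfl
        rw [flagForm_eq_dihedralForm hy (hw _), subdivide_vert_comp_three]
      · exact fun a ha => if_neg fun h => ha (subdivide_endsWith_inr_inr.1 h.2).2.symm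
    · exact fun t _ => Finset.sum_eq_zero fun s _ => if_neg fun h =>
        subdivide_endsWith_inr_inl h.2
  have h2 : ∑ q, D' (Sum.inr (Sum.inr (pairEquiv q))) w •
        (K.subdivide t₀).cornerForm p (Sum.inr (soPos q).1) (soPos q).2 (Sum.inr j) =
      ∑ s : Equiv.Perm (Fin 4), if Equiv.Perm.sign s = K.ori t₀ ∧ s 2 = j then g s else 0 := by
    refine Matrix.eq_of_two_nsmul_eq ?_
    rw [sum_pair_cornerForm P' (fun φ => D' (Sum.inr φ) w) (Sum.inr j)]
    have h3 : ∀ s : Equiv.Perm (Fin 4), (∑ b : Fin 4, if b ≠ s 0 ∧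
        (K.subdivide t₀).EndsWith (Sum.inr j) (Sum.inr b) s then
        D' (Sum.inr ((K.subdivide t₀).face (Sum.inr b) (s 0))) w •
          (K.subdivide t₀).orderBivector p (Sum.inr b) s else 0) = if s 2 = j then g s else 0 := by
      intro s
      rw [Fintype.sum_eq_single (s 3)]
      · refine if_congr ?_ ?_ rfl
        · rw [subdivide_endsWith_inr_inr]
          exact ⟨fun h => h.2.1, fun h => ⟨s.injective.ne (by decide), h, rfl⟩⟩
        · have := fun k => congrFun (subdivide_vert_comp_three (K := K) (t₀ := t₀) s) k
          simp only [Function.comp_apply] at this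
          rw [orderBivector, this, this, this]
          rfl
      · exact fun a ha => if_neg fun h => ha (subdivide_endsWith_inr_inr.1 h.2).2.symm
    rw [Finset.sum_congr rfl fun s _ => h3 s, sum_perm_eq_sum_sign (K.ori t₀)
      (a := 0) (b := 3) (by decide) (fun s => by
        rw [show (s * Equiv.swap 0 3 : Equiv.Perm (Fin 4)) 2 = s 2 from congrArg s (by decide)]),
      Finset.smul_sum]
    refine Finset.sum_congr rfl fun s _ => ?_
    -- The exchange passes to the other tetrahedron at the same inner face without moving the
    -- triangle.
    have hs : g (s * Equiv.swap 0 3) = g s := by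
      have e0 : (s * Equiv.swap 0 3 : Equiv.Perm (Fin 4)) 0 = s 3 := congrArg s (by decide)
      have e1 : (s * Equiv.swap 0 3 : Equiv.Perm (Fin 4)) 1 = s 1 := congrArg s (by decide)
      have e2 : (s * Equiv.swap 0 3 : Equiv.Perm (Fin 4)) 2 = s 2 := congrArg s (by decide)
      have e3 : (s * Equiv.swap 0 3 : Equiv.Perm (Fin 4)) 3 = s 0 := congrArg s (by decide)
      simp only [g, θ, B, e0, e1, e2, e3]
      rw [subdivide_face_comm (s.injective.ne (by decide))]
    rw [hs]
    split_ifs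
    · rw [two_nsmul]
    · rw [smul_zero]
  rw [h1, h2, ← Finset.sum_add_distrib]
  -- The right-oriented orderings with a fixed third label form a cycle of length three,
  -- corresponding to the three tetrahedra around the new edge.
  refine Eq.trans (Finset.sum_congr rfl fun s _ => ?_) (sum_perm_eq_zero
    (Equiv.swap 0 1 * Equiv.swap 1 3) (q := fun s => Equiv.Perm.sign s = K.ori t₀ ∧ s 2 = j)
    (g := fun s => dihedralForm p w ![B s 0, B s 1, B s 2, none] + g s) (fun s => ?_) ?_)
  · split_ifs
    · rfl
    · rw [add_zero]
  · rw [show (s * (Equiv.swap 0 1 * Equiv.swap 1 3) : Equiv.Perm (Fin 4)) 2 = s 2 from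
      congrArg s (by decide), Equiv.Perm.sign_mul,
      show Equiv.Perm.sign (Equiv.swap 0 1 * Equiv.swap 1 3 : Equiv.Perm (Fin 4)) = 1 by decide,
      mul_one]
  · rintro s ⟨hs, -⟩
    have hθ : ∀ s : Equiv.Perm (Fin 4), Equiv.Perm.sign s = K.ori t₀ → HasFDerivAt
        (fun q : Option V → R4 => theta (q (B s 1)) (q (B s 2)) (q none) (q (B s 3)) (q (B s 0)))
        (θ s) p := by
      intro s hs
      have := P'.hasFDerivAt_angle_pair hv hp hs (m := 3) (by decide) (hD' _)
      rw [subdivide_vert_self, subdivide_vert_of_ne (s.injective.ne (by decide)),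
        subdivide_vert_of_ne (s.injective.ne (by decide))] at this
      exact this
    have hc : Equiv.Perm.sign (Equiv.swap 0 1 * Equiv.swap 1 3 : Equiv.Perm (Fin 4)) = 1 := by
      decide
    have e : ∀ s k, B (s * (Equiv.swap 0 1 * Equiv.swap 1 3)) k = B s (![1, 3, 2, 0] k) := by
      intro s k
      fin_cases k <;> exact congrArg (fun k => some (K.vert t₀ (s k))) (by decide)
    have t0 := hθ s hs
    have t1 := hθ (s * (Equiv.swap 0 1 * Equiv.swap 1 3)) (by
      rw [Equiv.Perm.sign_mul, hc, hs, mul_one])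
    have t2 := hθ (s * (Equiv.swap 0 1 * Equiv.swap 1 3) * (Equiv.swap 0 1 * Equiv.swap 1 3)) (by
      rw [Equiv.Perm.sign_mul, Equiv.Perm.sign_mul, hc, hs, mul_one, mul_one])
    simp only [e] at t1 t2
    simp only [g, e]
    refine dihedralForm_cycle (e := none) (j := B s 2) (k := B s 0) (l := B s 1) (m := B s 3) ?_
      t0 t1 t2 w
    have : ![B s 0, B s 1, B s 3, B s 2, none] = Option.map (K.vert t₀ ∘ s) ∘
        ![some 0, some 1, some 3, some 2, none] := by
      funext i; fin_cases i <;> rfl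
    rw [this]
    exact affineIndependent_cell hv hp s (by decide)

/-- The identity at the old edges. -/
theorem subdivide_curvature_inl (hv : ∀ t, Function.Injective (K.vert t)) {p : Option V → R4}
    (hp : GeneralPosition p) (P : Presentation K fun v => p (some v))
    (P' : Presentation (K.subdivide t₀) p) {D : E ⊕ F → (V → R4) →L[ℝ] ℝ}
    (hD : ∀ r, HasFDerivAt (fun q => P.measure q r) (D r) fun v => p (some v))
    {D' : (E ⊕ Fin 4) ⊕ (F ⊕ {s : Finset (Fin 4) // s.card = 2}) → (Option V → R4) →L[ℝ] ℝ}
    (hD' : ∀ r, HasFDerivAt (fun q => P'.measure q r) (D' r) p)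
    {y : (E ⊕ Fin 4) ⊕ (F ⊕ {s : Finset (Fin 4) // s.card = 2}) → ℝ}
    (hy : ∀ f, y (Sum.inr f) = 0) {y₀ : E ⊕ F → ℝ} (hy₀ : ∀ f, y₀ (Sum.inr f) = 0)
    (hyy : ∀ e, y (Sum.inl (Sum.inl e)) = y₀ (Sum.inl e)) {w : Option V → R4}
    (hw : ∀ a i j, i ≠ j → y (Sum.inl ((K.subdivide t₀).edge (Sum.inr a) i j)) =
      distDeriv p ((K.subdivide t₀).vert (Sum.inr a) i) ((K.subdivide t₀).vert (Sum.inr a) j) w)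
    (e : E) : (K.subdivide t₀).curvature p (Sum.inl e) y -
      (∑ x, ((D (Sum.inr (K.face t₀ x))).comp (restrictPoints V) -
        D' (Sum.inr (Sum.inl (K.face t₀ x)))) w • K.cornerForm (fun v => p (some v)) t₀ x e -
      ∑ q, D' (Sum.inr (Sum.inr (pairEquiv q))) w •
        (K.subdivide t₀).cornerForm p (Sum.inr (soPos q).1) (soPos q).2 (Sum.inl e)) =
      K.curvature (fun v => p (some v)) e y₀ := by
  classical
  let B : Equiv.Perm (Fin 4) → Fin 4 → Option V := fun s i => some (K.vert t₀ (s i))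
  let Δ : Fin 4 → (Option V → R4) →L[ℝ] ℝ := fun x =>
    (D (Sum.inr (K.face t₀ x))).comp (restrictPoints V) - D' (Sum.inr (Sum.inl (K.face t₀ x)))
  let θ : Equiv.Perm (Fin 4) → (Option V → R4) →L[ℝ] ℝ := fun s =>
    D' (Sum.inr ((K.subdivide t₀).face (Sum.inr (s 1)) (s 0)))
  let g : Equiv.Perm (Fin 4) → Matrix (Fin 4) (Fin 4) ℝ := fun s =>
    θ s w • faceBivector (p none) (p (B s 2)) (p (B s 3))
  have hew : ∀ s : Equiv.Perm (Fin 4),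
      K.EndsWith e t₀ (s * Equiv.swap 0 1) ↔ K.EndsWith e t₀ s := by
    intro s
    rw [EndsWith, EndsWith, show (s * Equiv.swap 0 1 : Equiv.Perm (Fin 4)) 2 = s 2 from
      congrArg s (by decide), show (s * Equiv.swap 0 1 : Equiv.Perm (Fin 4)) 3 = s 3 from
      congrArg s (by decide)]
  have e0 : ∀ s, (s * Equiv.swap 0 1 : Equiv.Perm (Fin 4)) 0 = s 1 := fun s =>
    congrArg s (by decide)
  have e1 : ∀ s, (s * Equiv.swap 0 1 : Equiv.Perm (Fin 4)) 1 = s 0 := fun s =>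
    congrArg s (by decide)
  have e2 : ∀ s, (s * Equiv.swap 0 1 : Equiv.Perm (Fin 4)) 2 = s 2 := fun s =>
    congrArg s (by decide)
  have e3 : ∀ s, (s * Equiv.swap 0 1 : Equiv.Perm (Fin 4)) 3 = s 3 := fun s =>
    congrArg s (by decide)
  -- the new tetrahedra
  have h1 : (∑ a : Fin 4, ∑ s : Equiv.Perm (Fin 4),
      if (K.subdivide t₀).IsFlag (Sum.inl e) (Sum.inr a) s then
        (K.subdivide t₀).flagForm p y (Sum.inr a) s else 0) =
      ∑ s : Equiv.Perm (Fin 4), if Equiv.Perm.sign s = K.ori t₀ ∧ K.EndsWith e t₀ s then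
        dihedralForm p w ![none, B s 1, B s 2, B s 3] +
          dihedralForm p w ![B s 0, none, B s 2, B s 3] else 0 := by
    rw [Finset.sum_comm]
    refine Finset.sum_congr rfl fun s _ => ?_
    have h01 : s 0 ≠ s 1 := s.injective.ne (by decide)
    have hf : ∀ a, (K.subdivide t₀).IsFlag (Sum.inl e) (Sum.inr a) s ↔
        (a = s 0 ∨ a = s 1) ∧ Equiv.Perm.sign s = K.ori t₀ ∧ K.EndsWith e t₀ s := fun a =>
      (and_congr Iff.rfl subdivide_endsWith_inl_inr).trans and_left_comm
    simp only [hf]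
    rw [Fintype.sum_eq_add _ _ h01 fun a ha => if_neg fun h => h.1.elim ha.1 ha.2]
    rw [flagForm_eq_dihedralForm hy (hw _), flagForm_eq_dihedralForm hy (hw _),
      subdivide_vert_comp_zero, subdivide_vert_comp_one]
    by_cases h : Equiv.Perm.sign s = K.ori t₀ ∧ K.EndsWith e t₀ s <;> simp [h, B]
  -- the old tetrahedron
  have h2 : K.curvature (fun v => p (some v)) e y₀ =
      (∑ s : Equiv.Perm (Fin 4), if Equiv.Perm.sign s = K.ori t₀ ∧ K.EndsWith e t₀ s then
        dihedralForm p w ![B s 0, B s 1, B s 2, B s 3] else 0) +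
      ∑ t : {t : T // t ≠ t₀}, ∑ s : Equiv.Perm (Fin 4),
        if (K.subdivide t₀).IsFlag (Sum.inl e) (Sum.inl t) s then
          (K.subdivide t₀).flagForm p y (Sum.inl t) s else 0 := by
    rw [curvature, Fintype.sum_eq_add_sum_subtype_ne _ t₀]
    congr 1
    · refine Finset.sum_congr rfl fun s _ => if_congr Iff.rfl ?_ rfl
      rw [flagForm_eq_dihedralForm (w := fun v => w (some v)) hy₀ fun i j hij => ?_]
      · have : ![B s 0, B s 1, B s 2, B s 3] = some ∘ K.vert t₀ ∘ s := by
          funext i; fin_cases i <;> rfl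
        rw [this]
        rfl
      -- Every edge of the old tetrahedron remains in a new tetrahedron replacing a vertex not on
      -- it, and its length is read there.
      · obtain ⟨a, hai, haj⟩ : ∃ a, i ≠ a ∧ j ≠ a := by revert i j; decide
        have := hw a i j hij
        rw [subdivide_vert_of_ne hai, subdivide_vert_of_ne haj] at this
        rw [← hyy]
        refine Eq.trans (congrArg _ (congrArg _ ?_)) this
        simp [subdivide, hai, haj]
    · refine Finset.sum_congr rfl fun t _ => Finset.sum_congr rfl fun s _ =>
        if_congr (and_congr Iff.rfl subdivide_endsWith_inl_inl.symm) ?_ rfl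
      rw [flagForm, flagForm, hy, hy₀]
      simp only [← hyy]
      rfl
  -- the old faces
  have h3 : ∑ x, Δ x w • K.cornerForm (fun v => p (some v)) t₀ x e =
      ∑ s : Equiv.Perm (Fin 4), if Equiv.Perm.sign s = K.ori t₀ ∧ K.EndsWith e t₀ s then
        Δ (s 0) w • faceBivector (p (B s 1)) (p (B s 2)) (p (B s 3)) +
          Δ (s 1) w • faceBivector (p (B s 0)) (p (B s 2)) (p (B s 3)) else 0 := by
    have h : ∀ x, Δ x w • K.cornerForm (fun v => p (some v)) t₀ x e =
        ∑ s : Equiv.Perm (Fin 4), if s 0 = x then (if K.EndsWith e t₀ s then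
          Δ x w • faceBivector (p (B s 1)) (p (B s 2)) (p (B s 3)) else 0) else 0 := by
      intro x
      rw [cornerForm, Finset.smul_sum]
      refine Finset.sum_congr rfl fun s _ => ?_
      rw [smul_ite, smul_zero, ite_and]
      rfl
    rw [Finset.sum_congr rfl fun x _ => h x, Finset.sum_comm]
    simp only [Finset.sum_ite_eq, Finset.mem_univ, if_true]
    rw [sum_perm_eq_sum_sign (K.ori t₀) (by decide : (0 : Fin 4) ≠ 1) hew]
    simp only [B, e0, e1, e2, e3]
  -- the new faces
  have h4 : ∑ q, D' (Sum.inr (Sum.inr (pairEquiv q))) w •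
        (K.subdivide t₀).cornerForm p (Sum.inr (soPos q).1) (soPos q).2 (Sum.inl e) =
      ∑ s : Equiv.Perm (Fin 4), if Equiv.Perm.sign s = K.ori t₀ ∧ K.EndsWith e t₀ s then
        g s else 0 := by
    refine Matrix.eq_of_two_nsmul_eq ?_
    rw [sum_pair_cornerForm P' (fun φ => D' (Sum.inr φ) w) (Sum.inl e)]
    have h : ∀ s : Equiv.Perm (Fin 4), (∑ b : Fin 4, if b ≠ s 0 ∧
        (K.subdivide t₀).EndsWith (Sum.inl e) (Sum.inr b) s then
        D' (Sum.inr ((K.subdivide t₀).face (Sum.inr b) (s 0))) w •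
          (K.subdivide t₀).orderBivector p (Sum.inr b) s else 0) =
        if K.EndsWith e t₀ s then g s else 0 := by
      intro s
      rw [Fintype.sum_eq_single (s 1)]
      · refine if_congr ?_ ?_ rfl
        · rw [subdivide_endsWith_inl_inr]
          exact ⟨fun h => h.2.2, fun h => ⟨s.injective.ne (by decide), Or.inr rfl, h⟩⟩
        · have := fun k => congrFun (subdivide_vert_comp_one (K := K) (t₀ := t₀) s) k
          simp only [Function.comp_apply] at this
          rw [orderBivector, this, this, this]
          rfl
      · exact fun a ha => if_neg fun h =>
          (subdivide_endsWith_inl_inr.1 h.2).1.elim h.1 ha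
    rw [Finset.sum_congr rfl fun s _ => h s,
      sum_perm_eq_sum_sign (K.ori t₀) (by decide : (0 : Fin 4) ≠ 1) hew, Finset.smul_sum]
    refine Finset.sum_congr rfl fun s _ => ?_
    have hs : g (s * Equiv.swap 0 1) = g s := by
      simp only [g, θ, B, e0, e1, e2, e3]
      rw [subdivide_face_comm (s.injective.ne (by decide))]
    rw [hs]
    split_ifs
    · rw [two_nsmul]
    · rw [smul_zero]
  -- The identity is local to a flag: the dihedral angle of the old tetrahedron is compared with
  -- those of its two pieces, the error being expressed by the two old faces and the inner face at
  -- the edge.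
  have h5 : (∑ s : Equiv.Perm (Fin 4), if Equiv.Perm.sign s = K.ori t₀ ∧ K.EndsWith e t₀ s then
        dihedralForm p w ![none, B s 1, B s 2, B s 3] +
          dihedralForm p w ![B s 0, none, B s 2, B s 3] else 0) -
      (∑ s : Equiv.Perm (Fin 4), if Equiv.Perm.sign s = K.ori t₀ ∧ K.EndsWith e t₀ s then
        dihedralForm p w ![B s 0, B s 1, B s 2, B s 3] else 0) =
      (∑ s : Equiv.Perm (Fin 4), if Equiv.Perm.sign s = K.ori t₀ ∧ K.EndsWith e t₀ s then
        Δ (s 0) w • faceBivector (p (B s 1)) (p (B s 2)) (p (B s 3)) +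
          Δ (s 1) w • faceBivector (p (B s 0)) (p (B s 2)) (p (B s 3)) else 0) -
      ∑ s : Equiv.Perm (Fin 4), if Equiv.Perm.sign s = K.ori t₀ ∧ K.EndsWith e t₀ s then
        g s else 0 := by
    rw [← Finset.sum_sub_distrib, ← Finset.sum_sub_distrib]
    refine Finset.sum_congr rfl fun s _ => ?_
    split_ifs with h
    · have hs := h.1
      have t0 := P'.hasFDerivAt_angle_pair hv hp hs (m := 1) (by decide) (hD' _)
      rw [subdivide_vert_self, subdivide_vert_of_ne (s.injective.ne (by decide)),
        subdivide_vert_of_ne (s.injective.ne (by decide))] at t0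
      have t1 := (P.hasFDerivAt_angle_divide hv hp P' hs (hD _) (hD' _)).1
      -- The roles of the two old faces are exchanged together with the direction of the edge, so
      -- the ordering stays right-oriented.
      have f0 : (s * Equiv.swap 0 1 * Equiv.swap 2 3 : Equiv.Perm (Fin 4)) 0 = s 1 :=
        congrArg s (by decide)
      have f1 : (s * Equiv.swap 0 1 * Equiv.swap 2 3 : Equiv.Perm (Fin 4)) 1 = s 0 :=
        congrArg s (by decide)
      have f2 : (s * Equiv.swap 0 1 * Equiv.swap 2 3 : Equiv.Perm (Fin 4)) 2 = s 3 :=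
        congrArg s (by decide)
      have f3 : (s * Equiv.swap 0 1 * Equiv.swap 2 3 : Equiv.Perm (Fin 4)) 3 = s 2 :=
        congrArg s (by decide)
      have t2 := (P.hasFDerivAt_angle_divide hv hp P'
        (s := s * Equiv.swap 0 1 * Equiv.swap 2 3) (by
          rw [Equiv.Perm.sign_mul, Equiv.Perm.sign_mul, Equiv.Perm.sign_swap (by decide),
            Equiv.Perm.sign_swap (by decide), hs]
          simp) (hD _) (hD' _)).1
      rw [f0, f1, f2, f3] at t2
      refine dihedralForm_divide (e := none) (k := B s 0) (l := B s 1) (i := B s 2) (j := B s 3) ?_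
        t0 t1 t2 w
      have : ![B s 0, none, B s 1, B s 2, B s 3] = Option.map (K.vert t₀ ∘ s) ∘
          ![some 0, none, some 1, some 2, some 3] := by
        funext i; fin_cases i <;> rfl
      rw [this]
      exact affineIndependent_cell hv hp s (by decide)
    · rw [sub_self]
  change _ - (∑ x, Δ x w • _ - _) = _
  rw [h2, h3, h4, ← h5, curvature, Fintype.sum_sum_type, h1]
  abel

end TetComplex

/-- A combination of the differentials of distances as a combination of the differentials of the
edge lengths. -/
theorem exists_edge_coefficients {A κ X : Type*} [Fintype κ] [DecidableEq κ] (ed : A → A → κ)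
    {δ : A → A → X → ℝ} {d : κ → X → ℝ} (hd : ∀ a b, a ≠ b → d (ed a b) = δ a b)
    (h0 : ∀ a v, δ a a v = 0) {n : ℕ} (c : Fin n → Fin n → ℝ) (σ : Fin n → A)
    (hσ : Function.Injective σ) : ∃ C : κ → ℝ,
      (∀ v, ∑ k, C k * d k v = ∑ i, ∑ j, c i j * δ (σ i) (σ j) v) ∧
      ∀ k w, (∀ a b, a ≠ b → δ a b w = if ed a b = k then 1 else 0) →
        C k = ∑ i, ∑ j, c i j * δ (σ i) (σ j) w := by
  -- The coefficient of an edge collects all ordered pairs of points which it joins. Its evaluation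
  -- on a velocity changing this edge alone is the partial derivative by the length.
  refine ⟨fun k => ∑ i, ∑ j, if i ≠ j ∧ ed (σ i) (σ j) = k then c i j else 0, fun v => ?_,
    fun k w hw => ?_⟩
  · simp only [Finset.sum_mul]
    rw [Finset.sum_comm]
    refine Finset.sum_congr rfl fun i _ => ?_
    rw [Finset.sum_comm]
    refine Finset.sum_congr rfl fun j _ => ?_
    by_cases h : i = j
    · subst h
      rw [h0, mul_zero]
      exact Finset.sum_eq_zero fun k _ => by rw [if_neg fun h => h.1 rfl, zero_mul]
    · rw [Fintype.sum_eq_single (ed (σ i) (σ j)) fun k hk => by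
        rw [if_neg fun h' => hk h'.2.symm, zero_mul], if_pos ⟨h, rfl⟩, hd _ _ (hσ.ne h)]
  · refine Finset.sum_congr rfl fun i _ => Finset.sum_congr rfl fun j _ => ?_
    by_cases h : i = j
    · subst h
      rw [h0, mul_zero, if_neg fun h => h.1 rfl]
    · rw [hw _ _ (hσ.ne h)]
      by_cases h' : ed (σ i) (σ j) = k <;> simp [h, h']

theorem exists_perm_zero_one : ∀ (ε : ℤˣ) (a b : Fin 4), a ≠ b → ∃ s : Equiv.Perm (Fin 4),
    Equiv.Perm.sign s = ε ∧ s 0 = a ∧ s 1 = b := by decide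

/-- The velocities of five points changing the distances in the prescribed way. -/
theorem GeneralPosition.exists_distDeriv_eq {V : Type*} [Fintype V] {p : V → R4}
    (hp : GeneralPosition p) {ζ : Option (Fin 4) → V} (hζ : Function.Injective ζ)
    {L : Option (Fin 4) → Option (Fin 4) → ℝ} (hL : ∀ a b, L a b = L b a) :
    ∃ w : V → R4, ∀ a b, a ≠ b → distDeriv p (ζ a) (ζ b) w = L a b := by
  let ψ := finSuccEquiv 4
  have hi := hζ.comp ψ.injective
  obtain ⟨v, hv⟩ := _root_.exists_distDeriv_eq (hp _ hi) (L := fun i j => L (ψ i) (ψ j))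
    fun i j => hL _ _
  refine ⟨Function.extend (ζ ∘ ψ) v 0, fun a b hab => ?_⟩
  obtain ⟨i, rfl⟩ := ψ.surjective a
  obtain ⟨j, rfl⟩ := ψ.surjective b
  rw [← hv i j (ne_of_apply_ne ψ hab)]
  have hw : Function.extend (ζ ∘ ψ) v 0 ∘ ζ ∘ ψ = v := Function.extend_comp hi v 0
  exact (distDeriv_comp p (ζ ∘ ψ) i j (Function.extend (ζ ∘ ψ) v 0)).symm.trans (by rw [hw])

/-! ### The lengths in the 4-simplex of the new vertex. -/

namespace TetComplex

variable {V E F T : Type*} {K : TetComplex V E F T}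

/-- The two sides of a face lie in different tetrahedra, so a tetrahedron meets it once. -/
theorem FaceStar.face_injective (σ : ∀ f, K.FaceStar f) (t : T) :
    Function.Injective (K.face t) := by
  intro x y h
  rcases (σ (K.face t y)).covers t x h with ⟨h1, h2⟩ | ⟨h1, h2⟩ <;>
    rcases (σ (K.face t y)).covers t y rfl with ⟨h3, h4⟩ | ⟨h3, h4⟩
  · exact h2.trans h4.symm
  · exact absurd (h1.symm.trans h3) (σ _).left_ne_right
  · exact absurd (h3.symm.trans h1) (σ _).left_ne_right
  · exact h2.trans h4.symm

/-- The edges joining the vertices of the divided tetrahedron and the new vertex. -/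
def cellEdge (K : TetComplex V E F T) (t₀ : T) : Option (Fin 4) → Option (Fin 4) → E ⊕ Fin 4
  | some i, some j => Sum.inl (K.edge t₀ i j)
  | some i, none => Sum.inr i
  | none, some j => Sum.inr j
  | none, none => Sum.inl (K.edge t₀ 0 0)

theorem cellEdge_comm (hK : K.IsRegular) (t₀ : T) : ∀ a b, K.cellEdge t₀ a b = K.cellEdge t₀ b a
  | some i, some j => congrArg Sum.inl (hK.edge_symm t₀ i j)
  | some _, none => rfl
  | none, some _ => rfl
  | none, none => rfl

variable [DecidableEq T]

theorem subdivide_edge (t₀ : T) (a : Fin 4) {i j : Fin 4} (h : i ≠ j) :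
    (K.subdivide t₀).edge (Sum.inr a) i j =
      K.cellEdge t₀ (if i = a then none else some i) (if j = a then none else some j) := by
  by_cases hi : i = a
  · have hj : j ≠ a := fun hj => h (hi.trans hj.symm)
    simp [subdivide, hi, hj, cellEdge]
  · by_cases hj : j = a <;> simp [subdivide, hi, hj, cellEdge]

theorem subdivide_vert (t₀ : T) (a i : Fin 4) : (K.subdivide t₀).vert (Sum.inr a) i =
    Option.map (K.vert t₀) (if i = a then none else some i) := by
  by_cases hi : i = a <;> simp [subdivide, hi]

variable [Fintype V] [Fintype T]

/-- The differentials of the lengths are the differentials of the distances. -/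
theorem distDeriv_cellEdge (hK : K.IsRegular) {p : Option V → R4} (t₀ : T) (a b : Option (Fin 4))
    (hab : a ≠ b) : distDeriv p ((K.subdivide t₀).src (K.cellEdge t₀ a b))
      ((K.subdivide t₀).tgt (K.cellEdge t₀ a b)) =
      distDeriv p (Option.map (K.vert t₀) a) (Option.map (K.vert t₀) b) := by
  obtain ⟨c, i, j, hij, rfl, rfl⟩ : ∃ c i j : Fin 4, i ≠ j ∧
      (if i = c then none else some i) = a ∧ (if j = c then none else some j) = b := by
    revert a b; decide
  rw [← subdivide_edge t₀ c hij, ← subdivide_vert, ← subdivide_vert]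
  rcases (hK.subdivide (t₀ := t₀)).edge_ends (Sum.inr c) i j hij with ⟨h1, h2⟩ | ⟨h1, h2⟩
  · rw [h1, h2]
  · rw [h1, h2]
    ext v
    exact distDeriv_comm _ _ _ _

end TetComplex

namespace Presentation

variable {V E F T : Type*} {K : TetComplex V E F T} [Fintype V] [Fintype E] [Fintype F] [Fintype T]
  [DecidableEq V] [DecidableEq E] [DecidableEq F] [DecidableEq T]

/-- The inner face between the pieces replacing the vertices of a pair contains the new vertex and
the complementary pair; this is the reason for `q.rev`. It contributes to the two new edges in the
face only. -/
theorem subdivide_f₃ (hr : K.IsRegular) (hv : ∀ t, Function.Injective (K.vert t))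
    {p : Option V → R4} (hp : GeneralPosition p) {t₀ : T} (P' : Presentation (K.subdivide t₀) p)
    (j : Fin 4) (m : Fin 3) (q : Fin 6) :
    P'.f₃ (Sum.inr j, m) (Sum.inr (Sum.inr (pairEquiv q))) =
      (P'.doubleArea (Sum.inr (pairEquiv q)))⁻¹ *
        if j = (soPos q.rev).1 then component (P'.axes (Sum.inr j))
          (dualWedge ⇑(p none - p (some (K.vert t₀ (soPos q.rev).1)))
            ⇑(p none - p (some (K.vert t₀ (soPos q.rev).2)))) m
        else if j = (soPos q.rev).2 then component (P'.axes (Sum.inr j))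
          (dualWedge ⇑(p none - p (some (K.vert t₀ (soPos q.rev).2)))
            ⇑(p none - p (some (K.vert t₀ (soPos q.rev).1)))) m
        else 0 := by
  have hn' : (K.subdivide t₀).Nondeg p := TetComplex.subdivide_nondeg hv hp
  have hr' : (K.subdivide t₀).IsRegular := hr.subdivide
  have hq : ∀ (q : Fin 6) (j : Fin 4),
      ((j = (soPos q).1 ∨ j = (soPos q).2) ∧ j ≠ (soPos q.rev).1 ∧ j ≠ (soPos q.rev).2) ∨
      ∃ s : Equiv.Perm (Fin 4), s 0 = (soPos q).2 ∧ s 2 = j ∧ s 3 = (soPos q).1 ∧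
        ((s 2 = (soPos q.rev).1 ∧ s 1 = (soPos q.rev).2) ∨
          (s 2 = (soPos q.rev).2 ∧ s 2 ≠ (soPos q.rev).1 ∧ s 1 = (soPos q.rev).1)) := by decide
  rw [← TetComplex.subdivide_face_soPos (K := K) (t₀ := t₀)]
  rcases hq q j with ⟨h, h1, h2⟩ | ⟨s, h0, h2, h3, h⟩
  · rw [if_neg h1, if_neg h2, mul_zero]
    refine P'.f₃_eq_zero hr' hn' (fun s h0 hs => ?_) m
    obtain ⟨e2, e3⟩ := TetComplex.subdivide_endsWith_inr_inr.1 hs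
    rcases h with rfl | rfl
    · exact absurd (s.injective (e2.trans e3.symm)) (by decide)
    · exact absurd (s.injective (e2.trans h0.symm)) (by decide)
  · have := P'.f₃_flag hr' hn' (t := Sum.inr (s 3)) (e := Sum.inr (s 2)) (s := s)
      (TetComplex.subdivide_endsWith_inr_inr.2 ⟨rfl, rfl⟩) m
    rw [TetComplex.subdivide_vert_self,
      TetComplex.subdivide_vert_of_ne (s.injective.ne (by decide)),
      TetComplex.subdivide_vert_of_ne (s.injective.ne (by decide))] at this
    rw [← h0, ← h2, ← h3, this]
    rcases h with ⟨e1, e2⟩ | ⟨e1, e2, e3⟩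
    · rw [if_pos e1, ← e1, ← e2]
    · rw [if_neg e2, if_pos e1, ← e1, ← e3]

end Presentation

namespace Presentation

variable {V E F T : Type*} {K : TetComplex V E F T} [Fintype V] [Fintype E] [Fintype F] [Fintype T]
  [DecidableEq V] [DecidableEq E] [DecidableEq F] [DecidableEq T]

/-- The new angles and the changes of the old ones depend on the lengths of the edges of the
divided tetrahedron and of the new edges only. -/
theorem subdivide_angle_coefficients (hv : ∀ t, Function.Injective (K.vert t))
    {p : Option V → R4} (hp : GeneralPosition p) (P : Presentation K fun v => p (some v)) {t₀ : T}
    (P' : Presentation (K.subdivide t₀) p) {D : E ⊕ F → (V → R4) →L[ℝ] ℝ}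
    (hD : ∀ r, HasFDerivAt (fun q => P.measure q r) (D r) fun v => p (some v))
    {D' : (E ⊕ Fin 4) ⊕ (F ⊕ {s : Finset (Fin 4) // s.card = 2}) → (Option V → R4) →L[ℝ] ℝ}
    (hD' : ∀ r, HasFDerivAt (fun q => P'.measure q r) (D' r) p)
    (h0 : ∀ f, f ∉ Set.range (K.face t₀) →
      (D (Sum.inr f)).comp (restrictPoints V) - D' (Sum.inr (Sum.inl f)) = 0) (r : F ⊕ Fin 6) :
    ∃ (σ : Fin 5 → Option (Fin 4)) (c : Fin 5 → Fin 5 → ℝ), Function.Injective σ ∧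
      ∀ v, Sum.elim
        (fun f => (D (Sum.inr f)).comp (restrictPoints V) - D' (Sum.inr (Sum.inl f)))
        (fun q => -D' (Sum.inr (Sum.inr (pairEquiv q)))) r v =
        ∑ i, ∑ j, c i j * distDeriv p (Option.map (K.vert t₀) (σ i))
          (Option.map (K.vert t₀) (σ j)) v := by
  have inj : ∀ (s : Equiv.Perm (Fin 4)) (τ : Fin 5 → Option (Fin 4)), Function.Injective τ →
      Function.Injective (Option.map s ∘ τ) := fun s τ h =>
    (Option.map_injective s.injective).comp h
  rcases r with f | q
  · by_cases hf : f ∈ Set.range (K.face t₀)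
    · obtain ⟨x, rfl⟩ := hf
      obtain ⟨s, hs, rfl⟩ := exists_perm_zero (K.ori t₀) x
      obtain ⟨-, c, hc⟩ := P.hasFDerivAt_angle_divide hv hp P' hs (hD _) (hD' _)
      refine ⟨Option.map s ∘ ![some 1, some 2, some 3, none, some 0], c, inj _ _ (by decide), ?_⟩
      intro v
      have e : ![some (K.vert t₀ (s 1)), some (K.vert t₀ (s 2)), some (K.vert t₀ (s 3)), none,
          some (K.vert t₀ (s 0))] = fun i => Option.map (K.vert t₀)
            ((Option.map s ∘ ![some 1, some 2, some 3, none, some 0]) i) := by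
        funext i; fin_cases i <;> rfl
      rw [e] at hc
      exact hc v
    · refine ⟨![some 1, some 2, some 3, none, some 0], 0, by decide, fun v => ?_⟩
      rw [Sum.elim_inl, h0 f hf]
      simp
  · obtain ⟨s, hs, hs0, hs1⟩ := exists_perm_zero_one (K.ori t₀) (soPos q).2 (soPos q).1
      (by revert q; decide)
    have h := P'.hasFDerivAt_angle_pair hv hp hs (m := 1) (by decide) (hD' _)
    rw [TetComplex.subdivide_vert_self,
      TetComplex.subdivide_vert_of_ne (s.injective.ne (by decide)),
      TetComplex.subdivide_vert_of_ne (s.injective.ne (by decide)), hs0, hs1,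
      TetComplex.subdivide_face_soPos, ← hs0, ← hs1] at h
    have e : (p ∘ fun i => Option.map (K.vert t₀)
        ((Option.map s ∘ ![none, some 2, some 3, some 1, some 0]) i)) =
        p ∘ Option.map (K.vert t₀ ∘ s) ∘ ![none, some 2, some 3, some 1, some 0] := by
      funext i; fin_cases i <;> rfl
    obtain ⟨c, D₁, hD₁, hc⟩ := exists_hasFDerivAt_theta_comp (x := p)
      (σ := fun i => Option.map (K.vert t₀)
        ((Option.map s ∘ ![none, some 2, some 3, some 1, some 0]) i)) (by
        rw [e]
        exact TetComplex.affineIndependent_cell hv hp s (by decide))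
    refine ⟨Option.map s ∘ ![none, some 2, some 3, some 1, some 0], -c, inj _ _ (by decide), ?_⟩
    intro v
    rw [Sum.elim_inr, h.unique hD₁, neg_apply, hc, ← Finset.sum_neg_distrib]
    refine Finset.sum_congr rfl fun i _ => ?_
    rw [← Finset.sum_neg_distrib]
    refine Finset.sum_congr rfl fun j _ => ?_
    rw [Pi.neg_apply, Pi.neg_apply, neg_mul]

/-- Invariance under the move 1 → 4. -/
theorem subdivide_invariant (hK : K.IsClosedPseudotriangulation) {p : Option V → R4}
    (hp : GeneralPosition p) (P : Presentation K fun v => p (some v)) (t₀ : T)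
    (P' : Presentation (K.subdivide t₀) p) :
    (P.Acyclic ↔ P'.Acyclic) ∧
      (P.Acyclic → ∃ I : ℝ, I ≠ 0 ∧ P.HasInvariant I ∧ P'.HasInvariant I) := by
  classical
  have hr := hK.isRegular
  have hr' : (K.subdivide t₀).IsRegular := hr.subdivide
  have hv := hK.vert_injective
  have hn := TetComplex.nondeg_restrict hv hp
  have hn' : (K.subdivide t₀).Nondeg p := TetComplex.subdivide_nondeg hv hp
  obtain ⟨ι, ιE, ιF, ι'⟩ := Equiv.exists_sumSumSumComm (E := E) (F := F)
    (Equiv.sumCongr (Equiv.refl (Fin 4)) pairEquiv)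
  have ιQ : ∀ q, ι (Sum.inr (Sum.inr q)) = Sum.inr (Sum.inr (pairEquiv q)) := fun q => ι' _
  have ιJ : ∀ j, ι (Sum.inr (Sum.inl j)) = Sum.inl (Sum.inr j) := fun j => ι' _
  have ιk : ∀ k : E ⊕ Fin 4, ι (Sum.map Sum.inl Sum.inl k) = Sum.inl k := by
    rintro (e | j)
    exacts [ιE e, ιJ j]
  choose D hD _ using P.exists_hasFDerivAt_measure hn hp.restrict
  choose D' hD' hz using P'.exists_hasFDerivAt_measure hn' hp
  have hE : ∀ e, D' (Sum.inl e) = distDeriv p ((K.subdivide t₀).src e) ((K.subdivide t₀).tgt e) :=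
    fun e => (hD' _).unique (P'.hasFDerivAt_length hn' e)
  have hfar : ∀ f, f ∉ Set.range (K.face t₀) →
      (D (Sum.inr f)).comp (restrictPoints V) - D' (Sum.inr (Sum.inl f)) = 0 := by
    intro f hf
    have ht : ∀ t i, K.face t i = f → t ≠ t₀ := fun t i h h' => hf ⟨i, h' ▸ h⟩
    -- The value at `t₀` is arbitrary: no tetrahedron at the face considered equals `t₀`, and only
    -- injectivity is required.
    let τ : T → {t : T // t ≠ t₀} ⊕ Fin 4 := fun t =>
      if h : t = t₀ then Sum.inr 0 else Sum.inl ⟨t, h⟩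
    have hτ : ∀ t i, K.face t i = f → ∃ h, τ t = Sum.inl ⟨t, h⟩ := fun t i h =>
      ⟨ht t i h, dif_neg (ht t i h)⟩
    rw [P.angle_restrict hn' P' (f := f) (τ := τ) (fun t t' h => ?_) (fun t i h j => ?_)
      (fun t i h => ?_) (fun t i h => ?_) (hD (Sum.inr f)) (hD' (Sum.inr (Sum.inl f))), sub_self]
    · by_cases h1 : t = t₀ <;> by_cases h2 : t' = t₀ <;> simp [τ, h1, h2]
      · exact h (h1.trans h2.symm)
      · exact h
    · obtain ⟨h', e⟩ := hτ t i h
      rw [e]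
      rfl
    · obtain ⟨h', e⟩ := hτ t i h
      rw [e, ← h]
      rfl
    · obtain ⟨h', e⟩ := hτ t i h
      rw [e]
      rfl
  -- The corrections which turn the new angles at old faces into the old ones and the angles at
  -- inner faces into zero.
  let Δ : F ⊕ Fin 6 → (Option V → R4) →L[ℝ] ℝ := Sum.elim
    (fun f => (D (Sum.inr f)).comp (restrictPoints V) - D' (Sum.inr (Sum.inl f)))
    (fun q => -D' (Sum.inr (Sum.inr (pairEquiv q))))
  have hC : ∀ r, ∃ C : E ⊕ Fin 4 → ℝ, (∀ v, ∑ k, C k * D' (Sum.inl k) v = Δ r v) ∧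
      ∀ k w, (∀ a b, a ≠ b → distDeriv p (Option.map (K.vert t₀) a) (Option.map (K.vert t₀) b) w =
        if K.cellEdge t₀ a b = k then 1 else 0) → C k = Δ r w := by
    intro r
    obtain ⟨σ, c, hσ, hc⟩ := P.subdivide_angle_coefficients hv hp P' hD hD' hfar r
    obtain ⟨C, h1, h2⟩ := exists_edge_coefficients (K.cellEdge t₀)
      (δ := fun a b v => distDeriv p (Option.map (K.vert t₀) a) (Option.map (K.vert t₀) b) v)
      (d := fun k v => D' (Sum.inl k) v)
      (fun a b hab => by funext v; rw [hE, TetComplex.distDeriv_cellEdge hr t₀ a b hab])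
      (fun a v => distDeriv_self _ _ _) c σ hσ
    exact ⟨C, fun v => (h1 v).trans (hc v).symm, fun k w hw => (h2 k w hw).trans (hc w).symm⟩
  choose C hC₁ hC₂ using hC
  -- the star of the new vertex
  let a : Fin 4 → Fin 4 → ℝ := fun j => ⇑(p none - p (some (K.vert t₀ j)))
  -- Here all four vectors are edge vectors, so the nonvanishing is general position itself.
  have ha : (Matrix.of a).det ≠ 0 := by
    have h1 := linearIndependent_det (AffineIndependent.linearIndependent_sub_zero
      (TetComplex.affineIndependent_cell (t₀ := t₀) hv hp 1
        (σ := ![none, some 0, some 1, some 2, some 3]) (by decide)))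
    have h2 : Matrix.of a = -Matrix.of ![⇑(p (some (K.vert t₀ 0)) - p none),
        ⇑(p (some (K.vert t₀ 1)) - p none), ⇑(p (some (K.vert t₀ 2)) - p none),
        ⇑(p (some (K.vert t₀ 3)) - p none)] := by
      ext i j
      fin_cases i <;> simp [a]
    rw [h2, Matrix.det_neg]
    exact mul_ne_zero (by norm_num) h1
  let l : Fin 4 → ℝ := fun j => dist (p (some (K.vert t₀ j))) (p none)
  have hl : ∀ j, l j ≠ 0 := fun j => P'.dist_ne hn' (Sum.inr j)
  let M : Matrix (Fin 4) (Fin 4) ℝ :=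
    P'.f₂.submatrix (fun j => ι (Sum.inr (Sum.inl j))) fun k => (none, k)
  have hM : absDet M = |(Matrix.of a).det| * ∏ j, (l j)⁻¹ := by
    have h1 : M = Matrix.diagonal (fun j => (l j)⁻¹) * Matrix.of a := by
      ext j k
      rw [Matrix.diagonal_mul, Matrix.of_apply]
      change P'.f₂ (ι (Sum.inr (Sum.inl j))) (none, k) = _
      rw [ιJ, P'.f₂_apply_of_hasFDerivAt (P'.hasFDerivAt_length hn' _), distDeriv_apply]
      change (l j)⁻¹ * inner ℝ (p (some (K.vert t₀ j)) - p none)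
        ((Pi.single none (EuclideanSpace.single k 1) : Option V → R4) (some (K.vert t₀ j)) -
          (Pi.single none (EuclideanSpace.single k 1) : Option V → R4) none) = _
      rw [Pi.single_eq_same, Pi.single_eq_of_ne (by simp), zero_sub, inner_neg_right,
        EuclideanSpace.inner_single_right]
      simp [a]
    rw [absDet_square, h1, Matrix.det_mul, abs_mul, Matrix.det_diagonal, mul_comm,
      Finset.abs_prod]
    congr 1
    exact Finset.prod_congr rfl fun j _ => abs_of_nonneg (inv_nonneg.2 dist_nonneg)
  -- Twelve flags at four edges: each pair of edges gives one reversed and one increasing flag.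
  let x₀ : Fin 6 ⊕ Fin 6 ≃ Fin 4 × Fin 3 := Equiv.ofBijective
    (Sum.elim ![(3, 2), (3, 1), (2, 1), (3, 0), (2, 0), (1, 0)]
      ![(0, 0), (0, 1), (0, 2), (1, 1), (1, 2), (2, 2)]) (by decide)
  let u : Fin 6 → Fin 4 × Fin 4 := fun q => soPos q.rev
  have hx₁ : ∀ q, (x₀ (Sum.inl q)).1 = (u q).2 ∧
      (x₀ (Sum.inl q)).1.succAbove (x₀ (Sum.inl q)).2 = (u q).1 := by decide
  have hx₂ : ∀ k, (x₀ (Sum.inr k)).1 = (soPos k).1 ∧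
      (x₀ (Sum.inr k)).1.succAbove (x₀ (Sum.inr k)).2 = (soPos k).2 := by decide
  obtain ⟨S, hS₁, hS₂⟩ := P'.absDet_star hn' (fun j => Sum.inr j) id a (fun j => rfl) u
    (by decide) (by decide) x₀ hx₁ hx₂ (fun q => (P'.doubleArea (Sum.inr (pairEquiv q)))⁻¹)
    (P'.f₃.submatrix (fun c => (Sum.inr c.1, c.2)) fun q => ι (Sum.inr (Sum.inr q)))
    (fun j m q => by
      rw [Matrix.submatrix_apply, ιQ]
      exact P'.subdivide_f₃ hr hv hp j m q)
    (P'.f₄.submatrix (fun k => (none, k)) fun c => (Sum.inr c.1, c.2))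
    (fun k j m => by
      rw [Matrix.submatrix_apply, P'.f₄_apply]
      simp [TetComplex.subdivide])
  refine insertion hr hr' hn hn' P P' (fun e => rfl) (fun e => rfl) ι ιE ιF
    (fun q => ⟨_, _, _, ιQ q, TetComplex.subdivide_face_soPos q⟩) (by simp) (by simp)
    D hD D' hD' hz (Matrix.of C) ?_ ?_ ?_ ?_ ?_ ?_ M rfl _ rfl _ rfl S ?_ (P.weight_ne_zero hn)
  · intro e v
    rw [hE, (hD _).unique (P.hasFDerivAt_length hn e)]
    rfl
  · intro f v
    simp only [ιk, Matrix.of_apply]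
    rw [hC₁]
    exact add_sub_cancel _ _
  · intro q v
    simp only [ιk, Matrix.of_apply]
    rw [hC₁, ιQ]
    exact add_neg_cancel _
  · intro f e
    obtain ⟨t, i, ht, hti⟩ := P.exists_corner_ne f t₀
    rw [(P'.faceStar _).curvature_face (t := Sum.inl ⟨t, ht⟩) (x := i) (congrArg Sum.inl hti),
      TetComplex.subdivide_cornerForm_inl, (P.faceStar f).curvature_face hti]
  · intro f j
    obtain ⟨t, i, ht, hti⟩ := P.exists_corner_ne f t₀
    rw [(P'.faceStar _).curvature_face (t := Sum.inl ⟨t, ht⟩) (x := i) (congrArg Sum.inl hti)]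
    exact TetComplex.cornerForm_eq_zero fun s _ => TetComplex.subdivide_endsWith_inr_inl
  · intro k e'
    -- Velocities of the five points which change, among the lengths in the 4-simplex, only the
    -- length of `k` and change it at unit rate. On them the coefficient of the correction is its
    -- actual rate of change, so the corrected column is a deformation in `ℝ⁴`.
    obtain ⟨w, hw⟩ := hp.exists_distDeriv_eq (Option.map_injective (hv t₀))
      (L := fun a b => if K.cellEdge t₀ a b = k then 1 else 0)
      (fun a b => by rw [TetComplex.cellEdge_comm hr])
    have hy : ∀ f, (Pi.single (Sum.inl k) 1 :
        (E ⊕ Fin 4) ⊕ (F ⊕ {s : Finset (Fin 4) // s.card = 2}) → ℝ) (Sum.inr f) = 0 :=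
      fun f => Pi.single_eq_of_ne (by simp) _
    have hyw : ∀ c i j, i ≠ j → (Pi.single (Sum.inl k) 1 :
        (E ⊕ Fin 4) ⊕ (F ⊕ {s : Finset (Fin 4) // s.card = 2}) → ℝ)
          (Sum.inl ((K.subdivide t₀).edge (Sum.inr c) i j)) =
        distDeriv p ((K.subdivide t₀).vert (Sum.inr c) i) ((K.subdivide t₀).vert (Sum.inr c) j)
          w := by
      intro c i j hij
      rw [TetComplex.subdivide_edge t₀ c hij, TetComplex.subdivide_vert,
        TetComplex.subdivide_vert, hw _ _ (by by_cases h : i = c <;> by_cases h' : j = c <;> simp_all),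
        Pi.single_apply]
      simp only [Sum.inl.injEq]
    -- Only the angles at the four faces of the divided tetrahedron are corrected.
    have hold : ∑ f, Δ (Sum.inl f) w •
        (K.subdivide t₀).curvature p e' (Pi.single (Sum.inr (Sum.inl f)) 1) =
        ∑ x, Δ (Sum.inl (K.face t₀ x)) w • (K.subdivide t₀).cornerForm p (Sum.inr x) x e' := by
      refine (Fintype.sum_of_injective (K.face t₀)
        (TetComplex.FaceStar.face_injective P.faceStar t₀) _ _ (fun f hf => ?_) fun x => ?_).symm
      · have : Δ (Sum.inl f) = 0 := hfar f hf
        rw [this]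
        exact zero_smul _ _
      · rw [(P'.faceStar _).curvature_face TetComplex.subdivide_face_self]
    have hnew : ∀ q, Δ (Sum.inr q) w •
        (K.subdivide t₀).curvature p e' (Pi.single (Sum.inr (Sum.inr (pairEquiv q))) 1) =
        -(D' (Sum.inr (Sum.inr (pairEquiv q))) w •
          (K.subdivide t₀).cornerForm p (Sum.inr (soPos q).1) (soPos q).2 e') := by
      intro q
      rw [(P'.faceStar _).curvature_face (TetComplex.subdivide_face_soPos q), ← neg_smul]
      rfl
    simp only [Fintype.sum_sum_type, Matrix.of_apply, hC₂ _ k w hw, Sum.map_inl, Sum.map_inr, ιF,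
      ιQ, ιk, hold, hnew]
    rw [Finset.sum_neg_distrib, ← sub_eq_add_neg]
    rcases e' with e | j
    · simp only [TetComplex.subdivide_cornerForm_inr]
      rcases k with e₁ | i
      · refine TetComplex.subdivide_curvature_inl hv hp P P' hD hD' hy
          (y₀ := Pi.single (Sum.inl e₁) 1) (fun f => Pi.single_eq_of_ne (by simp) _)
          (fun e₂ => ?_) hyw e
        simp [Pi.single_apply]
      -- A new length has no counterpart in the old complex, so the comparison is with the zero
      -- variation.
      · refine (TetComplex.subdivide_curvature_inl hv hp P P' hD hD' hy
          (y₀ := 0) (fun f => rfl) (fun e₂ => ?_) hyw e).trans ?_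
        · simp
        · exact map_zero (K.curvatureLin (fun v => p (some v)) e)
    -- The faces of the old tetrahedron do not contain the new edges.
    · have h0 : ∀ x, (K.subdivide t₀).cornerForm p (Sum.inr x) x (Sum.inr j) = 0 := fun x =>
        TetComplex.cornerForm_eq_zero fun s hs h =>
          absurd (s.injective (hs.trans (TetComplex.subdivide_endsWith_inr_inr.1 h).2.symm))
            (by decide)
      simp only [h0, smul_zero, Finset.sum_const_zero, zero_sub, sub_neg_eq_add]
      exact TetComplex.subdivide_curvature_inr hv hp P' hD' hy hyw j
  · have hF : ∀ f, P'.doubleArea (Sum.inl f) = P.doubleArea f := by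
      intro f
      obtain ⟨t, i, ht, hti⟩ := P.exists_corner_ne f t₀
      obtain ⟨s, -, hs⟩ := exists_perm_zero (K.ori t) i
      rw [P.doubleArea_eq s (by rw [hs, hti]), P'.doubleArea_eq (t := Sum.inl ⟨t, ht⟩) s
        (congrArg Sum.inl (by rw [hs, hti]))]
      rfl
    have hd : |(Matrix.of a).det| ≠ 0 := abs_ne_zero.2 ha
    have hL : ∏ j, l j ≠ 0 := Finset.prod_ne_zero_iff.2 fun j _ => hl j
    have hF' : ∏ φ, P'.doubleArea (Sum.inr φ) ≠ 0 :=
      Finset.prod_ne_zero_iff.2 fun j _ => (P'.doubleArea_pos hn' _).ne'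
    have hF'' : ∏ f, P.doubleArea f ≠ 0 :=
      Finset.prod_ne_zero_iff.2 fun j _ => (P.doubleArea_pos hn _).ne'
    have h1 : ∏ q, |(P'.doubleArea (Sum.inr (pairEquiv q)))⁻¹| =
        (∏ φ, P'.doubleArea (Sum.inr φ))⁻¹ := by
      rw [← Finset.prod_inv_distrib, ← Equiv.prod_comp pairEquiv]
      exact Finset.prod_congr rfl fun q _ =>
        abs_of_nonneg (inv_nonneg.2 (P'.doubleArea_pos hn' _).le)
    have h2 : ∏ j : Fin 4, (dist (p ((K.subdivide t₀).src (Sum.inr j)))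
        (p ((K.subdivide t₀).tgt (Sum.inr j))) ^ 2 * |(Matrix.of a).det|) =
        (∏ j, l j) ^ 2 * |(Matrix.of a).det| ^ 4 := by
      rw [Finset.prod_mul_distrib, Finset.prod_const, Finset.card_univ, Fintype.card_fin,
        ← Finset.prod_pow]
      rfl
    have h3 : ∏ e, P'.length e p ^ 3 =
        (∏ e, P.length e (fun v => p (some v)) ^ 3) * (∏ j, l j) ^ 3 := by
      rw [Fintype.prod_sum_type, ← Finset.prod_pow]
      rfl
    -- The powers of `|det a|` are `1 + 3 - 4`, so only lengths and areas remain.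
    rw [hM, hS₁, hS₂, h1, h2, weight, weight, h3, Fintype.prod_sum_type,
      Finset.prod_congr rfl fun f _ => hF f, Finset.prod_inv_distrib]
    field_simp

end Presentation

/-- The presentations before and after a move are chosen independently, so the equality of the
invariants holds for all auxiliary choices of stars, axes and frames. -/
theorem theorem3 {V E F T : Type*} [Fintype V] [Fintype E] [Fintype F] [Fintype T]
    [DecidableEq V] [DecidableEq E] [DecidableEq F] [DecidableEq T]
    (K : TetComplex V E F T) (hK : K.IsClosedPseudotriangulation)
    (p : Option V → R4) (hp : GeneralPosition p)
    (P : Presentation K (fun v => p (some v))) (t₀ : T) :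
    (∀ (i₀ : Fin 4) (P' : Presentation (K.inflate t₀ i₀) p),
      (P.Acyclic ↔ P'.Acyclic) ∧
      (P.Acyclic → ∃ I : ℝ, I ≠ 0 ∧ P.HasInvariant I ∧ P'.HasInvariant I)) ∧
    (∀ P' : Presentation (K.subdivide t₀) p,
      (P.Acyclic ↔ P'.Acyclic) ∧
      (P.Acyclic → ∃ I : ℝ, I ≠ 0 ∧ P.HasInvariant I ∧ P'.HasInvariant I)) :=
  ⟨fun i₀ P' => P.inflate_invariant hK hp t₀ i₀ P', fun P' => P.subdivide_invariant hK hp t₀ P'⟩
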